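/- Let $d\ge 2$, $a>0$, $M_1>0$ and $M_0,E_0,H_0\in\mathbb R$. There are constants $K,T>0$, depending only on $d,M_1,M_0,E_0,H_0$ (and on the normalizing constant $a$), such that the following holds for every $\gamma\in[-2,0]$, where for $\gamma=-2$ we assume $d\ge 3$. Let $0<S\le\infty$ and let $f\ge 0$ be a classical solution on $[0,S)\times\mathbb R^d$ of the space homogeneous Landau equation $$\partial_t f=\sum_{i,j}\bar a_{ij}\,\partial_{ij}f+\bar c\,f,$$ $$\bar a(t,v)=a\int_{\mathbb R^d}\Big(I-\frac{w}{|w|}\otimes\frac{w}{|w|}\Big)|w|^{\gamma+2}f(t,v-w)\,dw,$$ $$\bar c(t,v)=-\sum_{i,j}\partial_{ij}\bar a_{ij}(t,v)=(d-1)(d+\gamma)\,a\int_{\mathbb R^d}|w|^{\gamma}f(t,v-w)\,dw,$$ with initial data $f(0,\cdot)=f_0$. If $$M_1\le\int f_0\,dv\le M_0,\qquad \int|v|^2f_0\,dv\le E_0,\qquad \int f_0\log f_0\,dv\le H_0,$$ then for all $v\in\mathbb R^d$ and $0<t<S$, $$f(t,v)\le K\,t^{-d/2}\ \text{ if } t\le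 T,\qquad f(t,v)\le K\,T^{-d/2}\ \text{ if } t>T.$$ Here a classical solution is a function $f\ge0$ with finite mass, energy and entropy at each time $t\in[0,S)$, such that $f,\partial_tf,D_vf,D_v^2f$ exist and are continuous on $(0,S)\times\mathbb R^d$, the equation holds there pointwise, $f$ as well as its mass and energy are bounded (qualitatively) on compact time subintervals of $(0,S)$, and the initial data is attained in the sense that $\int(1+|v|^2)|f(t,v)-f_0(v)|\,dv\to0$ and $\int f(t,v)\log f(t,v)\,dv\to\int f_0\log f_0\,dv$ as $t\to0^+$. -/

import Mathlib

open MeasureTheory Filter Topology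

noncomputable section

namespace Landau

/-- Velocity space `ℝ^d` with its Euclidean norm. -/
abbrev Vel (d : ℕ) : Type := EuclideanSpace ℝ (Fin d)

/-- The matrix `(I - w/|w| ⊗ w/|w|) |w|^(γ+2)`. (The value at `w = 0` is irrelevant.) -/
def kernel {d : ℕ} (γ : ℝ) (w : Vel d) : Matrix (Fin d) (Fin d) ℝ :=
  Matrix.of fun i j =>
    ((if i = j then 1 else 0) - (w i / ‖w‖) * (w j / ‖w‖)) * ‖w‖ ^ (γ + 2)

/-- The diffusion matrix `a ∫ (I - w/|w| ⊗ w/|w|) |w|^(γ+2) g(v - w) dw` of a density `g`;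
`a` is the normalizing constant `a_{d,γ}`. -/
def diffusion {d : ℕ} (a γ : ℝ) (g : Vel d → ℝ) (v : Vel d) : Matrix (Fin d) (Fin d) ℝ :=
  Matrix.of fun i j => a * ∫ w, kernel γ w i j * g (v - w)

/-- The zeroth order coefficient `c_{d,γ} ∫ |w|^γ g(v - w) dw`, for `γ > -d`. The constant is
`c_{d,γ} = (d - 1) (d + γ) a`, because `-∂ᵢⱼ` of the matrix `kernel γ w` is
`(d - 1) (d + γ) |w|^γ`; thus this coefficient is `-∂ᵢⱼ` of the diffusion matrix. -/
def reaction {d : ℕ} (a γ : ℝ) (g : Vel d → ℝ) (v : Vel d) : ℝ :=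
  (((d : ℝ) - 1) * ((d : ℝ) + γ) * a) * ∫ w, ‖w‖ ^ γ * g (v - w)

/-- The second partial derivative `∂ᵢⱼ g (v)`. -/
def partial₂ {d : ℕ} (g : Vel d → ℝ) (v : Vel d) (i j : Fin d) : ℝ :=
  iteratedFDeriv ℝ 2 g v ![EuclideanSpace.single i 1, EuclideanSpace.single j 1]

/-- `∫ g dv`. -/
def mass {d : ℕ} (g : Vel d → ℝ) : ℝ := ∫ v, g v

/-- `∫ |v|² g dv`. -/
def energy {d : ℕ} (g : Vel d → ℝ) : ℝ := ∫ v, ‖v‖ ^ 2 * g v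

/-- `∫ g log g dv`, with `0 log 0 = 0`. -/
def entropy {d : ℕ} (g : Vel d → ℝ) : ℝ := ∫ v, g v * Real.log (g v)

/-- The integrals defining mass, energy and entropy converge absolutely. -/
structure FiniteMassEnergyEntropy {d : ℕ} (g : Vel d → ℝ) : Prop where
  mass : Integrable g
  energy : Integrable fun v => ‖v‖ ^ 2 * g v
  entropy : Integrable fun v => g v * Real.log (g v)

/-- The open time-velocity domain `(0, S) × ℝ^d`, with `S` possibly infinite. -/
def domain (d : ℕ) (S : EReal) : Set (ℝ × Vel d) := {p | 0 < p.1 ∧ (p.1 : EReal) < S}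

/-- `f` is a (nonnegative) classical solution on `[0, S)` of the space homogeneous Landau
equation `∂ₜ f = āᵢⱼ ∂ᵢⱼ f + c̄ f`, with initial datum `f 0`. -/
structure IsClassicalSolution {d : ℕ} (a γ : ℝ) (S : EReal) (f : ℝ → Vel d → ℝ) : Prop where
  nonneg : ∀ t : ℝ, 0 ≤ t → (t : EReal) < S → ∀ v, 0 ≤ f t v
  finite : ∀ t : ℝ, 0 ≤ t → (t : EReal) < S → FiniteMassEnergyEntropy (f t)
  /-- `f` is `C¹` in time and `C²` in velocity on `(0, S) × ℝ^d`. -/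
  differentiable_time : ∀ t : ℝ, 0 < t → (t : EReal) < S → ∀ v,
    DifferentiableAt ℝ (fun s => f s v) t
  contDiff_velocity : ∀ t : ℝ, 0 < t → (t : EReal) < S → ContDiff ℝ 2 (f t)
  continuous_self : ContinuousOn (fun p : ℝ × Vel d => f p.1 p.2) (domain d S)
  continuous_time_deriv :
    ContinuousOn (fun p : ℝ × Vel d => deriv (fun s => f s p.2) p.1) (domain d S)
  continuous_gradient :
    ContinuousOn (fun p : ℝ × Vel d => fderiv ℝ (f p.1) p.2) (domain d S)
  continuous_hessian :
    ContinuousOn (fun p : ℝ × Vel d => iteratedFDeriv ℝ 2 (f p.1) p.2) (domain d S)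
  /-- On compact subintervals of `(0, S)`, `f` is bounded, and so are its mass and energy
  (no quantitative information is attached to this bound). -/
  locally_bounded : ∀ s s' : ℝ, 0 < s → (s' : EReal) < S → ∃ B : ℝ, ∀ t ∈ Set.Icc s s',
    (∀ v, f t v ≤ B) ∧ mass (f t) ≤ B ∧ energy (f t) ≤ B
  /-- The equation. -/
  equation : ∀ t : ℝ, 0 < t → (t : EReal) < S → ∀ v,
    deriv (fun s => f s v) t =
      (∑ i, ∑ j, diffusion a γ (f t) v i j * partial₂ (f t) v i j)
        + reaction a γ (f t) v * f t v
  /-- The initial datum is attained in the weighted space `L¹((1 + |v|²) dv)` and in entropy. -/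
  initial : Tendsto (fun t : ℝ => ∫ v, (1 + ‖v‖ ^ 2) * |f t v - f 0 v|) (𝓝[>] 0) (𝓝 0)
  initial_entropy : Tendsto (fun t : ℝ => entropy (f t)) (𝓝[>] 0) (𝓝 (entropy (f 0)))

end Landau

end

/-!
Smoothing of the homogeneous Landau equation for very soft potentials, `γ ∈ [-2, 0]`: the supremum
of a solution at time `t` is `O(t ^ (-d / 2))`, as for the heat equation.

*Hydrodynamic bounds.* A classical solution conserves mass and energy (`mass_eq`, `energy_eq`), and
its entropy does not increase (`entropy_le`). All this is obtained from the weak form of the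
equation (`hasDerivAt_integral_test`), with cutoffs; the entropy is also regularized, and its
production has a sign because `∫ c[G] G` is a quadratic interaction of `∇G` with itself through the
nonnegative matrix `kernel` (`sum_integral_prod_le`). Hence at every time the density lies in the
class `Profile`, and only this class enters the estimates below. The coefficients of the equation
are then controlled: the density is uniformly integrable (`exists_integral_excess_le`), so that it
does not concentrate near lines, and the diffusion matrix is bounded below by a multiple of
`⟨v⟩^γ ((1 + |v|²) I - v ⊗ v)` (`exists_le_quad_diffusion`) and above in the same anisotropic manner
(`Profile.diffusion_le`). The reaction coefficient splits into a part which is small compared with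
`1 / t`, and a part generated by the large values of the density at small distance, whose integrals
over unit balls are small (`Profile.reaction_le`, `Profile.lintegral_nearReaction_le`).

*Contact estimate.* Suppose that the solution reaches a height `N` at `(t₀, v₀)`, and is at most
`5 N / 4` shortly before. A paraboloid of height `~ N`, adapted to the anisotropy of the diffusion
at `v₀` (`stretch`), then touches the solution from above with a full set of slopes. The
Krylov–Tso estimate (`krylov_tso`) bounds the measure of this set by an integral over the contact
set of a power of the reaction coefficient and of the inverse length of the time interval
(`contact_estimate`). On the contact set the solution is at least `N / 2`, so that by Chebyshev's
inequality this set is small. With `N = k ^ d (t₀ - s) ^ (-d / 2)`, all terms scale alike, and the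
estimate fails if `k` is large and the excess of the density over a high level is small
(`lt_of_scaling`, `le_of_contact`).

*Conclusion.* The supremum of a solution does not jump upwards (`exists_le_add_mul`), so that the
previous step applies at the first time at which the bound started from the time `s` would fail
(`exists_bound_from`). The theorem follows with `s → 0`, or with `s = t - T` for large times.
-/

noncomputable section

namespace Landau

section

/-! ### The Krylov–Tso estimate -/

/-- Necessary second order condition at an interior maximum on the line. -/
theorem second_deriv_nonpos_of_isLocalMax {φ φ' : ℝ → ℝ} {x c : ℝ} (hmax : IsLocalMax φ x)
    (h1 : ∀ᶠ s in 𝓝 x, HasDerivAt φ (φ' s) s) (h2 : HasDerivAt φ' c x) : c ≤ 0 := by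
  by_contra! hc
  have hd : deriv φ =ᶠ[𝓝 x] φ' := h1.mono fun s hs => hs.deriv
  have h2' : deriv (deriv φ) x = c := by rw [hd.deriv_eq, h2.deriv]
  have hmin : IsLocalMin φ x :=
    isLocalMin_of_deriv_deriv_pos (by rw [h2']; exact hc) hmax.deriv_eq_zero
      h1.self_of_nhds.continuousAt
  -- a point that is both a local maximum and a local minimum has `φ` constant nearby
  have hconst : φ =ᶠ[𝓝 x] fun _ => φ x := by
    filter_upwards [hmax, hmin] with s hs hs' using le_antisymm hs hs'
  have : deriv φ =ᶠ[𝓝 x] fun _ => 0 := by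
    have := hconst.deriv
    simpa using this
  rw [this.deriv_eq] at h2'
  simp at h2'
  linarith

variable {d : ℕ}

/-- On one time slice: the area formula weighted by a function of the image point. -/
theorem lintegral_le_lintegral_mul_abs_det {Ω Γ P : Set (Vel d)} {grad : Vel d → Vel d}
    {hess : Vel d → (Vel d →L[ℝ] Vel d)} {w : Vel d → ℝ} {D : Vel d → ℝ}
    (hD : Measurable D) (hw : Measurable w)
    (hΓ : MeasurableSet Γ) (hΓΩ : Γ ⊆ Ω)
    (hhess : ∀ v ∈ Ω, HasFDerivAt grad (hess v) v)
    (hdet : Measurable fun v => (hess v).det)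
    (hcont : ∀ p ∈ P, 0 < D p → ∃ v ∈ Γ, grad v = p ∧ D p ≤ w v) :
    ∫⁻ p in P, ENNReal.ofReal (D p) ≤
      ∫⁻ v in Γ, ENNReal.ofReal (w v) * ENNReal.ofReal |(hess v).det| := by
  have hL : ∫⁻ p in P, ENNReal.ofReal (D p) =
      ∫⁻ l in Set.Ioi (0 : ℝ), volume.restrict P {p | l < max (D p) 0} := by
    rw [← lintegral_eq_lintegral_meas_lt]
    · refine lintegral_congr fun p => ?_
      rcases le_total (D p) 0 with h | h
      · rw [max_eq_right h, ENNReal.ofReal_of_nonpos h]; simp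
      · rw [max_eq_left h]
    · exact Eventually.of_forall fun p => le_max_right _ _
    · exact (hD.max measurable_const).aemeasurable
  rw [hL]
  have hstep : ∀ l ∈ Set.Ioi (0 : ℝ), volume.restrict P {p | l < max (D p) 0} ≤
      ∫⁻ v in Γ, ({v | l < w v}.indicator fun v => ENNReal.ofReal |(hess v).det|) v := by
    intro l hl
    have hm : MeasurableSet {v | l < w v} := measurableSet_lt measurable_const hw
    rw [Measure.restrict_apply (measurableSet_lt measurable_const (hD.max measurable_const)),
      lintegral_indicator hm, Measure.restrict_restrict hm]
    refine le_trans (measure_mono ?_) (addHaar_image_le_lintegral_abs_det_fderiv volume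
      (hm.inter hΓ) (f := grad) fun v hv => (hhess v (hΓΩ hv.2)).hasFDerivWithinAt)
    rintro p ⟨hp, hpP⟩
    have hp' : l < D p := by
      rcases lt_max_iff.1 (show l < max (D p) 0 from hp) with h | h
      · exact h
      · exact absurd h (not_lt.2 (le_of_lt hl))
    obtain ⟨v, hv, hvp, hle⟩ := hcont p hpP (lt_trans hl hp')
    exact ⟨v, ⟨lt_of_lt_of_le hp' hle, hv⟩, hvp⟩
  refine le_trans (setLIntegral_mono' measurableSet_Ioi hstep) ?_
  have hjm : Measurable fun x : ℝ × Vel d =>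
      ({v | x.1 < w v}.indicator fun v => ENNReal.ofReal |(hess v).det|) x.2 := by
    have : (fun x : ℝ × Vel d =>
        ({v | x.1 < w v}.indicator fun v => ENNReal.ofReal |(hess v).det|) x.2) =
        {x : ℝ × Vel d | x.1 < w x.2}.indicator
          fun x => ENNReal.ofReal |(hess x.2).det| := by
      ext x; simp [Set.indicator]
    rw [this]
    refine Measurable.indicator ?_ (measurableSet_lt measurable_fst (hw.comp measurable_snd))
    have : Measurable fun x : ℝ × Vel d => (hess x.2).det := hdet.comp measurable_snd
    exact this.abs.ennreal_ofReal
  rw [lintegral_lintegral_swap hjm.aemeasurable]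
  refine lintegral_mono fun v => ?_
  have : (fun l : ℝ => ({v | l < w v}.indicator fun v => ENNReal.ofReal |(hess v).det|) v) =
      (Set.Iio (w v)).indicator fun _ => ENNReal.ofReal |(hess v).det| := by
    ext l; simp [Set.indicator]
  simp only [this]
  rw [lintegral_indicator measurableSet_Iio, lintegral_const, Measure.restrict_restrict
    measurableSet_Iio, Measure.restrict_apply MeasurableSet.univ, Set.univ_inter, mul_comm]
  gcongr
  rw [Set.inter_comm, Set.Ioi_inter_Iio, Real.volume_Ioo, sub_zero]

/-- At an interior local maximum of `w - p·(v - v₀)` the gradient of `w` is `p` and its Hessian is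
nonpositive. -/
theorem grad_eq_and_hess_nonpos_of_isLocalMax {Ω : Set (Vel d)} {w : Vel d → ℝ}
    {grad : Vel d → Vel d} {hess : Vel d → (Vel d →L[ℝ] Vel d)} {x p v₀ : Vel d} (hΩ : IsOpen Ω)
    (hx : x ∈ Ω) (hgrad : ∀ v ∈ Ω, HasGradientAt w (grad v) v)
    (hhess : ∀ v ∈ Ω, HasFDerivAt grad (hess v) v)
    (hlm : IsLocalMax (fun v => w v - inner ℝ p (v - v₀)) x) :
    grad x = p ∧ ∀ ξ, inner ℝ ξ (hess x ξ) ≤ 0 := by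
  have hline : ∀ v ∈ Ω, HasFDerivAt (fun v => w v - inner ℝ p (v - v₀))
      (innerSL ℝ (grad v) - innerSL ℝ p) v := by
    intro v hv
    have h1 := (hgrad v hv).hasFDerivAt
    have h2 : HasFDerivAt (fun v => inner ℝ p (v - v₀)) (innerSL ℝ p) v :=
      (innerSL ℝ p).hasFDerivAt.comp v ((hasFDerivAt_id v).sub_const v₀)
    exact h1.sub h2
  have hgp : grad x = p := by
    have h0 := hlm.hasFDerivAt_eq_zero (hline x hx)
    rw [← map_sub] at h0
    have := congrArg (fun l => l (grad x - p)) h0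
    simp only [innerSL_apply_apply, zero_apply, inner_self_eq_zero] at this
    exact sub_eq_zero.1 this
  refine ⟨hgp, fun ξ => ?_⟩
  have hγ : ∀ s : ℝ, HasDerivAt (fun s : ℝ => x + s • ξ) ξ s := fun s => by
    simpa using ((hasDerivAt_id s).smul_const ξ).const_add x
  have hγ0 : x + (0 : ℝ) • ξ = x := by simp
  have hT : Tendsto (fun s : ℝ => x + s • ξ) (𝓝 0) (𝓝 x) := by
    have := (hγ 0).continuousAt.tendsto
    rwa [hγ0] at this
  refine second_deriv_nonpos_of_isLocalMax
    (φ := fun s => w (x + s • ξ) - inner ℝ p (x + s • ξ - v₀))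
    (φ' := fun s => inner ℝ ξ (grad (x + s • ξ) - p)) (x := 0) ?_ ?_ ?_
  · filter_upwards [hT.eventually hlm] with s hs
    simpa only [hγ0] using hs
  · filter_upwards [hT.eventually (hΩ.mem_nhds hx)] with s hs
    refine ((hline _ hs).comp_hasDerivAt s (hγ s)).congr_deriv ?_
    simp only [sub_apply, innerSL_apply_apply, inner_sub_right,
      real_inner_comm]
  · have h1 : HasFDerivAt grad (hess x) (x + (0 : ℝ) • ξ) := by
      rw [hγ0]; exact hhess x hx
    exact ((innerSL ℝ ξ).hasFDerivAt.comp _ (h1.sub_const p)).comp_hasDerivAt (0 : ℝ) (hγ 0)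

/-- The running maximum `m(t, p)` over `[t₁, t] × B` of the positive part of `u - p·(v - v₀)`:
it is continuous, Lipschitz and nondecreasing in time, and attained where it is positive. -/
theorem exists_running_max {u ut : ℝ → Vel d → ℝ} {t₁ t₀ L : ℝ} (ht : t₁ < t₀)
    {B : Set (Vel d)} {v₀ : Vel d} (hB : IsCompact B) (hv₀ : v₀ ∈ B)
    (hc : ContinuousOn (fun p : ℝ × Vel d => u p.1 p.2) (Set.Icc t₁ t₀ ×ˢ Set.univ))
    (hut : ∀ t ∈ Set.Icc t₁ t₀, ∀ v, HasDerivAt (fun s => u s v) (ut t v) t)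
    (hL : ∀ t ∈ Set.Icc t₁ t₀, ∀ v ∈ B, |ut t v| ≤ L) :
    ∃ m : ℝ × Vel d → ℝ, Continuous m ∧
      (∀ p, AbsolutelyContinuousOnInterval (fun t => m (t, p)) t₁ t₀) ∧
      (∀ p, ∀ t ∈ Set.Icc t₁ t₀, 0 ≤ m (t, p)) ∧
      (∀ p, ∀ t ∈ Set.Icc t₁ t₀, ∀ v ∈ B, u t v - inner ℝ p (v - v₀) ≤ m (t, p)) ∧
      (∀ p, ∀ t ∈ Set.Icc t₁ t₀, ∀ t' ∈ Set.Icc t₁ t, m (t', p) ≤ m (t, p)) ∧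
      (∀ p, ∀ t ∈ Set.Icc t₁ t₀, m (t, p) ≤ 0 ∨ ∃ s ∈ Set.Icc t₁ t, ∃ v ∈ B,
        m (t, p) = u s v - inner ℝ p (v - v₀)) := by
  set U : ℝ → Vel d → ℝ := fun s v => u (Set.projIcc t₁ t₀ ht.le s) v with hU
  have hUc : Continuous fun p : ℝ × Vel d => U p.1 p.2 := by
    have h1 : Continuous fun p : ℝ × Vel d => ((Set.projIcc t₁ t₀ ht.le p.1 : ℝ), p.2) := by
      have : Continuous fun p : ℝ × Vel d => (Set.projIcc t₁ t₀ ht.le p.1 : ℝ) :=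
        continuous_subtype_val.comp (continuous_projIcc.comp continuous_fst)
      exact this.prodMk continuous_snd
    exact hc.comp_continuous h1 fun p => ⟨(Set.projIcc t₁ t₀ ht.le p.1).2, trivial⟩
  have hUu : ∀ s ∈ Set.Icc t₁ t₀, ∀ v, U s v = u s v := fun s hs v => by
    simp [hU, Set.projIcc_of_mem ht.le hs]
  set K : Set (ℝ × Vel d) := Set.Icc (0 : ℝ) 1 ×ˢ B with hK
  have hKc : IsCompact K := isCompact_Icc.prod hB
  have hKn : K.Nonempty := ⟨(0, v₀), ⟨by simp, hv₀⟩⟩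
  set F : ℝ × Vel d → ℝ × Vel d → ℝ := fun q x =>
    max (U (t₁ + x.1 * (q.1 - t₁)) x.2 - inner ℝ q.2 (x.2 - v₀)) 0 with hF
  have hFc : Continuous fun y : (ℝ × Vel d) × (ℝ × Vel d) => F y.1 y.2 := by
    have h1 : Continuous fun y : (ℝ × Vel d) × (ℝ × Vel d) =>
        U (t₁ + y.2.1 * (y.1.1 - t₁)) y.2.2 :=
      hUc.comp (f := fun y : (ℝ × Vel d) × (ℝ × Vel d) =>
        (t₁ + y.2.1 * (y.1.1 - t₁), y.2.2)) (by fun_prop)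
    have h2 : Continuous fun y : (ℝ × Vel d) × (ℝ × Vel d) =>
      inner ℝ y.1.2 (y.2.2 - v₀) := by fun_prop
    exact (h1.sub h2).max continuous_const
  have hFc1 : ∀ q, Continuous (F q) := fun q =>
    hFc.comp (continuous_const.prodMk continuous_id)
  set m : ℝ × Vel d → ℝ := fun q => sSup (F q '' K) with hm
  have hmc : Continuous m := hKc.continuous_sSup hFc
  have hmatt : ∀ q, ∃ x ∈ K, m q = F q x := fun q =>
    hKc.exists_sSup_image_eq hKn (hFc1 q).continuousOn
  have hmle : ∀ q, ∀ x ∈ K, F q x ≤ m q := fun q x hx =>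
    le_csSup (hKc.image (hFc1 q)).bddAbove ⟨x, hx, rfl⟩
  have hmem : ∀ t ∈ Set.Icc t₁ t₀, ∀ θ ∈ Set.Icc (0 : ℝ) 1, t₁ + θ * (t - t₁) ∈ Set.Icc t₁ t₀ := by
    rintro t ⟨ha, hb⟩ θ ⟨h0, h1⟩
    have := mul_nonneg h0 (sub_nonneg.2 ha)
    have := mul_le_mul_of_nonneg_right h1 (sub_nonneg.2 ha)
    constructor <;> linarith
  have hULip : ∀ v ∈ B, ∀ s ∈ Set.Icc t₁ t₀, ∀ s' ∈ Set.Icc t₁ t₀,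
      |u s v - u s' v| ≤ L * |s - s'| := by
    intro v hv s hs s' hs'
    have := Convex.norm_image_sub_le_of_norm_hasDerivWithin_le (f := fun s => u s v)
      (f' := fun s => ut s v) (C := L) (s := Set.Icc t₁ t₀)
      (fun x hx => (hut x hx v).hasDerivWithinAt) (fun x hx => hL x hx v hv)
      (convex_Icc _ _) hs' hs
    simpa using this
  have hL0 : 0 ≤ L := le_trans (abs_nonneg _) (hL t₁ ⟨le_rfl, ht.le⟩ v₀ hv₀)
  have hmLip1 : ∀ p, ∀ t ∈ Set.Icc t₁ t₀, ∀ t' ∈ Set.Icc t₁ t₀,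
      m (t, p) ≤ m (t', p) + L * |t - t'| := by
    intro p t htt t' htt'
    obtain ⟨x, hx, hxe⟩ := hmatt (t, p)
    rw [hxe]
    refine le_trans ?_ (add_le_add_left (hmle (t', p) x hx) _)
    have h1 := hULip x.2 hx.2 _ (hmem t htt x.1 hx.1) _ (hmem t' htt' x.1 hx.1)
    have h2 : |t₁ + x.1 * (t - t₁) - (t₁ + x.1 * (t' - t₁))| ≤ |t - t'| := by
      have : t₁ + x.1 * (t - t₁) - (t₁ + x.1 * (t' - t₁)) = x.1 * (t - t') := by ring
      rw [this, abs_mul, abs_of_nonneg hx.1.1]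
      exact mul_le_of_le_one_left (abs_nonneg _) hx.1.2
    have h3 := mul_le_mul_of_nonneg_left h2 hL0
    have h4 := abs_le.1 (h1.trans h3)
    simp only [hF]
    rw [hUu _ (hmem t htt x.1 hx.1), hUu _ (hmem t' htt' x.1 hx.1)]
    refine max_le ?_ ?_
    · have := le_max_left (u (t₁ + x.1 * (t' - t₁)) x.2 - inner ℝ p (x.2 - v₀)) 0
      linarith [h4.2]
    · have := le_max_right (u (t₁ + x.1 * (t' - t₁)) x.2 - inner ℝ p (x.2 - v₀)) 0
      have := mul_nonneg hL0 (abs_nonneg (t - t'))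
      linarith
  have hmAC : ∀ p, AbsolutelyContinuousOnInterval (fun t => m (t, p)) t₁ t₀ := by
    intro p
    refine LipschitzOnWith.absolutelyContinuousOnInterval (K := L.toNNReal) ?_
    rw [Set.uIcc_of_le ht.le]
    refine LipschitzOnWith.of_dist_le_mul fun x hx y hy => ?_
    rw [Real.dist_eq, Real.dist_eq, Real.coe_toNNReal _ hL0, abs_le]
    have h1 := hmLip1 p x hx y hy
    have h2 := hmLip1 p y hy x hx
    rw [abs_sub_comm] at h2
    constructor <;> linarith
  have hmono : ∀ p, ∀ t ∈ Set.Icc t₁ t₀, ∀ t' ∈ Set.Icc t₁ t, m (t', p) ≤ m (t, p) := by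
    intro p t htt t' htt'
    obtain ⟨x, hx, hxe⟩ := hmatt (t', p)
    rw [hxe]
    rcases eq_or_lt_of_le htt.1 with h | h
    · have : t' = t := le_antisymm htt'.2 (h ▸ htt'.1)
      rw [this]; exact hmle _ x hx
    · have hpos : 0 < t - t₁ := sub_pos.2 h
      have hx' : (x.1 * (t' - t₁) / (t - t₁), x.2) ∈ K := by
        refine ⟨⟨div_nonneg (mul_nonneg hx.1.1 (sub_nonneg.2 htt'.1)) hpos.le, ?_⟩, hx.2⟩
        rw [div_le_one hpos]
        calc x.1 * (t' - t₁) ≤ 1 * (t' - t₁) :=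
              mul_le_mul_of_nonneg_right hx.1.2 (sub_nonneg.2 htt'.1)
          _ ≤ t - t₁ := by linarith [htt'.2]
      have := hmle (t, p) _ hx'
      simp only [hF] at this ⊢
      rwa [div_mul_cancel₀ _ hpos.ne'] at this
  refine ⟨m, hmc, hmAC, fun p t _ => ?_, fun p t ht' v hv => ?_, hmono, fun p t htI => ?_⟩
  · obtain ⟨x, hx⟩ := hKn
    exact (le_max_right _ 0).trans (hmle (t, p) x hx)
  · have := (le_max_left _ 0).trans (hmle (t, p) (1, v) ⟨by simp, hv⟩)
    have e : t₁ + 1 * (t - t₁) = t := by ring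
    simp only [e] at this
    rwa [hUu _ ht'] at this
  · obtain ⟨x, hx, hxe⟩ := hmatt (t, p)
    have hs := hmem t htI x.1 hx.1
    rcases le_or_gt (m (t, p)) 0 with h0 | h0
    · exact Or.inl h0
    · refine Or.inr ⟨_, ⟨hs.1, ?_⟩, x.2, hx.2, ?_⟩
      · nlinarith [hx.1.2, htI.1]
      rw [hxe] at h0 ⊢
      simp only [hF] at h0 ⊢
      rw [hUu _ hs] at h0 ⊢
      rcases lt_max_iff.1 h0 with h | h
      · exact max_eq_left h.le
      · exact absurd h (lt_irrefl _)

/-- **Krylov–Tso (parabolic Alexandrov–Bakelman–Pucci) estimate.** If all the affine functions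
with slope in `P` dominate `u` on the parabolic boundary of `[t₁, t₀] × B`, while `b ≤ u(t₀, v₀)`,
then as `t` increases the affine functions touch `u` from above at points of the contact sets
`Γ t`; computing in every time slice the measure of the set of slopes bounds `b |P|` by the
integral of `∂ₜu |det D²u|` over the contact set. Working in slices, no differentiability of the
gradient in time is needed. -/
theorem krylov_tso {u ut : ℝ → Vel d → ℝ} {t₁ t₀ L b : ℝ} (ht : t₁ < t₀)
    {Ω B P : Set (Vel d)} {v₀ : Vel d} (hΩ : IsOpen Ω) (hB : IsCompact B)
    (hv₀ : v₀ ∈ B) (hΩB : Ω ⊆ B)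
    (hc : ContinuousOn (fun p : ℝ × Vel d => u p.1 p.2) (Set.Icc t₁ t₀ ×ˢ Set.univ))
    (hut : ∀ t ∈ Set.Icc t₁ t₀, ∀ v, HasDerivAt (fun s => u s v) (ut t v) t)
    (hL : ∀ t ∈ Set.Icc t₁ t₀, ∀ v ∈ B, |ut t v| ≤ L)
    {grad : ℝ → Vel d → Vel d} {hess : ℝ → Vel d → (Vel d →L[ℝ] Vel d)}
    (hgrad : ∀ t ∈ Set.Ioo t₁ t₀, ∀ v ∈ Ω, HasGradientAt (u t) (grad t v) v)
    (hhess : ∀ t ∈ Set.Ioo t₁ t₀, ∀ v ∈ Ω, HasFDerivAt (grad t) (hess t v) v)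
    (hP : MeasurableSet P)
    (hbot : ∀ p ∈ P, ∀ v ∈ B, u t₁ v - inner ℝ p (v - v₀) ≤ 0)
    (hlat : ∀ p ∈ P, ∀ t ∈ Set.Icc t₁ t₀, ∀ v ∈ B \ Ω, u t v - inner ℝ p (v - v₀) ≤ 0)
    (hb : b ≤ u t₀ v₀)
    {Γ : ℝ → Set (Vel d)} (hΓm : ∀ t ∈ Set.Ioo t₁ t₀, MeasurableSet (Γ t))
    (hΓΩ : ∀ t ∈ Set.Ioo t₁ t₀, Γ t ⊆ Ω)
    (hΓ : ∀ t ∈ Set.Ioo t₁ t₀, ∀ v ∈ Ω, ∀ p ∈ P, 0 < u t v - inner ℝ p (v - v₀) →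
      (∀ ξ, inner ℝ ξ (hess t v ξ) ≤ 0) → 0 < ut t v → v ∈ Γ t)
    (hutm : ∀ t ∈ Set.Ioo t₁ t₀, Measurable (ut t))
    (hdetm : ∀ t ∈ Set.Ioo t₁ t₀, Measurable fun v => (hess t v).det) :
    ENNReal.ofReal b * volume P ≤ ∫⁻ t in Set.Ioo t₁ t₀, ∫⁻ v in Γ t,
      ENNReal.ofReal (ut t v) * ENNReal.ofReal |(hess t v).det| := by
  obtain ⟨m, hmc, hmAC, hm0', hge, hmono, hmatt⟩ := exists_running_max ht hB hv₀ hc hut hL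
  -- at a time where `m` increases, the maximum is attained now, in the interior
  have hcontact : ∀ t ∈ Set.Ioo t₁ t₀, ∀ p ∈ P, 0 < deriv (fun s => m (s, p)) t →
      ∃ v ∈ Γ t, grad t v = p ∧ deriv (fun s => m (s, p)) t ≤ ut t v := by
    intro t htt p hp hpos
    have htI : t ∈ Set.Icc t₁ t₀ := Set.Ioo_subset_Icc_self htt
    have hdiff : HasDerivAt (fun s => m (s, p)) (deriv (fun s => m (s, p)) t) t := by
      refine DifferentiableAt.hasDerivAt ?_
      by_contra h
      rw [deriv_zero_of_not_differentiableAt h] at hpos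
      exact lt_irrefl _ hpos
    have hlt : ∀ t' ∈ Set.Ico t₁ t, m (t', p) < m (t, p) := by
      intro t' ht'
      by_contra! hge
      have hconst : ∀ s ∈ Set.Icc t' t, m (s, p) = m (t, p) := fun s hs =>
        le_antisymm (hmono p t htI s ⟨ht'.1.trans hs.1, hs.2⟩)
          (hge.trans (hmono p s ⟨ht'.1.trans hs.1, hs.2.trans htI.2⟩ t' ⟨ht'.1, hs.1⟩))
      have h0 : HasDerivWithinAt (fun s => m (s, p)) 0 (Set.Icc t' t) t :=
        (hasDerivWithinAt_const t _ (m (t, p))).congr (fun s hs => hconst s hs) rfl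
      have hu : UniqueDiffWithinAt ℝ (Set.Icc t' t) t :=
        uniqueDiffOn_Icc ht'.2 t ⟨ht'.2.le, le_rfl⟩
      have := hu.eq_deriv _ hdiff.hasDerivWithinAt h0
      linarith
    have hm0 : 0 < m (t, p) :=
      (hm0' p t₁ ⟨le_rfl, ht.le⟩).trans_lt (hlt t₁ ⟨le_rfl, htt.1⟩)
    obtain ⟨s, hs, x, hx, hval⟩ := (hmatt p t htI).resolve_left hm0.not_ge
    have hsI : s ∈ Set.Icc t₁ t₀ := ⟨hs.1, hs.2.trans htI.2⟩
    have hst : s = t := by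
      by_contra hne
      have h1 := hge p s hsI x hx
      have h2 := hlt s ⟨hs.1, lt_of_le_of_ne hs.2 hne⟩
      rw [← hval] at h1
      linarith
    rw [hst] at hval
    have hΩx : x ∈ Ω := by
      by_contra hn
      have := hlat p hp t htI x ⟨hx, hn⟩
      linarith
    have hlm : IsLocalMax (fun v => u t v - inner ℝ p (v - v₀)) x := by
      filter_upwards [hΩ.mem_nhds hΩx] with v hv
      show u t v - inner ℝ p (v - v₀) ≤ u t x - inner ℝ p (x - v₀)
      rw [← hval]
      exact hge p t htI v (hΩB hv)
    obtain ⟨hgp, hneg⟩ := grad_eq_and_hess_nonpos_of_isLocalMax hΩ hΩx (hgrad t htt) (hhess t htt) hlm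
    have hder : deriv (fun s => m (s, p)) t ≤ ut t x := by
      -- compare left difference quotients
      have h1 : HasDerivAt (fun s => m (s, p) - (u s x - inner ℝ p (x - v₀)))
          (deriv (fun s => m (s, p)) t - ut t x) t :=
        hdiff.sub ((hut t htI x).sub_const _)
      by_contra! hgt
      have hpos' : 0 < deriv (fun s => m (s, p)) t - ut t x := sub_pos.2 hgt
      have h2 := h1.hasDerivWithinAt (s := Set.Iio t)
      have h3 := (hasDerivWithinAt_iff_tendsto_slope' (by simp)).1 h2
      have h4 : ∀ᶠ s in 𝓝[<] t, slope (fun s => m (s, p) - (u s x - inner ℝ p (x - v₀))) t s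
          ≤ 0 := by
        have hI : Set.Ioo t₁ t ∈ 𝓝[<] t := Ioo_mem_nhdsLT htt.1
        filter_upwards [hI] with s hs
        rw [slope_def_field]
        refine div_nonpos_of_nonneg_of_nonpos ?_ (by linarith [hs.2])
        have := hge p s ⟨hs.1.le, hs.2.le.trans htI.2⟩ x hx
        rw [hval]
        linarith
      have h5 := le_of_tendsto h3 h4
      linarith
    exact ⟨x, hΓ t htt x hΩx p hp (hval ▸ hm0) hneg (hpos.trans_le hder), hgp, hder⟩
  -- integrate in time, exchange the integrals, and use the area formula in each slice
  have hDm : Measurable fun q : Vel d × ℝ => deriv (fun s => m (s, q.1)) q.2 :=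
    measurable_deriv_with_param (f := fun p s => m (s, p)) (hmc.comp (continuous_snd.prodMk continuous_fst))
  have hb1 : ∀ p ∈ P, ENNReal.ofReal b ≤
      ∫⁻ t in Set.Ioo t₁ t₀, ENNReal.ofReal (deriv (fun s => m (s, p)) t) := by
    intro p hp
    have h1 := (hmAC p).integral_deriv_eq_sub
    have h2 : b ≤ m (t₀, p) := by
      have := hge p t₀ ⟨ht.le, le_rfl⟩ v₀ hv₀
      simp at this
      linarith
    have h3 : m (t₁, p) ≤ 0 := by
      rcases hmatt p t₁ ⟨le_rfl, ht.le⟩ with h | ⟨s, hs, v, hv, h⟩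
      · exact h
      · rw [h, le_antisymm hs.2 hs.1]
        exact hbot p hp v hv
    have h4 : b ≤ ∫ t in Set.Ioo t₁ t₀, deriv (fun s => m (s, p)) t := by
      rw [← integral_Ioc_eq_integral_Ioo, ← intervalIntegral.integral_of_le ht.le, h1]
      linarith
    refine (ENNReal.ofReal_le_ofReal h4).trans ?_
    refine ENNReal.ofReal_le_of_le_toReal ?_ |>.trans le_rfl
    by_cases hi : Integrable (fun t => deriv (fun s => m (s, p)) t) (volume.restrict (Set.Ioo t₁ t₀))
    · rw [integral_eq_lintegral_pos_part_sub_lintegral_neg_part hi]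
      linarith [ENNReal.toReal_nonneg (a := ∫⁻ t in Set.Ioo t₁ t₀,
        ENNReal.ofReal (-deriv (fun s => m (s, p)) t))]
    · rw [integral_undef hi]; exact ENNReal.toReal_nonneg
  calc ENNReal.ofReal b * volume P = ∫⁻ _ in P, ENNReal.ofReal b := by
        rw [lintegral_const, Measure.restrict_apply MeasurableSet.univ, Set.univ_inter]
    _ ≤ ∫⁻ p in P, ∫⁻ t in Set.Ioo t₁ t₀, ENNReal.ofReal (deriv (fun s => m (s, p)) t) :=
        setLIntegral_mono' hP hb1
    _ = ∫⁻ t in Set.Ioo t₁ t₀, ∫⁻ p in P, ENNReal.ofReal (deriv (fun s => m (s, p)) t) :=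
        lintegral_lintegral_swap hDm.ennreal_ofReal.aemeasurable
    _ ≤ _ := by
        refine setLIntegral_mono' measurableSet_Ioo fun t htt => ?_
        exact lintegral_le_lintegral_mul_abs_det (Ω := Ω) (grad := grad t)
          (hDm.comp (measurable_id.prodMk measurable_const)) (hutm t htt) (hΓm t htt) (hΓΩ t htt)
          (hhess t htt) (hdetm t htt) (hcontact t htt)

end

section

/-! ### The derivatives of the kernels -/

variable {d : ℕ}

/-- The first partial derivative `∂ᵢ u (v)`. -/
def pd (i : Fin d) (u : Vel d → ℝ) (v : Vel d) : ℝ := fderiv ℝ u v (EuclideanSpace.single i 1)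

/-- The singular part `|z|^γ 1_{|z| < 1}` of the kernel `|z|^γ`. -/
def sing (γ : ℝ) (z : Vel d) : ℝ := (Metric.ball (0 : Vel d) 1).indicator (fun z => ‖z‖ ^ γ) z

theorem sing_nonneg (γ : ℝ) (z : Vel d) : 0 ≤ sing γ z :=
  Set.indicator_nonneg (fun z _ => Real.rpow_nonneg (norm_nonneg z) γ) z

theorem integrable_sing {γ : ℝ} (hd : 2 ≤ d) (hγ : 0 < (d : ℝ) + γ) :
    Integrable (sing γ : Vel d → ℝ) := by
  have : Nontrivial (Vel d) := by
    have : Nonempty (Fin d) := ⟨⟨0, by omega⟩⟩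
    infer_instance
  rw [show (sing γ : Vel d → ℝ) = (Metric.ball (0 : Vel d) 1).indicator (fun z => ‖z‖ ^ γ) from rfl,
    integrable_indicator_iff measurableSet_ball,
    integrableOn_fun_norm_addHaar volume (f := fun y => y ^ γ)]
  rw [finrank_euclideanSpace_fin]
  have h1 : IntervalIntegrable (fun x : ℝ => x ^ ((d : ℝ) - 1 + γ)) volume 0 1 :=
    intervalIntegral.intervalIntegrable_rpow' (by linarith)
  rw [intervalIntegrable_iff_integrableOn_Ioo_of_le zero_le_one] at h1
  refine h1.congr_fun (fun x hx => ?_) measurableSet_Ioo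
  simp only [smul_eq_mul]
  rw [Real.rpow_add hx.1, ← Real.rpow_natCast, Nat.cast_sub (by omega)]
  simp

theorem norm_rpow_le_sing_add_one {γ : ℝ} (hγ : γ ≤ 0) (z : Vel d) : ‖z‖ ^ γ ≤ sing γ z + 1 := by
  by_cases h : z ∈ Metric.ball (0 : Vel d) 1
  · simp [sing, Set.indicator_of_mem h]
  · have h1 : 1 ≤ ‖z‖ := by simpa using h
    simp only [sing, Set.indicator_of_notMem h, zero_add]
    exact Real.rpow_le_one_of_one_le_of_nonpos h1 hγ

/-- The vector kernel `|z|^γ z_j`, up to the factor `-(d - 1)` the divergence of `kernel γ`. -/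
def vecKernel (γ : ℝ) (j : Fin d) (z : Vel d) : ℝ := ‖z‖ ^ γ * z j

theorem abs_coord_le (z : Vel d) (i : Fin d) : |z i| ≤ ‖z‖ := by
  simpa using PiLp.norm_apply_le z i

theorem measurable_coord (i : Fin d) : Measurable fun z : Vel d => z i :=
  (PiLp.continuous_apply 2 _ i).measurable

theorem measurable_vecKernel (γ : ℝ) (j : Fin d) : Measurable (vecKernel γ j) :=
  (measurable_norm.pow_const γ).mul (measurable_coord j)

theorem measurable_kernel (γ : ℝ) (i j : Fin d) : Measurable fun z : Vel d => kernel γ z i j := by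
  unfold kernel
  simp only [Matrix.of_apply]
  exact (measurable_const.sub (((measurable_coord i).div measurable_norm).mul
    ((measurable_coord j).div measurable_norm))).mul (measurable_norm.pow_const _)

/-- Away from the origin the kernel is `(|z|² δᵢⱼ - zᵢ zⱼ) |z|^γ`. -/
theorem kernel_eq (γ : ℝ) {z : Vel d} (hz : z ≠ 0) (i j : Fin d) :
    kernel γ z i j = ((if i = j then ‖z‖ ^ 2 else 0) - z i * z j) * ‖z‖ ^ γ := by
  have h : 0 < ‖z‖ := norm_pos_iff.2 hz
  unfold kernel
  simp only [Matrix.of_apply]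
  rw [Real.rpow_add h, Real.rpow_two]
  split_ifs <;> field_simp
  ring

theorem abs_sub_coord_mul_le (z : Vel d) (i j : Fin d) :
    |(if i = j then ‖z‖ ^ 2 else 0) - z i * z j| ≤ 2 * ‖z‖ ^ 2 := by
  have h1 : |z i * z j| ≤ ‖z‖ ^ 2 := by
    rw [abs_mul, sq]
    exact mul_le_mul (abs_coord_le z i) (abs_coord_le z j) (abs_nonneg _) (norm_nonneg _)
  have h2 : |(if i = j then ‖z‖ ^ 2 else 0)| ≤ ‖z‖ ^ 2 := by
    split_ifs
    · rw [abs_of_nonneg (by positivity)]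
    · simp
  rw [abs_le] at h1 h2 ⊢
  constructor <;> linarith [h1.1, h1.2, h2.1, h2.2]

theorem norm_sq_mul_rpow_le {γ : ℝ} (hγ : γ ∈ Set.Icc (-2 : ℝ) 0) (z : Vel d) :
    ‖z‖ ^ 2 * ‖z‖ ^ γ ≤ (1 + ‖z‖) ^ 2 := by
  rcases eq_or_lt_of_le (norm_nonneg z) with h | h
  · rw [← h]; norm_num
  · rw [← Real.rpow_two, ← Real.rpow_add h, ← Real.rpow_two]
    calc ‖z‖ ^ (2 + γ) ≤ (1 + ‖z‖) ^ (2 + γ) :=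
          Real.rpow_le_rpow h.le (by linarith) (by linarith [hγ.1])
      _ ≤ (1 + ‖z‖) ^ (2 : ℝ) :=
          Real.rpow_le_rpow_of_exponent_le (by linarith) (by linarith [hγ.2])

theorem norm_mul_rpow_le {γ : ℝ} (hγ : γ ∈ Set.Icc (-2 : ℝ) 0) (z : Vel d) :
    ‖z‖ * ‖z‖ ^ γ ≤ sing γ z + (1 + ‖z‖) := by
  have h0 := norm_nonneg z
  by_cases h : z ∈ Metric.ball (0 : Vel d) 1
  · have h1 : ‖z‖ < 1 := by simpa using h
    have h2 := Real.rpow_nonneg h0 γ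
    simp only [sing, Set.indicator_of_mem h]
    nlinarith
  · have h1 : 1 ≤ ‖z‖ := by simpa using h
    have h2 := Real.rpow_le_one_of_one_le_of_nonpos h1 hγ.2
    have := sing_nonneg γ z
    nlinarith

/-- Kernels of growth `σ`: measurable, and bounded by the integrable singularity `|z|^γ 1_{|z|<1}`
plus `(1 + |z|)^σ`, up to a factor. -/
structure KernelBound (γ : ℝ) (σ : ℕ) (k : Vel d → ℝ) : Prop where
  meas : Measurable k
  bound : ∀ z, |k z| ≤ 2 * (sing γ z + (1 + ‖z‖) ^ σ)

theorem kernelBound_kernel {γ : ℝ} (hγ : γ ∈ Set.Icc (-2 : ℝ) 0) (i j : Fin d) :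
    KernelBound γ 2 fun z : Vel d => kernel γ z i j := by
  refine ⟨measurable_kernel γ i j, fun z => ?_⟩
  have h1 := sing_nonneg γ z
  by_cases hz : z = 0
  · subst hz
    have h2 : |kernel γ (0 : Vel d) i j| ≤ 1 := by
      unfold kernel
      simp only [Matrix.of_apply, norm_zero]
      have : |(0 : ℝ) ^ (γ + 2)| ≤ 1 := by
        rw [abs_of_nonneg (Real.rpow_nonneg le_rfl _)]
        exact Real.zero_rpow_le_one _
      split_ifs <;> simp [this]
    simp only [norm_zero]; linarith
  · rw [kernel_eq γ hz, abs_mul, abs_of_nonneg (Real.rpow_nonneg (norm_nonneg z) γ)]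
    have h2 := norm_sq_mul_rpow_le hγ z
    have h3 := mul_le_mul_of_nonneg_right (abs_sub_coord_mul_le z i j)
      (Real.rpow_nonneg (norm_nonneg z) γ)
    linarith

theorem kernelBound_vecKernel {γ : ℝ} (hγ : γ ∈ Set.Icc (-2 : ℝ) 0) (j : Fin d) :
    KernelBound γ 1 (vecKernel γ j) := by
  refine ⟨measurable_vecKernel γ j, fun z => ?_⟩
  have h1 := norm_mul_rpow_le hγ z
  have h2 := sing_nonneg γ z
  have h3 := mul_le_mul_of_nonneg_left (abs_coord_le z j) (Real.rpow_nonneg (norm_nonneg z) γ)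
  unfold vecKernel
  rw [abs_mul, abs_of_nonneg (Real.rpow_nonneg (norm_nonneg z) γ), pow_one]
  have := norm_nonneg z
  linarith

theorem kernelBound_rpow {γ : ℝ} (hγ : γ ∈ Set.Icc (-2 : ℝ) 0) :
    KernelBound γ 0 fun z : Vel d => ‖z‖ ^ γ := by
  refine ⟨measurable_norm.pow_const γ, fun z => ?_⟩
  rw [abs_of_nonneg (Real.rpow_nonneg (norm_nonneg z) γ), pow_zero]
  linarith [norm_rpow_le_sing_add_one hγ.2 z, sing_nonneg γ z]

/-- Integration by parts against a compactly supported `C¹` function. -/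
theorem integral_mul_pd_eq_neg {X Φ : Vel d → ℝ} (hX : ContDiff ℝ 1 X) (hΦ : ContDiff ℝ 1 Φ)
    (hc : HasCompactSupport Φ) (i : Fin d) :
    ∫ z, X z * pd i Φ z = -∫ z, pd i X z * Φ z := by
  have hX' : Continuous fun z => fderiv ℝ X z (EuclideanSpace.single i 1) :=
    (hX.continuous_fderiv (by norm_num)).clm_apply continuous_const
  have hΦ' : Continuous fun z => fderiv ℝ Φ z (EuclideanSpace.single i 1) :=
    (hΦ.continuous_fderiv (by norm_num)).clm_apply continuous_const
  refine integral_mul_fderiv_eq_neg_fderiv_mul_of_integrable ?_ ?_ ?_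
    (fun x _ => hX.differentiable (by norm_num) x) (fun x _ => hΦ.differentiable (by norm_num) x)
  · exact (hX'.mul hΦ.continuous).integrable_of_hasCompactSupport hc.mul_left
  · exact (hX.continuous.mul hΦ').integrable_of_hasCompactSupport
      (hc.fderiv_apply ℝ _).mul_left
  · exact (hX.continuous.mul hΦ.continuous).integrable_of_hasCompactSupport hc.mul_left

theorem continuous_pd {u : Vel d → ℝ} (hu : ContDiff ℝ 1 u) (i : Fin d) : Continuous (pd i u) :=
  (hu.continuous_fderiv (by norm_num)).clm_apply continuous_const

theorem hasCompactSupport_pd {u : Vel d → ℝ} (hu : HasCompactSupport u) (i : Fin d) :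
    HasCompactSupport (pd i u) := hu.fderiv_apply ℝ _

theorem integrable_kernelBound_mul {γ : ℝ} (hd : 2 ≤ d) (hγd : 0 < (d : ℝ) + γ) (σ : ℕ)
    {ψ : Vel d → ℝ} (hψ : Continuous ψ) (hc : HasCompactSupport ψ) :
    Integrable fun z => (sing γ z + (1 + ‖z‖) ^ σ) * ψ z := by
  simp only [add_mul]
  refine Integrable.add ?_ ?_
  · obtain ⟨C, hC⟩ := hc.exists_bound_of_continuous hψ
    exact (integrable_sing hd hγd).mul_bdd hψ.aestronglyMeasurable
      (Eventually.of_forall hC)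
  · exact Continuous.integrable_of_hasCompactSupport (by fun_prop) hc.mul_left

/-- Regularization of `|z|^γ`. -/
def regPow (γ δ : ℝ) (z : Vel d) : ℝ := (‖z‖ ^ 2 + δ) ^ (γ / 2)

theorem hasFDerivAt_norm_sq_add_rpow {δ : ℝ} (hδ : 0 < δ) (p : ℝ) (z : Vel d) :
    HasFDerivAt (fun z : Vel d => (‖z‖ ^ 2 + δ) ^ p)
      ((p * (‖z‖ ^ 2 + δ) ^ (p - 1)) • (2 • innerSL ℝ z)) z := by
  have h1 : HasFDerivAt (fun z : Vel d => ‖z‖ ^ 2 + δ) (2 • innerSL ℝ z) z :=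
    ((hasStrictFDerivAt_norm_sq z).hasFDerivAt).add_const δ
  have h2 : (‖z‖ ^ 2 + δ) ≠ 0 := by positivity
  exact (Real.hasDerivAt_rpow_const (Or.inl h2)).comp_hasFDerivAt z h1

theorem contDiff_norm_sq_add_rpow {δ : ℝ} (hδ : 0 < δ) (p : ℝ) {n : ℕ} :
    ContDiff ℝ n (fun z : Vel d => (‖z‖ ^ 2 + δ) ^ p) :=
  ((contDiff_norm_sq ℝ).add contDiff_const).rpow_const_of_ne fun z => by positivity

theorem regPow_le {γ δ : ℝ} (hγ : γ ≤ 0) (hδ : 0 < δ) {z : Vel d} (hz : z ≠ 0) :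
    regPow γ δ z ≤ ‖z‖ ^ γ := by
  have h : 0 < ‖z‖ := norm_pos_iff.2 hz
  have : ‖z‖ ^ γ = (‖z‖ ^ 2) ^ (γ / 2) := by
    rw [← Real.rpow_two, ← Real.rpow_mul h.le]; congr 1; ring
  rw [this]
  exact Real.rpow_le_rpow_of_nonpos (by positivity) (by linarith) (by linarith)

theorem regPow_nonneg {γ δ : ℝ} (hδ : 0 < δ) (z : Vel d) : 0 ≤ regPow γ δ z :=
  Real.rpow_nonneg (by positivity) _

theorem tendsto_norm_sq_add_rpow (p : ℝ) {z : Vel d} (hz : z ≠ 0) :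
    Tendsto (fun n : ℕ => (‖z‖ ^ 2 + 1 / ((n : ℝ) + 1)) ^ p) atTop (𝓝 (‖z‖ ^ (2 * p))) := by
  have h : 0 < ‖z‖ := norm_pos_iff.2 hz
  have : ‖z‖ ^ (2 * p) = (‖z‖ ^ 2 + 0) ^ p := by
    rw [add_zero, ← Real.rpow_two, ← Real.rpow_mul h.le]
  rw [this]
  have h1 : Tendsto (fun n : ℕ => ‖z‖ ^ 2 + 1 / ((n : ℝ) + 1)) atTop (𝓝 (‖z‖ ^ 2 + 0)) :=
    tendsto_const_nhds.add tendsto_one_div_add_atTop_nhds_zero_nat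
  exact h1.rpow_const (Or.inl (by positivity))

/-- Passing to the limit in integrals against regularized kernels. -/
theorem tendsto_integral_regularized {γ : ℝ} (hd : 2 ≤ d) (hγd : 0 < (d : ℝ) + γ) {C : ℝ}
    {k : Vel d → ℝ} {kn : ℕ → Vel d → ℝ} (hm : ∀ n, Measurable (kn n))
    (hb : ∀ n z, z ≠ 0 → |kn n z| ≤ C * (sing γ z + (1 + ‖z‖) ^ 2))
    (hlim : ∀ z, z ≠ 0 → Tendsto (fun n => kn n z) atTop (𝓝 (k z)))
    {ψ : Vel d → ℝ} (hψ : Continuous ψ) (hc : HasCompactSupport ψ) :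
    Tendsto (fun n => ∫ z, kn n z * ψ z) atTop (𝓝 (∫ z, k z * ψ z)) := by
  have : Nontrivial (Vel d) := by
    have : Nonempty (Fin d) := ⟨⟨0, by omega⟩⟩
    infer_instance
  have hne : ∀ᵐ z : Vel d, z ≠ 0 := by
    simp [ae_iff]
  refine tendsto_integral_of_dominated_convergence
    (fun z => C * ((sing γ z + (1 + ‖z‖) ^ 2) * |ψ z|))
    (fun n => ((hm n).mul hψ.measurable).aestronglyMeasurable)
    ((integrable_kernelBound_mul hd hγd 2 hψ.abs hc.norm).const_mul C) ?_ ?_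
  · intro n
    filter_upwards [hne] with z hz
    rw [norm_mul, Real.norm_eq_abs, Real.norm_eq_abs, ← mul_assoc]
    exact mul_le_mul_of_nonneg_right (hb n z hz) (abs_nonneg _)
  · filter_upwards [hne] with z hz
    exact (hlim z hz).mul_const _

theorem pd_mul_of_hasFDerivAt {P s : Vel d → ℝ} {P' s' : Vel d →L[ℝ] ℝ} {z : Vel d} (i : Fin d)
    (hP : HasFDerivAt P P' z) (hs : HasFDerivAt s s' z) :
    pd i (fun z => P z * s z) z = P z * s' (EuclideanSpace.single i 1)
      + s z * P' (EuclideanSpace.single i 1) := by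
  unfold pd
  rw [show (fun z => P z * s z) = P * s from rfl, (hP.mul hs).fderiv]
  simp

theorem hasFDerivAt_coord (i : Fin d) (z : Vel d) :
    HasFDerivAt (fun z : Vel d => z i) (EuclideanSpace.proj i : Vel d →L[ℝ] ℝ) z :=
  (EuclideanSpace.proj i : Vel d →L[ℝ] ℝ).hasFDerivAt

theorem contDiff_coord (i : Fin d) {n : ℕ} : ContDiff ℝ n (fun z : Vel d => z i) :=
  (EuclideanSpace.proj i : Vel d →L[ℝ] ℝ).contDiff

theorem norm_sq_eq_sum (z : Vel d) : ‖z‖ ^ 2 = ∑ i, z i ^ 2 := by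
  rw [EuclideanSpace.norm_sq_eq]; simp

/-- `∂ᵢ` of the kernel is `-(d - 1) |z|^γ zⱼ`, in the sense of distributions. -/
theorem sum_integral_kernel_mul_pd {γ : ℝ} (hd : 2 ≤ d) (hγ : γ ∈ Set.Icc (-2 : ℝ) 0)
    (hγd : 0 < (d : ℝ) + γ) {Φ : Vel d → ℝ} (hΦ : ContDiff ℝ 1 Φ) (hc : HasCompactSupport Φ)
    (j : Fin d) :
    ∑ i, ∫ z, kernel γ z i j * pd i Φ z = ((d : ℝ) - 1) * ∫ z, vecKernel γ j z * Φ z := by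
  set X : ℕ → Fin d → Vel d → ℝ := fun n i z =>
    ((if i = j then ‖z‖ ^ 2 else 0) - z i * z j) * regPow γ (1 / ((n : ℝ) + 1)) z with hX
  have hδ : ∀ n : ℕ, (0 : ℝ) < 1 / ((n : ℝ) + 1) := fun n => by positivity
  have hPc : ∀ i, ContDiff ℝ 1 fun z : Vel d => (if i = j then ‖z‖ ^ 2 else 0) - z i * z j := by
    intro i
    refine ContDiff.sub ?_ ((contDiff_coord i).mul (contDiff_coord j))
    split_ifs
    · exact contDiff_norm_sq ℝ
    · exact contDiff_const
  have hXc : ∀ n i, ContDiff ℝ 1 (X n i) := fun n i =>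
    (hPc i).mul (contDiff_norm_sq_add_rpow (hδ n) _ (n := 1))
  have hdiv : ∀ n z, ∑ i, pd i (X n i) z
      = -((d : ℝ) - 1) * (z j * regPow γ (1 / ((n : ℝ) + 1)) z) := by
    intro n z
    have h1 : ∀ i, pd i (X n i) z =
        ((if i = j then ‖z‖ ^ 2 else 0) - z i * z j) *
          (γ * (‖z‖ ^ 2 + 1 / ((n : ℝ) + 1)) ^ (γ / 2 - 1) * z i)
        + regPow γ (1 / ((n : ℝ) + 1)) z * ((if i = j then z i else 0) - z j) := by
      intro i
      have hP : HasFDerivAt (fun z : Vel d => (if i = j then ‖z‖ ^ 2 else 0) - z i * z j)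
          ((if i = j then (2 • innerSL ℝ z) else 0) -
            (z i • (EuclideanSpace.proj j : Vel d →L[ℝ] ℝ)
              + z j • (EuclideanSpace.proj i : Vel d →L[ℝ] ℝ))) z := by
        refine HasFDerivAt.sub ?_ ((hasFDerivAt_coord i z).mul (hasFDerivAt_coord j z))
        split_ifs
        · exact (hasStrictFDerivAt_norm_sq z).hasFDerivAt
        · exact hasFDerivAt_const _ _
      rw [show X n i = fun z => ((if i = j then ‖z‖ ^ 2 else 0) - z i * z j) *
        (‖z‖ ^ 2 + 1 / ((n : ℝ) + 1)) ^ (γ / 2) from rfl]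
      rw [pd_mul_of_hasFDerivAt i hP (hasFDerivAt_norm_sq_add_rpow (hδ n) (γ / 2) z)]
      congr 1
      · congr 1
        simp [EuclideanSpace.inner_single_right]
        ring
      · unfold regPow
        congr 1
        by_cases hij : i = j
        · subst hij
          simp [EuclideanSpace.inner_single_right]; ring
        · have : ¬ j = i := fun h => hij h.symm
          simp [hij, this]
    simp only [h1]
    rw [Finset.sum_add_distrib, ← Finset.mul_sum, Finset.sum_sub_distrib]
    have h2 : ∑ i, ((if i = j then ‖z‖ ^ 2 else 0) - z i * z j) *
          (γ * (‖z‖ ^ 2 + 1 / ((n : ℝ) + 1)) ^ (γ / 2 - 1) * z i) = 0 := by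
      set q := γ * (‖z‖ ^ 2 + 1 / ((n : ℝ) + 1)) ^ (γ / 2 - 1)
      have : ∀ i, ((if i = j then ‖z‖ ^ 2 else 0) - z i * z j) * (q * z i) =
          (if i = j then ‖z‖ ^ 2 * q * z i else 0) - (q * z j) * z i ^ 2 := by
        intro i; split_ifs <;> ring
      simp only [this]
      rw [Finset.sum_sub_distrib, ← Finset.mul_sum, ← norm_sq_eq_sum]
      simp; ring
    rw [h2]
    simp
    ring
  have hparts : ∀ n, ∑ i, ∫ z, X n i z * pd i Φ z
      = ((d : ℝ) - 1) * ∫ z, (z j * regPow γ (1 / ((n : ℝ) + 1)) z) * Φ z := by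
    intro n
    rw [← integral_const_mul]
    calc ∑ i, ∫ z, X n i z * pd i Φ z = ∑ i, -∫ z, pd i (X n i) z * Φ z :=
          Finset.sum_congr rfl fun i _ => integral_mul_pd_eq_neg (hXc n i) hΦ hc i
      _ = -∫ z, ∑ i, pd i (X n i) z * Φ z := by
          rw [Finset.sum_neg_distrib, integral_finsetSum]
          intro i _
          exact ((continuous_pd (hXc n i) i).mul hΦ.continuous).integrable_of_hasCompactSupport
            hc.mul_left
      _ = _ := by
          rw [← integral_neg]
          refine integral_congr_ae (Eventually.of_forall fun z => ?_)
          simp only []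
          rw [← Finset.sum_mul, hdiv]
          ring
  have hreg : ∀ z : Vel d, z ≠ 0 → Tendsto (fun n : ℕ => regPow γ (1 / ((n : ℝ) + 1)) z) atTop
      (𝓝 (‖z‖ ^ γ)) := fun z hz => by
    have := tendsto_norm_sq_add_rpow (γ / 2) hz
    rwa [mul_div_cancel₀ _ (two_ne_zero' ℝ)] at this
  have hregm : ∀ n : ℕ, Measurable (regPow γ (1 / ((n : ℝ) + 1)) : Vel d → ℝ) := fun n =>
    ((measurable_norm.pow_const 2).add_const _).pow_const _
  have hl : Tendsto (fun n => ∑ i, ∫ z, X n i z * pd i Φ z) atTop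
      (𝓝 (∑ i, ∫ z, kernel γ z i j * pd i Φ z)) := by
    refine tendsto_finsetSum _ fun i _ => tendsto_integral_regularized hd hγd (C := 2)
      (fun n => (hXc n i).continuous.measurable) ?_ ?_ (continuous_pd hΦ i)
      (hasCompactSupport_pd hc i)
    · intro n z hz
      rw [hX]
      simp only []
      rw [abs_mul, abs_of_nonneg (regPow_nonneg (hδ n) z)]
      have h1 := norm_sq_mul_rpow_le hγ z
      have h2 := mul_le_mul (abs_sub_coord_mul_le z i j) (regPow_le hγ.2 (hδ n) hz)
        (regPow_nonneg (hδ n) z) (by positivity)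
      have := sing_nonneg γ z
      linarith
    · intro z hz
      rw [kernel_eq γ hz]
      exact (hreg z hz).const_mul _
  have hr : Tendsto (fun n : ℕ => ((d : ℝ) - 1) *
      ∫ z, (z j * regPow γ (1 / ((n : ℝ) + 1)) z) * Φ z) atTop
      (𝓝 (((d : ℝ) - 1) * ∫ z, vecKernel γ j z * Φ z)) := by
    refine Tendsto.const_mul _ (tendsto_integral_regularized hd hγd (C := 1)
      (fun n => (measurable_coord j).mul (hregm n)) ?_ ?_ hΦ.continuous hc)
    · intro n z hz
      rw [Pi.mul_apply, abs_mul, abs_of_nonneg (regPow_nonneg (hδ n) z)]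
      have h1 := norm_mul_rpow_le hγ z
      have h2 := mul_le_mul (abs_coord_le z j) (regPow_le hγ.2 (hδ n) hz)
        (regPow_nonneg (hδ n) z) (by positivity)
      have := norm_nonneg z
      nlinarith
    · intro z hz
      unfold vecKernel
      rw [mul_comm]
      exact (hreg z hz).const_mul _
  simp only [hparts] at hl
  exact tendsto_nhds_unique hl hr

/-- `∂ⱼ (|z|^γ zⱼ) = (d + γ) |z|^γ` in the sense of distributions. -/
theorem sum_integral_vecKernel_mul_pd {γ : ℝ} (hd : 2 ≤ d) (hγ : γ ∈ Set.Icc (-2 : ℝ) 0)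
    (hγd : 0 < (d : ℝ) + γ) {Φ : Vel d → ℝ} (hΦ : ContDiff ℝ 1 Φ) (hc : HasCompactSupport Φ) :
    ∑ j, ∫ z, vecKernel γ j z * pd j Φ z = -(((d : ℝ) + γ) * ∫ z, ‖z‖ ^ γ * Φ z) := by
  set X : ℕ → Fin d → Vel d → ℝ := fun n i z => z i * regPow γ (1 / ((n : ℝ) + 1)) z with hX
  have hδ : ∀ n : ℕ, (0 : ℝ) < 1 / ((n : ℝ) + 1) := fun n => by positivity
  have hXc : ∀ n i, ContDiff ℝ 1 (X n i) := fun n i =>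
    (contDiff_coord i (n := 1)).mul (contDiff_norm_sq_add_rpow (hδ n) _ (n := 1))
  set D : ℕ → Vel d → ℝ := fun n z => (d : ℝ) * regPow γ (1 / ((n : ℝ) + 1)) z +
    γ * (‖z‖ ^ 2 * (‖z‖ ^ 2 + 1 / ((n : ℝ) + 1)) ^ (γ / 2 - 1)) with hD
  have hdiv : ∀ n z, ∑ i, pd i (X n i) z = D n z := by
    intro n z
    have h1 : ∀ i, pd i (X n i) z =
        γ * (‖z‖ ^ 2 + 1 / ((n : ℝ) + 1)) ^ (γ / 2 - 1) * z i ^ 2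
        + regPow γ (1 / ((n : ℝ) + 1)) z := by
      intro i
      rw [show X n i = fun z => z i * (‖z‖ ^ 2 + 1 / ((n : ℝ) + 1)) ^ (γ / 2) from rfl]
      rw [pd_mul_of_hasFDerivAt i (hasFDerivAt_coord i z)
        (hasFDerivAt_norm_sq_add_rpow (hδ n) (γ / 2) z)]
      congr 1
      · simp [EuclideanSpace.inner_single_right]
        ring
      · simp [regPow]
    simp only [h1]
    rw [Finset.sum_add_distrib, ← Finset.mul_sum, ← norm_sq_eq_sum]
    simp [hD]
    ring
  have hparts : ∀ n, ∑ i, ∫ z, X n i z * pd i Φ z = -∫ z, D n z * Φ z := by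
    intro n
    calc ∑ i, ∫ z, X n i z * pd i Φ z = ∑ i, -∫ z, pd i (X n i) z * Φ z :=
          Finset.sum_congr rfl fun i _ => integral_mul_pd_eq_neg (hXc n i) hΦ hc i
      _ = -∫ z, ∑ i, pd i (X n i) z * Φ z := by
          rw [Finset.sum_neg_distrib, integral_finsetSum]
          intro i _
          exact ((continuous_pd (hXc n i) i).mul hΦ.continuous).integrable_of_hasCompactSupport
            hc.mul_left
      _ = _ := by
          congr 1
          refine integral_congr_ae (Eventually.of_forall fun z => ?_)
          simp only []
          rw [← Finset.sum_mul, hdiv]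
  have hreg : ∀ z : Vel d, z ≠ 0 → Tendsto (fun n : ℕ => regPow γ (1 / ((n : ℝ) + 1)) z) atTop
      (𝓝 (‖z‖ ^ γ)) := fun z hz => by
    have := tendsto_norm_sq_add_rpow (γ / 2) hz
    rwa [mul_div_cancel₀ _ (two_ne_zero' ℝ)] at this
  have hregm : ∀ n : ℕ, Measurable (regPow γ (1 / ((n : ℝ) + 1)) : Vel d → ℝ) := fun n =>
    ((measurable_norm.pow_const 2).add_const _).pow_const _
  have hl : Tendsto (fun n => ∑ i, ∫ z, X n i z * pd i Φ z) atTop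
      (𝓝 (∑ i, ∫ z, vecKernel γ i z * pd i Φ z)) := by
    refine tendsto_finsetSum _ fun i _ => tendsto_integral_regularized hd hγd (C := 1)
      (fun n => (hXc n i).continuous.measurable) ?_ ?_ (continuous_pd hΦ i)
      (hasCompactSupport_pd hc i)
    · intro n z hz
      rw [hX]
      simp only []
      rw [abs_mul, abs_of_nonneg (regPow_nonneg (hδ n) z)]
      have h1 := norm_mul_rpow_le hγ z
      have h2 := mul_le_mul (abs_coord_le z i) (regPow_le hγ.2 (hδ n) hz)
        (regPow_nonneg (hδ n) z) (by positivity)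
      have := norm_nonneg z
      nlinarith
    · intro z hz
      unfold vecKernel
      rw [mul_comm]
      exact (hreg z hz).const_mul _
  have hr : Tendsto (fun n : ℕ => -∫ z, D n z * Φ z) atTop
      (𝓝 (-∫ z, (((d : ℝ) + γ) * ‖z‖ ^ γ) * Φ z)) := by
    refine Tendsto.neg (tendsto_integral_regularized hd hγd (C := d + 2)
      (fun n => ((hregm n).const_mul _).add (((measurable_norm.pow_const 2).mul
        (((measurable_norm.pow_const 2).add_const _).pow_const _)).const_mul γ)) ?_ ?_
        hΦ.continuous hc)
    · intro n z hz
      have h0 : 0 < ‖z‖ := norm_pos_iff.2 hz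
      have hp : 0 < ‖z‖ ^ 2 + 1 / ((n : ℝ) + 1) := by positivity
      have h1 := regPow_le hγ.2 (hδ n) hz
      have h2 := regPow_nonneg (γ := γ) (hδ n) z
      have h3 : ‖z‖ ^ 2 * (‖z‖ ^ 2 + 1 / ((n : ℝ) + 1)) ^ (γ / 2 - 1)
          ≤ regPow γ (1 / ((n : ℝ) + 1)) z := by
        rw [Real.rpow_sub_one hp.ne', regPow, mul_div_assoc', div_le_iff₀ hp, mul_comm]
        exact mul_le_mul_of_nonneg_left (by linarith [hδ n]) (Real.rpow_nonneg hp.le _)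
      have h4 : 0 ≤ ‖z‖ ^ 2 * (‖z‖ ^ 2 + 1 / ((n : ℝ) + 1)) ^ (γ / 2 - 1) := by positivity
      have h5 := norm_rpow_le_sing_add_one hγ.2 z
      have h6 := sing_nonneg γ z
      have h7 : |γ| ≤ 2 := abs_le.2 ⟨hγ.1, by linarith [hγ.2]⟩
      calc |D n z| ≤ |(d : ℝ) * regPow γ (1 / ((n : ℝ) + 1)) z| +
            |γ * (‖z‖ ^ 2 * (‖z‖ ^ 2 + 1 / ((n : ℝ) + 1)) ^ (γ / 2 - 1))| := abs_add_le _ _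
        _ ≤ (d : ℝ) * ‖z‖ ^ γ + 2 * ‖z‖ ^ γ := by
            rw [abs_mul, abs_mul, abs_of_nonneg h2, abs_of_nonneg h4, Nat.abs_cast]
            exact add_le_add (mul_le_mul_of_nonneg_left h1 (Nat.cast_nonneg d))
              (mul_le_mul h7 (h3.trans h1) h4 zero_le_two)
        _ = ((d : ℝ) + 2) * ‖z‖ ^ γ := by ring
        _ ≤ _ := by
            refine mul_le_mul_of_nonneg_left (h5.trans ?_) (by positivity)
            nlinarith
    · intro z hz
      have h0 : 0 < ‖z‖ := norm_pos_iff.2 hz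
      have h1 := tendsto_norm_sq_add_rpow (γ / 2 - 1) hz
      have h2 := ((hreg z hz).const_mul (d : ℝ)).add ((h1.const_mul (‖z‖ ^ 2)).const_mul γ)
      convert! h2 using 2
      have : ‖z‖ ^ γ = ‖z‖ ^ 2 * ‖z‖ ^ (2 * (γ / 2 - 1)) := by
        rw [← Real.rpow_two, ← Real.rpow_add h0]; congr 1; ring
      rw [← this]; ring
  simp only [hparts] at hl
  rw [tendsto_nhds_unique hl hr, ← integral_const_mul]
  simp only [mul_assoc]

end

section

/-! ### Convolutions with the kernels -/

variable {d : ℕ}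

/-- Densities which are bounded, and have first absolute moments of order `0` and `2`, all three
bounds being `≤ B`. No sign is imposed. -/
structure Dens (B : ℝ) (g : Vel d → ℝ) : Prop where
  meas : Measurable g
  bdd : ∀ v, |g v| ≤ B
  int : Integrable g
  int2 : Integrable fun v => ‖v‖ ^ 2 * g v
  mass : ∫ v, |g v| ≤ B
  energy : ∫ v, ‖v‖ ^ 2 * |g v| ≤ B

theorem Dens.nonneg_const {B : ℝ} {g : Vel d → ℝ} (hg : Dens B g) : 0 ≤ B :=
  (abs_nonneg _).trans (hg.bdd 0)

theorem Dens.int2_abs {B : ℝ} {g : Vel d → ℝ} (hg : Dens B g) :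
    Integrable fun v => ‖v‖ ^ 2 * |g v| := by
  refine hg.int2.abs.congr (Eventually.of_forall fun v => ?_)
  simp [abs_mul]

/-- A measurable function dominated by a density is a density. -/
theorem Dens.of_abs_le {B : ℝ} {g h : Vel d → ℝ} (hg : Dens B g) (hh : Measurable h)
    (hle : ∀ v, |h v| ≤ |g v|) : Dens B h := by
  have h1 : Integrable h := hg.int.mono hh.aestronglyMeasurable (Eventually.of_forall fun v => hle v)
  have h2 : Integrable fun v => ‖v‖ ^ 2 * h v := by
    refine hg.int2.mono ((measurable_norm.pow_const 2).mul hh).aestronglyMeasurable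
      (Eventually.of_forall fun v => ?_)
    rw [norm_mul, norm_mul]
    exact mul_le_mul_of_nonneg_left (hle v) (norm_nonneg _)
  refine ⟨hh, fun v => (hle v).trans (hg.bdd v), h1, h2, ?_, ?_⟩
  · exact (integral_mono h1.abs hg.int.abs hle).trans hg.mass
  · refine le_trans (integral_mono ?_ hg.int2_abs fun v => ?_) hg.energy
    · refine h2.abs.congr (Eventually.of_forall fun v => ?_)
      simp [abs_mul]
    · exact mul_le_mul_of_nonneg_left (hle v) (by positivity)

/-- The convolution `∫ k(w) g(v - w) dw`. -/
def conv (k g : Vel d → ℝ) (v : Vel d) : ℝ := ∫ w, k w * g (v - w)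

theorem conv_eq (k g : Vel d → ℝ) (v : Vel d) : conv k g v = ∫ y, k (v - y) * g y := by
  unfold conv
  rw [← integral_sub_left_eq_self (fun w => k w * g (v - w)) volume v]
  simp

theorem one_add_norm_sub_pow_le {σ : ℕ} (hσ : σ ≤ 2) (v y : Vel d) :
    (1 + ‖v - y‖) ^ σ ≤ (1 + ‖v‖) ^ σ * (2 * (1 + ‖y‖ ^ 2)) := by
  have h0 := norm_nonneg v
  have h1 := norm_nonneg y
  have h2 : 1 + ‖v - y‖ ≤ (1 + ‖v‖) * (1 + ‖y‖) := by
    have := norm_sub_le v y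
    nlinarith
  calc (1 + ‖v - y‖) ^ σ ≤ ((1 + ‖v‖) * (1 + ‖y‖)) ^ σ :=
        pow_le_pow_left₀ (by positivity) h2 σ
    _ = (1 + ‖v‖) ^ σ * (1 + ‖y‖) ^ σ := mul_pow _ _ _
    _ ≤ (1 + ‖v‖) ^ σ * (2 * (1 + ‖y‖ ^ 2)) := by
        refine mul_le_mul_of_nonneg_left ?_ (by positivity)
        calc (1 + ‖y‖) ^ σ ≤ (1 + ‖y‖) ^ 2 := pow_le_pow_right₀ (by linarith) hσ
          _ ≤ _ := by nlinarith [sq_nonneg (1 - ‖y‖)]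

theorem Dens.integrable_weight {B : ℝ} {g : Vel d → ℝ} (hg : Dens B g) :
    Integrable fun y => (1 + ‖y‖ ^ 2) * |g y| := by
  simp only [add_mul, one_mul]
  exact hg.int.abs.add hg.int2_abs

theorem Dens.integral_weight_le {B : ℝ} {g : Vel d → ℝ} (hg : Dens B g) :
    ∫ y, (1 + ‖y‖ ^ 2) * |g y| ≤ 2 * B := by
  simp only [add_mul, one_mul]
  rw [integral_add hg.int.abs hg.int2_abs]
  linarith [hg.mass, hg.energy]

theorem KernelBound.abs_mul_le {γ B : ℝ} {σ : ℕ} (hσ : σ ≤ 2) {k g : Vel d → ℝ}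
    (hk : KernelBound γ σ k) (hg : Dens B g) (v y : Vel d) :
    |k (v - y) * g y| ≤ 2 * B * sing γ (v - y) +
      4 * (1 + ‖v‖) ^ σ * ((1 + ‖y‖ ^ 2) * |g y|) := by
  rw [abs_mul]
  have h1 := mul_le_mul_of_nonneg_right (hk.bound (v - y)) (abs_nonneg (g y))
  have h2 := mul_le_mul_of_nonneg_left (hg.bdd y) (sing_nonneg γ (v - y))
  have h3 := mul_le_mul_of_nonneg_right (one_add_norm_sub_pow_le hσ v y) (abs_nonneg (g y))
  nlinarith

/-- The integral of the singular part of the kernel. -/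
def singMass (d : ℕ) (γ : ℝ) : ℝ := ∫ z : Vel d, sing γ z

theorem singMass_nonneg (d : ℕ) (γ : ℝ) : 0 ≤ singMass d γ :=
  integral_nonneg fun z => sing_nonneg γ z

section
variable {γ B : ℝ} {σ : ℕ} {k g : Vel d → ℝ}

theorem integrable_kernel_dens (hd : 2 ≤ d) (hγd : 0 < (d : ℝ) + γ) (hσ : σ ≤ 2)
    (hk : KernelBound γ σ k) (hg : Dens B g) (v : Vel d) :
    Integrable fun y => k (v - y) * g y := by
  have h1 : Integrable fun y => sing γ (v - y) := (integrable_sing hd hγd).comp_sub_left v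
  refine Integrable.mono' ((h1.const_mul (2 * B)).add
    (hg.integrable_weight.const_mul (4 * (1 + ‖v‖) ^ σ))) ?_
    (Eventually.of_forall fun y => hk.abs_mul_le hσ hg v y)
  exact ((hk.meas.comp (measurable_const.sub measurable_id)).mul hg.meas).aestronglyMeasurable

theorem abs_conv_le (hd : 2 ≤ d) (hγd : 0 < (d : ℝ) + γ) (hσ : σ ≤ 2)
    (hk : KernelBound γ σ k) (hg : Dens B g) (v : Vel d) :
    |conv k g v| ≤ (2 * singMass d γ + 8) * B * (1 + ‖v‖) ^ σ := by
  have hB := hg.nonneg_const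
  have h1 : Integrable fun y => sing γ (v - y) := (integrable_sing hd hγd).comp_sub_left v
  rw [conv_eq]
  have h2 : ∫ y, sing γ (v - y) = singMass d γ := integral_sub_left_eq_self (sing γ) volume v
  have h3 : 1 ≤ (1 + ‖v‖) ^ σ := one_le_pow₀ (by linarith [norm_nonneg v])
  calc |∫ y, k (v - y) * g y| ≤ ∫ y, |k (v - y) * g y| := abs_integral_le_integral_abs
    _ ≤ ∫ y, (2 * B * sing γ (v - y) + 4 * (1 + ‖v‖) ^ σ * ((1 + ‖y‖ ^ 2) * |g y|)) :=
        integral_mono (integrable_kernel_dens hd hγd hσ hk hg v).abs ((h1.const_mul (2 * B)).add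
          (hg.integrable_weight.const_mul (4 * (1 + ‖v‖) ^ σ))) fun y => hk.abs_mul_le hσ hg v y
    _ = 2 * B * singMass d γ + 4 * (1 + ‖v‖) ^ σ * ∫ y, (1 + ‖y‖ ^ 2) * |g y| := by
        rw [integral_add (h1.const_mul (2 * B)) (hg.integrable_weight.const_mul _),
          integral_const_mul, integral_const_mul, h2]
    _ ≤ 2 * B * singMass d γ * (1 + ‖v‖) ^ σ + 4 * (1 + ‖v‖) ^ σ * (2 * B) := by
        refine add_le_add ?_ (mul_le_mul_of_nonneg_left hg.integral_weight_le (by positivity))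
        exact le_mul_of_one_le_right (by have := singMass_nonneg d γ; positivity) h3
    _ = _ := by ring

/-- Joint integrability of `k(v - y) g(y) ψ(v)`. -/
theorem integrable_prod_kernel (hd : 2 ≤ d) (hγd : 0 < (d : ℝ) + γ) (hσ : σ ≤ 2)
    (hk : KernelBound γ σ k) (hg : Dens B g) {ψ : Vel d → ℝ} (hψ : Integrable ψ)
    (hψ' : Integrable fun v => (1 + ‖v‖) ^ σ * ψ v) :
    Integrable (fun p : Vel d × Vel d => k (p.1 - p.2) * g p.2 * ψ p.1)
      (volume.prod volume) := by
  have h1 : Integrable (fun p : Vel d × Vel d => ψ p.1 * sing γ (p.1 - p.2))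
      (volume.prod volume) := by
    have hs : Integrable fun z : Vel d => sing γ (-z) := (integrable_sing hd hγd).comp_neg
    have := (Integrable.convolution_integrand (ContinuousLinearMap.mul ℝ ℝ) hψ hs).swap
    refine this.congr (Eventually.of_forall fun p => ?_)
    simp
  have h2 : Integrable (fun p : Vel d × Vel d => ((1 + ‖p.1‖) ^ σ * ψ p.1) *
      ((1 + ‖p.2‖ ^ 2) * |g p.2|)) (volume.prod volume) :=
    hψ'.mul_prod hg.integrable_weight
  refine Integrable.mono' ((h1.abs.const_mul (2 * B)).add (h2.abs.const_mul 4)) ?_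
    (Eventually.of_forall fun p => ?_)
  · refine AEStronglyMeasurable.mul (Measurable.aestronglyMeasurable ?_)
      hψ.aestronglyMeasurable.comp_fst
    exact (hk.meas.comp (measurable_fst.sub measurable_snd)).mul (hg.meas.comp measurable_snd)
  · have h3 := mul_le_mul_of_nonneg_right (hk.abs_mul_le hσ hg p.1 p.2) (abs_nonneg (ψ p.1))
    have e1 : |ψ p.1 * sing γ (p.1 - p.2)| = |ψ p.1| * sing γ (p.1 - p.2) := by
      rw [abs_mul, abs_of_nonneg (sing_nonneg _ _)]
    have e2 : |(1 + ‖p.1‖) ^ σ * ψ p.1 * ((1 + ‖p.2‖ ^ 2) * |g p.2|)| =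
        (1 + ‖p.1‖) ^ σ * |ψ p.1| * ((1 + ‖p.2‖ ^ 2) * |g p.2|) := by
      rw [abs_mul, abs_mul, abs_mul, abs_abs, abs_of_nonneg (by positivity : 0 ≤ (1 + ‖p.1‖) ^ σ),
        abs_of_nonneg (by positivity : 0 ≤ 1 + ‖p.2‖ ^ 2)]
    rw [Real.norm_eq_abs, abs_mul, Pi.add_apply]
    rw [e1, e2]
    linarith

theorem integrable_conv_mul (hd : 2 ≤ d) (hγd : 0 < (d : ℝ) + γ) (hσ : σ ≤ 2)
    (hk : KernelBound γ σ k) (hg : Dens B g) {ψ : Vel d → ℝ} (hψ : Integrable ψ)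
    (hψ' : Integrable fun v => (1 + ‖v‖) ^ σ * ψ v) :
    Integrable fun v => conv k g v * ψ v := by
  refine (integrable_prod_kernel hd hγd hσ hk hg hψ hψ').integral_prod_left.congr
    (Eventually.of_forall fun v => ?_)
  simp only [conv_eq]
  rw [integral_mul_const]

theorem integral_conv_mul (hd : 2 ≤ d) (hγd : 0 < (d : ℝ) + γ) (hσ : σ ≤ 2)
    (hk : KernelBound γ σ k) (hg : Dens B g) {ψ : Vel d → ℝ} (hψ : Integrable ψ)
    (hψ' : Integrable fun v => (1 + ‖v‖) ^ σ * ψ v) :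
    ∫ v, conv k g v * ψ v = ∫ y, g y * ∫ z, k z * ψ (z + y) := by
  have h := integral_integral_swap (f := fun v y => k (v - y) * g y * ψ v)
    (integrable_prod_kernel hd hγd hσ hk hg hψ hψ')
  calc ∫ v, conv k g v * ψ v = ∫ v, ∫ y, k (v - y) * g y * ψ v := by
        refine integral_congr_ae (Eventually.of_forall fun v => ?_)
        simp only [conv_eq]
        rw [integral_mul_const]
    _ = ∫ y, ∫ v, k (v - y) * g y * ψ v := h
    _ = _ := by
        refine integral_congr_ae (Eventually.of_forall fun y => ?_)
        simp only []
        rw [← integral_const_mul, ← integral_add_right_eq_self _ y]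
        refine integral_congr_ae (Eventually.of_forall fun z => ?_)
        simp only [add_sub_cancel_right]
        ring

theorem integrable_mul_integral_kernel (hd : 2 ≤ d) (hγd : 0 < (d : ℝ) + γ) (hσ : σ ≤ 2)
    (hk : KernelBound γ σ k) (hg : Dens B g) {ψ : Vel d → ℝ} (hψ : Integrable ψ)
    (hψ' : Integrable fun v => (1 + ‖v‖) ^ σ * ψ v) :
    Integrable fun y => g y * ∫ z, k z * ψ (z + y) := by
  refine (integrable_prod_kernel hd hγd hσ hk hg hψ hψ').integral_prod_right.congr
    (Eventually.of_forall fun y => ?_)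
  simp only []
  rw [← integral_const_mul, ← integral_add_right_eq_self _ y]
  refine integral_congr_ae (Eventually.of_forall fun z => ?_)
  simp only [add_sub_cancel_right]
  ring

theorem integrable_weight_mul_of_hasCompactSupport (σ : ℕ) {ψ : Vel d → ℝ} (hψ : Continuous ψ)
    (hc : HasCompactSupport ψ) : Integrable fun v => (1 + ‖v‖) ^ σ * ψ v :=
  Continuous.integrable_of_hasCompactSupport (by fun_prop) hc.mul_left

theorem integrable_conv_mul_of_hasCompactSupport (hd : 2 ≤ d) (hγd : 0 < (d : ℝ) + γ) (hσ : σ ≤ 2)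
    (hk : KernelBound γ σ k) (hg : Dens B g) {ψ : Vel d → ℝ} (hψ : Continuous ψ)
    (hc : HasCompactSupport ψ) : Integrable fun v => conv k g v * ψ v :=
  integrable_conv_mul hd hγd hσ hk hg (hψ.integrable_of_hasCompactSupport hc)
    (integrable_weight_mul_of_hasCompactSupport σ hψ hc)

/-- Summing distributional derivatives of kernels over the density: if `∑ᵢ ∂ᵢ kᵢ = -C k'` in the
sense of distributions, the same holds after convolution. -/
theorem sum_integral_conv_mul_pd (hd : 2 ≤ d) (hγd : 0 < (d : ℝ) + γ) (hσ : σ ≤ 2)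
    {K : Fin d → Vel d → ℝ} (hK : ∀ i, KernelBound γ σ (K i)) {σ' : ℕ} (hσ' : σ' ≤ 2)
    (hk : KernelBound γ σ' k) {C : ℝ}
    (hdist : ∀ Φ : Vel d → ℝ, ContDiff ℝ 1 Φ → HasCompactSupport Φ →
      ∑ i, ∫ z, K i z * pd i Φ z = C * ∫ z, k z * Φ z)
    (hg : Dens B g) {Φ : Vel d → ℝ} (hΦ : ContDiff ℝ 1 Φ) (hc : HasCompactSupport Φ) :
    ∑ i, ∫ v, conv (K i) g v * pd i Φ v = C * ∫ v, conv k g v * Φ v := by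
  have hi : ∀ i, Integrable (pd i Φ) := fun i =>
    (continuous_pd hΦ i).integrable_of_hasCompactSupport (hasCompactSupport_pd hc i)
  have hi' : ∀ i, Integrable fun v => (1 + ‖v‖) ^ σ * pd i Φ v := fun i =>
    integrable_weight_mul_of_hasCompactSupport σ (continuous_pd hΦ i) (hasCompactSupport_pd hc i)
  calc ∑ i, ∫ v, conv (K i) g v * pd i Φ v
      = ∑ i, ∫ y, g y * ∫ z, K i z * pd i Φ (z + y) :=
        Finset.sum_congr rfl fun i _ => integral_conv_mul hd hγd hσ (hK i) hg (hi i) (hi' i)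
    _ = ∫ y, ∑ i, g y * ∫ z, K i z * pd i Φ (z + y) :=
        (integral_finsetSum _ fun i _ =>
          integrable_mul_integral_kernel hd hγd hσ (hK i) hg (hi i) (hi' i)).symm
    _ = ∫ y, C * (g y * ∫ z, k z * Φ (z + y)) := by
        refine integral_congr_ae (Eventually.of_forall fun y => ?_)
        simp only []
        have hΦy : ContDiff ℝ 1 fun z => Φ (z + y) := hΦ.comp (contDiff_id.add contDiff_const)
        have hcy : HasCompactSupport fun z => Φ (z + y) :=
          hc.comp_homeomorph (Homeomorph.addRight y)
        have := hdist _ hΦy hcy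
        have e : ∀ i z, pd i (fun z => Φ (z + y)) z = pd i Φ (z + y) := fun i z => by
          unfold pd; rw [fderiv_comp_add_right]
        simp only [e] at this
        rw [← Finset.mul_sum, this]
        ring
    _ = _ := by
        rw [integral_const_mul, integral_conv_mul hd hγd hσ' hk hg
          (hΦ.continuous.integrable_of_hasCompactSupport hc)
          (integrable_weight_mul_of_hasCompactSupport σ' hΦ.continuous hc)]

end

/-! ### The weak form of the diffusion operator -/

/-- The drift `-(d - 1) a ∫ |w|^γ wⱼ g(v - w) dw`, the divergence of the diffusion matrix. -/
def drift (a γ : ℝ) (g : Vel d → ℝ) (j : Fin d) (v : Vel d) : ℝ :=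
  -(((d : ℝ) - 1) * a) * conv (vecKernel γ j) g v

theorem diffusion_eq (a γ : ℝ) (g : Vel d → ℝ) (v : Vel d) (i j : Fin d) :
    diffusion a γ g v i j = a * conv (fun z => kernel γ z i j) g v := rfl

theorem reaction_eq (a γ : ℝ) (g : Vel d → ℝ) (v : Vel d) :
    reaction a γ g v = (((d : ℝ) - 1) * ((d : ℝ) + γ) * a) * conv (fun z => ‖z‖ ^ γ) g v := rfl

theorem kernel_symm (γ : ℝ) (z : Vel d) (i j : Fin d) : kernel γ z i j = kernel γ z j i := by
  unfold kernel
  simp only [Matrix.of_apply, eq_comm (a := i)]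
  ring

theorem diffusion_symm (a γ : ℝ) (g : Vel d → ℝ) (v : Vel d) (i j : Fin d) :
    diffusion a γ g v i j = diffusion a γ g v j i := by
  rw [diffusion_eq, diffusion_eq]
  simp only [kernel_symm γ _ i j]

/-- The standing conditions on the dimension and the exponent. The last one makes `|z|^γ` locally
integrable, and excludes only `γ = -2` in dimension two. -/
structure Params (d : ℕ) (γ : ℝ) : Prop where
  dim : 2 ≤ d
  mem : γ ∈ Set.Icc (-2 : ℝ) 0
  pos : 0 < (d : ℝ) + γ

section
variable {γ B a : ℝ} {g : Vel d → ℝ}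

theorem sum_integral_diffusion_mul_pd (hp : Params d γ) (hg : Dens B g) {Φ : Vel d → ℝ}
    (hΦ : ContDiff ℝ 1 Φ) (hc : HasCompactSupport Φ) (j : Fin d) :
    ∑ i, ∫ v, diffusion a γ g v i j * pd i Φ v = -∫ v, drift a γ g j v * Φ v := by
  have := sum_integral_conv_mul_pd hp.dim hp.pos le_rfl
    (fun i => kernelBound_kernel hp.mem i j) (by norm_num) (kernelBound_vecKernel hp.mem j)
    (fun Φ hΦ hc => sum_integral_kernel_mul_pd hp.dim hp.mem hp.pos hΦ hc j) hg hΦ hc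
  simp only [diffusion_eq, drift, mul_assoc, integral_const_mul]
  rw [← Finset.mul_sum, this]
  ring

theorem sum_integral_drift_mul_pd (hp : Params d γ) (hg : Dens B g) {Φ : Vel d → ℝ}
    (hΦ : ContDiff ℝ 1 Φ) (hc : HasCompactSupport Φ) :
    ∑ j, ∫ v, drift a γ g j v * pd j Φ v = ∫ v, reaction a γ g v * Φ v := by
  have := sum_integral_conv_mul_pd hp.dim hp.pos (by norm_num)
    (fun i => kernelBound_vecKernel hp.mem i) (by norm_num) (kernelBound_rpow hp.mem)
    (C := -((d : ℝ) + γ)) (fun Φ hΦ hc => by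
      rw [sum_integral_vecKernel_mul_pd hp.dim hp.mem hp.pos hΦ hc]; ring) hg hΦ hc
  simp only [reaction_eq, drift, mul_assoc, integral_const_mul]
  rw [← Finset.mul_sum, this]
  ring

theorem integrable_diffusion_mul (hp : Params d γ) (hg : Dens B g) {ψ : Vel d → ℝ}
    (hψ : Continuous ψ) (hc : HasCompactSupport ψ) (i j : Fin d) :
    Integrable fun v => diffusion a γ g v i j * ψ v := by
  simp only [diffusion_eq, mul_assoc]
  exact (integrable_conv_mul_of_hasCompactSupport hp.dim hp.pos le_rfl
    (kernelBound_kernel hp.mem i j) hg hψ hc).const_mul a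

theorem integrable_reaction_mul (hp : Params d γ) (hg : Dens B g) {ψ : Vel d → ℝ}
    (hψ : Continuous ψ) (hc : HasCompactSupport ψ) :
    Integrable fun v => reaction a γ g v * ψ v := by
  simp only [reaction_eq, mul_assoc]
  exact (((integrable_conv_mul_of_hasCompactSupport hp.dim hp.pos (by norm_num)
    (kernelBound_rpow hp.mem) hg hψ hc).const_mul _).const_mul _).const_mul _

theorem contDiff_pd {u : Vel d → ℝ} (hu : ContDiff ℝ 2 u) (i : Fin d) : ContDiff ℝ 1 (pd i u) :=
  (hu.fderiv_right (m := 1) (by norm_num)).clm_apply contDiff_const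

theorem pd_mul {u w : Vel d → ℝ} (hu : ContDiff ℝ 1 u) (hw : ContDiff ℝ 1 w) (i : Fin d)
    (v : Vel d) : pd i (fun v => u v * w v) v = u v * pd i w v + w v * pd i u v :=
  pd_mul_of_hasFDerivAt i (hu.differentiable (by norm_num) v).hasFDerivAt
    (hw.differentiable (by norm_num) v).hasFDerivAt

theorem pd_add {u w : Vel d → ℝ} (hu : ContDiff ℝ 1 u) (hw : ContDiff ℝ 1 w) (i : Fin d)
    (v : Vel d) : pd i (fun v => u v + w v) v = pd i u v + pd i w v := by
  unfold pd
  rw [fderiv_fun_add (hu.differentiable (by norm_num) v) (hw.differentiable (by norm_num) v)]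
  simp

theorem partial₂_eq {u : Vel d → ℝ} (hu : ContDiff ℝ 2 u) (v : Vel d) (i j : Fin d) :
    partial₂ u v i j = pd i (pd j u) v := by
  unfold partial₂ pd
  rw [iteratedFDeriv_two_apply]
  have h := ((hu.fderiv_right (m := 1) (by norm_num)).differentiable (by norm_num) v).hasFDerivAt
  rw [(h.clm_apply (hasFDerivAt_const (EuclideanSpace.single j (1 : ℝ)) v)).fderiv]
  simp

/-- The double divergence of the diffusion matrix is minus the reaction coefficient. -/
theorem sum_integral_diffusion_mul_pd_pd (hp : Params d γ) (hg : Dens B g) {Φ : Vel d → ℝ}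
    (hΦ : ContDiff ℝ 2 Φ) (hc : HasCompactSupport Φ) :
    ∑ i, ∑ j, ∫ v, diffusion a γ g v i j * pd i (pd j Φ) v = -∫ v, reaction a γ g v * Φ v := by
  rw [Finset.sum_comm, ← sum_integral_drift_mul_pd hp hg (hΦ.of_le (by norm_num)) hc,
    ← Finset.sum_neg_distrib]
  exact Finset.sum_congr rfl fun j _ =>
    sum_integral_diffusion_mul_pd hp hg (contDiff_pd hΦ j) (hasCompactSupport_pd hc j) j

theorem integral_add_sub_add {f₁ f₂ f₃ f₄ : Vel d → ℝ} (h₁ : Integrable f₁) (h₂ : Integrable f₂)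
    (h₃ : Integrable f₃) (h₄ : Integrable f₄) :
    ∫ v, (f₁ v + f₂ v - (f₃ v + f₄ v)) =
      ((∫ v, f₁ v) + ∫ v, f₂ v) - ((∫ v, f₃ v) + ∫ v, f₄ v) := by
  rw [integral_sub (f := fun v => f₁ v + f₂ v) (g := fun v => f₃ v + f₄ v) (h₁.add h₂) (h₃.add h₄),
    integral_add h₁ h₂, integral_add h₃ h₄]

/-- **Weak form.** Integrating the nondivergence operator by parts against a test function. -/
theorem sum_integral_diffusion_mul_test (hp : Params d γ) (hg : Dens B g) {u χ : Vel d → ℝ}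
    (hu : ContDiff ℝ 2 u) (hχ : ContDiff ℝ 2 χ) (hc : HasCompactSupport χ) :
    ∑ i, ∑ j, ∫ v, diffusion a γ g v i j * (χ v * pd i (pd j u) v) =
      -(∫ v, reaction a γ g v * (χ v * u v))
      + (∑ i, ∑ j, ∫ v, diffusion a γ g v i j * (u v * pd j (pd i χ) v))
      + 2 * ∑ j, ∫ v, drift a γ g j v * (u v * pd j χ v) := by
  have hu1 : ContDiff ℝ 1 u := hu.of_le (by norm_num)
  have hχ1 : ContDiff ℝ 1 χ := hχ.of_le (by norm_num)
  have hpt : ∀ i j v, diffusion a γ g v i j * (χ v * pd i (pd j u) v) =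
      (diffusion a γ g v i j * pd i (pd j fun v => χ v * u v) v
        + diffusion a γ g v i j * (u v * pd j (pd i χ) v))
      - (diffusion a γ g v i j * pd i (fun v => u v * pd j χ v) v
        + diffusion a γ g v i j * pd j (fun v => u v * pd i χ v) v) := by
    intro i j v
    have e1 : (pd j fun v => χ v * u v) = fun v => χ v * pd j u v + u v * pd j χ v :=
      funext fun v => pd_mul hχ1 hu1 j v
    rw [e1, pd_add (hχ1.mul (contDiff_pd hu j)) (hu1.mul (contDiff_pd hχ j)),
      pd_mul hχ1 (contDiff_pd hu j), pd_mul hu1 (contDiff_pd hχ j), pd_mul hu1 (contDiff_pd hχ i)]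
    ring
  have hΦ : ContDiff ℝ 2 fun v => χ v * u v := hχ.mul hu
  have hΦc : HasCompactSupport fun v => χ v * u v := hc.mul_right
  have hY : ∀ j, ContDiff ℝ 1 fun v => u v * pd j χ v := fun j => hu1.mul (contDiff_pd hχ j)
  have hYc : ∀ j, HasCompactSupport fun v => u v * pd j χ v := fun j =>
    (hasCompactSupport_pd hc j).mul_left
  have i1 : ∀ i j, Integrable fun v => diffusion a γ g v i j * pd i (pd j fun v => χ v * u v) v :=
    fun i j => integrable_diffusion_mul hp hg (continuous_pd (contDiff_pd hΦ j) i)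
      (hasCompactSupport_pd (hasCompactSupport_pd hΦc j) i) i j
  have i2 : ∀ i j, Integrable fun v => diffusion a γ g v i j * (u v * pd j (pd i χ) v) :=
    fun i j => integrable_diffusion_mul hp hg
      (hu.continuous.mul (continuous_pd (contDiff_pd hχ i) j))
      (hasCompactSupport_pd (hasCompactSupport_pd hc i) j).mul_left i j
  have i3 : ∀ i j, Integrable fun v => diffusion a γ g v i j * pd i (fun v => u v * pd j χ v) v :=
    fun i j => integrable_diffusion_mul hp hg (continuous_pd (hY j) i)
      (hasCompactSupport_pd (hYc j) i) i j
  have i4 : ∀ i j, Integrable fun v => diffusion a γ g v i j * pd j (fun v => u v * pd i χ v) v :=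
    fun i j => integrable_diffusion_mul hp hg (continuous_pd (hY i) j)
      (hasCompactSupport_pd (hYc i) j) i j
  have hint : ∀ i j, ∫ v, diffusion a γ g v i j * (χ v * pd i (pd j u) v) =
      ((∫ v, diffusion a γ g v i j * pd i (pd j fun v => χ v * u v) v)
        + ∫ v, diffusion a γ g v i j * (u v * pd j (pd i χ) v))
      - ((∫ v, diffusion a γ g v i j * pd i (fun v => u v * pd j χ v) v)
        + ∫ v, diffusion a γ g v i j * pd j (fun v => u v * pd i χ v) v) := by
    intro i j
    simp only [hpt]
    exact integral_add_sub_add (i1 i j) (i2 i j) (i3 i j) (i4 i j)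
  simp only [hint, Finset.sum_sub_distrib, Finset.sum_add_distrib]
  rw [sum_integral_diffusion_mul_pd_pd hp hg hΦ hΦc]
  have s3 : ∑ i, ∑ j, ∫ v, diffusion a γ g v i j * pd i (fun v => u v * pd j χ v) v =
      -∑ j, ∫ v, drift a γ g j v * (u v * pd j χ v) := by
    rw [Finset.sum_comm, ← Finset.sum_neg_distrib]
    exact Finset.sum_congr rfl fun j _ => sum_integral_diffusion_mul_pd hp hg (hY j) (hYc j) j
  have s4 : ∑ i, ∑ j, ∫ v, diffusion a γ g v i j * pd j (fun v => u v * pd i χ v) v =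
      -∑ j, ∫ v, drift a γ g j v * (u v * pd j χ v) := by
    rw [← Finset.sum_neg_distrib]
    refine Finset.sum_congr rfl fun i _ => ?_
    simp only [diffusion_symm a γ g _ i]
    exact sum_integral_diffusion_mul_pd hp hg (hY i) (hYc i) i
  rw [s3, s4]
  ring

end

end

section

/-! ### The evolution of integrals of functions of the solution -/

variable {d : ℕ}

theorem contDiff_one_comp_of_nonneg {k k' : ℝ → ℝ} (hk : ∀ x, 0 ≤ x → HasDerivAt k (k' x) x)
    (hk' : ContinuousOn k' (Set.Ici 0)) {u : Vel d → ℝ} (hu : ContDiff ℝ 1 u) (h0 : ∀ v, 0 ≤ u v) :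
    ContDiff ℝ 1 fun v => k (u v) := by
  have h1 : ∀ v, HasFDerivAt (fun v => k (u v)) (k' (u v) • fderiv ℝ u v) v := fun v =>
    (hk _ (h0 v)).comp_hasFDerivAt v (hu.differentiable (by norm_num) v).hasFDerivAt
  rw [contDiff_one_iff_fderiv]
  refine ⟨fun v => (h1 v).differentiableAt, ?_⟩
  have : fderiv ℝ (fun v => k (u v)) = fun v => k' (u v) • fderiv ℝ u v :=
    funext fun v => (h1 v).fderiv
  rw [this]
  exact (hk'.comp_continuous hu.continuous h0).smul (hu.continuous_fderiv (by norm_num))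

theorem pd_comp {k k' : ℝ → ℝ} (hk : ∀ x, 0 ≤ x → HasDerivAt k (k' x) x)
    {u : Vel d → ℝ} (hu : ContDiff ℝ 1 u) (h0 : ∀ v, 0 ≤ u v) (i : Fin d) (v : Vel d) :
    pd i (fun v => k (u v)) v = k' (u v) * pd i u v := by
  unfold pd
  have h1 : HasFDerivAt (fun v => k (u v)) (k' (u v) • fderiv ℝ u v) v :=
    (hk _ (h0 v)).comp_hasFDerivAt v (hu.differentiable (by norm_num) v).hasFDerivAt
  rw [h1.fderiv]
  simp

theorem continuousOn_of_hasDerivAt {k k' : ℝ → ℝ} (hk : ∀ x, 0 ≤ x → HasDerivAt k (k' x) x) :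
    ContinuousOn k (Set.Ici 0) := fun x hx => (hk x hx).continuousAt.continuousWithinAt

theorem contDiff_two_comp_of_nonneg {k k' k'' : ℝ → ℝ} (hk : ∀ x, 0 ≤ x → HasDerivAt k (k' x) x)
    (hk' : ∀ x, 0 ≤ x → HasDerivAt k' (k'' x) x) (hk'' : ContinuousOn k'' (Set.Ici 0))
    {u : Vel d → ℝ} (hu : ContDiff ℝ 2 u) (h0 : ∀ v, 0 ≤ u v) :
    ContDiff ℝ 2 fun v => k (u v) := by
  have hu1 : ContDiff ℝ 1 u := hu.of_le (by norm_num)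
  have h1 : ∀ v, HasFDerivAt (fun v => k (u v)) (k' (u v) • fderiv ℝ u v) v := fun v =>
    (hk _ (h0 v)).comp_hasFDerivAt v (hu.differentiable (by norm_num) v).hasFDerivAt
  rw [show (2 : WithTop ℕ∞) = 1 + 1 by norm_num, contDiff_succ_iff_fderiv]
  refine ⟨fun v => (h1 v).differentiableAt, by simp, ?_⟩
  have : fderiv ℝ (fun v => k (u v)) = fun v => k' (u v) • fderiv ℝ u v :=
    funext fun v => (h1 v).fderiv
  rw [this]
  exact (contDiff_one_comp_of_nonneg hk' hk'' hu1 h0).smul (hu.fderiv_right (m := 1) (by norm_num))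

theorem pd_pd_comp {k k' k'' : ℝ → ℝ} (hk : ∀ x, 0 ≤ x → HasDerivAt k (k' x) x)
    (hk' : ∀ x, 0 ≤ x → HasDerivAt k' (k'' x) x) (hk'' : ContinuousOn k'' (Set.Ici 0))
    {u : Vel d → ℝ} (hu : ContDiff ℝ 2 u) (h0 : ∀ v, 0 ≤ u v) (i j : Fin d) (v : Vel d) :
    pd i (pd j fun v => k (u v)) v =
      k' (u v) * pd i (pd j u) v + k'' (u v) * (pd i u v * pd j u v) := by
  have hu1 : ContDiff ℝ 1 u := hu.of_le (by norm_num)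
  have e : (pd j fun v => k (u v)) = fun v => k' (u v) * pd j u v :=
    funext fun v => pd_comp hk hu1 h0 j v
  rw [e, pd_mul (contDiff_one_comp_of_nonneg hk' hk'' hu1 h0) (contDiff_pd hu j),
    pd_comp hk' hu1 h0]
  ring

section
variable {a γ : ℝ} {S : EReal} {f : ℝ → Vel d → ℝ}

theorem exists_real_between {t : ℝ} (ht : (t : EReal) < S) : ∃ s : ℝ, t < s ∧ (s : EReal) < S := by
  obtain ⟨s, h1, h2⟩ := EReal.lt_iff_exists_real_btwn.1 ht
  exact ⟨s, EReal.coe_lt_coe_iff.1 h1, h2⟩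

theorem coe_lt_of_le {s t : ℝ} (h : s ≤ t) (ht : (t : EReal) < S) : (s : EReal) < S :=
  (EReal.coe_le_coe_iff.2 h).trans_lt ht

theorem IsClassicalSolution.dens (hf : IsClassicalSolution a γ S f) {s s' : ℝ} (hs : 0 < s)
    (hs' : (s' : EReal) < S) : ∃ B, ∀ t ∈ Set.Icc s s', Dens B (f t) := by
  obtain ⟨B, hB⟩ := hf.locally_bounded s s' hs hs'
  refine ⟨B, fun t ht => ?_⟩
  have h0 : 0 < t := hs.trans_le ht.1
  have hS : (t : EReal) < S := coe_lt_of_le ht.2 hs'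
  have hn := hf.nonneg t h0.le hS
  have hfin := hf.finite t h0.le hS
  obtain ⟨b1, b2, b3⟩ := hB t ht
  refine ⟨(hf.contDiff_velocity t h0 hS).continuous.measurable, fun v => ?_, hfin.mass,
    hfin.energy, ?_, ?_⟩
  · rw [abs_of_nonneg (hn v)]; exact b1 v
  · simp only [abs_of_nonneg (hn _)]; exact b2
  · simp only [abs_of_nonneg (hn _)]; exact b3

theorem IsClassicalSolution.dens_at (hf : IsClassicalSolution a γ S f) {t : ℝ} (ht : 0 < t)
    (hS : (t : EReal) < S) : ∃ B, Dens B (f t) := by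
  obtain ⟨B, hB⟩ := hf.dens ht hS
  exact ⟨B, hB t ⟨le_rfl, le_rfl⟩⟩

theorem isCompact_slab {s s' : ℝ} {K : Set (Vel d)} (hK : IsCompact K) :
    IsCompact (Set.Icc s s' ×ˢ K) := isCompact_Icc.prod hK

theorem slab_subset_domain {s s' : ℝ} (hs : 0 < s) (hs' : (s' : EReal) < S) (K : Set (Vel d)) :
    Set.Icc s s' ×ˢ K ⊆ domain d S := fun p hp =>
  ⟨hs.trans_le hp.1.1, coe_lt_of_le hp.1.2 hs'⟩

/-- Differentiation under the integral sign. -/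
theorem IsClassicalSolution.hasDerivAt_integral (hf : IsClassicalSolution a γ S f) {t : ℝ}
    (ht : 0 < t) (hS : (t : EReal) < S) {k k' : ℝ → ℝ}
    (hk : ∀ x, 0 ≤ x → HasDerivAt k (k' x) x) (hk' : ContinuousOn k' (Set.Ici 0))
    {χ : Vel d → ℝ} (hχ : Continuous χ) (hc : HasCompactSupport χ) :
    HasDerivAt (fun t => ∫ v, χ v * k (f t v))
      (∫ v, χ v * (k' (f t v) * deriv (fun s => f s v) t)) t := by
  obtain ⟨s', hts', hs'⟩ := exists_real_between hS
  have hsub := slab_subset_domain (d := d) (half_pos ht) hs' (tsupport χ)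
  have hcont : ContinuousOn (fun p : ℝ × Vel d =>
      χ p.2 * (k' (f p.1 p.2) * deriv (fun s => f s p.2) p.1))
      (Set.Icc (t / 2) s' ×ˢ tsupport χ) := by
    refine (hχ.comp continuous_snd).continuousOn.mul (ContinuousOn.mul ?_
      (hf.continuous_time_deriv.mono hsub))
    exact hk'.comp (hf.continuous_self.mono hsub) fun p hp =>
      hf.nonneg p.1 (hsub hp).1.le (hsub hp).2 p.2
  obtain ⟨C, hC⟩ := (isCompact_slab (s := t / 2) (s' := s') hc).exists_bound_of_continuousOn hcont
  have hI : Set.Ioo (t / 2) s' ∈ 𝓝 t := Ioo_mem_nhds (half_lt_self ht) hts'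
  have hpos : ∀ x ∈ Set.Ioo (t / 2) s', 0 < x ∧ (x : EReal) < S := fun x hx =>
    ⟨(half_pos ht).trans hx.1, coe_lt_of_le hx.2.le hs'⟩
  have hcf : ∀ x ∈ Set.Ioo (t / 2) s', Continuous fun v => χ v * k (f x v) := fun x hx =>
    hχ.mul ((continuousOn_of_hasDerivAt hk).comp_continuous
      (hf.contDiff_velocity x (hpos x hx).1 (hpos x hx).2).continuous
      (hf.nonneg x (hpos x hx).1.le (hpos x hx).2))
  have htI : t ∈ Set.Ioo (t / 2) s' := ⟨half_lt_self ht, hts'⟩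
  have hdc : Continuous fun v => deriv (fun s => f s v) t :=
    hf.continuous_time_deriv.comp_continuous (continuous_const.prodMk continuous_id)
      fun v => ⟨ht, hS⟩
  refine (hasDerivAt_integral_of_dominated_loc_of_deriv_le
    (F' := fun x v => χ v * (k' (f x v) * deriv (fun s => f s v) x))
    (bound := (tsupport χ).indicator fun _ => C) hI ?_ ?_ ?_ ?_ ?_ ?_).2
  · filter_upwards [hI] with x hx using (hcf x hx).aestronglyMeasurable
  · exact (hcf t htI).integrable_of_hasCompactSupport hc.mul_right
  · refine Continuous.aestronglyMeasurable (hχ.mul (Continuous.mul ?_ hdc))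
    exact hk'.comp_continuous (hf.contDiff_velocity t ht hS).continuous (hf.nonneg t ht.le hS)
  · refine Eventually.of_forall fun v x hx => ?_
    by_cases hv : v ∈ tsupport χ
    · rw [Set.indicator_of_mem hv]
      exact hC (x, v) ⟨⟨hx.1.le, hx.2.le⟩, hv⟩
    · rw [Set.indicator_of_notMem hv, image_eq_zero_of_notMem_tsupport hv]
      simp
  · rw [integrable_indicator_iff (isClosed_tsupport χ).measurableSet]
    exact integrableOn_const hc.isCompact.measure_ne_top
  · refine Eventually.of_forall fun v x hx => ?_
    refine HasDerivAt.const_mul _ ?_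
    exact (hk _ (hf.nonneg x (hpos x hx).1.le (hpos x hx).2 v)).comp x
      (hf.differentiable_time x (hpos x hx).1 (hpos x hx).2 v).hasDerivAt

/-- The transport terms `∑ ∫ u āᵢⱼ ∂ⱼᵢχ + 2 ∑ ∫ u b̄ⱼ ∂ⱼχ` in the evolution of `∫ u χ`. -/
def testFlux (a γ : ℝ) (g u χ : Vel d → ℝ) : ℝ :=
  (∑ i, ∑ j, ∫ v, diffusion a γ g v i j * (u v * pd j (pd i χ) v))
    + 2 * ∑ j, ∫ v, drift a γ g j v * (u v * pd j χ v)

/-- The dissipation `∑ ∫ χ h āᵢⱼ ∂ᵢu ∂ⱼu`. -/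
def dissipation (a γ : ℝ) (g u w : Vel d → ℝ) : ℝ :=
  ∑ i, ∑ j, ∫ v, diffusion a γ g v i j * (w v * (pd i u v * pd j u v))

/-- The evolution of `∫ χ h(f)`, for a renormalization `h = k` with two derivatives on `[0, ∞)`. -/
theorem IsClassicalSolution.hasDerivAt_integral_test (hp : Params d γ)
    (hf : IsClassicalSolution a γ S f) {t : ℝ} (ht : 0 < t) (hS : (t : EReal) < S)
    {k k' k'' : ℝ → ℝ} (hk : ∀ x, 0 ≤ x → HasDerivAt k (k' x) x)
    (hk' : ∀ x, 0 ≤ x → HasDerivAt k' (k'' x) x) (hk'' : ContinuousOn k'' (Set.Ici 0))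
    {χ : Vel d → ℝ} (hχ : ContDiff ℝ 2 χ) (hc : HasCompactSupport χ) :
    HasDerivAt (fun t => ∫ v, χ v * k (f t v))
      (-dissipation a γ (f t) (f t) (fun v => χ v * k'' (f t v))
        + testFlux a γ (f t) (fun v => k (f t v)) χ
        + ∫ v, reaction a γ (f t) v * (χ v * (f t v * k' (f t v) - k (f t v)))) t := by
  have hk'c := continuousOn_of_hasDerivAt hk'
  obtain ⟨B, hg⟩ := hf.dens_at ht hS
  have hn := hf.nonneg t ht.le hS
  have hu := hf.contDiff_velocity t ht hS
  have hu1 : ContDiff ℝ 1 (f t) := hu.of_le (by norm_num)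
  have hU := contDiff_two_comp_of_nonneg hk hk' hk'' hu hn
  have ck' : Continuous fun v => k' (f t v) := hk'c.comp_continuous hu.continuous hn
  have ck'' : Continuous fun v => k'' (f t v) := hk''.comp_continuous hu.continuous hn
  convert! hf.hasDerivAt_integral ht hS hk hk'c hχ.continuous hc using 1
  have hW := sum_integral_diffusion_mul_test (a := a) hp hg hU hχ hc
  simp only [pd_pd_comp hk hk' hk'' hu hn] at hW
  have iA : ∀ i j, Integrable fun v => diffusion a γ (f t) v i j *
      (χ v * (k' (f t v) * pd i (pd j (f t)) v)) := fun i j =>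
    integrable_diffusion_mul hp hg (hχ.continuous.mul
      (ck'.mul (continuous_pd (contDiff_pd hu j) i))) hc.mul_right i j
  have iD : ∀ i j, Integrable fun v => diffusion a γ (f t) v i j *
      (χ v * k'' (f t v) * (pd i (f t) v * pd j (f t) v)) := fun i j =>
    integrable_diffusion_mul hp hg ((hχ.continuous.mul ck'').mul
      ((continuous_pd hu1 i).mul (continuous_pd hu1 j))) hc.mul_right.mul_right i j
  have hsplit : ∀ i j, ∫ v, diffusion a γ (f t) v i j * (χ v * (k' (f t v) * pd i (pd j (f t)) v +
      k'' (f t v) * (pd i (f t) v * pd j (f t) v))) =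
      (∫ v, diffusion a γ (f t) v i j * (χ v * (k' (f t v) * pd i (pd j (f t)) v))) +
      ∫ v, diffusion a γ (f t) v i j * (χ v * k'' (f t v) * (pd i (f t) v * pd j (f t) v)) := by
    intro i j
    refine Eq.trans (integral_congr_ae (Eventually.of_forall fun v => ?_))
      (integral_add (iA i j) (iD i j))
    simp only []
    ring
  simp only [hsplit, Finset.sum_add_distrib] at hW
  have ir1 : Integrable fun v => reaction a γ (f t) v * (χ v * k (f t v)) :=
    integrable_reaction_mul hp hg (hχ.continuous.mul hU.continuous) hc.mul_right
  have ir2 : Integrable fun v => reaction a γ (f t) v * (χ v * (f t v * k' (f t v))) :=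
    integrable_reaction_mul hp hg (hχ.continuous.mul (hu.continuous.mul ck')) hc.mul_right
  have hr : ∫ v, reaction a γ (f t) v * (χ v * (f t v * k' (f t v) - k (f t v))) =
      (∫ v, reaction a γ (f t) v * (χ v * (f t v * k' (f t v)))) -
      ∫ v, reaction a γ (f t) v * (χ v * k (f t v)) := by
    rw [← integral_sub ir2 ir1]
    refine integral_congr_ae (Eventually.of_forall fun v => ?_)
    simp only []
    ring
  have hrhs : ∫ v, χ v * (k' (f t v) * deriv (fun s => f s v) t) =
      (∑ i, ∑ j, ∫ v, diffusion a γ (f t) v i j * (χ v * (k' (f t v) * pd i (pd j (f t)) v)))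
      + ∫ v, reaction a γ (f t) v * (χ v * (f t v * k' (f t v))) := by
    have e1 : ∀ i, ∑ j, ∫ v, diffusion a γ (f t) v i j *
        (χ v * (k' (f t v) * pd i (pd j (f t)) v)) =
        ∫ v, ∑ j, diffusion a γ (f t) v i j * (χ v * (k' (f t v) * pd i (pd j (f t)) v)) :=
      fun i => (integral_finsetSum _ fun j _ => iA i j).symm
    rw [Finset.sum_congr rfl fun i _ => e1 i, ← integral_finsetSum _ fun i _ =>
      integrable_finsetSum _ fun j _ => iA i j, ← integral_add
        (integrable_finsetSum _ fun i _ => integrable_finsetSum _ fun j _ => iA i j) ir2]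
    refine integral_congr_ae (Eventually.of_forall fun v => ?_)
    simp only []
    rw [hf.equation t ht hS v]
    simp only [partial₂_eq hu, mul_add, Finset.mul_sum]
    congr 1
    · refine Finset.sum_congr rfl fun i _ => Finset.sum_congr rfl fun j _ => ?_
      ring
    · ring
  rw [hrhs, hr]
  unfold dissipation testFlux
  linarith

end

end

section

/-! ### Cutoff functions -/

variable {d : ℕ}

/-- A fixed smooth bump function, equal to `1` on the unit ball and supported in the ball of
radius `2`. -/
def bump : ContDiffBump (0 : Vel d) := ⟨1, 2, zero_lt_one, one_lt_two⟩

/-- The cutoff `χ(v / R)`. -/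
def cutoff (R : ℝ) (v : Vel d) : ℝ := bump (R⁻¹ • v)

theorem pd_comp_smul {u : Vel d → ℝ} (hu : ContDiff ℝ 1 u) (c : ℝ) (j : Fin d) (v : Vel d) :
    pd j (fun v => u (c • v)) v = c * pd j u (c • v) := by
  have h1 : HasFDerivAt (fun v : Vel d => c • v) (c • ContinuousLinearMap.id ℝ (Vel d)) v :=
    (hasFDerivAt_id v).const_smul c
  have h2 := ((hu.differentiable (by norm_num) (c • v)).hasFDerivAt).comp v h1
  unfold pd
  rw [show (fun v => u (c • v)) = u ∘ fun v => c • v from rfl, h2.fderiv]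
  simp

theorem pd_const_mul {u : Vel d → ℝ} (hu : ContDiff ℝ 1 u) (c : ℝ) (j : Fin d) (v : Vel d) :
    pd j (fun v => c * u v) v = c * pd j u v := by
  unfold pd
  rw [fderiv_const_mul (hu.differentiable (by norm_num) v)]
  simp

theorem pd_pd_comp_smul {u : Vel d → ℝ} (hu : ContDiff ℝ 2 u) (c : ℝ) (i j : Fin d) (v : Vel d) :
    pd j (pd i fun v => u (c • v)) v = c ^ 2 * pd j (pd i u) (c • v) := by
  have e : (pd i fun v => u (c • v)) = fun v => c * pd i u (c • v) :=
    funext fun v => pd_comp_smul (hu.of_le (by norm_num)) c i v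
  have h1 := contDiff_pd hu i
  rw [e, pd_const_mul (u := fun v => pd i u (c • v)) (h1.comp (contDiff_const_smul c)),
    pd_comp_smul h1]
  ring

theorem contDiff_bump {n : ℕ} : ContDiff ℝ n (bump : Vel d → ℝ) := bump.contDiff

theorem contDiff_cutoff (R : ℝ) {n : ℕ} : ContDiff ℝ n (cutoff R : Vel d → ℝ) :=
  contDiff_bump.comp (contDiff_const_smul _)

theorem hasCompactSupport_comp_smul {u : Vel d → ℝ} (hu : HasCompactSupport u) {c : ℝ}
    (hc : c ≠ 0) : HasCompactSupport fun v => u (c • v) :=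
  hu.comp_homeomorph (Homeomorph.smulOfNeZero c hc)

theorem hasCompactSupport_cutoff {R : ℝ} (hR : 0 < R) :
    HasCompactSupport (cutoff R : Vel d → ℝ) :=
  hasCompactSupport_comp_smul bump.hasCompactSupport (inv_ne_zero hR.ne')

theorem cutoff_nonneg (R : ℝ) (v : Vel d) : 0 ≤ cutoff R v := bump.nonneg

theorem cutoff_le_one (R : ℝ) (v : Vel d) : cutoff R v ≤ 1 := bump.le_one

theorem cutoff_eq_one {R : ℝ} (hR : 0 < R) {v : Vel d} (hv : ‖v‖ ≤ R) : cutoff R v = 1 := by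
  refine bump.one_of_mem_closedBall ?_
  rw [mem_closedBall_zero_iff, norm_smul, norm_inv, Real.norm_of_nonneg hR.le]
  rw [inv_mul_le_iff₀ hR]
  simpa [bump] using hv

/-- Where `χ < 1` one has `|v| ≥ R`. -/
theorem one_sub_cutoff_le {R : ℝ} (hR : 0 < R) (v : Vel d) :
    1 - cutoff R v ≤ ‖v‖ ^ 2 / R ^ 2 := by
  rcases le_or_gt ‖v‖ R with h | h
  · rw [cutoff_eq_one hR h]; simp; positivity
  · have : 1 ≤ ‖v‖ ^ 2 / R ^ 2 := by
      rw [one_le_div (by positivity)]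
      exact pow_le_pow_left₀ hR.le h.le 2
    linarith [cutoff_nonneg R v]

theorem pd_congr {u w : Vel d → ℝ} {v : Vel d} (h : u =ᶠ[𝓝 v] w) (j : Fin d) :
    pd j u =ᶠ[𝓝 v] pd j w := by
  filter_upwards [h.eventuallyEq_nhds] with x hx
  unfold pd
  rw [hx.fderiv_eq]

theorem pd_const (c : ℝ) (j : Fin d) : pd j (fun _ : Vel d => c) = fun _ => 0 := by
  funext v; unfold pd; simp

theorem bump_eventuallyEq_one {w : Vel d} (hw : ‖w‖ < 1) :
    (bump : Vel d → ℝ) =ᶠ[𝓝 w] fun _ => 1 := by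
  filter_upwards [Metric.isOpen_ball.mem_nhds (mem_ball_zero_iff.2 hw)] with x hx
  exact bump.one_of_mem_closedBall (Metric.ball_subset_closedBall hx)

/-- The derivatives of the cutoffs, against the growth of the coefficients. -/
theorem exists_cutoff_bound (d : ℕ) : ∃ L : ℝ, 0 ≤ L ∧ ∀ R : ℝ, 1 ≤ R → ∀ v : Vel d,
    (∀ i j, |pd j (pd i (cutoff R)) v| * (1 + ‖v‖) ^ 2 ≤ L * (‖v‖ ^ 2 / R ^ 2)) ∧
    (∀ j, |pd j (cutoff R) v| * (1 + ‖v‖) ≤ L * (‖v‖ ^ 2 / R ^ 2)) ∧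
    (∀ j, |pd j (cutoff R) v| ^ 2 * (1 + ‖v‖) ^ 2 ≤ L * (‖v‖ ^ 2 / R ^ 2)) := by
  have hb : ContDiff ℝ 2 (bump : Vel d → ℝ) := contDiff_bump
  have hb1 : ContDiff ℝ 1 (bump : Vel d → ℝ) := contDiff_bump
  have hcb : HasCompactSupport (bump : Vel d → ℝ) := bump.hasCompactSupport
  have h2 : ∀ i j : Fin d, ∃ C, ∀ v : Vel d, ‖pd j (pd i bump) v‖ ≤ C := fun i j =>
    (hasCompactSupport_pd (hasCompactSupport_pd hcb i) j).exists_bound_of_continuous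
      (continuous_pd (contDiff_pd hb i) j)
  have h1 : ∀ j : Fin d, ∃ C, ∀ v : Vel d, ‖pd j bump v‖ ≤ C := fun j =>
    (hasCompactSupport_pd hcb j).exists_bound_of_continuous (continuous_pd hb1 j)
  choose C2 hC2 using h2
  choose C1 hC1 using h1
  set M : ℝ := ∑ i, ∑ j, |C2 i j| + ∑ j, |C1 j| with hM
  have hM0 : 0 ≤ M := add_nonneg (Finset.sum_nonneg fun i _ => Finset.sum_nonneg fun j _ =>
    abs_nonneg _) (Finset.sum_nonneg fun j _ => abs_nonneg _)
  have hM2 : ∀ (i j : Fin d) (v : Vel d), |pd j (pd i bump) v| ≤ M := by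
    intro i j v
    have e1 : |C2 i j| ≤ ∑ j, |C2 i j| :=
      Finset.single_le_sum (f := fun j => |C2 i j|) (fun _ _ => abs_nonneg _) (Finset.mem_univ j)
    have e2 : ∑ j, |C2 i j| ≤ ∑ i, ∑ j, |C2 i j| :=
      Finset.single_le_sum (f := fun i => ∑ j, |C2 i j|)
        (fun _ _ => Finset.sum_nonneg fun _ _ => abs_nonneg _) (Finset.mem_univ i)
    have e3 : 0 ≤ ∑ j, |C1 j| := Finset.sum_nonneg fun _ _ => abs_nonneg _
    have e4 := (hC2 i j v).trans (le_abs_self _)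
    rw [Real.norm_eq_abs] at e4
    linarith
  have hM1 : ∀ (j : Fin d) (v : Vel d), |pd j bump v| ≤ M := by
    intro j v
    have e1 : |C1 j| ≤ ∑ j, |C1 j| :=
      Finset.single_le_sum (f := fun j => |C1 j|) (fun _ _ => abs_nonneg _) (Finset.mem_univ j)
    have e3 : 0 ≤ ∑ i, ∑ j, |C2 i j| :=
      Finset.sum_nonneg fun _ _ => Finset.sum_nonneg fun _ _ => abs_nonneg _
    have e4 := (hC1 j v).trans (le_abs_self _)
    rw [Real.norm_eq_abs] at e4
    linarith
  refine ⟨4 * M + 4 * M ^ 2, by positivity, fun R hR v => ?_⟩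
  have hR0 : 0 < R := by linarith
  have hv0 := norm_nonneg v
  have d2 : ∀ i j, pd j (pd i (cutoff R)) v = R⁻¹ ^ 2 * pd j (pd i bump) (R⁻¹ • v) := fun i j =>
    pd_pd_comp_smul hb _ i j v
  have d1 : ∀ j, pd j (cutoff R) v = R⁻¹ * pd j bump (R⁻¹ • v) := fun j =>
    pd_comp_smul hb1 _ j v
  rcases lt_or_ge ‖v‖ R with h | h
  · have hw : ‖R⁻¹ • v‖ < 1 := by
      rw [norm_smul, norm_inv, Real.norm_of_nonneg hR0.le, inv_mul_lt_iff₀ hR0]; linarith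
    have z1 : ∀ j, pd j bump =ᶠ[𝓝 (R⁻¹ • v)] fun _ => 0 := fun j => by
      have := pd_congr (bump_eventuallyEq_one hw) j
      rwa [pd_const] at this
    have z2 : ∀ i j, pd j (pd i bump) (R⁻¹ • v) = 0 := fun i j => by
      have := (pd_congr (z1 i) j).self_of_nhds
      rwa [pd_const] at this
    have hpos : 0 ≤ (4 * M + 4 * M ^ 2) * (‖v‖ ^ 2 / R ^ 2) := by positivity
    refine ⟨fun i j => ?_, fun j => ?_, fun j => ?_⟩
    · rw [d2, z2]; simpa using hpos
    · rw [d1, (z1 j).self_of_nhds]; simpa using hpos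
    · rw [d1, (z1 j).self_of_nhds]; simpa using hpos
  · have hv1 : 1 + ‖v‖ ≤ 2 * ‖v‖ := by linarith
    have hr : R⁻¹ * ‖v‖ ≥ 1 := by rw [ge_iff_le, ← div_eq_inv_mul, one_le_div hR0]; exact h
    have hq : ‖v‖ ^ 2 / R ^ 2 = (R⁻¹ * ‖v‖) ^ 2 := by field_simp
    have hi : 0 < R⁻¹ := inv_pos.2 hR0
    rw [hq]
    have hsq : (1 + ‖v‖) ^ 2 ≤ (2 * ‖v‖) ^ 2 := pow_le_pow_left₀ (by positivity) hv1 2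
    refine ⟨fun i j => ?_, fun j => ?_, fun j => ?_⟩
    · rw [d2, abs_mul, abs_of_nonneg (by positivity : 0 ≤ R⁻¹ ^ 2)]
      calc R⁻¹ ^ 2 * |pd j (pd i bump) (R⁻¹ • v)| * (1 + ‖v‖) ^ 2
          ≤ R⁻¹ ^ 2 * M * (2 * ‖v‖) ^ 2 := by
            gcongr; exact hM2 i j _
        _ = 4 * M * (R⁻¹ * ‖v‖) ^ 2 := by ring
        _ ≤ _ := mul_le_mul_of_nonneg_right (by nlinarith) (by positivity)
    · rw [d1, abs_mul, abs_of_nonneg hi.le]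
      calc R⁻¹ * |pd j bump (R⁻¹ • v)| * (1 + ‖v‖) ≤ R⁻¹ * M * (2 * ‖v‖) := by
            gcongr; exact hM1 j _
        _ = 2 * M * (R⁻¹ * ‖v‖) := by ring
        _ ≤ 2 * M * (R⁻¹ * ‖v‖) ^ 2 := by
            refine mul_le_mul_of_nonneg_left ?_ (by positivity)
            nlinarith
        _ ≤ _ := mul_le_mul_of_nonneg_right (by nlinarith) (by positivity)
    · rw [d1, abs_mul, abs_of_nonneg hi.le]
      calc (R⁻¹ * |pd j bump (R⁻¹ • v)|) ^ 2 * (1 + ‖v‖) ^ 2 ≤ (R⁻¹ * M) ^ 2 * (2 * ‖v‖) ^ 2 := by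
            gcongr; exact hM1 j _
        _ = 4 * M ^ 2 * (R⁻¹ * ‖v‖) ^ 2 := by ring
        _ ≤ _ := mul_le_mul_of_nonneg_right (by nlinarith) (by positivity)

theorem tendsto_integral_cutoff_mul {g : Vel d → ℝ} (hg : Integrable g) :
    Tendsto (fun n : ℕ => ∫ v, cutoff ((n : ℝ) + 1) v * g v) atTop (𝓝 (∫ v, g v)) := by
  refine tendsto_integral_of_dominated_convergence (fun v => |g v|) (fun n => ?_) hg.abs
    (fun n => Eventually.of_forall fun v => ?_) (Eventually.of_forall fun v => ?_)
  · exact ((contDiff_cutoff _ (n := 0)).continuous.aestronglyMeasurable).mul hg.aestronglyMeasurable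
  · rw [norm_mul, Real.norm_of_nonneg (cutoff_nonneg _ v)]
    exact mul_le_of_le_one_left (norm_nonneg _) (cutoff_le_one _ v)
  · obtain ⟨N, hN⟩ := exists_nat_ge ‖v‖
    refine tendsto_const_nhds.congr' ?_
    filter_upwards [eventually_ge_atTop N] with n hn
    have : (N : ℝ) ≤ n := Nat.cast_le.2 hn
    rw [cutoff_eq_one (by positivity) (by linarith), one_mul]

/-! ### Conservation of mass -/

section
variable {a γ B : ℝ} {g : Vel d → ℝ}

/-- The constant bounding the convolutions with the kernels. -/
def convConst (d : ℕ) (γ B : ℝ) : ℝ := (2 * singMass d γ + 8) * B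

theorem convConst_nonneg (hB : 0 ≤ B) : 0 ≤ convConst d γ B := by
  have := singMass_nonneg d γ
  unfold convConst; positivity

theorem abs_diffusion_le (hp : Params d γ) (ha : 0 ≤ a) (hg : Dens B g) (v : Vel d) (i j : Fin d) :
    |diffusion a γ g v i j| ≤ a * convConst d γ B * (1 + ‖v‖) ^ 2 := by
  rw [diffusion_eq, abs_mul, abs_of_nonneg ha, mul_assoc]
  exact mul_le_mul_of_nonneg_left (abs_conv_le hp.dim hp.pos le_rfl
    (kernelBound_kernel hp.mem i j) hg v) ha

theorem abs_drift_le (hp : Params d γ) (ha : 0 ≤ a) (hg : Dens B g) (v : Vel d) (j : Fin d) :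
    |drift a γ g j v| ≤ d * a * convConst d γ B * (1 + ‖v‖) := by
  have h1 := abs_conv_le hp.dim hp.pos (by norm_num) (kernelBound_vecKernel hp.mem j) hg v
  rw [pow_one] at h1
  have hd1 : (2 : ℝ) ≤ d := by exact_mod_cast hp.dim
  rw [drift, abs_mul, abs_neg, abs_mul, abs_of_nonneg ha,
    abs_of_nonneg (by linarith : (0 : ℝ) ≤ d - 1), mul_assoc (_ * _) (convConst d γ B)]
  exact mul_le_mul (by nlinarith) h1 (abs_nonneg _) (by positivity)

theorem abs_reaction_le (hp : Params d γ) (ha : 0 ≤ a) (hg : Dens B g) (v : Vel d) :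
    |reaction a γ g v| ≤ d * d * a * convConst d γ B := by
  have h1 := abs_conv_le hp.dim hp.pos (by norm_num) (kernelBound_rpow hp.mem) hg v
  rw [pow_zero, mul_one] at h1
  have hd1 : (2 : ℝ) ≤ d := by exact_mod_cast hp.dim
  have := hp.pos
  have := hp.mem.2
  rw [reaction_eq, abs_mul, abs_of_nonneg (by
    have : (0 : ℝ) ≤ d - 1 := by linarith
    have := hp.pos.le
    positivity)]
  refine mul_le_mul ?_ h1 (abs_nonneg _) (by positivity)
  refine mul_le_mul_of_nonneg_right ?_ ha
  exact mul_le_mul (by linarith) (by linarith) (by linarith) (by positivity)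

/-- The transport terms across the boundary of a large ball are small. -/
theorem exists_testFlux_bound (hp : Params d γ) (ha : 0 ≤ a) (hB : 0 ≤ B) :
    ∃ C : ℝ, 0 ≤ C ∧ ∀ R : ℝ, 1 ≤ R → ∀ (g u : Vel d → ℝ) (M : ℝ), 0 ≤ M → Dens B g →
      (∀ v, |u v| ≤ M * |g v|) → |testFlux a γ g u (cutoff R)| ≤ C * M / R ^ 2 := by
  obtain ⟨L, hL0, hL⟩ := exists_cutoff_bound d
  set D := a * convConst d γ B
  have hD0 : 0 ≤ D := mul_nonneg ha (convConst_nonneg hB)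
  refine ⟨(d * d + 2 * (d * d)) * (D * (L * B)), by positivity, fun R hR g u M hM hg hu => ?_⟩
  have key : ∀ (K ψ : Vel d → ℝ) (E : ℝ), 0 ≤ E →
      (∀ v, |K v * ψ v| ≤ E * L * (‖v‖ ^ 2 / R ^ 2)) →
      |∫ v, K v * (u v * ψ v)| ≤ E * (L * B) * M / R ^ 2 := by
    intro K ψ E hE hKψ
    calc |∫ v, K v * (u v * ψ v)| ≤ ∫ v, E * L * M / R ^ 2 * (‖v‖ ^ 2 * |g v|) := by
          rw [← Real.norm_eq_abs]
          refine norm_integral_le_of_norm_le (hg.int2_abs.const_mul _)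
            (Eventually.of_forall fun v => ?_)
          rw [Real.norm_eq_abs, show K v * (u v * ψ v) = (K v * ψ v) * u v by ring, abs_mul]
          calc |K v * ψ v| * |u v| ≤ (E * L * (‖v‖ ^ 2 / R ^ 2)) * (M * |g v|) :=
                mul_le_mul (hKψ v) (hu v) (abs_nonneg _) (by positivity)
            _ = _ := by ring
      _ = E * L * M / R ^ 2 * ∫ v, ‖v‖ ^ 2 * |g v| := integral_const_mul _ _
      _ ≤ E * L * M / R ^ 2 * B := mul_le_mul_of_nonneg_left hg.energy (by positivity)
      _ = _ := by ring
  have k1 : ∀ i j, |∫ v, diffusion a γ g v i j * (u v * pd j (pd i (cutoff R)) v)| ≤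
      D * (L * B) * M / R ^ 2 := by
    intro i j
    refine key (fun v => diffusion a γ g v i j) _ D hD0 fun v => ?_
    rw [abs_mul]
    calc |diffusion a γ g v i j| * |pd j (pd i (cutoff R)) v| ≤
          (D * (1 + ‖v‖) ^ 2) * |pd j (pd i (cutoff R)) v| :=
          mul_le_mul_of_nonneg_right (abs_diffusion_le hp ha hg v i j) (abs_nonneg _)
      _ = D * (|pd j (pd i (cutoff R)) v| * (1 + ‖v‖) ^ 2) := by ring
      _ ≤ D * (L * (‖v‖ ^ 2 / R ^ 2)) := mul_le_mul_of_nonneg_left ((hL R hR v).1 i j) hD0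
      _ = _ := by ring
  have k2 : ∀ j, |∫ v, drift a γ g j v * (u v * pd j (cutoff R) v)| ≤
      d * (D * (L * B) * M / R ^ 2) := by
    intro j
    refine (key (fun v => drift a γ g j v) _ (d * D) (by positivity) fun v => ?_).trans
      (le_of_eq (by ring))
    rw [abs_mul]
    calc |drift a γ g j v| * |pd j (cutoff R) v| ≤
          (d * a * convConst d γ B * (1 + ‖v‖)) * |pd j (cutoff R) v| :=
          mul_le_mul_of_nonneg_right (abs_drift_le hp ha hg v j) (abs_nonneg _)
      _ = d * D * (|pd j (cutoff R) v| * (1 + ‖v‖)) := by ring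
      _ ≤ d * D * (L * (‖v‖ ^ 2 / R ^ 2)) :=
          mul_le_mul_of_nonneg_left ((hL R hR v).2.1 j) (by positivity)
      _ = _ := by ring
  have s1 : |∑ i, ∑ j, ∫ v, diffusion a γ g v i j * (u v * pd j (pd i (cutoff R)) v)| ≤
      ∑ _i : Fin d, ∑ _j : Fin d, D * (L * B) * M / R ^ 2 :=
    (Finset.abs_sum_le_sum_abs _ _).trans (Finset.sum_le_sum fun i _ =>
      (Finset.abs_sum_le_sum_abs _ _).trans (Finset.sum_le_sum fun j _ => k1 i j))
  have s2 : |∑ j, ∫ v, drift a γ g j v * (u v * pd j (cutoff R) v)| ≤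
      ∑ _j : Fin d, d * (D * (L * B) * M / R ^ 2) :=
    (Finset.abs_sum_le_sum_abs _ _).trans (Finset.sum_le_sum fun j _ => k2 j)
  simp only [Finset.sum_const, Finset.card_univ, Fintype.card_fin, nsmul_eq_mul] at s1 s2
  unfold testFlux
  refine (abs_add_le _ _).trans ?_
  rw [abs_mul, abs_two]
  refine (add_le_add s1 (mul_le_mul_of_nonneg_left s2 zero_le_two)).trans (le_of_eq ?_)
  ring

variable {S : EReal} {f : ℝ → Vel d → ℝ}

/-- The identity function as a renormalization. -/
theorem IsClassicalSolution.hasDerivAt_integral_mul_test (hp : Params d γ)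
    (hf : IsClassicalSolution a γ S f) {t : ℝ} (ht : 0 < t) (hS : (t : EReal) < S)
    {χ : Vel d → ℝ} (hχ : ContDiff ℝ 2 χ) (hc : HasCompactSupport χ) :
    HasDerivAt (fun t => ∫ v, χ v * f t v) (testFlux a γ (f t) (f t) χ) t := by
  have := hf.hasDerivAt_integral_test hp ht hS (k := id) (k' := fun _ => 1) (k'' := fun _ => 0)
    (fun x _ => hasDerivAt_id x) (fun x _ => hasDerivAt_const x 1) continuousOn_const hχ hc
  simpa [dissipation] using this

/-- **Conservation of mass.** -/
theorem IsClassicalSolution.mass_eq (hp : Params d γ) (ha : 0 ≤ a)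
    (hf : IsClassicalSolution a γ S f) {t₁ t₂ : ℝ} (h1 : 0 < t₁) (h12 : t₁ ≤ t₂)
    (h2 : (t₂ : EReal) < S) : mass (f t₂) = mass (f t₁) := by
  obtain ⟨B, hB⟩ := hf.dens h1 h2
  have hB0 : 0 ≤ B := (hB t₁ ⟨le_rfl, h12⟩).nonneg_const
  obtain ⟨C, hC0, hC⟩ := exists_testFlux_bound hp ha hB0
  have hpos : ∀ t ∈ Set.Icc t₁ t₂, 0 < t ∧ (t : EReal) < S := fun t ht =>
    ⟨h1.trans_le ht.1, coe_lt_of_le ht.2 h2⟩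
  have hbound : ∀ n : ℕ, |(∫ v, cutoff ((n : ℝ) + 1) v * f t₂ v)
      - ∫ v, cutoff ((n : ℝ) + 1) v * f t₁ v| ≤ C * 1 / ((n : ℝ) + 1) ^ 2 * (t₂ - t₁) := by
    intro n
    have hn : (1 : ℝ) ≤ (n : ℝ) + 1 := by linarith [Nat.cast_nonneg (α := ℝ) n]
    have := Convex.norm_image_sub_le_of_norm_hasDerivWithin_le
      (f := fun t => ∫ v, cutoff ((n : ℝ) + 1) v * f t v)
      (f' := fun t => testFlux a γ (f t) (f t) (cutoff ((n : ℝ) + 1)))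
      (C := C * 1 / ((n : ℝ) + 1) ^ 2) (s := Set.Icc t₁ t₂) (x := t₁) (y := t₂)
      (fun t ht => (hf.hasDerivAt_integral_mul_test hp (hpos t ht).1 (hpos t ht).2
        (contDiff_cutoff _) (hasCompactSupport_cutoff (by linarith))).hasDerivWithinAt)
      (fun t ht => hC _ hn (f t) (f t) 1 zero_le_one (hB t ht) fun v => by rw [one_mul])
      (convex_Icc _ _) ⟨le_rfl, h12⟩ ⟨h12, le_rfl⟩
    simpa [abs_of_nonneg (sub_nonneg.2 h12)] using this
  have l1 := tendsto_integral_cutoff_mul (hB t₂ ⟨h12, le_rfl⟩).int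
  have l2 := tendsto_integral_cutoff_mul (hB t₁ ⟨le_rfl, h12⟩).int
  have l3 : Tendsto (fun n : ℕ => C * 1 / ((n : ℝ) + 1) ^ 2 * (t₂ - t₁)) atTop (𝓝 0) := by
    have : Tendsto (fun n : ℕ => (1 / ((n : ℝ) + 1)) ^ 2) atTop (𝓝 (0 ^ 2)) :=
      tendsto_one_div_add_atTop_nhds_zero_nat.pow 2
    have := (this.const_mul C).mul_const (t₂ - t₁)
    simpa [div_eq_mul_inv] using this
  have := le_of_tendsto_of_tendsto (l1.sub l2).abs l3 (Eventually.of_forall hbound)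
  have h0 := abs_nonpos_iff.1 this
  exact sub_eq_zero.1 h0

end

end

section

/-! ### Conservation of energy -/

variable {d : ℕ}

/-- The truncated energy weight `|v|² χ(v / R)`. -/
def quadTest (R : ℝ) (v : Vel d) : ℝ := ‖v‖ ^ 2 * cutoff R v

theorem contDiff_quadTest (R : ℝ) {n : ℕ} : ContDiff ℝ n (quadTest R : Vel d → ℝ) :=
  (contDiff_norm_sq ℝ).mul (contDiff_cutoff R)

theorem hasCompactSupport_quadTest {R : ℝ} (hR : 0 < R) :
    HasCompactSupport (quadTest R : Vel d → ℝ) := (hasCompactSupport_cutoff hR).mul_left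

theorem quadTest_eq_smul {R : ℝ} (hR : 0 < R) :
    (quadTest R : Vel d → ℝ) = fun v => R ^ 2 * quadTest 1 (R⁻¹ • v) := by
  funext v
  unfold quadTest cutoff
  rw [norm_smul, norm_inv, Real.norm_of_nonneg hR.le, inv_one, one_smul]
  field_simp

theorem pd_norm_sq (j : Fin d) : pd j (fun v : Vel d => ‖v‖ ^ 2) = fun v => 2 * v j := by
  funext v
  unfold pd
  rw [(hasStrictFDerivAt_norm_sq v).hasFDerivAt.fderiv]
  simp [EuclideanSpace.inner_single_right]

theorem pd_two_mul_coord (i j : Fin d) :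
    pd j (fun v : Vel d => 2 * v i) = fun _ => if i = j then 2 else 0 := by
  funext v
  rw [pd_const_mul (contDiff_coord i), pd, (hasFDerivAt_coord i v).fderiv]
  simp

theorem quadTest_eventuallyEq {R : ℝ} (hR : 0 < R) {v : Vel d} (hv : ‖v‖ < R) :
    (quadTest R : Vel d → ℝ) =ᶠ[𝓝 v] fun v => ‖v‖ ^ 2 := by
  filter_upwards [Metric.isOpen_ball.mem_nhds (mem_ball_zero_iff.2 hv)] with x hx
  unfold quadTest
  rw [cutoff_eq_one hR (mem_ball_zero_iff.1 hx).le, mul_one]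

theorem pd_quadTest {R : ℝ} (hR : 0 < R) {v : Vel d} (hv : ‖v‖ < R) (j : Fin d) :
    pd j (quadTest R) v = 2 * v j := by
  have := (pd_congr (quadTest_eventuallyEq hR hv) j).self_of_nhds
  rwa [pd_norm_sq] at this

theorem pd_pd_quadTest {R : ℝ} (hR : 0 < R) {v : Vel d} (hv : ‖v‖ < R) (i j : Fin d) :
    pd j (pd i (quadTest R)) v = if i = j then 2 else 0 := by
  have h1 := pd_congr (quadTest_eventuallyEq hR hv) i
  rw [pd_norm_sq] at h1
  have := (pd_congr h1 j).self_of_nhds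
  rwa [pd_two_mul_coord] at this

/-- Second derivatives of the truncated energy weights are bounded uniformly in `R`. -/
theorem exists_quadTest_bound (d : ℕ) : ∃ M : ℝ, 0 ≤ M ∧ ∀ R : ℝ, 0 < R →
    (∀ (i j : Fin d) (v : Vel d), |pd j (pd i (quadTest R)) v| ≤ M) ∧
    (∀ (j : Fin d) (v y : Vel d), |pd j (quadTest R) v - pd j (quadTest R) y| ≤ M * ‖v - y‖) := by
  have hb : ContDiff ℝ 2 (quadTest 1 : Vel d → ℝ) := contDiff_quadTest 1
  have hb1 : ContDiff ℝ 1 (quadTest 1 : Vel d → ℝ) := contDiff_quadTest 1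
  have hcb : HasCompactSupport (quadTest 1 : Vel d → ℝ) := hasCompactSupport_quadTest zero_lt_one
  have h2 : ∀ i j : Fin d, ∃ C, ∀ v : Vel d, ‖pd j (pd i (quadTest 1)) v‖ ≤ C := fun i j =>
    (hasCompactSupport_pd (hasCompactSupport_pd hcb i) j).exists_bound_of_continuous
      (continuous_pd (contDiff_pd hb i) j)
  have h1 : ∀ j : Fin d, ∃ C, LipschitzWith C (pd j (quadTest 1)) := fun j =>
    (contDiff_pd hb j).lipschitzWith_of_hasCompactSupport (hasCompactSupport_pd hcb j) (by simp)
  choose C2 hC2 using h2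
  choose C1 hC1 using h1
  have e3 : 0 ≤ ∑ j, (C1 j : ℝ) := Finset.sum_nonneg fun j _ => (C1 j).2
  have e4 : 0 ≤ ∑ i, ∑ j, |C2 i j| :=
    Finset.sum_nonneg fun _ _ => Finset.sum_nonneg fun _ _ => abs_nonneg _
  refine ⟨∑ i, ∑ j, |C2 i j| + ∑ j, (C1 j : ℝ), add_nonneg e4 e3, fun R hR => ⟨?_, ?_⟩⟩
  · intro i j v
    have e1 : |C2 i j| ≤ ∑ j, |C2 i j| :=
      Finset.single_le_sum (f := fun j => |C2 i j|) (fun _ _ => abs_nonneg _) (Finset.mem_univ j)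
    have e2 : ∑ j, |C2 i j| ≤ ∑ i, ∑ j, |C2 i j| :=
      Finset.single_le_sum (f := fun i => ∑ j, |C2 i j|)
        (fun _ _ => Finset.sum_nonneg fun _ _ => abs_nonneg _) (Finset.mem_univ i)
    have e5 := (hC2 i j (R⁻¹ • v)).trans (le_abs_self _)
    rw [Real.norm_eq_abs] at e5
    have e6 : (pd i fun v => R ^ 2 * quadTest 1 (R⁻¹ • v)) =
        fun v : Vel d => R ^ 2 * pd i (fun v => quadTest 1 (R⁻¹ • v)) v :=
      funext fun v => pd_const_mul (hb1.comp (contDiff_const_smul _)) _ i v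
    rw [quadTest_eq_smul hR, e6, pd_const_mul (u := fun v => pd i (fun v => quadTest 1 (R⁻¹ • v)) v)
        (contDiff_pd (hb.comp (contDiff_const_smul _)) i),
      pd_pd_comp_smul hb, ← mul_assoc, ← mul_pow, mul_inv_cancel₀ hR.ne', one_pow, one_mul]
    linarith
  · intro j v y
    have e1 : (C1 j : ℝ) ≤ ∑ j, (C1 j : ℝ) :=
      Finset.single_le_sum (f := fun j => (C1 j : ℝ)) (fun j _ => (C1 j).2) (Finset.mem_univ j)
    have e5 : ∀ v : Vel d, pd j (quadTest R) v = R * pd j (quadTest 1) (R⁻¹ • v) := fun v => by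
      rw [quadTest_eq_smul hR, pd_const_mul (u := fun v => quadTest 1 (R⁻¹ • v))
        (hb1.comp (contDiff_const_smul _)), pd_comp_smul hb1,
        ← mul_assoc, sq, mul_assoc R R, mul_inv_cancel₀ hR.ne', mul_one]
    have e6 := (hC1 j).dist_le_mul (R⁻¹ • v) (R⁻¹ • y)
    rw [Real.dist_eq, dist_eq_norm, ← smul_sub, norm_smul, norm_inv, Real.norm_of_nonneg hR.le]
      at e6
    rw [e5, e5, ← mul_sub, abs_mul, abs_of_pos hR]
    calc R * |pd j (quadTest 1) (R⁻¹ • v) - pd j (quadTest 1) (R⁻¹ • y)|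
        ≤ R * (C1 j * (R⁻¹ * ‖v - y‖)) := mul_le_mul_of_nonneg_left e6 hR.le
      _ = C1 j * ‖v - y‖ := by field_simp
      _ ≤ _ := mul_le_mul_of_nonneg_right (by linarith) (norm_nonneg _)

section
variable {a γ B : ℝ} {g : Vel d → ℝ}

theorem integral_conv_mul_eq_prod {σ : ℕ} {k : Vel d → ℝ} (hp : Params d γ) (hσ : σ ≤ 2)
    (hk : KernelBound γ σ k) (hg : Dens B g) {ψ : Vel d → ℝ} (hψ : Integrable ψ)
    (hψ' : Integrable fun v => (1 + ‖v‖) ^ σ * ψ v) :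
    ∫ v, conv k g v * ψ v =
      ∫ p : Vel d × Vel d, k (p.1 - p.2) * g p.2 * ψ p.1 ∂(volume.prod volume) := by
  rw [integral_prod _ (integrable_prod_kernel hp.dim hp.pos hσ hk hg hψ hψ')]
  refine integral_congr_ae (Eventually.of_forall fun v => ?_)
  simp only [conv_eq]
  rw [integral_mul_const]

/-- The interaction of two particles in the weak form tested with `φ`, before symmetrization. -/
def pairFlux (γ : ℝ) (φ : Vel d → ℝ) (v y : Vel d) : ℝ :=
  (∑ i, ∑ j, kernel γ (v - y) i j * pd j (pd i φ) v)
    - 2 * ((d : ℝ) - 1) * ∑ j, vecKernel γ j (v - y) * pd j φ v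

theorem Dens.integrable_mul_bounded (hg : Dens B g) {ψ : Vel d → ℝ} (hψ : Continuous ψ)
    (hc : HasCompactSupport ψ) : Integrable fun v => g v * ψ v := by
  obtain ⟨C, hC⟩ := hc.exists_bound_of_continuous hψ
  exact hg.int.mul_bdd hψ.aestronglyMeasurable (Eventually.of_forall hC)

theorem Dens.integrable_weight_mul_bounded (hg : Dens B g) {ψ : Vel d → ℝ} (hψ : Continuous ψ)
    (hc : HasCompactSupport ψ) (σ : ℕ) : Integrable fun v => (1 + ‖v‖) ^ σ * (g v * ψ v) := by
  have := hg.integrable_mul_bounded (ψ := fun v => (1 + ‖v‖) ^ σ * ψ v)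
    (by fun_prop) hc.mul_left
  refine this.congr (Eventually.of_forall fun v => ?_)
  simp only []; ring

/-- The weak form, as a double integral over pairs of particles. -/
theorem testFlux_eq_prod (hp : Params d γ) (hg : Dens B g) {φ : Vel d → ℝ}
    (hφ : ContDiff ℝ 2 φ) (hc : HasCompactSupport φ) :
    Integrable (fun p : Vel d × Vel d => g p.1 * g p.2 * pairFlux γ φ p.1 p.2)
      (volume.prod volume) ∧
    testFlux a γ g g φ = a * ∫ p : Vel d × Vel d, g p.1 * g p.2 * pairFlux γ φ p.1 p.2
      ∂(volume.prod volume) := by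
  have hφ1 : ContDiff ℝ 1 φ := hφ.of_le (by norm_num)
  have c2 : ∀ i j, Continuous (pd j (pd i φ)) := fun i j => continuous_pd (contDiff_pd hφ i) j
  have s2 : ∀ i j, HasCompactSupport (pd j (pd i φ)) := fun i j =>
    hasCompactSupport_pd (hasCompactSupport_pd hc i) j
  have c1 : ∀ j, Continuous (pd j φ) := fun j => continuous_pd hφ1 j
  have s1 : ∀ j, HasCompactSupport (pd j φ) := fun j => hasCompactSupport_pd hc j
  have i2 : ∀ i j, Integrable (fun p : Vel d × Vel d => kernel γ (p.1 - p.2) i j * g p.2 *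
      (g p.1 * pd j (pd i φ) p.1)) (volume.prod volume) := fun i j =>
    integrable_prod_kernel hp.dim hp.pos le_rfl (kernelBound_kernel hp.mem i j) hg
      (hg.integrable_mul_bounded (c2 i j) (s2 i j))
      (hg.integrable_weight_mul_bounded (c2 i j) (s2 i j) 2)
  have i1 : ∀ j, Integrable (fun p : Vel d × Vel d => vecKernel γ j (p.1 - p.2) * g p.2 *
      (g p.1 * pd j φ p.1)) (volume.prod volume) := fun j =>
    integrable_prod_kernel hp.dim hp.pos (by norm_num) (kernelBound_vecKernel hp.mem j) hg
      (hg.integrable_mul_bounded (c1 j) (s1 j))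
      (hg.integrable_weight_mul_bounded (c1 j) (s1 j) 1)
  have e2 : ∀ i j, ∫ v, diffusion a γ g v i j * (g v * pd j (pd i φ) v) =
      a * ∫ p : Vel d × Vel d, kernel γ (p.1 - p.2) i j * g p.2 * (g p.1 * pd j (pd i φ) p.1)
        ∂(volume.prod volume) := fun i j => by
    simp only [diffusion_eq, mul_assoc a]
    rw [integral_const_mul, integral_conv_mul_eq_prod hp le_rfl (kernelBound_kernel hp.mem i j) hg
      (hg.integrable_mul_bounded (c2 i j) (s2 i j))
      (hg.integrable_weight_mul_bounded (c2 i j) (s2 i j) 2)]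
  have e1 : ∀ j, ∫ v, drift a γ g j v * (g v * pd j φ v) =
      -(((d : ℝ) - 1) * a) * ∫ p : Vel d × Vel d, vecKernel γ j (p.1 - p.2) * g p.2 *
        (g p.1 * pd j φ p.1) ∂(volume.prod volume) := fun j => by
    simp only [drift, mul_assoc (-(((d : ℝ) - 1) * a))]
    rw [integral_const_mul, integral_conv_mul_eq_prod hp (by norm_num)
      (kernelBound_vecKernel hp.mem j) hg
      (hg.integrable_mul_bounded (c1 j) (s1 j))
      (hg.integrable_weight_mul_bounded (c1 j) (s1 j) 1)]
  have I2 := integrable_finsetSum Finset.univ fun i _ =>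
    integrable_finsetSum Finset.univ fun j _ => i2 i j
  have I1 := integrable_finsetSum Finset.univ fun j _ => i1 j
  have hpt : ∀ p : Vel d × Vel d, g p.1 * g p.2 * pairFlux γ φ p.1 p.2 =
      (∑ i, ∑ j, kernel γ (p.1 - p.2) i j * g p.2 * (g p.1 * pd j (pd i φ) p.1)) -
      2 * ((d : ℝ) - 1) * ∑ j, vecKernel γ j (p.1 - p.2) * g p.2 * (g p.1 * pd j φ p.1) := by
    intro p
    unfold pairFlux
    simp only [mul_sub, Finset.mul_sum]
    congr 1
    · exact Finset.sum_congr rfl fun i _ => Finset.sum_congr rfl fun j _ => by ring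
    · exact Finset.sum_congr rfl fun i _ => by ring
  refine ⟨(I2.sub (I1.const_mul (2 * ((d : ℝ) - 1)))).congr
    (Eventually.of_forall fun p => (hpt p).symm), ?_⟩
  simp only [hpt]
  rw [integral_sub I2 (I1.const_mul _), integral_const_mul, integral_finsetSum _ fun i _ =>
    integrable_finsetSum _ fun j _ => i2 i j, integral_finsetSum _ fun j _ => i1 j]
  simp only [integral_finsetSum _ fun j _ => i2 _ j]
  unfold testFlux
  simp only [e1, e2, ← Finset.mul_sum]
  ring

theorem ae_prod_ne (hd : 2 ≤ d) :
    ∀ᵐ p : Vel d × Vel d ∂(volume.prod volume), p.1 ≠ p.2 := by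
  have : Nontrivial (Vel d) := by
    have : Nonempty (Fin d) := ⟨⟨0, by omega⟩⟩
    infer_instance
  rw [ae_iff]
  have hm : MeasurableSet {p : Vel d × Vel d | ¬ p.1 ≠ p.2} := by
    simp only [not_not]
    exact measurableSet_eq_fun measurable_fst measurable_snd
  rw [Measure.measure_prod_null hm]
  refine Eventually.of_forall fun v => ?_
  have : Prod.mk v ⁻¹' {p : Vel d × Vel d | ¬ p.1 ≠ p.2} = {v} := by
    ext y; simp [eq_comm]
  simp [this]

theorem kernel_neg (γ : ℝ) (z : Vel d) (i j : Fin d) : kernel γ (-z) i j = kernel γ z i j := by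
  unfold kernel
  simp [norm_neg, neg_div]

theorem vecKernel_neg (γ : ℝ) (z : Vel d) (j : Fin d) : vecKernel γ j (-z) = -vecKernel γ j z := by
  unfold vecKernel
  simp [norm_neg]

/-- Symmetrization gains a difference of gradients, which compensates the growth of the vector kernel
and gives the cancellation for quadratic weights. -/
theorem pairFlux_add_swap (γ : ℝ) (φ : Vel d → ℝ) (v y : Vel d) :
    pairFlux γ φ v y + pairFlux γ φ y v =
      (∑ i, ∑ j, kernel γ (v - y) i j * (pd j (pd i φ) v + pd j (pd i φ) y))
      - 2 * ((d : ℝ) - 1) * ∑ j, vecKernel γ j (v - y) * (pd j φ v - pd j φ y) := by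
  unfold pairFlux
  rw [← neg_sub v y]
  simp only [kernel_neg, vecKernel_neg, mul_add, mul_sub, Finset.sum_add_distrib,
    Finset.sum_sub_distrib, neg_mul, Finset.sum_neg_distrib]
  ring

/-- Two particles conserve their energy: for the weight `|v|²` the symmetrized flux vanishes. -/
theorem pairFlux_quadTest_eq_zero {R : ℝ} (hR : 0 < R) {v y : Vel d} (hne : v ≠ y) (hv : ‖v‖ < R)
    (hy : ‖y‖ < R) :
    pairFlux γ (quadTest R) v y + pairFlux γ (quadTest R) y v = 0 := by
  rw [pairFlux_add_swap]
  simp only [pd_quadTest hR hv, pd_quadTest hR hy, pd_pd_quadTest hR hv, pd_pd_quadTest hR hy]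
  have hz : v - y ≠ 0 := sub_ne_zero.2 hne
  simp only [kernel_eq γ hz]
  have e1 : ∀ i : Fin d, ∑ j, ((if i = j then ‖v - y‖ ^ 2 else 0) - (v - y) i * (v - y) j) *
      ‖v - y‖ ^ γ * ((if i = j then (2 : ℝ) else 0) + if i = j then 2 else 0) =
      4 * ‖v - y‖ ^ γ * (‖v - y‖ ^ 2 - (v - y) i ^ 2) := by
    intro i
    rw [Finset.sum_eq_single i]
    · simp; ring
    · intro j _ hj; simp [Ne.symm hj]
    · simp
  have e2 : ∑ j, vecKernel γ j (v - y) * (2 * v j - 2 * y j) =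
      2 * ‖v - y‖ ^ γ * ‖v - y‖ ^ 2 := by
    rw [norm_sq_eq_sum, Finset.mul_sum]
    refine Finset.sum_congr rfl fun j _ => ?_
    simp only [vecKernel, PiLp.sub_apply]
    ring
  rw [Finset.sum_congr rfl fun i _ => e1 i, e2, ← Finset.mul_sum, Finset.sum_sub_distrib,
    ← norm_sq_eq_sum]
  simp
  ring

theorem exists_pairFlux_quadTest_bound (hp : Params d γ) : ∃ C : ℝ, 0 ≤ C ∧ ∀ R : ℝ, 0 < R →
    ∀ v y : Vel d, v ≠ y → |pairFlux γ (quadTest R) v y + pairFlux γ (quadTest R) y v| ≤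
      C * ((1 + ‖v‖ ^ 2) * (1 + ‖y‖ ^ 2)) := by
  obtain ⟨M, hM0, hM⟩ := exists_quadTest_bound d
  have hd : (2 : ℝ) ≤ d := by exact_mod_cast hp.dim
  refine ⟨(d * d * (4 * M) + 2 * d * (d * M)) * 4, by positivity, fun R hR v y hne => ?_⟩
  have hz : v - y ≠ 0 := sub_ne_zero.2 hne
  set z := v - y with hzd
  have hq := norm_sq_mul_rpow_le hp.mem z
  have hz0 := norm_nonneg z
  have hzp := Real.rpow_nonneg hz0 γ
  have k2 : ∀ i j, |kernel γ z i j * (pd j (pd i (quadTest R)) v + pd j (pd i (quadTest R)) y)| ≤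
      4 * M * (1 + ‖z‖) ^ 2 := by
    intro i j
    rw [kernel_eq γ hz, abs_mul, abs_mul, abs_of_nonneg hzp]
    have h1 := mul_le_mul_of_nonneg_right (abs_sub_coord_mul_le z i j) hzp
    have h2 : |pd j (pd i (quadTest R)) v + pd j (pd i (quadTest R)) y| ≤ 2 * M :=
      (abs_add_le _ _).trans (by linarith [(hM R hR).1 i j v, (hM R hR).1 i j y])
    calc _ ≤ (2 * (1 + ‖z‖) ^ 2) * (2 * M) :=
          mul_le_mul (by linarith) h2 (abs_nonneg _) (by positivity)
      _ = _ := by ring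
  have k1 : ∀ j, |vecKernel γ j z * (pd j (quadTest R) v - pd j (quadTest R) y)| ≤
      M * (1 + ‖z‖) ^ 2 := by
    intro j
    unfold vecKernel
    rw [abs_mul, abs_mul, abs_of_nonneg hzp]
    calc _ ≤ (‖z‖ ^ γ * ‖z‖) * (M * ‖z‖) :=
          mul_le_mul (mul_le_mul_of_nonneg_left (abs_coord_le z j) hzp) ((hM R hR).2 j v y)
            (abs_nonneg _) (by positivity)
      _ = M * (‖z‖ ^ 2 * ‖z‖ ^ γ) := by ring
      _ ≤ _ := mul_le_mul_of_nonneg_left hq hM0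
  have s2 : |∑ i, ∑ j, kernel γ z i j *
      (pd j (pd i (quadTest R)) v + pd j (pd i (quadTest R)) y)| ≤
      ∑ _i : Fin d, ∑ _j : Fin d, 4 * M * (1 + ‖z‖) ^ 2 :=
    (Finset.abs_sum_le_sum_abs _ _).trans (Finset.sum_le_sum fun i _ =>
      (Finset.abs_sum_le_sum_abs _ _).trans (Finset.sum_le_sum fun j _ => k2 i j))
  have s1 : |∑ j, vecKernel γ j z * (pd j (quadTest R) v - pd j (quadTest R) y)| ≤
      ∑ _j : Fin d, M * (1 + ‖z‖) ^ 2 :=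
    (Finset.abs_sum_le_sum_abs _ _).trans (Finset.sum_le_sum fun j _ => k1 j)
  simp only [Finset.sum_const, Finset.card_univ, Fintype.card_fin, nsmul_eq_mul] at s1 s2
  have hw : (1 + ‖z‖) ^ 2 ≤ 4 * ((1 + ‖v‖ ^ 2) * (1 + ‖y‖ ^ 2)) := by
    have h1 := one_add_norm_sub_pow_le (le_refl 2) v y
    have h2 : (1 + ‖v‖) ^ 2 ≤ 2 * (1 + ‖v‖ ^ 2) := by nlinarith [sq_nonneg (1 - ‖v‖)]
    have h3 := mul_le_mul_of_nonneg_right h2 (by positivity : 0 ≤ 2 * (1 + ‖y‖ ^ 2))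
    linarith
  rw [pairFlux_add_swap, sub_eq_add_neg]
  refine (abs_add_le _ _).trans ?_
  rw [abs_neg, abs_mul, abs_of_nonneg (by linarith : (0 : ℝ) ≤ 2 * (d - 1))]
  calc _ ≤ d * (d * (4 * M * (1 + ‖z‖) ^ 2)) + 2 * (d - 1) * (d * (M * (1 + ‖z‖) ^ 2)) :=
        add_le_add s2 (mul_le_mul_of_nonneg_left s1 (by linarith))
    _ ≤ d * (d * (4 * M * (1 + ‖z‖) ^ 2)) + 2 * d * (d * (M * (1 + ‖z‖) ^ 2)) := by
        gcongr; linarith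
    _ = (d * d * (4 * M) + 2 * d * (d * M)) * (1 + ‖z‖) ^ 2 := by ring
    _ ≤ (d * d * (4 * M) + 2 * d * (d * M)) * (4 * ((1 + ‖v‖ ^ 2) * (1 + ‖y‖ ^ 2))) :=
        mul_le_mul_of_nonneg_left hw (by positivity)
    _ = _ := by ring

/-- The mass and energy of a density outside the ball of radius `R`. -/
def tail (R : ℝ) (g : Vel d → ℝ) : ℝ :=
  ∫ v, (Metric.ball (0 : Vel d) R)ᶜ.indicator (fun v => (1 + ‖v‖ ^ 2) * |g v|) v

theorem Dens.integrable_tail (hg : Dens B g) (R : ℝ) :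
    Integrable fun v => (Metric.ball (0 : Vel d) R)ᶜ.indicator (fun v => (1 + ‖v‖ ^ 2) * |g v|) v :=
  hg.integrable_weight.indicator measurableSet_ball.compl

theorem Dens.tail_le (hg : Dens B g) (R : ℝ) : tail R g ≤ 2 * B := by
  refine le_trans (integral_mono (hg.integrable_tail R) hg.integrable_weight fun v => ?_)
    hg.integral_weight_le
  exact Set.indicator_le_self' (fun _ _ => by positivity) v

theorem Dens.tendsto_tail (hg : Dens B g) :
    Tendsto (fun n : ℕ => tail ((n : ℝ) + 1) g) atTop (𝓝 0) := by
  have := tendsto_integral_of_dominated_convergence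
    (F := fun (n : ℕ) v => (Metric.ball (0 : Vel d) ((n : ℝ) + 1))ᶜ.indicator
      (fun v => (1 + ‖v‖ ^ 2) * |g v|) v) (f := fun _ => (0 : ℝ))
    (fun v => (1 + ‖v‖ ^ 2) * |g v|) (fun n => (hg.integrable_tail _).aestronglyMeasurable)
    hg.integrable_weight (fun n => Eventually.of_forall fun v => ?_)
    (Eventually.of_forall fun v => ?_)
  · simpa [tail] using this
  · rw [Real.norm_of_nonneg (Set.indicator_nonneg (fun _ _ => by positivity) _)]
    exact Set.indicator_le_self' (fun _ _ => by positivity) v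
  · obtain ⟨N, hN⟩ := exists_nat_ge ‖v‖
    refine tendsto_const_nhds.congr' ?_
    filter_upwards [eventually_ge_atTop N] with n hn
    have : (N : ℝ) ≤ n := Nat.cast_le.2 hn
    rw [Set.indicator_of_notMem]
    simp
    linarith

/-- The truncated energy changes only through the tails. -/
theorem exists_testFlux_quadTest_bound (hp : Params d γ) (ha : 0 ≤ a) :
    ∃ C : ℝ, 0 ≤ C ∧ ∀ R : ℝ, 0 < R → ∀ (g : Vel d → ℝ) (B : ℝ), Dens B g →
      |testFlux a γ g g (quadTest R)| ≤ C * B * tail R g := by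
  obtain ⟨C, hC0, hC⟩ := exists_pairFlux_quadTest_bound hp
  refine ⟨2 * a * C, by positivity, fun R hR g B hg => ?_⟩
  obtain ⟨hi, he⟩ := testFlux_eq_prod (a := a) hp hg (contDiff_quadTest R (n := 2))
    (hasCompactSupport_quadTest hR)
  set F : Vel d × Vel d → ℝ := fun p => g p.1 * g p.2 * pairFlux γ (quadTest R) p.1 p.2 with hF
  set T : Vel d → ℝ := fun v =>
    (Metric.ball (0 : Vel d) R)ᶜ.indicator (fun v => (1 + ‖v‖ ^ 2) * |g v|) v with hT
  set W : Vel d → ℝ := fun v => (1 + ‖v‖ ^ 2) * |g v| with hW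
  have hTi : Integrable T := hg.integrable_tail R
  have hWi : Integrable W := hg.integrable_weight
  have hsym : 2 * ∫ p, F p ∂(volume.prod volume) =
      ∫ p, (F p + F p.swap) ∂(volume.prod volume) := by
    have e1 : ∫ p, (F p + F p.swap) ∂(volume.prod volume) =
        (∫ p, F p ∂(volume.prod volume)) + ∫ p : Vel d × Vel d, F p.swap ∂(volume.prod volume) :=
      integral_add hi hi.swap
    rw [e1, integral_prod_swap (f := F)]
    ring
  have hW0 : ∀ v, 0 ≤ W v := fun v => by rw [hW]; positivity
  have hT0 : ∀ v, 0 ≤ T v := fun v => Set.indicator_nonneg (fun _ _ => by positivity) v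
  have hbound : |∫ p, (F p + F p.swap) ∂(volume.prod volume)| ≤
      ∫ p : Vel d × Vel d, C * (T p.1 * W p.2 + W p.1 * T p.2) ∂(volume.prod volume) := by
    rw [← Real.norm_eq_abs]
    refine norm_integral_le_of_norm_le (((hTi.mul_prod hWi).add (hWi.mul_prod hTi)).const_mul C) ?_
    filter_upwards [ae_prod_ne hp.dim] with p hne
    have e : F p + F p.swap = g p.1 * g p.2 *
        (pairFlux γ (quadTest R) p.1 p.2 + pairFlux γ (quadTest R) p.2 p.1) := by
      simp only [hF, Prod.fst_swap, Prod.snd_swap]; ring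
    rw [e, Real.norm_eq_abs, abs_mul, abs_mul]
    by_cases h1 : ‖p.1‖ < R
    · by_cases h2 : ‖p.2‖ < R
      · rw [pairFlux_quadTest_eq_zero hR hne h1 h2, abs_zero, mul_zero]
        have := mul_nonneg (hT0 p.1) (hW0 p.2)
        have := mul_nonneg (hW0 p.1) (hT0 p.2)
        positivity
      · have e2 : T p.2 = W p.2 := Set.indicator_of_mem (by simpa using h2) _
        have := mul_nonneg (hT0 p.1) (hW0 p.2)
        calc _ ≤ |g p.1| * |g p.2| * (C * ((1 + ‖p.1‖ ^ 2) * (1 + ‖p.2‖ ^ 2))) :=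
              mul_le_mul_of_nonneg_left (hC R hR _ _ hne) (by positivity)
          _ = C * (W p.1 * W p.2) := by simp only [hW]; ring
          _ ≤ _ := by
              rw [e2]; exact mul_le_mul_of_nonneg_left (by linarith) hC0
    · have e2 : T p.1 = W p.1 := Set.indicator_of_mem (by simpa using h1) _
      have := mul_nonneg (hW0 p.1) (hT0 p.2)
      calc _ ≤ |g p.1| * |g p.2| * (C * ((1 + ‖p.1‖ ^ 2) * (1 + ‖p.2‖ ^ 2))) :=
            mul_le_mul_of_nonneg_left (hC R hR _ _ hne) (by positivity)
        _ = C * (W p.1 * W p.2) := by simp only [hW]; ring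
        _ ≤ _ := by
            rw [e2]; exact mul_le_mul_of_nonneg_left (by linarith) hC0
  have hval : ∫ p : Vel d × Vel d, C * (T p.1 * W p.2 + W p.1 * T p.2) ∂(volume.prod volume) =
      2 * C * ((∫ v, T v) * ∫ v, W v) := by
    rw [integral_const_mul, integral_add (hTi.mul_prod hWi) (hWi.mul_prod hTi),
      integral_prod_mul, integral_prod_mul]
    ring
  rw [hval] at hbound
  have hTn : 0 ≤ ∫ v, T v := integral_nonneg hT0
  have h4 : (∫ v, T v) * ∫ v, W v ≤ (∫ v, T v) * (2 * B) :=
    mul_le_mul_of_nonneg_left hg.integral_weight_le hTn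
  rw [he, abs_mul, abs_of_nonneg ha]
  have h5 : 2 * |∫ p, F p ∂(volume.prod volume)| ≤ 2 * C * ((∫ v, T v) * (2 * B)) := by
    rw [show 2 * |∫ p, F p ∂(volume.prod volume)| = |2 * ∫ p, F p ∂(volume.prod volume)| by
      rw [abs_mul, abs_two], hsym]
    exact hbound.trans (mul_le_mul_of_nonneg_left h4 (by positivity))
  have h6 : tail R g = ∫ v, T v := rfl
  rw [h6]
  calc a * |∫ p, F p ∂(volume.prod volume)| ≤ a * (C * ((∫ v, T v) * (2 * B))) :=
        mul_le_mul_of_nonneg_left (by linarith) ha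
    _ = _ := by ring

variable {S : EReal} {f : ℝ → Vel d → ℝ}

/-- **Conservation of energy.** -/
theorem IsClassicalSolution.energy_eq (hp : Params d γ) (ha : 0 ≤ a)
    (hf : IsClassicalSolution a γ S f) {t₁ t₂ : ℝ} (h1 : 0 < t₁) (h12 : t₁ ≤ t₂)
    (h2 : (t₂ : EReal) < S) : energy (f t₂) = energy (f t₁) := by
  obtain ⟨B, hB⟩ := hf.dens h1 h2
  have hB0 : 0 ≤ B := (hB t₁ ⟨le_rfl, h12⟩).nonneg_const
  obtain ⟨C, hC0, hC⟩ := exists_testFlux_quadTest_bound (d := d) hp ha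
  have hpos : ∀ t ∈ Set.Icc t₁ t₂, 0 < t ∧ (t : EReal) < S := fun t ht =>
    ⟨h1.trans_le ht.1, coe_lt_of_le ht.2 h2⟩
  set E : ℕ → ℝ → ℝ := fun n t => ∫ v, quadTest ((n : ℝ) + 1) v * f t v with hE
  have hn : ∀ n : ℕ, (0 : ℝ) < (n : ℝ) + 1 := fun n => by positivity
  have hder : ∀ n, ∀ t ∈ Set.Icc t₁ t₂, HasDerivAt (E n)
      (testFlux a γ (f t) (f t) (quadTest ((n : ℝ) + 1))) t := fun n t ht =>
    hf.hasDerivAt_integral_mul_test hp (hpos t ht).1 (hpos t ht).2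
      (contDiff_quadTest _) (hasCompactSupport_quadTest (hn n))
  have hdb : ∀ n, ∀ t ∈ Set.Icc t₁ t₂, |deriv (E n) t| ≤ C * B * tail ((n : ℝ) + 1) (f t) :=
    fun n t ht => by rw [(hder n t ht).deriv]; exact hC _ (hn n) _ _ (hB t ht)
  have hdb' : ∀ n, ∀ t ∈ Set.Icc t₁ t₂, |deriv (E n) t| ≤ C * B * (2 * B) := fun n t ht =>
    (hdb n t ht).trans (mul_le_mul_of_nonneg_left ((hB t ht).tail_le _) (by positivity))
  have hint : ∀ n, IntervalIntegrable (deriv (E n)) volume t₁ t₂ := by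
    intro n
    rw [intervalIntegrable_iff_integrableOn_Icc_of_le h12]
    refine Measure.integrableOn_of_bounded (M := C * B * (2 * B)) (by simp)
      (measurable_deriv _).aestronglyMeasurable ?_
    exact (ae_restrict_iff' measurableSet_Icc).2 (Eventually.of_forall fun t ht => hdb' n t ht)
  have hftc : ∀ n, ∫ t in t₁..t₂, deriv (E n) t = E n t₂ - E n t₁ := fun n =>
    intervalIntegral.integral_eq_sub_of_hasDerivAt (fun t ht => by
      rw [Set.uIcc_of_le h12] at ht
      exact (hder n t ht).differentiableAt.hasDerivAt) (hint n)
  -- no uniform rate in `t` is known for the tails, hence dominated convergence in time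
  have l0 : Tendsto (fun n => ∫ t in t₁..t₂, deriv (E n) t) atTop
      (𝓝 (∫ _t in t₁..t₂, (0 : ℝ))) := by
    refine intervalIntegral.tendsto_integral_filter_of_dominated_convergence
      (fun _ => C * B * (2 * B)) (Eventually.of_forall fun n =>
        (measurable_deriv _).aestronglyMeasurable) (Eventually.of_forall fun n =>
        Eventually.of_forall fun t ht => ?_) (by simp) (Eventually.of_forall fun t ht => ?_)
    · rw [Set.uIoc_of_le h12] at ht
      exact hdb' n t ⟨ht.1.le, ht.2⟩
    · rw [Set.uIoc_of_le h12] at ht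
      have htI : t ∈ Set.Icc t₁ t₂ := ⟨ht.1.le, ht.2⟩
      have := ((hB t htI).tendsto_tail).const_mul (C * B)
      rw [mul_zero] at this
      exact squeeze_zero_norm (fun n => hdb n t htI) this
  simp only [hftc, intervalIntegral.integral_zero] at l0
  have lim : ∀ t ∈ Set.Icc t₁ t₂, Tendsto (fun n => E n t) atTop (𝓝 (energy (f t))) := by
    intro t ht
    refine (tendsto_integral_cutoff_mul (hB t ht).int2).congr fun n => ?_
    refine integral_congr_ae (Eventually.of_forall fun v => ?_)
    simp only [quadTest]
    ring
  exact sub_eq_zero.1 (tendsto_nhds_unique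
    ((lim t₂ ⟨h12, le_rfl⟩).sub (lim t₁ ⟨le_rfl, h12⟩)) l0)

end

end

section

/-! ### Quadratic interactions -/

variable {d : ℕ}

/-- The quadratic form `ξ ↦ ∑ Aᵢⱼ ξᵢ ξⱼ`. -/
def quad (A : Matrix (Fin d) (Fin d) ℝ) (ξ : Fin d → ℝ) : ℝ := ∑ i, ∑ j, A i j * (ξ i * ξ j)

theorem quad_const_mul (A : Matrix (Fin d) (Fin d) ℝ) (c : ℝ) (ξ : Fin d → ℝ) :
    quad A (fun i => c * ξ i) = c ^ 2 * quad A ξ := by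
  unfold quad
  simp only [Finset.mul_sum]
  exact Finset.sum_congr rfl fun i _ => Finset.sum_congr rfl fun j _ => by ring

theorem quad_sub {A : Matrix (Fin d) (Fin d) ℝ} (hA : ∀ i j, A i j = A j i) (ξ η : Fin d → ℝ) :
    quad A (fun i => ξ i - η i) = quad A ξ + quad A η - 2 * ∑ i, ∑ j, A i j * (ξ i * η j) := by
  have h : ∑ i, ∑ j, A i j * (η i * ξ j) = ∑ i, ∑ j, A i j * (ξ i * η j) := by
    rw [Finset.sum_comm]
    exact Finset.sum_congr rfl fun i _ => Finset.sum_congr rfl fun j _ => by rw [hA j i]; ring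
  have e : quad A (fun i => ξ i - η i) = quad A ξ + quad A η -
      ((∑ i, ∑ j, A i j * (ξ i * η j)) + ∑ i, ∑ j, A i j * (η i * ξ j)) := by
    unfold quad
    simp only [← Finset.sum_add_distrib, ← Finset.sum_sub_distrib]
    exact Finset.sum_congr rfl fun i _ => Finset.sum_congr rfl fun j _ => by ring
  rw [e, h]; ring

theorem two_mul_sum_le_quad_add_quad {A : Matrix (Fin d) (Fin d) ℝ} (hA : ∀ i j, A i j = A j i)
    (h0 : ∀ ξ, 0 ≤ quad A ξ) (ξ η : Fin d → ℝ) :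
    2 * ∑ i, ∑ j, A i j * (ξ i * η j) ≤ quad A ξ + quad A η := by
  have := h0 fun i => ξ i - η i
  rw [quad_sub hA] at this
  linarith

/-- The inequality of arithmetic and geometric means for the quadratic form of a nonnegative matrix. -/
theorem quad_add_le {A : Matrix (Fin d) (Fin d) ℝ} (hA : ∀ i j, A i j = A j i)
    (h0 : ∀ ξ, 0 ≤ quad A ξ) {κ : ℝ} (hκ : 0 < κ) (ξ η : Fin d → ℝ) :
    quad A (fun i => ξ i + η i) ≤ (1 + κ) * quad A ξ + (1 + 1 / κ) * quad A η := by
  have h1 := h0 fun i => κ * ξ i - η i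
  rw [quad_sub hA, quad_const_mul] at h1
  have h2 := quad_sub hA ξ fun i => -1 * η i
  rw [quad_const_mul] at h2
  have e1 : (fun i => ξ i - -1 * η i) = fun i => ξ i + η i := by funext i; ring
  have e2 : ∑ i, ∑ j, A i j * (ξ i * (-1 * η j)) = -∑ i, ∑ j, A i j * (ξ i * η j) := by
    simp only [← Finset.sum_neg_distrib]
    exact Finset.sum_congr rfl fun i _ => Finset.sum_congr rfl fun j _ => by ring
  have e3 : ∑ i, ∑ j, A i j * (κ * ξ i * η j) = κ * ∑ i, ∑ j, A i j * (ξ i * η j) := by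
    simp only [Finset.mul_sum]
    exact Finset.sum_congr rfl fun i _ => Finset.sum_congr rfl fun j _ => by ring
  rw [e1, e2] at h2
  rw [e3] at h1
  rw [h2]
  have h3 : 2 * ∑ i, ∑ j, A i j * (ξ i * η j) ≤ κ * quad A ξ + 1 / κ * quad A η := by
    refine le_of_mul_le_mul_left ?_ hκ
    have : κ * (κ * quad A ξ + 1 / κ * quad A η) = κ ^ 2 * quad A ξ + quad A η := by field_simp
    linarith
  linarith

/-- The form of the kernel is `|z ∧ ξ|² |z|^γ`. -/
theorem quad_kernel {γ : ℝ} {z : Vel d} (hz : z ≠ 0) (ξ : Vel d) :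
    quad (kernel γ z) ξ = (‖z‖ ^ 2 * ‖ξ‖ ^ 2 - (inner ℝ z ξ) ^ 2) * ‖z‖ ^ γ := by
  have e : inner ℝ z ξ = ∑ i, z i * ξ i := by
    rw [PiLp.inner_apply]; exact Finset.sum_congr rfl fun i _ => by simp [mul_comm]
  unfold quad
  simp only [kernel_eq γ hz]
  have e1 : ∀ i, ∑ j, ((if i = j then ‖z‖ ^ 2 else 0) - z i * z j) * ‖z‖ ^ γ * (ξ i * ξ j) =
      (‖z‖ ^ 2 * ξ i ^ 2 - z i * ξ i * inner ℝ z ξ) * ‖z‖ ^ γ := by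
    intro i
    rw [e, Finset.mul_sum]
    have : ∀ j, ((if i = j then ‖z‖ ^ 2 else 0) - z i * z j) * ‖z‖ ^ γ * (ξ i * ξ j) =
        (if i = j then ‖z‖ ^ 2 * ‖z‖ ^ γ * (ξ i * ξ j) else 0) -
          z i * ξ i * (z j * ξ j) * ‖z‖ ^ γ := by
      intro j; split_ifs <;> ring
    rw [Finset.sum_congr rfl fun j _ => this j, Finset.sum_sub_distrib,
      Finset.sum_ite_eq, if_pos (Finset.mem_univ i), ← Finset.sum_mul]
    ring
  rw [Finset.sum_congr rfl fun i _ => e1 i, ← Finset.sum_mul, Finset.sum_sub_distrib,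
    ← Finset.mul_sum, ← Finset.sum_mul, ← e, ← norm_sq_eq_sum]
  ring

theorem quad_kernel_nonneg {γ : ℝ} {z : Vel d} (hz : z ≠ 0) (ξ : Fin d → ℝ) :
    0 ≤ quad (kernel γ z) ξ := by
  have := quad_kernel (γ := γ) hz (WithLp.toLp 2 ξ)
  have e : quad (kernel γ z) ξ = quad (kernel γ z) (WithLp.toLp 2 ξ : Vel d) := rfl
  rw [e, this]
  have h := abs_real_inner_le_norm z (WithLp.toLp 2 ξ)
  have h2 := sq_le_sq₀ (abs_nonneg _) (by positivity) |>.2 h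
  rw [sq_abs, mul_pow] at h2
  exact mul_nonneg (sub_nonneg.2 h2) (Real.rpow_nonneg (norm_nonneg _) _)

section
variable {a γ B : ℝ} {g : Vel d → ℝ}

theorem quad_diffusion_eq (hp : Params d γ) (hg : Dens B g) (v : Vel d) (ξ : Fin d → ℝ) :
    quad (diffusion a γ g v) ξ = a * ∫ y, quad (kernel γ (v - y)) ξ * g y := by
  have hi : ∀ i j, Integrable fun y => kernel γ (v - y) i j * g y := fun i j =>
    integrable_kernel_dens hp.dim hp.pos le_rfl (kernelBound_kernel hp.mem i j) hg v
  unfold quad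
  simp only [diffusion_eq, conv_eq, Finset.sum_mul]
  have e : ∀ i j, ∫ y, kernel γ (v - y) i j * (ξ i * ξ j) * g y =
      (∫ y, kernel γ (v - y) i j * g y) * (ξ i * ξ j) := fun i j => by
    rw [← integral_mul_const]
    exact integral_congr_ae (Eventually.of_forall fun y => by simp only []; ring)
  have hi' : ∀ i j, Integrable fun y => kernel γ (v - y) i j * (ξ i * ξ j) * g y := fun i j =>
    ((hi i j).mul_const (ξ i * ξ j)).congr
      (Eventually.of_forall fun y => by simp only []; ring)
  rw [integral_finsetSum _ fun i _ => integrable_finsetSum _ fun j _ => hi' i j, Finset.mul_sum]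
  refine Finset.sum_congr rfl fun i _ => ?_
  rw [integral_finsetSum _ fun j _ => hi' i j, Finset.mul_sum]
  exact Finset.sum_congr rfl fun j _ => by rw [e]; ring

theorem nontrivial_vel (hd : 2 ≤ d) : Nontrivial (Vel d) := by
  have : Nonempty (Fin d) := ⟨⟨0, by omega⟩⟩
  infer_instance

theorem ae_sub_ne_zero (hd : 2 ≤ d) (v : Vel d) : ∀ᵐ y : Vel d, v - y ≠ 0 := by
  have := nontrivial_vel hd
  rw [ae_iff]
  have : {y : Vel d | ¬ v - y ≠ 0} = {v} := by
    ext y; simp [sub_eq_zero, eq_comm]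
  rw [this]
  simp

theorem quad_diffusion_nonneg (hp : Params d γ) (ha : 0 ≤ a) (hg : Dens B g)
    (h0 : ∀ v, 0 ≤ g v) (v : Vel d) (ξ : Fin d → ℝ) : 0 ≤ quad (diffusion a γ g v) ξ := by
  rw [quad_diffusion_eq hp hg]
  refine mul_nonneg ha (integral_nonneg_of_ae ?_)
  filter_upwards [ae_sub_ne_zero hp.dim v] with y hy
  exact mul_nonneg (quad_kernel_nonneg hy ξ) (h0 y)

theorem Dens.integrable_sq_weight (hg : Dens B g) (σ : ℕ) (hσ : σ ≤ 2) {ψ : Vel d → ℝ}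
    (hψ : Measurable ψ) {M : ℝ} (hM : ∀ v, |ψ v| ≤ M) :
    Integrable fun v => (1 + ‖v‖) ^ σ * (g v * ψ v) := by
  refine Integrable.mono' ((hg.integrable_weight).const_mul (2 * M)) ?_
    (Eventually.of_forall fun v => ?_)
  · exact ((measurable_const.add measurable_norm).pow_const σ).mul (hg.meas.mul hψ)
      |>.aestronglyMeasurable
  · rw [Real.norm_eq_abs, abs_mul, abs_mul, abs_of_nonneg (by positivity : 0 ≤ (1 + ‖v‖) ^ σ)]
    have h1 : (1 + ‖v‖) ^ σ ≤ (1 + ‖v‖) ^ 2 :=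
      pow_le_pow_right₀ (by linarith [norm_nonneg v]) hσ
    have h2 : (1 + ‖v‖) ^ σ ≤ 2 * (1 + ‖v‖ ^ 2) := by nlinarith [sq_nonneg (1 - ‖v‖)]
    calc (1 + ‖v‖) ^ σ * (|g v| * |ψ v|) ≤ (2 * (1 + ‖v‖ ^ 2)) * (|g v| * M) :=
          mul_le_mul h2 (mul_le_mul_of_nonneg_left (hM v) (abs_nonneg _)) (by positivity)
            (by positivity)
      _ = _ := by ring

theorem Dens.integrable_mul_of_bounded (hg : Dens B g) {ψ : Vel d → ℝ}
    (hψ : Measurable ψ) {M : ℝ} (hM : ∀ v, |ψ v| ≤ M) : Integrable fun v => g v * ψ v := by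
  simpa using hg.integrable_sq_weight 0 (by norm_num) hψ hM

/-- A bounded function of compact support is a density in the sense of `Dens`. -/
theorem exists_dens_of_hasCompactSupport {u : Vel d → ℝ} (hu : Continuous u)
    (hc : HasCompactSupport u) : ∃ B, Dens B u := by
  obtain ⟨C, hC⟩ := hc.exists_bound_of_continuous hu
  refine ⟨max C (max (∫ v, |u v|) (∫ v, ‖v‖ ^ 2 * |u v|)), hu.measurable,
    fun v => (hC v).trans (le_max_left _ _), hu.integrable_of_hasCompactSupport hc,
    (by fun_prop : Continuous fun v => ‖v‖ ^ 2 * u v).integrable_of_hasCompactSupport hc.mul_left,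
    (le_max_left _ _).trans (le_max_right _ _), (le_max_right _ _).trans (le_max_right _ _)⟩

theorem pd_comp_sub_left {u : Vel d → ℝ} (hu : ContDiff ℝ 1 u) (v : Vel d) (i : Fin d)
    (z : Vel d) : pd i (fun z => u (v - z)) z = -pd i u (v - z) := by
  unfold pd
  have h := (hu.differentiable one_ne_zero (v - z)).hasFDerivAt.comp z
    ((hasFDerivAt_id z).const_sub v)
  rw [show (fun z => u (v - z)) = u ∘ HSub.hSub v from rfl, h.fderiv]
  simp

/-- The drift of a smooth density is the convolution of the kernel with its gradient. -/
theorem drift_eq_sum (hp : Params d γ) {G : Vel d → ℝ} (hG : ContDiff ℝ 1 G)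
    (hc : HasCompactSupport G) (j : Fin d) (v : Vel d) :
    drift a γ G j v = a * ∑ i, conv (fun z => kernel γ z i j) (pd i G) v := by
  have hΦ : ContDiff ℝ 1 fun z => G (v - z) := hG.comp (contDiff_const.sub contDiff_id)
  have hcΦ : HasCompactSupport fun z => G (v - z) :=
    hc.comp_homeomorph (Homeomorph.subLeft v)
  have h := sum_integral_kernel_mul_pd hp.dim hp.mem hp.pos hΦ hcΦ j
  simp only [pd_comp_sub_left hG, mul_neg, integral_neg, Finset.sum_neg_distrib] at h
  unfold drift conv
  linear_combination a * h

/-- Two integrations by parts turn `∫ c[G] G` into a quadratic interaction of `∇G` with itself. -/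
theorem integral_reaction_mul_self (hp : Params d γ) {G : Vel d → ℝ} (hG : ContDiff ℝ 1 G)
    (hc : HasCompactSupport G) :
    ∫ v, reaction a γ G v * G v = a * ∑ i, ∑ j, ∫ p : Vel d × Vel d,
      kernel γ (p.1 - p.2) i j * pd i G p.2 * pd j G p.1 ∂(volume.prod volume) := by
  obtain ⟨B, hB⟩ := exists_dens_of_hasCompactSupport hG.continuous hc
  rw [← sum_integral_drift_mul_pd hp hB hG hc, Finset.sum_comm, Finset.mul_sum]
  refine Finset.sum_congr rfl fun j _ => ?_
  have hpc : ∀ i, Continuous (pd i G) := fun i => continuous_pd hG i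
  have hps : ∀ i, HasCompactSupport (pd i G) := fun i => hasCompactSupport_pd hc i
  choose B' hB' using fun i => exists_dens_of_hasCompactSupport (hpc i) (hps i)
  have hi : ∀ i, Integrable fun v => conv (fun z => kernel γ z i j) (pd i G) v * pd j G v :=
    fun i => integrable_conv_mul_of_hasCompactSupport hp.dim hp.pos le_rfl
      (kernelBound_kernel hp.mem i j) (hB' i) (hpc j) (hps j)
  have e : ∀ v, drift a γ G j v * pd j G v =
      a * ∑ i, conv (fun z => kernel γ z i j) (pd i G) v * pd j G v := fun v => by
    rw [drift_eq_sum hp hG hc, mul_assoc, Finset.sum_mul]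
  simp only [e]
  rw [integral_const_mul, integral_finsetSum _ fun i _ => hi i]
  congr 1
  exact Finset.sum_congr rfl fun i _ => integral_conv_mul_eq_prod hp le_rfl
    (kernelBound_kernel hp.mem i j) (hB' i)
    ((hpc j).integrable_of_hasCompactSupport (hps j))
    (integrable_weight_mul_of_hasCompactSupport 2 (hpc j) (hps j))

/-- A cross interaction is at most the average of the self interactions, the kernel being a
nonnegative matrix. -/
theorem sum_integral_prod_le (hp : Params d γ) (ha : 0 ≤ a) (hg : Dens B g) (h0 : ∀ v, 0 ≤ g v)
    {Z : Fin d → Vel d → ℝ} (hZ : ∀ i, Measurable (Z i)) {M : ℝ} (hM : ∀ i v, |Z i v| ≤ M) :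
    a * ∑ i, ∑ j, ∫ p : Vel d × Vel d,
      kernel γ (p.1 - p.2) i j * (g p.2 * Z i p.2) * (g p.1 * Z j p.1) ∂(volume.prod volume) ≤
    ∑ i, ∑ j, ∫ v, diffusion a γ g v i j * (g v * (Z i v * Z j v)) := by
  have hM2 : ∀ i j v, |Z i v * Z j v| ≤ M * M := fun i j v => by
    rw [abs_mul]
    exact mul_le_mul (hM i v) (hM j v) (abs_nonneg _) ((abs_nonneg _).trans (hM i v))
  have hZZ : ∀ i j, Measurable fun v => Z i v * Z j v := fun i j => (hZ i).mul (hZ j)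
  have i1 : ∀ i j, Integrable (fun p : Vel d × Vel d => kernel γ (p.1 - p.2) i j * g p.2 *
      (g p.1 * (Z i p.1 * Z j p.1))) (volume.prod volume) := fun i j =>
    integrable_prod_kernel hp.dim hp.pos le_rfl (kernelBound_kernel hp.mem i j) hg
      (hg.integrable_mul_of_bounded (hZZ i j) (hM2 i j))
      (hg.integrable_sq_weight 2 le_rfl (hZZ i j) (hM2 i j))
  have i0 : ∀ i j, Integrable (fun p : Vel d × Vel d => kernel γ (p.1 - p.2) i j * g p.2 *
      (g p.1 * Z j p.1)) (volume.prod volume) := fun i j =>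
    integrable_prod_kernel hp.dim hp.pos le_rfl (kernelBound_kernel hp.mem i j) hg
      (hg.integrable_mul_of_bounded (hZ j) (hM j))
      (hg.integrable_sq_weight 2 le_rfl (hZ j) (hM j))
  have i2 : ∀ i j, Integrable (fun p : Vel d × Vel d => kernel γ (p.1 - p.2) i j *
      (g p.2 * Z i p.2) * (g p.1 * Z j p.1)) (volume.prod volume) := fun i j => by
    refine ((i0 i j).bdd_mul (c := M) (f := fun p : Vel d × Vel d => Z i p.2)
      ((hZ i).comp measurable_snd).aestronglyMeasurable
      (Eventually.of_forall fun p => hM i p.2)).congr (Eventually.of_forall fun p => ?_)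
    simp only []; ring
  have e1 : ∀ i j, ∫ v, diffusion a γ g v i j * (g v * (Z i v * Z j v)) =
      a * ∫ p : Vel d × Vel d, kernel γ (p.1 - p.2) i j * g p.2 * (g p.1 * (Z i p.1 * Z j p.1))
        ∂(volume.prod volume) := fun i j => by
    simp only [diffusion_eq, mul_assoc a]
    rw [integral_const_mul, integral_conv_mul_eq_prod hp le_rfl (kernelBound_kernel hp.mem i j) hg
      (hg.integrable_mul_of_bounded (hZZ i j) (hM2 i j))
      (hg.integrable_sq_weight 2 le_rfl (hZZ i j) (hM2 i j))]
  simp only [e1, ← Finset.mul_sum]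
  refine mul_le_mul_of_nonneg_left ?_ ha
  have I1 := integrable_finsetSum Finset.univ fun i _ =>
    integrable_finsetSum Finset.univ fun j _ => i1 i j
  have I2 := integrable_finsetSum Finset.univ fun i _ =>
    integrable_finsetSum Finset.univ fun j _ => i2 i j
  have s1 : ∑ i, ∑ j, ∫ p : Vel d × Vel d, kernel γ (p.1 - p.2) i j * g p.2 *
      (g p.1 * (Z i p.1 * Z j p.1)) ∂(volume.prod volume) =
      ∫ p : Vel d × Vel d, ∑ i, ∑ j, kernel γ (p.1 - p.2) i j * g p.2 *
      (g p.1 * (Z i p.1 * Z j p.1)) ∂(volume.prod volume) := by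
    rw [integral_finsetSum _ fun i _ => integrable_finsetSum _ fun j _ => i1 i j]
    exact Finset.sum_congr rfl fun i _ => (integral_finsetSum _ fun j _ => i1 i j).symm
  have s2 : ∑ i, ∑ j, ∫ p : Vel d × Vel d, kernel γ (p.1 - p.2) i j *
      (g p.2 * Z i p.2) * (g p.1 * Z j p.1) ∂(volume.prod volume) =
      ∫ p : Vel d × Vel d, ∑ i, ∑ j, kernel γ (p.1 - p.2) i j *
      (g p.2 * Z i p.2) * (g p.1 * Z j p.1) ∂(volume.prod volume) := by
    rw [integral_finsetSum _ fun i _ => integrable_finsetSum _ fun j _ => i2 i j]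
    exact Finset.sum_congr rfl fun i _ => (integral_finsetSum _ fun j _ => i2 i j).symm
  rw [s1, s2]
  set F : Vel d × Vel d → ℝ := fun p => ∑ i, ∑ j, kernel γ (p.1 - p.2) i j * g p.2 *
      (g p.1 * (Z i p.1 * Z j p.1)) with hF
  have hswap : ∫ p : Vel d × Vel d, F p.swap ∂(volume.prod volume) =
      ∫ p, F p ∂(volume.prod volume) := integral_prod_swap (f := F)
  have hadd : ∫ p : Vel d × Vel d, (F p + F p.swap) ∂(volume.prod volume) =
      (∫ p, F p ∂(volume.prod volume)) + ∫ p : Vel d × Vel d, F p.swap ∂(volume.prod volume) :=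
    integral_add I1 I1.swap
  have hmono := integral_mono_ae (I2.const_mul 2) (I1.add I1.swap) (by
    filter_upwards [ae_prod_ne hp.dim] with p hne
    have hz : p.1 - p.2 ≠ 0 := sub_ne_zero.2 hne
    have h := two_mul_sum_le_quad_add_quad (kernel_symm γ (p.1 - p.2)) (quad_kernel_nonneg hz)
      (fun i => Z i p.2) (fun i => Z i p.1)
    have h' := mul_le_mul_of_nonneg_left h (mul_nonneg (h0 p.1) (h0 p.2))
    have e2 : F p = g p.1 * g p.2 * quad (kernel γ (p.1 - p.2)) fun i => Z i p.1 := by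
      simp only [hF, quad, Finset.mul_sum]
      exact Finset.sum_congr rfl fun i _ => Finset.sum_congr rfl fun j _ => by ring
    have e3 : F p.swap = g p.1 * g p.2 * quad (kernel γ (p.1 - p.2)) fun i => Z i p.2 := by
      simp only [hF, quad, Finset.mul_sum, Prod.fst_swap, Prod.snd_swap]
      refine Finset.sum_congr rfl fun i _ => Finset.sum_congr rfl fun j _ => ?_
      rw [← neg_sub p.1 p.2, kernel_neg]; ring
    have e4 : ∑ i, ∑ j, kernel γ (p.1 - p.2) i j * (g p.2 * Z i p.2) * (g p.1 * Z j p.1) =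
        g p.1 * g p.2 * ∑ i, ∑ j, kernel γ (p.1 - p.2) i j * (Z i p.2 * Z j p.1) := by
      simp only [Finset.mul_sum]
      exact Finset.sum_congr rfl fun i _ => Finset.sum_congr rfl fun j _ => by ring
    simp only [e4]
    show _ ≤ F p + F p.swap
    rw [e2, e3]
    linarith)
  rw [integral_const_mul] at hmono
  have : ∫ p : Vel d × Vel d, (F p + F p.swap) ∂(volume.prod volume) =
      2 * ∫ p, F p ∂(volume.prod volume) := by rw [hadd, hswap]; ring
  have h' : 2 * ∫ p : Vel d × Vel d, ∑ i, ∑ j, kernel γ (p.1 - p.2) i j *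
      (g p.2 * Z i p.2) * (g p.1 * Z j p.1) ∂(volume.prod volume) ≤
      2 * ∫ p, F p ∂(volume.prod volume) := by
    rw [← this]; exact hmono
  linarith

end

end

section

/-! ### Regularized entropy -/

variable {d : ℕ}

/-- The regularized entropy density `(x + ε) log (1 + x / ε) - x`. -/
def regEnt (ε x : ℝ) : ℝ := (x + ε) * Real.log (1 + x / ε) - x

/-- `ε log (1 + x / ε)`: the part of `x` which the regularized entropy does not see. -/
def slowPart (ε x : ℝ) : ℝ := ε * Real.log (1 + x / ε)

theorem one_add_div_pos {ε x : ℝ} (hε : 0 < ε) (hx : 0 ≤ x) : 0 < 1 + x / ε := by positivity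

theorem hasDerivAt_log_one_add_div {ε x : ℝ} (hε : 0 < ε) (hx : 0 ≤ x) :
    HasDerivAt (fun x => Real.log (1 + x / ε)) (1 / (x + ε)) x := by
  have h := (((hasDerivAt_id x).div_const ε).const_add 1).log (one_add_div_pos hε hx).ne'
  convert! h using 1
  simp only [id]
  field_simp
  ring

theorem hasDerivAt_regEnt {ε x : ℝ} (hε : 0 < ε) (hx : 0 ≤ x) :
    HasDerivAt (regEnt ε) (Real.log (1 + x / ε)) x := by
  have h := (((hasDerivAt_id x).add_const ε).mul (hasDerivAt_log_one_add_div hε hx)).sub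
    (hasDerivAt_id x)
  convert! h using 1
  simp only [id]
  have : x + ε ≠ 0 := by positivity
  field_simp
  ring

theorem hasDerivAt_sub_slowPart {ε x : ℝ} (hε : 0 < ε) (hx : 0 ≤ x) :
    HasDerivAt (fun x => x - slowPart ε x) (x * (1 / (x + ε))) x := by
  have h := (hasDerivAt_id x).sub ((hasDerivAt_log_one_add_div hε hx).const_mul ε)
  convert! h using 1
  have : x + ε ≠ 0 := by positivity
  field_simp
  ring

theorem log_one_add_div_nonneg {ε x : ℝ} (hε : 0 < ε) (hx : 0 ≤ x) :
    0 ≤ Real.log (1 + x / ε) := Real.log_nonneg (by have := div_nonneg hx hε.le; linarith)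

theorem log_one_add_div_le {ε x : ℝ} (hε : 0 < ε) (hx : 0 ≤ x) :
    Real.log (1 + x / ε) ≤ x / ε := by
  have := Real.log_le_sub_one_of_pos (one_add_div_pos hε hx); linarith

theorem slowPart_nonneg {ε x : ℝ} (hε : 0 < ε) (hx : 0 ≤ x) : 0 ≤ slowPart ε x :=
  mul_nonneg hε.le (log_one_add_div_nonneg hε hx)

theorem slowPart_le {ε x : ℝ} (hε : 0 < ε) (hx : 0 ≤ x) : slowPart ε x ≤ x := by
  have := mul_le_mul_of_nonneg_left (log_one_add_div_le hε hx) hε.le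
  rwa [mul_div_cancel₀ _ hε.ne'] at this

theorem log_one_add_sq_le {u : ℝ} (hu : 0 ≤ u) : Real.log (1 + u ^ 2) ≤ u := by
  rw [Real.log_le_iff_le_exp (by positivity)]
  have := Real.sum_le_exp_of_nonneg hu 4
  simp only [Finset.sum_range_succ, Finset.sum_range_zero] at this
  norm_num [Nat.factorial] at this
  nlinarith [mul_nonneg hu (sq_nonneg (u - 3 / 2))]

theorem slowPart_le_sqrt {ε x : ℝ} (hε : 0 < ε) (hx : 0 ≤ x) :
    slowPart ε x ≤ Real.sqrt ε * (1 + x) := by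
  have h := log_one_add_sq_le (Real.sqrt_nonneg (x / ε))
  rw [Real.sq_sqrt (div_nonneg hx hε.le), Real.sqrt_div hx] at h
  have h1 : slowPart ε x ≤ ε * (Real.sqrt x / Real.sqrt ε) := mul_le_mul_of_nonneg_left h hε.le
  have h2 : ε * (Real.sqrt x / Real.sqrt ε) = Real.sqrt ε * Real.sqrt x := by
    have h3 := Real.sqrt_pos.2 hε
    field_simp
    rw [Real.sq_sqrt hε.le]
    ring
  have h3 : Real.sqrt x ≤ 1 + x := by
    nlinarith [Real.sq_sqrt hx, Real.sqrt_nonneg x, sq_nonneg (Real.sqrt x - 1)]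
  rw [h2] at h1
  exact h1.trans (mul_le_mul_of_nonneg_left h3 (Real.sqrt_nonneg _))

theorem regEnt_nonneg {ε x : ℝ} (hε : 0 < ε) (hx : 0 ≤ x) : 0 ≤ regEnt ε x := by
  have h := Real.one_sub_inv_le_log_of_pos (one_add_div_pos hε hx)
  have h2 := mul_le_mul_of_nonneg_left h (by positivity : 0 ≤ x + ε)
  have h3 : (x + ε) * (1 - (1 + x / ε)⁻¹) = x := by
    have : x + ε ≠ 0 := by positivity
    have : ε + x ≠ 0 := by positivity
    field_simp
    ring
  unfold regEnt
  linarith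

theorem regEnt_le {ε x : ℝ} (hε : 0 < ε) (hx : 0 ≤ x) : regEnt ε x ≤ x / ε * x := by
  have h := mul_le_mul_of_nonneg_left (log_one_add_div_le hε hx) (by positivity : 0 ≤ x + ε)
  have h3 : (x + ε) * (x / ε) = x / ε * x + x := by field_simp
  unfold regEnt
  linarith

/-- The excess of the regularized entropy density over `x log x`, up to a multiple of `x`. -/
def entExcess (ε x : ℝ) : ℝ := regEnt ε x - (x * Real.log x - x * Real.log ε - x)

theorem entExcess_eq {ε x : ℝ} (hε : 0 < ε) (hx : 0 < x) :
    entExcess ε x = x * Real.log (1 + ε / x) + slowPart ε x := by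
  have h1 : Real.log (1 + x / ε) = Real.log (x + ε) - Real.log ε := by
    rw [← Real.log_div (by positivity) hε.ne']; congr 1; field_simp; ring
  have h2 : Real.log (1 + ε / x) = Real.log (x + ε) - Real.log x := by
    rw [← Real.log_div (by positivity) hx.ne']; congr 1; field_simp
  unfold entExcess regEnt slowPart
  rw [h1, h2]; ring

theorem entExcess_zero (ε : ℝ) : entExcess ε 0 = 0 := by simp [entExcess, regEnt]

theorem entExcess_nonneg {ε x : ℝ} (hε : 0 < ε) (hx : 0 ≤ x) : 0 ≤ entExcess ε x := by
  rcases hx.eq_or_lt with rfl | hx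
  · rw [entExcess_zero]
  · rw [entExcess_eq hε hx]
    exact add_nonneg (mul_nonneg hx.le (log_one_add_div_nonneg hx hε.le))
      (slowPart_nonneg hε hx.le)

theorem entExcess_le {ε x : ℝ} (hε : 0 < ε) (hx : 0 ≤ x) :
    entExcess ε x ≤ ε + Real.sqrt ε * (1 + x) := by
  rcases hx.eq_or_lt with rfl | hx
  · rw [entExcess_zero]; positivity
  · rw [entExcess_eq hε hx]
    exact add_le_add (slowPart_le hx hε.le) (slowPart_le_sqrt hε hx.le)

theorem entExcess_le_of_le_one {ε x : ℝ} (hε : 0 < ε) (hε1 : ε ≤ 1) (hx : 0 ≤ x) :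
    entExcess ε x ≤ x * x - x * Real.log x + x := by
  rcases hx.eq_or_lt with rfl | hx
  · rw [entExcess_zero]; simp
  · rw [entExcess_eq hε hx]
    have h1 : Real.log (1 + ε / x) ≤ Real.log (1 + 1 / x) :=
      Real.log_le_log (by positivity) (by gcongr)
    have h2 : Real.log (1 + 1 / x) = Real.log (1 + x / 1) - Real.log x := by
      rw [← Real.log_div (by positivity) hx.ne']; congr 1; field_simp; ring
    have h3 := log_one_add_div_le one_pos hx.le
    rw [div_one] at h3
    have h4 := mul_le_mul_of_nonneg_left (h1.trans (h2.le.trans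
      (sub_le_sub_right (by simpa using h3) (Real.log x)))) hx.le
    have h5 := slowPart_le hε hx.le
    nlinarith

section
variable {a γ B ε : ℝ} {g : Vel d → ℝ}

/-- The reaction operator is symmetric. -/
theorem integral_reaction_mul_symm (hp : Params d γ) (hg : Dens B g) {G : Vel d → ℝ}
    (hG : Continuous G) (hc : HasCompactSupport G) :
    ∫ v, reaction a γ g v * G v = ∫ v, reaction a γ G v * g v := by
  have h := integral_conv_mul hp.dim hp.pos (by norm_num) (kernelBound_rpow hp.mem) hg
    (hG.integrable_of_hasCompactSupport hc) (integrable_weight_mul_of_hasCompactSupport 0 hG hc)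
  simp only [reaction_eq, mul_assoc (((d : ℝ) - 1) * ((d : ℝ) + γ) * a)]
  rw [integral_const_mul, integral_const_mul, h]
  congr 1
  refine integral_congr_ae (Eventually.of_forall fun y => ?_)
  simp only [conv]
  rw [mul_comm]
  congr 1
  rw [← integral_neg_eq_self]
  refine integral_congr_ae (Eventually.of_forall fun z => ?_)
  simp only [norm_neg]
  rw [show -z + y = y - z by abel]

/-- The part of a density which contributes to its regularized, truncated entropy production: with
`h = regEnt ε` it is `χ (f h'(f) - h(f))`, evaluated at `f = g`. -/
def entPart (ε R : ℝ) (g : Vel d → ℝ) (v : Vel d) : ℝ := cutoff R v * (g v - slowPart ε (g v))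

theorem contDiff_sub_slowPart (hε : 0 < ε) (hg : ContDiff ℝ 1 g) (h0 : ∀ v, 0 ≤ g v) :
    ContDiff ℝ 1 fun v => g v - slowPart ε (g v) :=
  contDiff_one_comp_of_nonneg (k := fun x => x - slowPart ε x)
    (fun x hx => hasDerivAt_sub_slowPart hε hx) (by
      have : ∀ x ∈ Set.Ici (0 : ℝ), x + ε ≠ 0 := fun x hx => by
        have : 0 ≤ x := hx
        positivity
      exact continuousOn_id.mul (continuousOn_const.div
        (continuousOn_id.add continuousOn_const) this)) hg h0

theorem contDiff_entPart (hε : 0 < ε) (R : ℝ) (hg : ContDiff ℝ 1 g) (h0 : ∀ v, 0 ≤ g v) :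
    ContDiff ℝ 1 (entPart ε R g) := (contDiff_cutoff R).mul (contDiff_sub_slowPart hε hg h0)

theorem hasCompactSupport_entPart {R : ℝ} (hR : 0 < R) : HasCompactSupport (entPart ε R g) :=
  (hasCompactSupport_cutoff hR).mul_right

theorem entPart_nonneg (hε : 0 < ε) (R : ℝ) (h0 : ∀ v, 0 ≤ g v) (v : Vel d) :
    0 ≤ entPart ε R g v :=
  mul_nonneg (cutoff_nonneg R v) (sub_nonneg.2 (slowPart_le hε (h0 v)))

theorem entPart_le (hε : 0 < ε) (R : ℝ) (h0 : ∀ v, 0 ≤ g v) (v : Vel d) :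
    entPart ε R g v ≤ g v := by
  have h1 := mul_le_mul_of_nonneg_right (cutoff_le_one R v)
    (sub_nonneg.2 (slowPart_le hε (h0 v)))
  have h2 := slowPart_nonneg hε (h0 v)
  unfold entPart
  linarith

theorem dens_entPart (hε : 0 < ε) {R : ℝ} (hg : Dens B g) (hg1 : ContDiff ℝ 1 g)
    (h0 : ∀ v, 0 ≤ g v) : Dens B (entPart ε R g) :=
  hg.of_abs_le (contDiff_entPart hε R hg1 h0).continuous.measurable fun v => by
    rw [abs_of_nonneg (entPart_nonneg hε R h0 v), abs_of_nonneg (h0 v)]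
    exact entPart_le hε R h0 v

/-- The entropy production inequality: apart from boundary terms, the reaction term is controlled
by the dissipation. Writing `∇G = g Z` for `G = entPart ε R g`, the quadratic interaction of `∇G`
with itself is at most `∫ g ā(Z, Z)`, and `Z` is `∇g / (g + ε)` up to the gradient of the cutoff. -/
theorem exists_integral_reaction_mul_entPart_le (hp : Params d γ) (ha : 0 ≤ a) (hB : 0 ≤ B) :
    ∃ C : ℝ, 0 ≤ C ∧ ∀ (R ε κ : ℝ) (g : Vel d → ℝ), 1 ≤ R → 0 < ε → 0 < κ → Dens B g →
      ContDiff ℝ 1 g → (∀ v, 0 ≤ g v) →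
      ∫ v, reaction a γ (entPart ε R g) v * entPart ε R g v ≤
        (1 + κ) * dissipation a γ g g (fun v => cutoff R v * (1 / (g v + ε)))
          + (1 + 1 / κ) * (C / R ^ 2) := by
  obtain ⟨L, hL0, hL⟩ := exists_cutoff_bound d
  have hcc := convConst_nonneg (d := d) (γ := γ) hB
  refine ⟨d * d * (a * convConst d γ B) * L * B, by positivity,
    fun R ε κ g hR hε hκ hg hg1 h0 => ?_⟩
  have hR0 : 0 < R := by linarith
  set G := entPart ε R g with hGdef
  have hG1 : ContDiff ℝ 1 G := contDiff_entPart hε R hg1 h0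
  have hGc : HasCompactSupport G := hasCompactSupport_entPart hR0
  set χ : Vel d → ℝ := cutoff R with hχ
  have hχ1 : ContDiff ℝ 1 χ := contDiff_cutoff R
  have hχc : HasCompactSupport χ := hasCompactSupport_cutoff hR0
  have hgε : ∀ v, 0 < g v + ε := fun v => by have := h0 v; positivity
  -- `∇G = g (X + Y)`, where `Y` comes from the gradient of the cutoff
  set X : Fin d → Vel d → ℝ := fun i v => χ v * (1 / (g v + ε)) * pd i g v with hX
  set s : Vel d → ℝ := fun v => (g v - slowPart ε (g v)) / g v with hs
  set Y : Fin d → Vel d → ℝ := fun i v => s v * pd i χ v with hY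
  have hs01 : ∀ v, 0 ≤ s v ∧ s v ≤ 1 := fun v => by
    refine ⟨div_nonneg (sub_nonneg.2 (slowPart_le hε (h0 v))) (h0 v), ?_⟩
    exact div_le_one_of_le₀ (by have := slowPart_nonneg hε (h0 v); linarith) (h0 v)
  have hsg : ∀ v, g v * s v = g v - slowPart ε (g v) := fun v => by
    rcases (h0 v).eq_or_lt with h | h
    · simp [hs, ← h, slowPart]
    · exact mul_div_cancel₀ _ h.ne'
  have hpG : ∀ i v, pd i G v = g v * (X i v + Y i v) := fun i v => by
    have e1 := pd_mul hχ1 (contDiff_sub_slowPart hε hg1 h0) i v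
    rw [pd_comp (k := fun x => x - slowPart ε x)
      (fun x hx => hasDerivAt_sub_slowPart hε hx) hg1 h0] at e1
    have e2 : pd i G v = pd i (fun v => χ v * (g v - slowPart ε (g v))) v := rfl
    rw [e2, e1, ← hsg v]
    simp only [hX, hY]; ring
  have hXc : ∀ i, Continuous (X i) := fun i =>
    (hχ1.continuous.mul (continuous_const.div (hg1.continuous.add continuous_const)
      fun v => (hgε v).ne')).mul (continuous_pd hg1 i)
  have hXs : ∀ i, HasCompactSupport (X i) := fun i => (hχc.mul_right).mul_right
  have hsm : Measurable s :=
    (contDiff_sub_slowPart hε hg1 h0).continuous.measurable.div hg1.continuous.measurable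
  have hYm : ∀ i, Measurable (Y i) := fun i => hsm.mul (continuous_pd hχ1 i).measurable
  choose MX hMX using fun i => (hXs i).exists_bound_of_continuous (hXc i)
  choose MY hMY using fun i =>
    (hasCompactSupport_pd hχc i).exists_bound_of_continuous (continuous_pd hχ1 i)
  have hMY' : ∀ i v, |Y i v| ≤ MY i := fun i v => by
    simp only [hY]
    rw [abs_mul, abs_of_nonneg (hs01 v).1]
    exact (mul_le_of_le_one_left (abs_nonneg _) (hs01 v).2).trans (hMY i v)
  set M : ℝ := ∑ i, (|MX i| + |MY i|) with hM
  have hMi : ∀ i, |MX i| + |MY i| ≤ M := fun i =>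
    Finset.single_le_sum (f := fun i => |MX i| + |MY i|) (fun _ _ => by positivity)
      (Finset.mem_univ i)
  have hZm : ∀ i, Measurable fun v => X i v + Y i v := fun i => (hXc i).measurable.add (hYm i)
  have hZM : ∀ i v, |X i v + Y i v| ≤ M := fun i v =>
    (abs_add_le _ _).trans ((add_le_add ((hMX i v).trans (le_abs_self _))
      ((hMY' i v).trans (le_abs_self _))).trans (hMi i))
  have key := sum_integral_prod_le hp ha hg h0 hZm hZM
  have e0 : ∫ v, reaction a γ G v * G v = a * ∑ i, ∑ j, ∫ p : Vel d × Vel d,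
      kernel γ (p.1 - p.2) i j * (g p.2 * (X i p.2 + Y i p.2)) *
        (g p.1 * (X j p.1 + Y j p.1)) ∂(volume.prod volume) := by
    rw [integral_reaction_mul_self hp hG1 hGc]
    simp only [hpG]
  rw [e0]
  refine key.trans ?_
  -- pass from sums of integrals to the integral of a quadratic form
  have hZZ : ∀ i j, Measurable fun v => (X i v + Y i v) * (X j v + Y j v) := fun i j =>
    (hZm i).mul (hZm j)
  have hM2 : ∀ i j v, |(X i v + Y i v) * (X j v + Y j v)| ≤ M * M := fun i j v => by
    rw [abs_mul]
    exact mul_le_mul (hZM i v) (hZM j v) (abs_nonneg _) ((abs_nonneg _).trans (hZM i v))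
  have i1 : ∀ i j, Integrable fun v => diffusion a γ g v i j *
      (g v * ((X i v + Y i v) * (X j v + Y j v))) := fun i j => by
    simp only [diffusion_eq, mul_assoc a]
    exact (integrable_conv_mul hp.dim hp.pos le_rfl (kernelBound_kernel hp.mem i j) hg
      (hg.integrable_mul_of_bounded (hZZ i j) (hM2 i j))
      (hg.integrable_sq_weight 2 le_rfl (hZZ i j) (hM2 i j))).const_mul a
  have i2 : ∀ i j, Integrable fun v => diffusion a γ g v i j *
      (χ v * (1 / (g v + ε)) * (pd i g v * pd j g v)) := fun i j =>
    integrable_diffusion_mul hp hg ((hχ1.continuous.mul (continuous_const.div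
      (hg1.continuous.add continuous_const) fun v => (hgε v).ne')).mul
      ((continuous_pd hg1 i).mul (continuous_pd hg1 j))) ((hχc.mul_right).mul_right) i j
  have s1 : ∑ i, ∑ j, ∫ v, diffusion a γ g v i j *
      (g v * ((X i v + Y i v) * (X j v + Y j v))) = ∫ v, ∑ i, ∑ j, diffusion a γ g v i j *
      (g v * ((X i v + Y i v) * (X j v + Y j v))) := by
    rw [integral_finsetSum _ fun i _ => integrable_finsetSum _ fun j _ => i1 i j]
    exact Finset.sum_congr rfl fun i _ => (integral_finsetSum _ fun j _ => i1 i j).symm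
  have s2 : dissipation a γ g g (fun v => χ v * (1 / (g v + ε))) =
      ∫ v, ∑ i, ∑ j, diffusion a γ g v i j *
      (χ v * (1 / (g v + ε)) * (pd i g v * pd j g v)) := by
    rw [integral_finsetSum _ fun i _ => integrable_finsetSum _ fun j _ => i2 i j]
    exact Finset.sum_congr rfl fun i _ => (integral_finsetSum _ fun j _ => i2 i j).symm
  have I1 := integrable_finsetSum Finset.univ fun i _ =>
    integrable_finsetSum Finset.univ fun j _ => i1 i j
  have I2 := integrable_finsetSum Finset.univ fun i _ =>
    integrable_finsetSum Finset.univ fun j _ => i2 i j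
  set c : ℝ := d * d * (a * convConst d γ B) * L / R ^ 2 with hc
  have I3 : Integrable fun v => c * (‖v‖ ^ 2 * g v) := hg.int2.const_mul c
  have hpt : ∀ v, ∑ i, ∑ j, diffusion a γ g v i j * (g v * ((X i v + Y i v) * (X j v + Y j v))) ≤
      (1 + κ) * (∑ i, ∑ j, diffusion a γ g v i j *
        (χ v * (1 / (g v + ε)) * (pd i g v * pd j g v))) +
      (1 + 1 / κ) * (c * (‖v‖ ^ 2 * g v)) := by
    intro v
    set A := diffusion a γ g v with hA
    have hAs : ∀ i j, A i j = A j i := diffusion_symm a γ g v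
    have hA0 : ∀ ξ, 0 ≤ quad A ξ := quad_diffusion_nonneg hp ha hg h0 v
    have f1 : ∑ i, ∑ j, A i j * (g v * ((X i v + Y i v) * (X j v + Y j v))) =
        g v * quad A fun i => X i v + Y i v := by
      simp only [quad, Finset.mul_sum]
      exact Finset.sum_congr rfl fun i _ => Finset.sum_congr rfl fun j _ => by ring
    have f2 : ∑ i, ∑ j, A i j * (χ v * (1 / (g v + ε)) * (pd i g v * pd j g v)) =
        χ v * (1 / (g v + ε)) * quad A fun i => pd i g v := by
      simp only [quad, Finset.mul_sum]
      exact Finset.sum_congr rfl fun i _ => Finset.sum_congr rfl fun j _ => by ring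
    have f3 : quad A (fun i => X i v) = (χ v * (1 / (g v + ε))) ^ 2 * quad A fun i => pd i g v :=
      quad_const_mul A _ _
    have f4 : quad A (fun i => Y i v) = s v ^ 2 * quad A fun i => pd i χ v :=
      quad_const_mul A _ _
    have f5 := mul_le_mul_of_nonneg_left
      (quad_add_le hAs hA0 hκ (fun i => X i v) fun i => Y i v) (h0 v)
    have hχ0 : 0 ≤ χ v := cutoff_nonneg R v
    have hχ1' : χ v ≤ 1 := cutoff_le_one R v
    have f6 : g v * (χ v * (1 / (g v + ε))) ^ 2 ≤ χ v * (1 / (g v + ε)) := by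
      have h1 : g v * (1 / (g v + ε)) ≤ 1 := by
        rw [mul_one_div, div_le_one (hgε v)]; linarith
      have h2 : 0 ≤ 1 / (g v + ε) := one_div_nonneg.2 (hgε v).le
      have h3 : g v * (1 / (g v + ε)) * χ v ≤ 1 :=
        mul_le_one₀ h1 hχ0 hχ1'
      calc g v * (χ v * (1 / (g v + ε))) ^ 2
          = (g v * (1 / (g v + ε)) * χ v) * (χ v * (1 / (g v + ε))) := by ring
        _ ≤ 1 * (χ v * (1 / (g v + ε))) :=
            mul_le_mul_of_nonneg_right h3 (mul_nonneg hχ0 h2)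
        _ = _ := one_mul _
    have f7 : quad A (fun i => pd i χ v) ≤ c * ‖v‖ ^ 2 := by
      have h1 : ∀ i j, A i j * (pd i χ v * pd j χ v) ≤
          (a * convConst d γ B) * (L * (‖v‖ ^ 2 / R ^ 2)) := by
        intro i j
        have h2 := abs_diffusion_le hp ha hg v i j
        have h3 : |pd i χ v| * |pd j χ v| * (1 + ‖v‖) ^ 2 ≤ L * (‖v‖ ^ 2 / R ^ 2) := by
          have h4 := (hL R hR v).2.2 i
          have h5 := (hL R hR v).2.2 j
          have h6 : |pd i χ v| * |pd j χ v| ≤ (|pd i χ v| ^ 2 + |pd j χ v| ^ 2) / 2 := by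
            nlinarith [sq_nonneg (|pd i χ v| - |pd j χ v|)]
          have h7 := mul_le_mul_of_nonneg_right h6 (by positivity : 0 ≤ (1 + ‖v‖) ^ 2)
          have h8 : (|pd i χ v| ^ 2 + |pd j χ v| ^ 2) / 2 * (1 + ‖v‖) ^ 2 =
            (|pd i χ v| ^ 2 * (1 + ‖v‖) ^ 2 + |pd j χ v| ^ 2 * (1 + ‖v‖) ^ 2) / 2 := by ring
          linarith
        calc A i j * (pd i χ v * pd j χ v) ≤ |A i j * (pd i χ v * pd j χ v)| := le_abs_self _
          _ = |A i j| * (|pd i χ v| * |pd j χ v|) := by rw [abs_mul, abs_mul]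
          _ ≤ a * convConst d γ B * (1 + ‖v‖) ^ 2 * (|pd i χ v| * |pd j χ v|) :=
              mul_le_mul_of_nonneg_right h2 (by positivity)
          _ = a * convConst d γ B * (|pd i χ v| * |pd j χ v| * (1 + ‖v‖) ^ 2) := by ring
          _ ≤ _ := mul_le_mul_of_nonneg_left h3 (by positivity)
      have h9 := Finset.sum_le_sum fun i (_ : i ∈ (Finset.univ : Finset (Fin d))) =>
        Finset.sum_le_sum fun j (_ : j ∈ (Finset.univ : Finset (Fin d))) => h1 i j
      simp only [Finset.sum_const, Finset.card_univ, Fintype.card_fin, nsmul_eq_mul] at h9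
      refine h9.trans (le_of_eq ?_)
      rw [hc]; ring
    have f8 : g v * (s v ^ 2 * quad A fun i => pd i χ v) ≤ c * (‖v‖ ^ 2 * g v) := by
      have h1 : s v ^ 2 ≤ 1 := pow_le_one₀ (hs01 v).1 (hs01 v).2
      have h2 : s v ^ 2 * quad A (fun i => pd i χ v) ≤ c * ‖v‖ ^ 2 :=
        (mul_le_of_le_one_left (hA0 _) h1).trans f7
      calc _ ≤ g v * (c * ‖v‖ ^ 2) := mul_le_mul_of_nonneg_left h2 (h0 v)
        _ = _ := by ring
    rw [f1, f2]
    rw [f3, f4] at f5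
    have f9 := mul_le_mul_of_nonneg_right f6 (hA0 fun i => pd i g v)
    have hκ1 : 0 ≤ 1 / κ := by positivity
    have g1 := mul_le_mul_of_nonneg_left f9 (by linarith : 0 ≤ 1 + κ)
    have g2 := mul_le_mul_of_nonneg_left f8 (by linarith : 0 ≤ 1 + 1 / κ)
    calc _ ≤ _ := f5
      _ = (1 + κ) * (g v * (χ v * (1 / (g v + ε))) ^ 2 * quad A fun i => pd i g v) +
          (1 + 1 / κ) * (g v * (s v ^ 2 * quad A fun i => pd i χ v)) := by ring
      _ ≤ _ := add_le_add g1 g2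
  rw [s1, s2]
  have hmono := integral_mono I1 ((I2.const_mul (1 + κ)).add (I3.const_mul (1 + 1 / κ))) hpt
  have hsplit := integral_add (I2.const_mul (1 + κ)) (I3.const_mul (1 + 1 / κ))
  rw [integral_const_mul, integral_const_mul, integral_const_mul] at hsplit
  refine hmono.trans ?_
  refine (le_of_eq hsplit).trans ?_
  have he : ∫ v, ‖v‖ ^ 2 * g v ≤ B := by
    refine le_trans (le_of_eq ?_) hg.energy
    exact integral_congr_ae (Eventually.of_forall fun v => by
      simp only [abs_of_nonneg (h0 v)])
  have h3 : c * ∫ v, ‖v‖ ^ 2 * g v ≤ d * d * (a * convConst d γ B) * L * B / R ^ 2 := by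
    have hc0 : 0 ≤ c := by rw [hc]; positivity
    calc _ ≤ c * B := mul_le_mul_of_nonneg_left he hc0
      _ = _ := by rw [hc]; ring
  have hκ1 : 0 ≤ 1 + 1 / κ := by positivity
  exact add_le_add le_rfl (mul_le_mul_of_nonneg_left h3 hκ1)

end

end

section

/-! ### The H-theorem -/

variable {d : ℕ} {a γ B : ℝ} {g : Vel d → ℝ} {S : EReal} {f : ℝ → Vel d → ℝ}

theorem measurable_slowPart (ε : ℝ) : Measurable (slowPart ε) :=
  measurable_const.mul ((measurable_const.add (measurable_id.div_const ε)).log)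

theorem measurable_regEnt (ε : ℝ) : Measurable (regEnt ε) :=
  ((measurable_id.add_const ε).mul ((measurable_const.add (measurable_id.div_const ε)).log)).sub
    measurable_id

theorem Dens.integrable_slowPart (hg : Dens B g) (h0 : ∀ v, 0 ≤ g v) {ε : ℝ} (hε : 0 < ε) :
    Integrable fun v => slowPart ε (g v) :=
  hg.int.mono' ((measurable_slowPart ε).comp hg.meas).aestronglyMeasurable
    (Eventually.of_forall fun v => by
      rw [Real.norm_of_nonneg (slowPart_nonneg hε (h0 v))]; exact slowPart_le hε (h0 v))

/-- The slow part of a density vanishes with `ε`, at a rate depending on mass and energy only. -/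
theorem exists_integral_slowPart_le (d : ℕ) (hB : 0 ≤ B) {η : ℝ} (hη : 0 < η) :
    ∃ ε₀ : ℝ, 0 < ε₀ ∧ ∀ ε, 0 < ε → ε ≤ ε₀ → ∀ g : Vel d → ℝ, Dens B g → (∀ v, 0 ≤ g v) →
      ∫ v, slowPart ε (g v) ≤ η := by
  obtain ⟨ρ, hρ0, hρ⟩ : ∃ ρ : ℝ, 0 < ρ ∧ B / ρ ^ 2 ≤ η / 2 := by
    refine ⟨Real.sqrt (2 * B / η) + 1, by positivity, ?_⟩
    rw [div_le_iff₀ (by positivity)]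
    have h1 := Real.sq_sqrt (by positivity : 0 ≤ 2 * B / η)
    have h2 : 2 * B / η ≤ (Real.sqrt (2 * B / η) + 1) ^ 2 := by
      nlinarith [Real.sqrt_nonneg (2 * B / η)]
    rw [div_le_iff₀ hη] at h2
    linarith
  set V : ℝ := volume.real (Metric.ball (0 : Vel d) ρ) with hV
  have hV0 : 0 ≤ V := measureReal_nonneg
  refine ⟨(η / (2 * (V + B + 1))) ^ 2, by positivity, fun ε hε hεε g hg h0 => ?_⟩
  have hsq : Real.sqrt ε ≤ η / (2 * (V + B + 1)) :=
    (Real.sqrt_le_left (by positivity)).2 hεε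
  have hpt : ∀ v, slowPart ε (g v) ≤
      (Metric.ball (0 : Vel d) ρ).indicator (fun _ => Real.sqrt ε) v + Real.sqrt ε * g v +
        1 / ρ ^ 2 * (‖v‖ ^ 2 * g v) := fun v => by
    have hg0 := h0 v
    by_cases hv : v ∈ Metric.ball (0 : Vel d) ρ
    · rw [Set.indicator_of_mem hv]
      have := slowPart_le_sqrt hε (h0 v)
      have : 0 ≤ 1 / ρ ^ 2 * (‖v‖ ^ 2 * g v) := by positivity
      linarith
    · rw [Set.indicator_of_notMem hv]
      have h1 := slowPart_le hε (h0 v)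
      have h2 : ρ ≤ ‖v‖ := by simpa using hv
      have h3 : ρ ^ 2 ≤ ‖v‖ ^ 2 := pow_le_pow_left₀ hρ0.le h2 2
      have h4 : g v ≤ 1 / ρ ^ 2 * (‖v‖ ^ 2 * g v) := by
        rw [one_div_mul_eq_div, le_div_iff₀ (by positivity)]
        nlinarith
      have : 0 ≤ Real.sqrt ε * g v := by positivity
      linarith
  have j1 : Integrable ((Metric.ball (0 : Vel d) ρ).indicator fun _ => Real.sqrt ε) :=
    (integrable_indicator_iff measurableSet_ball).2
      (integrableOn_const measure_ball_lt_top.ne)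
  have j2 := hg.int.const_mul (Real.sqrt ε)
  have j3 := hg.int2.const_mul (1 / ρ ^ 2)
  have hmono := integral_mono (hg.integrable_slowPart h0 hε) ((j1.add j2).add j3) hpt
  have e1 : ∫ v, ((Metric.ball (0 : Vel d) ρ).indicator (fun _ => Real.sqrt ε) v +
      Real.sqrt ε * g v + 1 / ρ ^ 2 * (‖v‖ ^ 2 * g v)) =
      V * Real.sqrt ε + Real.sqrt ε * (∫ v, g v) + 1 / ρ ^ 2 * ∫ v, ‖v‖ ^ 2 * g v := by
    rw [integral_add (j1.fun_add j2) j3, integral_add j1 j2, integral_const_mul, integral_const_mul,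
      integral_indicator measurableSet_ball, setIntegral_const]
    rfl
  refine (hmono.trans e1.le).trans ?_
  have m1 : ∫ v, g v ≤ B := le_trans (le_of_eq (integral_congr_ae
    (Eventually.of_forall fun v => (abs_of_nonneg (h0 v)).symm))) hg.mass
  have m2 : ∫ v, ‖v‖ ^ 2 * g v ≤ B := le_trans (le_of_eq (integral_congr_ae
    (Eventually.of_forall fun v => by simp only [abs_of_nonneg (h0 v)]))) hg.energy
  have m3 : Real.sqrt ε * (∫ v, g v) ≤ Real.sqrt ε * B :=
    mul_le_mul_of_nonneg_left m1 (Real.sqrt_nonneg _)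
  have m4 : 1 / ρ ^ 2 * ∫ v, ‖v‖ ^ 2 * g v ≤ 1 / ρ ^ 2 * B :=
    mul_le_mul_of_nonneg_left m2 (by positivity)
  have m5 : Real.sqrt ε * (V + B) ≤ η / 2 := by
    have h1 := mul_le_mul_of_nonneg_right hsq (by positivity : 0 ≤ V + B)
    have h2 : η / (2 * (V + B + 1)) * (V + B) ≤ η / 2 := by
      rw [div_mul_eq_mul_div, div_le_div_iff₀ (by positivity) two_pos]
      nlinarith
    linarith
  have m6 : 1 / ρ ^ 2 * B = B / ρ ^ 2 := by ring
  linarith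

theorem Dens.integrable_regEnt (hg : Dens B g) (h0 : ∀ v, 0 ≤ g v) {ε : ℝ} (hε : 0 < ε) :
    Integrable fun v => regEnt ε (g v) :=
  (hg.int.const_mul (B / ε)).mono' ((measurable_regEnt ε).comp hg.meas).aestronglyMeasurable
    (Eventually.of_forall fun v => by
      rw [Real.norm_of_nonneg (regEnt_nonneg hε (h0 v))]
      refine (regEnt_le hε (h0 v)).trans (mul_le_mul_of_nonneg_right ?_ (h0 v))
      have := (le_abs_self _).trans (hg.bdd v)
      gcongr)

/-- The growth rate of the truncated regularized entropy is small. The reaction term is `∫ c[G] g`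
for `G = entPart ε R g`; the part `∫ c[G] G` is absorbed by the dissipation, and `g - G` is the slow
part of the density, up to the tail. -/
theorem exists_deriv_entropy_le (hp : Params d γ) (ha : 0 ≤ a) (hB : 0 ≤ B) :
    ∃ C : ℝ, 0 ≤ C ∧ ∀ (R ε : ℝ) (g : Vel d → ℝ), 1 ≤ R → 0 < ε → Dens B g →
      ContDiff ℝ 1 g → (∀ v, 0 ≤ g v) →
      -dissipation a γ g g (fun v => cutoff R v * (1 / (g v + ε)))
        + testFlux a γ g (fun v => regEnt ε (g v)) (cutoff R)
        + ∫ v, reaction a γ g v *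
          (cutoff R v * (g v * Real.log (1 + g v / ε) - regEnt ε (g v))) ≤
      C * (1 + 1 / ε) / R + C * ∫ v, slowPart ε (g v) := by
  obtain ⟨C1, hC1, h1⟩ := exists_integral_reaction_mul_entPart_le (d := d) hp ha hB
  obtain ⟨C2, hC2, h2⟩ := exists_testFlux_bound (d := d) hp ha hB
  set C3 := d * d * a * convConst d γ B with hC3d
  have hC3 : 0 ≤ C3 := by have := convConst_nonneg (d := d) (γ := γ) hB; positivity
  refine ⟨C3 * B + 2 * C1 + C2 * B + C3 * B + C3, by positivity,
    fun R ε g hR hε hg hg1 h0 => ?_⟩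
  have hR0 : 0 < R := by linarith
  set D := dissipation a γ g g (fun v => cutoff R v * (1 / (g v + ε))) with hD
  set G := entPart ε R g with hG
  have hGd : Dens B G := dens_entPart hε hg hg1 h0
  have hGc : Continuous G := (contDiff_entPart hε R hg1 h0).continuous
  have hGs : HasCompactSupport G := hasCompactSupport_entPart hR0
  have hG0 : ∀ v, 0 ≤ G v := entPart_nonneg hε R h0
  have hGle : ∀ v, G v ≤ g v := entPart_le hε R h0
  have b1 := h1 R ε (1 / R) g hR hε (by positivity) hg hg1 h0
  have b2 := h2 R hR g (fun v => regEnt ε (g v)) (B / ε) (by positivity) hg fun v => by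
    rw [abs_of_nonneg (regEnt_nonneg hε (h0 v)), abs_of_nonneg (h0 v)]
    refine (regEnt_le hε (h0 v)).trans (mul_le_mul_of_nonneg_right ?_ (h0 v))
    have := (le_abs_self _).trans (hg.bdd v)
    gcongr
  have e1 : ∀ v, cutoff R v * (g v * Real.log (1 + g v / ε) - regEnt ε (g v)) = G v := fun v => by
    simp only [hG, entPart, regEnt, slowPart]; ring
  simp only [e1]
  rw [integral_reaction_mul_symm hp hg hGc hGs]
  have hr : ∀ v, |reaction a γ G v| ≤ C3 := abs_reaction_le hp ha hGd
  have mG : ∫ v, G v ≤ B := le_trans (le_of_eq (integral_congr_ae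
    (Eventually.of_forall fun v => (abs_of_nonneg (hG0 v)).symm))) hGd.mass
  have iGG : Integrable fun v => reaction a γ G v * G v :=
    integrable_reaction_mul hp hGd hGc hGs
  have iGg : Integrable fun v => reaction a γ G v * g v := by
    have h := integrable_conv_mul hp.dim hp.pos (by norm_num) (kernelBound_rpow hp.mem) hGd
      (ψ := g) hg.int (by simpa using hg.int)
    refine (h.const_mul (((d : ℝ) - 1) * ((d : ℝ) + γ) * a)).congr
      (Eventually.of_forall fun v => ?_)
    simp only [reaction_eq]; ring
  set I := ∫ v, reaction a γ G v * G v with hI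
  have hIle : I ≤ C3 * B := by
    calc I ≤ ∫ v, C3 * G v := integral_mono iGG (hGd.int.const_mul _) fun v =>
          mul_le_mul_of_nonneg_right ((le_abs_self _).trans (hr v)) (hG0 v)
      _ = C3 * ∫ v, G v := integral_const_mul _ _
      _ ≤ _ := mul_le_mul_of_nonneg_left mG hC3
  have iW : Integrable fun v => 1 / R ^ 2 * (‖v‖ ^ 2 * g v) := hg.int2.const_mul _
  have iS := hg.integrable_slowPart h0 hε
  have hgG : ∀ v, g v - G v ≤ slowPart ε (g v) + 1 / R ^ 2 * (‖v‖ ^ 2 * g v) := fun v => by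
    have h3 := one_sub_cutoff_le hR0 v
    have h4 := slowPart_nonneg hε (h0 v)
    have h5 := slowPart_le hε (h0 v)
    have h6 := cutoff_le_one R v
    have h7 : (1 - cutoff R v) * (g v - slowPart ε (g v)) ≤ ‖v‖ ^ 2 / R ^ 2 * g v :=
      mul_le_mul h3 (by linarith) (by linarith) (by positivity)
    have h8 : ‖v‖ ^ 2 / R ^ 2 * g v = 1 / R ^ 2 * (‖v‖ ^ 2 * g v) := by ring
    simp only [hG, entPart]
    nlinarith
  have hJ : ∫ v, reaction a γ G v * g v ≤ I + C3 * ((∫ v, slowPart ε (g v)) + B / R ^ 2) := by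
    have hm := integral_mono iGg (iGG.add ((iS.add iW).const_mul C3)) (fun v => by
      have h3 : reaction a γ G v * (g v - G v) ≤ C3 * (g v - G v) :=
        mul_le_mul_of_nonneg_right ((le_abs_self _).trans (hr v)) (sub_nonneg.2 (hGle v))
      have h4 := mul_le_mul_of_nonneg_left (hgG v) hC3
      show reaction a γ G v * g v ≤ reaction a γ G v * G v +
        C3 * (slowPart ε (g v) + 1 / R ^ 2 * (‖v‖ ^ 2 * g v))
      nlinarith)
    have e2 : ∫ v, (reaction a γ G v * G v +
        C3 * (slowPart ε (g v) + 1 / R ^ 2 * (‖v‖ ^ 2 * g v))) =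
        I + C3 * ((∫ v, slowPart ε (g v)) + 1 / R ^ 2 * ∫ v, ‖v‖ ^ 2 * g v) := by
      rw [integral_add iGG ((iS.fun_add iW).const_mul C3), integral_const_mul, integral_add iS iW,
        integral_const_mul]
    have m2 : ∫ v, ‖v‖ ^ 2 * g v ≤ B := le_trans (le_of_eq (integral_congr_ae
      (Eventually.of_forall fun v => by simp only [abs_of_nonneg (h0 v)]))) hg.energy
    have m4 : 1 / R ^ 2 * ∫ v, ‖v‖ ^ 2 * g v ≤ B / R ^ 2 := by
      calc _ ≤ 1 / R ^ 2 * B := mul_le_mul_of_nonneg_left m2 (by positivity)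
        _ = _ := by ring
    have := mul_le_mul_of_nonneg_left m4 hC3
    refine (hm.trans e2.le).trans ?_
    linarith
  have hRR : 1 / R ^ 2 ≤ 1 / R := by
    refine one_div_le_one_div_of_le hR0 ?_
    nlinarith
  have hRi : 0 < 1 / R := by positivity
  -- `I ≤ (1 + 1/R) D + …` and `I` is bounded, so that `D` absorbs `I` up to `O(1/R)`
  have k1 : I - D ≤ (C3 * B + 2 * C1) / R := by
    have h3 : (1 + 1 / (1 / R)) * (C1 / R ^ 2) = (1 + 1 / R) * (C1 / R) := by
      field_simp; ring
    rw [h3] at b1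
    have h4 : I ≤ (1 + 1 / R) * (D + C1 / R) := by linarith
    have h5 : I - 1 / R * I ≤ D + C1 / R := by
      by_cases h6 : 0 ≤ D + C1 / R
      · have h7 := mul_le_mul_of_nonneg_left h4 (by
          rw [sub_nonneg, div_le_one hR0]; exact hR : (0 : ℝ) ≤ 1 - 1 / R)
        have h8 : (1 - 1 / R) * ((1 + 1 / R) * (D + C1 / R)) =
          (D + C1 / R) - (1 / R) ^ 2 * (D + C1 / R) := by ring
        have h9 : 0 ≤ (1 / R) ^ 2 * (D + C1 / R) := by positivity
        linarith
      · push Not at h6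
        have h7 : I < 0 := lt_of_le_of_lt h4 (mul_neg_of_pos_of_neg (by positivity) h6)
        have h8 : (1 + 1 / R) * (D + C1 / R) ≤ 1 * (D + C1 / R) :=
          mul_le_mul_of_nonpos_right (by linarith) h6.le
        have h10 : ∀ v, 0 ≤ reaction a γ G v * G v := fun v => by
          refine mul_nonneg ?_ (hG0 v)
          rw [reaction_eq]
          have hd : (2 : ℝ) ≤ d := by exact_mod_cast hp.dim
          refine mul_nonneg (mul_nonneg (mul_nonneg (by linarith) hp.pos.le) ha) ?_
          exact integral_nonneg fun w => mul_nonneg (Real.rpow_nonneg (norm_nonneg _) _) (hG0 _)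
        exact absurd (integral_nonneg h10) (not_le.2 h7)
    have h6 : 1 / R * I ≤ 1 / R * (C3 * B) := mul_le_mul_of_nonneg_left hIle hRi.le
    have h7 : (C3 * B + 2 * C1) / R = 1 / R * (C3 * B) + C1 / R + C1 / R := by ring
    have h8 : 0 ≤ C1 / R := by positivity
    linarith
  have k2 : C2 * (B / ε) / R ^ 2 ≤ C2 * B * (1 / ε) / R := by
    have : 0 ≤ C2 * B * (1 / ε) := by positivity
    calc C2 * (B / ε) / R ^ 2 = C2 * B * (1 / ε) * (1 / R ^ 2) := by ring
      _ ≤ C2 * B * (1 / ε) * (1 / R) := mul_le_mul_of_nonneg_left hRR this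
      _ = _ := by ring
  have k3 : C3 * (B / R ^ 2) ≤ C3 * B / R := by
    calc C3 * (B / R ^ 2) = C3 * B * (1 / R ^ 2) := by ring
      _ ≤ C3 * B * (1 / R) := mul_le_mul_of_nonneg_left hRR (by positivity)
      _ = _ := by ring
  have hS0 : 0 ≤ ∫ v, slowPart ε (g v) := integral_nonneg fun v => slowPart_nonneg hε (h0 v)
  have b2' := (le_abs_self _).trans b2
  have hfin : (C3 * B + 2 * C1) / R + C2 * B * (1 / ε) / R + C3 * B / R +
      C3 * (∫ v, slowPart ε (g v)) ≤
      (C3 * B + 2 * C1 + C2 * B + C3 * B + C3) * (1 + 1 / ε) / R +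
      (C3 * B + 2 * C1 + C2 * B + C3 * B + C3) * ∫ v, slowPart ε (g v) := by
    have q1 : 0 ≤ 1 / ε := by positivity
    have q2 : (C3 * B + 2 * C1 + C2 * B + C3 * B + C3) * (1 + 1 / ε) / R =
        (C3 * B + 2 * C1) / R + C2 * B * (1 / ε) / R + C3 * B / R +
        ((C3 * B + 2 * C1 + C3 * B + C3) * (1 / ε) + C2 * B + C3) / R := by ring
    have q3 : 0 ≤ ((C3 * B + 2 * C1 + C3 * B + C3) * (1 / ε) + C2 * B + C3) / R := by positivity
    have q4 : 0 ≤ (C3 * B + 2 * C1 + C2 * B + C3 * B) * ∫ v, slowPart ε (g v) := by positivity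
    rw [q2]
    linarith
  linarith

/-- **H-theorem**: the entropy does not increase. -/
theorem IsClassicalSolution.entropy_le (hp : Params d γ) (ha : 0 ≤ a)
    (hf : IsClassicalSolution a γ S f) {t₁ t₂ : ℝ} (h1 : 0 < t₁) (h12 : t₁ ≤ t₂)
    (h2 : (t₂ : EReal) < S) : entropy (f t₂) ≤ entropy (f t₁) := by
  obtain ⟨B, hB⟩ := hf.dens h1 h2
  have m1 : t₁ ∈ Set.Icc t₁ t₂ := ⟨le_rfl, h12⟩
  have m2 : t₂ ∈ Set.Icc t₁ t₂ := ⟨h12, le_rfl⟩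
  have hB0 : 0 ≤ B := (hB t₁ m1).nonneg_const
  have hpos : ∀ t ∈ Set.Icc t₁ t₂, 0 < t ∧ (t : EReal) < S := fun t ht =>
    ⟨h1.trans_le ht.1, coe_lt_of_le ht.2 h2⟩
  have h0 : ∀ t ∈ Set.Icc t₁ t₂, ∀ v, 0 ≤ f t v := fun t ht =>
    hf.nonneg t (hpos t ht).1.le (hpos t ht).2
  obtain ⟨C, hC0, hC⟩ := exists_deriv_entropy_le (d := d) hp ha hB0
  have hreg : ∀ η : ℝ, 0 < η → ∃ ε₀ : ℝ, 0 < ε₀ ∧ ∀ ε, 0 < ε → ε ≤ ε₀ →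
      (∫ v, regEnt ε (f t₂ v)) - (∫ v, regEnt ε (f t₁ v)) ≤ C * η * (t₂ - t₁) := by
    intro η hη
    obtain ⟨ε₀, hε₀, hs⟩ := exists_integral_slowPart_le d hB0 hη
    refine ⟨ε₀, hε₀, fun ε hε hεε => ?_⟩
    have hder : ∀ n : ℕ, ∀ t ∈ Set.Icc t₁ t₂, HasDerivAt
        (fun t => ∫ v, cutoff ((n : ℝ) + 1) v * regEnt ε (f t v)) _ t := fun n t ht =>
      hf.hasDerivAt_integral_test hp (hpos t ht).1 (hpos t ht).2
        (k := regEnt ε) (k' := fun x => Real.log (1 + x / ε)) (k'' := fun x => 1 / (x + ε))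
        (fun x hx => hasDerivAt_regEnt hε hx) (fun x hx => hasDerivAt_log_one_add_div hε hx)
        (continuousOn_const.div (continuousOn_id.add continuousOn_const) fun x hx => by
          have : 0 ≤ x := hx
          positivity)
        (contDiff_cutoff _) (hasCompactSupport_cutoff (by positivity))
    have hineq : ∀ n : ℕ, (∫ v, cutoff ((n : ℝ) + 1) v * regEnt ε (f t₂ v)) -
        (∫ v, cutoff ((n : ℝ) + 1) v * regEnt ε (f t₁ v)) ≤
        (C * (1 + 1 / ε) / ((n : ℝ) + 1) + C * η) * (t₂ - t₁) := fun n => by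
      refine Convex.image_sub_le_mul_sub_of_deriv_le (convex_Icc t₁ t₂)
        (fun t ht => (hder n t ht).continuousAt.continuousWithinAt)
        (fun t ht => (hder n t (interior_subset ht)).differentiableAt.differentiableWithinAt)
        (fun t ht => ?_) t₁ m1 t₂ m2 h12
      have ht' := interior_subset ht
      rw [(hder n t ht').deriv]
      refine (hC ((n : ℝ) + 1) ε (f t) (by simp) hε (hB t ht')
        ((hf.contDiff_velocity t (hpos t ht').1 (hpos t ht').2).of_le (by norm_num))
        (h0 t ht')).trans ?_
      have := mul_le_mul_of_nonneg_left (hs ε hε hεε (f t) (hB t ht') (h0 t ht')) hC0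
      linarith
    have l1 := (tendsto_integral_cutoff_mul ((hB t₂ m2).integrable_regEnt (h0 t₂ m2) hε)).sub
      (tendsto_integral_cutoff_mul ((hB t₁ m1).integrable_regEnt (h0 t₁ m1) hε))
    have l2 : Tendsto (fun n : ℕ => (C * (1 + 1 / ε) / ((n : ℝ) + 1) + C * η) * (t₂ - t₁)) atTop
        (𝓝 ((0 + C * η) * (t₂ - t₁))) := by
      refine Tendsto.mul_const _ (Tendsto.add_const _ ?_)
      have := (tendsto_one_div_add_atTop_nhds_zero_nat (𝕜 := ℝ)).const_mul (C * (1 + 1 / ε))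
      rw [mul_zero] at this
      exact this.congr fun n => by ring
    rw [zero_add] at l2
    exact le_of_tendsto_of_tendsto' l1 l2 hineq
  -- remove the regularization
  have hexc : Tendsto (fun n : ℕ => ∫ v, entExcess (1 / ((n : ℝ) + 1)) (f t₁ v)) atTop (𝓝 0) := by
    have hfin := hf.finite t₁ h1.le (hpos t₁ m1).2
    have hBt := hB t₁ m1
    have hx := h0 t₁ m1
    have hn : ∀ n : ℕ, 0 < 1 / ((n : ℝ) + 1) := fun n => by positivity
    have hn1 : ∀ n : ℕ, 1 / ((n : ℝ) + 1) ≤ 1 := fun n => by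
      rw [div_le_one (by positivity)]; simp
    have := tendsto_integral_of_dominated_convergence
      (F := fun (n : ℕ) v => entExcess (1 / ((n : ℝ) + 1)) (f t₁ v)) (f := fun _ => (0 : ℝ))
      (fun v => B * f t₁ v - f t₁ v * Real.log (f t₁ v) + f t₁ v)
      (fun n => ?_) (((hBt.int.const_mul B).sub hfin.entropy).add hBt.int)
      (fun n => Eventually.of_forall fun v => ?_) (Eventually.of_forall fun v => ?_)
    · simpa using this
    · have hm := hBt.meas
      exact (((measurable_regEnt _).comp hm).sub (((hm.mul hm.log).sub
        (hm.mul_const _)).sub hm)).aestronglyMeasurable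
    · rw [Real.norm_of_nonneg (entExcess_nonneg (hn n) (hx v))]
      refine (entExcess_le_of_le_one (hn n) (hn1 n) (hx v)).trans ?_
      have := mul_le_mul_of_nonneg_right ((le_abs_self _).trans (hBt.bdd v)) (hx v)
      linarith
    · have l := (tendsto_one_div_add_atTop_nhds_zero_nat (𝕜 := ℝ))
      have l2 := (Real.continuous_sqrt.tendsto 0).comp l
      rw [Real.sqrt_zero] at l2
      have l3 := l.add (l2.mul_const (1 + f t₁ v))
      rw [zero_mul, add_zero] at l3
      refine squeeze_zero (fun n => entExcess_nonneg (hn n) (hx v)) (fun n => ?_) l3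
      exact entExcess_le (hn n) (hx v)
  have hsplit : ∀ t ∈ Set.Icc t₁ t₂, ∀ ε : ℝ, 0 < ε → ∫ v, regEnt ε (f t v) =
      (∫ v, entExcess ε (f t v)) + (entropy (f t) - mass (f t) * Real.log ε - mass (f t)) := by
    intro t ht ε hε
    have hfin := (hf.finite t (hpos t ht).1.le (hpos t ht).2).entropy
    have i1 : Integrable fun v => f t v * Real.log (f t v) - f t v * Real.log ε - f t v :=
      (hfin.sub ((hB t ht).int.mul_const _)).sub (hB t ht).int
    have i0 : Integrable fun v => f t v * Real.log (f t v) - f t v * Real.log ε :=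
      hfin.sub ((hB t ht).int.mul_const _)
    have i2 : Integrable fun v => entExcess ε (f t v) :=
      ((hB t ht).integrable_regEnt (h0 t ht) hε).sub i1
    have e : ∫ v, regEnt ε (f t v) = ∫ v, (entExcess ε (f t v) +
        (f t v * Real.log (f t v) - f t v * Real.log ε - f t v)) :=
      integral_congr_ae (Eventually.of_forall fun v => by simp only [entExcess]; ring)
    rw [e, integral_add i2 i1, integral_sub i0 (hB t ht).int,
      integral_sub hfin ((hB t ht).int.mul_const _), integral_mul_const]
    rfl
  have hmass := hf.mass_eq hp ha h1 h12 h2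
  have hfinal : ∀ η : ℝ, 0 < η → entropy (f t₂) - entropy (f t₁) ≤ C * η * (t₂ - t₁) := by
    intro η hη
    obtain ⟨ε₀, hε₀, hr⟩ := hreg η hη
    have l := hexc.const_add (C * η * (t₂ - t₁))
    rw [add_zero] at l
    refine ge_of_tendsto l ?_
    filter_upwards [(tendsto_one_div_add_atTop_nhds_zero_nat (𝕜 := ℝ)).eventually
      (gt_mem_nhds hε₀)] with n hn
    have hn0 : 0 < 1 / ((n : ℝ) + 1) := by positivity
    have h3 := hr _ hn0 hn.le
    rw [hsplit t₂ m2 _ hn0, hsplit t₁ m1 _ hn0, hmass] at h3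
    have h4 : 0 ≤ ∫ v, entExcess (1 / ((n : ℝ) + 1)) (f t₂ v) :=
      integral_nonneg fun v => entExcess_nonneg hn0 (h0 t₂ m2 v)
    linarith
  have l : Tendsto (fun η : ℝ => C * η * (t₂ - t₁)) (𝓝[>] 0) (𝓝 (C * 0 * (t₂ - t₁))) :=
    (((continuous_const.mul continuous_id).mul continuous_const).tendsto 0).mono_left
      nhdsWithin_le_nhds
  rw [mul_zero, zero_mul] at l
  have := ge_of_tendsto l (eventually_mem_nhdsWithin.mono fun η hη => hfinal η hη)
  linarith

end

section

variable {d : ℕ} {a γ B : ℝ} {g : Vel d → ℝ} {S : EReal} {f : ℝ → Vel d → ℝ}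

/-! ### Hydrodynamic bounds down to the initial time -/

/-- A density whose mass, energy and entropy obey the given bounds. -/
structure Profile (M₁ M₀ E₀ H₀ : ℝ) (g : Vel d → ℝ) : Prop where
  nonneg : ∀ v, 0 ≤ g v
  finite : FiniteMassEnergyEntropy g
  dens : ∃ B, Dens B g
  le_mass : M₁ ≤ ∫ v, g v
  mass_le : ∫ v, g v ≤ M₀
  energy_le : ∫ v, ‖v‖ ^ 2 * g v ≤ E₀
  entropy_le : ∫ v, g v * Real.log (g v) ≤ H₀

/-- The conservation laws and the H-theorem hold between positive times; the convergence to the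
initial datum carries them to the time `0`. -/
theorem IsClassicalSolution.profile (hp : Params d γ) (ha : 0 ≤ a)
    (hf : IsClassicalSolution a γ S f) {M₁ M₀ E₀ H₀ : ℝ} (hM₁ : M₁ ≤ mass (f 0))
    (hM₀ : mass (f 0) ≤ M₀) (hE₀ : energy (f 0) ≤ E₀) (hH₀ : entropy (f 0) ≤ H₀) {t : ℝ}
    (ht : 0 < t) (hS : (t : EReal) < S) : Profile M₁ M₀ E₀ H₀ (f t) := by
  have h00 : FiniteMassEnergyEntropy (f 0) :=
    hf.finite 0 le_rfl (lt_of_le_of_lt (by exact_mod_cast ht.le) hS)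
  have hmem : ∀ᶠ s in 𝓝[>] (0 : ℝ), s ∈ Set.Ioc 0 t := Ioc_mem_nhdsGT ht
  have hw : ∀ s ∈ Set.Ioc 0 t, Integrable fun v => (1 + ‖v‖ ^ 2) * |f s v - f 0 v| := by
    intro s hs
    have h := hf.finite s hs.1.le (coe_lt_of_le hs.2 hS)
    have h1 := ((h.mass.sub h00.mass).add (h.energy.sub h00.energy)).abs
    refine h1.congr (Eventually.of_forall fun v => ?_)
    have : f s v - f 0 v + (‖v‖ ^ 2 * f s v - ‖v‖ ^ 2 * f 0 v) =
      (1 + ‖v‖ ^ 2) * (f s v - f 0 v) := by ring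
    simp only [Pi.add_apply, Pi.sub_apply, this, abs_mul]
    rw [abs_of_nonneg (by positivity : 0 ≤ 1 + ‖v‖ ^ 2)]
  have hmass : mass (f t) = mass (f 0) := by
    have l : Tendsto (fun s => |mass (f t) - mass (f 0)|) (𝓝[>] (0 : ℝ)) (𝓝 0) := by
      refine squeeze_zero' (Eventually.of_forall fun _ => abs_nonneg _) ?_ hf.initial
      filter_upwards [hmem] with s hs
      rw [hf.mass_eq hp ha hs.1 hs.2 hS]
      have h := hf.finite s hs.1.le (coe_lt_of_le hs.2 hS)
      unfold mass
      rw [← integral_sub h.mass h00.mass, ← Real.norm_eq_abs]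
      refine norm_integral_le_of_norm_le (hw s hs) (Eventually.of_forall fun v => ?_)
      rw [Real.norm_eq_abs]
      exact le_mul_of_one_le_left (abs_nonneg _) (by linarith [sq_nonneg ‖v‖])
    have := tendsto_nhds_unique tendsto_const_nhds l
    exact sub_eq_zero.1 (abs_eq_zero.1 this)
  have henergy : energy (f t) = energy (f 0) := by
    have l : Tendsto (fun s => |energy (f t) - energy (f 0)|) (𝓝[>] (0 : ℝ)) (𝓝 0) := by
      refine squeeze_zero' (Eventually.of_forall fun _ => abs_nonneg _) ?_ hf.initial
      filter_upwards [hmem] with s hs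
      rw [hf.energy_eq hp ha hs.1 hs.2 hS]
      have h := hf.finite s hs.1.le (coe_lt_of_le hs.2 hS)
      unfold energy
      rw [← integral_sub h.energy h00.energy, ← Real.norm_eq_abs]
      refine norm_integral_le_of_norm_le (hw s hs) (Eventually.of_forall fun v => ?_)
      rw [Real.norm_eq_abs, ← mul_sub, abs_mul, abs_of_nonneg (sq_nonneg ‖v‖)]
      exact mul_le_mul_of_nonneg_right (by linarith) (abs_nonneg _)
    have := tendsto_nhds_unique tendsto_const_nhds l
    exact sub_eq_zero.1 (abs_eq_zero.1 this)
  have hent : entropy (f t) ≤ entropy (f 0) := by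
    refine ge_of_tendsto hf.initial_entropy ?_
    filter_upwards [hmem] with s hs
    exact hf.entropy_le hp ha hs.1 hs.2 hS
  exact ⟨hf.nonneg t ht.le hS, hf.finite t ht.le hS, hf.dens_at ht hS, hM₁.trans hmass.ge,
    hmass.le.trans hM₀, henergy.le.trans hE₀, hent.trans hH₀⟩

/-! ### Nondegeneracy of the diffusion -/

/-- The negative part of `x log x` is controlled by `x s²` and a Gaussian in `s`. -/
theorem neg_two_mul_exp_le {x s : ℝ} (hx : 0 ≤ x) :
    0 ≤ x * Real.log x + x * s ^ 2 + 2 * Real.exp (-(1 / 2) * s ^ 2) := by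
  have he := Real.exp_pos (-(1 / 2) * s ^ 2)
  rcases hx.eq_or_lt with rfl | hx
  · simpa using he.le
  · set y := Real.sqrt x with hy
    have hy0 : 0 < y := Real.sqrt_pos.2 hx
    have hyx : y ^ 2 = x := Real.sq_sqrt hx.le
    by_cases h : Real.exp (-(1 / 2) * s ^ 2) ≤ y
    · have h1 : -(1 / 2) * s ^ 2 ≤ Real.log y := (Real.le_log_iff_exp_le hy0).2 h
      have h2 : Real.log x = 2 * Real.log y := by rw [← hyx, Real.log_pow]; norm_num
      rw [h2]
      nlinarith
    · push Not at h
      have h2 : Real.log x = 2 * Real.log y := by rw [← hyx, Real.log_pow]; norm_num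
      have h3 := Real.one_sub_inv_le_log_of_pos hy0
      have h4 : y ^ 2 * (1 - y⁻¹) = y ^ 2 - y := by field_simp
      have h5 := mul_le_mul_of_nonneg_left h3 (sq_nonneg y)
      rw [h2, ← hyx]
      nlinarith [mul_nonneg (sq_nonneg y) (sq_nonneg s), sq_nonneg y]

theorem excess_mul_log_le {x s m : ℝ} (hx : 0 ≤ x) (hm : 1 ≤ m) :
    max (x - m) 0 * Real.log m ≤
      x * Real.log x + x * s ^ 2 + 2 * Real.exp (-(1 / 2) * s ^ 2) := by
  by_cases h : x ≤ m
  · rw [max_eq_right (by linarith), zero_mul]; exact neg_two_mul_exp_le hx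
  · push Not at h
    rw [max_eq_left (by linarith)]
    have hl := Real.log_nonneg hm
    have h1 : Real.log m ≤ Real.log x := Real.log_le_log (by linarith) h.le
    have h2 : (x - m) * Real.log m ≤ x * Real.log x :=
      mul_le_mul (by linarith) h1 hl hx
    have := Real.exp_pos (-(1 / 2) * s ^ 2)
    have : 0 ≤ x * s ^ 2 := by positivity
    linarith

theorem integrable_gaussian (d : ℕ) :
    Integrable fun v : Vel d => Real.exp (-(1 / 2) * ‖v‖ ^ 2) := by
  have := (GaussianFourier.integrable_cexp_neg_mul_sq_norm_add (V := Vel d)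
    (b := (1 / 2 : ℂ)) (by norm_num) 0 0).norm
  refine this.congr (Eventually.of_forall fun v => ?_)
  simp only [inner_zero_left, Complex.norm_exp]
  congr 1
  simp [← Complex.ofReal_pow]

variable {M₁ M₀ E₀ H₀ : ℝ}

theorem Profile.integrable_excess (hg : Profile M₁ M₀ E₀ H₀ g) {m : ℝ} (hm : 0 ≤ m) :
    Integrable fun v => max (g v - m) 0 := by
  obtain ⟨B, hB⟩ := hg.dens
  refine hB.int.mono' ((hB.meas.sub_const m).max measurable_const).aestronglyMeasurable
    (Eventually.of_forall fun v => ?_)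
  rw [Real.norm_of_nonneg (le_max_right _ _)]
  exact max_le (by linarith) (hg.nonneg v)

/-- The entropy bound makes densities uniformly integrable. -/
theorem exists_integral_excess_le (d : ℕ) (M₁ M₀ E₀ H₀ : ℝ) {η : ℝ} (hη : 0 < η) :
    ∃ m : ℝ, 1 ≤ m ∧ ∀ g : Vel d → ℝ, Profile M₁ M₀ E₀ H₀ g → ∫ v, max (g v - m) 0 ≤ η := by
  set G : ℝ := ∫ v : Vel d, Real.exp (-(1 / 2) * ‖v‖ ^ 2) with hG
  set C : ℝ := |H₀ + E₀ + 2 * G| with hC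
  have hC0 : 0 ≤ C := abs_nonneg _
  refine ⟨Real.exp (C / η + 1), Real.one_le_exp (by positivity), fun g hg => ?_⟩
  set L : ℝ := C / η + 1 with hL
  have hL0 : 0 < L := by positivity
  have i1 := hg.finite.entropy
  have i2 : Integrable fun v => g v * ‖v‖ ^ 2 := hg.finite.energy.congr
    (Eventually.of_forall fun v => mul_comm _ _)
  have i3 := (integrable_gaussian d).const_mul 2
  -- the level is `e ^ L`, and `(g - e ^ L)₊ L` is integrated with the help of `excess_mul_log_le`
  have hm := integral_mono ((hg.integrable_excess (Real.exp_pos L).le).mul_const L)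
    ((i1.fun_add i2).add i3) (fun v => by
      have := excess_mul_log_le (s := ‖v‖) (hg.nonneg v)
        (Real.one_le_exp hL0.le : 1 ≤ Real.exp L)
      rwa [Real.log_exp] at this)
  have e : ∫ v, (g v * Real.log (g v) + g v * ‖v‖ ^ 2 + 2 * Real.exp (-(1 / 2) * ‖v‖ ^ 2)) =
      (∫ v, g v * Real.log (g v)) + (∫ v, ‖v‖ ^ 2 * g v) + 2 * G := by
    rw [integral_add (i1.fun_add i2) i3, integral_add i1 i2, integral_const_mul]
    simp only [mul_comm (g _) (‖_‖ ^ 2)]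
    rfl
  rw [integral_mul_const] at hm
  have h1 : (∫ v, max (g v - Real.exp L) 0) * L ≤ C := by
    refine (hm.trans e.le).trans (le_trans ?_ (le_abs_self _))
    linarith [hg.entropy_le, hg.energy_le]
  have h2 : C ≤ η * L := by rw [hL, mul_add, mul_div_cancel₀ _ hη.ne']; linarith
  exact le_of_mul_le_mul_right (h1.trans h2) hL0

theorem Profile.setIntegral_le (hg : Profile M₁ M₀ E₀ H₀ g) {m : ℝ} (hm : 0 ≤ m) {A : Set (Vel d)}
    (hA : volume A ≠ ⊤) :
    ∫ v in A, g v ≤ m * volume.real A + ∫ v, max (g v - m) 0 := by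
  obtain ⟨B, hB⟩ := hg.dens
  have iE := hg.integrable_excess hm
  have h1 : ∫ v in A, g v ≤ ∫ v in A, (m + max (g v - m) 0) :=
    integral_mono hB.int.integrableOn ((integrableOn_const hA).add iE.integrableOn) fun v => by
      have := le_max_left (g v - m) 0; show g v ≤ m + max (g v - m) 0; linarith
  have iC : Integrable (fun _ => m) (volume.restrict A) := integrableOn_const hA
  rw [integral_add iC iE.integrableOn, setIntegral_const] at h1
  have h2 := setIntegral_le_integral (s := A) iE (Eventually.of_forall fun v => le_max_right _ _)
  rw [smul_eq_mul, mul_comm] at h1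
  linarith

/-- Thin slabs have uniformly small volume inside a ball: many disjoint translates fit into a
slightly larger ball. -/
theorem exists_slab_volume_le (d : ℕ) (ρ : ℝ) {η : ℝ} (hη : 0 < η) : ∃ δ : ℝ, 0 < δ ∧
    ∀ e : Vel d, ‖e‖ = 1 → ∀ s : ℝ,
      volume.real {y ∈ Metric.ball (0 : Vel d) ρ | |inner ℝ e y - s| < δ} ≤ η := by
  set V : ℝ := volume.real (Metric.ball (0 : Vel d) (ρ + 1)) with hV
  obtain ⟨n, hn⟩ := exists_nat_ge (V / η + 1)
  have hV0 : 0 ≤ V := measureReal_nonneg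
  have hn1 : (1 : ℝ) ≤ n := le_trans (by have := div_nonneg hV0 hη.le; linarith) hn
  have hn0 : (0 : ℝ) < n := by linarith
  refine ⟨1 / (2 * n), by positivity, fun e he s => ?_⟩
  set δ : ℝ := 1 / (2 * n) with hδ
  have hδ0 : 0 < δ := by positivity
  set A : Set (Vel d) := {y ∈ Metric.ball (0 : Vel d) ρ | |inner ℝ e y - s| < δ} with hA
  have hAm : MeasurableSet A := by
    have hcont : Measurable fun y : Vel d => |inner ℝ e y - s| :=
      ((continuous_const.inner continuous_id).sub continuous_const).abs.measurable
    exact measurableSet_ball.inter (measurableSet_lt hcont measurable_const)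
  set T : ℕ → Set (Vel d) := fun k => (fun y => y + (-(2 * δ * k)) • e) ⁻¹' A with hT
  have hTm : ∀ k, MeasurableSet (T k) := fun k => (measurable_add_const _) hAm
  have hTv : ∀ k, volume (T k) = volume A := fun k => measure_preimage_add_right _ _ _
  have hee : inner ℝ e e = (1 : ℝ) := by rw [real_inner_self_eq_norm_sq, he, one_pow]
  have hin : ∀ k, ∀ y ∈ T k, |inner ℝ e y - 2 * δ * k - s| < δ := fun k y hy => by
    have := hy.2
    rwa [inner_add_right, inner_smul_right, hee, mul_one, ← sub_eq_add_neg] at this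
  have hdisj : Set.PairwiseDisjoint (↑(Finset.range n)) T := by
    intro k _ l _ hkl
    refine Set.disjoint_left.2 fun y hk hl => hkl ?_
    have h1 := abs_lt.1 (hin k y hk)
    have h2 := abs_lt.1 (hin l y hl)
    have h3 : (k : ℝ) < l + 1 := by nlinarith
    have h4 : (l : ℝ) < k + 1 := by nlinarith
    have h5 : k < l + 1 := by exact_mod_cast h3
    have h6 : l < k + 1 := by exact_mod_cast h4
    omega
  have hsub : (⋃ k ∈ Finset.range n, T k) ⊆ Metric.ball (0 : Vel d) (ρ + 1) := by
    refine Set.iUnion₂_subset fun k hk y hy => ?_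
    have h1 := mem_ball_zero_iff.1 hy.1
    have hk' : (k : ℝ) ≤ n := by exact_mod_cast (Finset.mem_range.1 hk).le
    have h2 : ‖(-(2 * δ * k)) • e‖ ≤ 1 := by
      rw [norm_smul, he, mul_one, norm_neg, Real.norm_of_nonneg (by positivity)]
      calc 2 * δ * k ≤ 2 * δ * n := by gcongr
        _ = 1 := by rw [hδ]; field_simp
    rw [mem_ball_zero_iff]
    have h3 : ‖y‖ ≤ ‖y + (-(2 * δ * k)) • e‖ + ‖(-(2 * δ * k)) • e‖ := by
      have := norm_sub_le (y + (-(2 * δ * k)) • e) ((-(2 * δ * k)) • e)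
      rwa [add_sub_cancel_right] at this
    linarith
  have hfin : volume (Metric.ball (0 : Vel d) (ρ + 1)) ≠ ⊤ := measure_ball_lt_top.ne
  have hAv : volume A ≠ ⊤ := ((measure_mono fun y hy => hy.1).trans_lt
    (measure_ball_lt_top (x := (0 : Vel d)) (r := ρ))).ne
  have h1 := measure_mono (μ := volume) hsub
  rw [measure_biUnion_finset hdisj fun k _ => hTm k, Finset.sum_congr rfl fun k _ => hTv k,
    Finset.sum_const, Finset.card_range, nsmul_eq_mul] at h1
  have h2 := ENNReal.toReal_mono hfin h1
  rw [ENNReal.toReal_mul, ENNReal.toReal_natCast] at h2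
  change (n : ℝ) * volume.real A ≤ V at h2
  have h3 : V ≤ η * n := by
    have h4 := mul_le_mul_of_nonneg_left hn hη.le
    rw [mul_add, mul_div_cancel₀ _ hη.ne'] at h4
    linarith
  have h4 : volume.real A * n ≤ η * n := by linarith
  exact le_of_mul_le_mul_right h4 hn0

/-- `√(1 + |v|²)`. -/
def jap (v : Vel d) : ℝ := Real.sqrt (1 + ‖v‖ ^ 2)

theorem jap_sq (v : Vel d) : jap v ^ 2 = 1 + ‖v‖ ^ 2 := Real.sq_sqrt (by positivity)

theorem one_le_jap (v : Vel d) : 1 ≤ jap v :=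
  Real.one_le_sqrt.2 (by linarith [sq_nonneg ‖v‖])

theorem norm_le_jap (v : Vel d) : ‖v‖ ≤ jap v := Real.le_sqrt_of_sq_le (by linarith)

theorem jap_le (v : Vel d) : jap v ≤ 1 + ‖v‖ :=
  Real.sqrt_le_iff.2 ⟨by positivity, by nlinarith [norm_nonneg v]⟩

theorem jap_pos (v : Vel d) : 0 < jap v := by linarith [one_le_jap v]

theorem exists_unit_orthogonal (hd : 2 ≤ d) (ξ : Vel d) :
    ∃ e : Vel d, ‖e‖ = 1 ∧ inner ℝ ξ e = (0 : ℝ) := by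
  have h : (ℝ ∙ ξ)ᗮ ≠ ⊥ := by
    intro h
    rw [Submodule.orthogonal_eq_bot_iff] at h
    have h1 := finrank_span_le_card (R := ℝ) ({ξ} : Set (Vel d))
    rw [h, finrank_top, finrank_euclideanSpace_fin] at h1
    simp at h1
    omega
  obtain ⟨w, hw, hw0⟩ := Submodule.exists_mem_ne_zero_of_ne_bot h
  refine ⟨(‖w‖⁻¹ : ℝ) • w, ?_, ?_⟩
  · rw [norm_smul, norm_inv, norm_norm, inv_mul_cancel₀ (norm_ne_zero_iff.2 hw0)]
  · rw [inner_smul_right, Submodule.mem_orthogonal_singleton_iff_inner_right.1 hw, mul_zero]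

/-- `|z ∧ ξ|` is at least the product of `|ξ|` and of the component of `z` in a direction orthogonal
to `ξ`. -/
theorem sq_inner_mul_le {ξ e z : Vel d} (he : ‖e‖ = 1) (h : inner ℝ ξ e = (0 : ℝ)) :
    (inner ℝ e z) ^ 2 * ‖ξ‖ ^ 2 ≤ ‖z‖ ^ 2 * ‖ξ‖ ^ 2 - (inner ℝ z ξ) ^ 2 := by
  set c : ℝ := inner ℝ e z with hc
  have h1 : inner ℝ (z - c • e) ξ = inner ℝ z ξ := by
    rw [inner_sub_left, inner_smul_left, real_inner_comm ξ e, h, mul_zero, sub_zero]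
  have h2 : ‖z - c • e‖ ^ 2 = ‖z‖ ^ 2 - c ^ 2 := by
    rw [norm_sub_sq_real, inner_smul_right, real_inner_comm, ← hc, norm_smul, he, mul_one,
      Real.norm_eq_abs, sq_abs]
    ring
  have h3 := abs_real_inner_le_norm (z - c • e) ξ
  have h4 := (sq_le_sq₀ (abs_nonneg _) (by positivity)).2 h3
  rw [sq_abs, h1, mul_pow, h2] at h4
  linarith

theorem wedge_add_le (z y ξ : Vel d) :
    ‖z + y‖ ^ 2 * ‖ξ‖ ^ 2 - (inner ℝ (z + y) ξ) ^ 2 ≤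
      2 * (‖z‖ ^ 2 * ‖ξ‖ ^ 2 - (inner ℝ z ξ) ^ 2) + 2 * (‖y‖ ^ 2 * ‖ξ‖ ^ 2) := by
  have h1 := abs_real_inner_le_norm (z - y) ξ
  have h2 := (sq_le_sq₀ (abs_nonneg _) (by positivity)).2 h1
  rw [sq_abs, mul_pow, norm_sub_sq_real, inner_sub_left] at h2
  rw [norm_add_sq_real, inner_add_left]
  nlinarith [sq_nonneg (inner ℝ y ξ : ℝ)]

theorem Profile.integrable_quad_kernel (hp : Params d γ) (hg : Profile M₁ M₀ E₀ H₀ g) (v : Vel d)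
    (ξ : Fin d → ℝ) : Integrable fun y => quad (kernel γ (v - y)) ξ * g y := by
  obtain ⟨B, hB⟩ := hg.dens
  have hi : ∀ i j, Integrable fun y => kernel γ (v - y) i j * (ξ i * ξ j) * g y := fun i j =>
    ((integrable_kernel_dens hp.dim hp.pos le_rfl (kernelBound_kernel hp.mem i j) hB v).mul_const
      (ξ i * ξ j)).congr (Eventually.of_forall fun y => by simp only []; ring)
  unfold quad
  simp only [Finset.sum_mul]
  exact integrable_finsetSum _ fun i _ => integrable_finsetSum _ fun j _ => hi i j

/-- A fixed part of the mass lies in a bounded set, at a fixed distance from any given hyperplane. -/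
theorem exists_mass_off_slab (d : ℕ) (M₀ E₀ H₀ : ℝ) (hM₁ : 0 < M₁) :
    ∃ ρ δ : ℝ, 0 < ρ ∧ 0 < δ ∧ ∀ g : Vel d → ℝ, Profile M₁ M₀ E₀ H₀ g →
      ∀ e : Vel d, ‖e‖ = 1 → ∀ s : ℝ,
        M₁ / 4 ≤ ∫ y in {y ∈ Metric.ball (0 : Vel d) ρ | δ ≤ |inner ℝ e y - s|}, g y := by
  -- each of the three losses (outside the ball, excess, slab) is at most `M₁ / 4`
  set ρ : ℝ := Real.sqrt (4 * |E₀| / M₁) + 1 with hρ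
  have hρ0 : 0 < ρ := by positivity
  have hρE : |E₀| ≤ M₁ / 4 * ρ ^ 2 := by
    have h1 := Real.sq_sqrt (by positivity : 0 ≤ 4 * |E₀| / M₁)
    have h2 : 4 * |E₀| / M₁ ≤ ρ ^ 2 := by nlinarith [Real.sqrt_nonneg (4 * |E₀| / M₁)]
    rw [div_le_iff₀ hM₁] at h2
    linarith
  obtain ⟨m, hm1, hm⟩ := exists_integral_excess_le d M₁ M₀ E₀ H₀ (by positivity : 0 < M₁ / 4)
  obtain ⟨δ, hδ0, hδ⟩ := exists_slab_volume_le d ρ (by positivity : 0 < M₁ / (4 * m))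
  refine ⟨ρ, δ, hρ0, hδ0, fun g hg e he s => ?_⟩
  obtain ⟨B, hB⟩ := hg.dens
  set A := {y ∈ Metric.ball (0 : Vel d) ρ | δ ≤ |inner ℝ e y - s|} with hA
  set A' := {y ∈ Metric.ball (0 : Vel d) ρ | |inner ℝ e y - s| < δ} with hA'
  have hcont : Measurable fun y : Vel d => |inner ℝ e y - s| :=
    ((continuous_const.inner continuous_id).sub continuous_const).abs.measurable
  have hA'm : MeasurableSet A' := measurableSet_ball.inter (measurableSet_lt hcont measurable_const)
  have hU : A ∪ A' = Metric.ball (0 : Vel d) ρ := by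
    ext y
    simp only [hA, hA', Set.mem_union, Set.mem_ofPred_eq, ← and_or_left]
    exact and_iff_left (le_or_gt _ _)
  have hD : Disjoint A A' := Set.disjoint_left.2 fun y h1 h2 => absurd h2.2 (not_lt.2 h1.2)
  have h1 : ∫ y in Metric.ball (0 : Vel d) ρ, g y = (∫ y in A, g y) + ∫ y in A', g y := by
    rw [← hU, setIntegral_union hD hA'm hB.int.integrableOn hB.int.integrableOn]
  have hA'v : volume A' ≠ ⊤ := ((measure_mono fun y hy => hy.1).trans_lt
    (measure_ball_lt_top (x := (0 : Vel d)) (r := ρ))).ne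
  have h2 := hg.setIntegral_le (by linarith : 0 ≤ m) hA'v
  have h3 : m * volume.real A' ≤ M₁ / 4 := by
    calc m * volume.real A' ≤ m * (M₁ / (4 * m)) :=
          mul_le_mul_of_nonneg_left (hδ e he s) (by linarith)
      _ = M₁ / 4 := by field_simp
  have h4 := hm g hg
  have h5 := integral_add_compl (measurableSet_ball (x := (0 : Vel d)) (ε := ρ)) hB.int
  have h6 : ∫ y in (Metric.ball (0 : Vel d) ρ)ᶜ, g y ≤ M₁ / 4 := by
    have h7 : ∫ y in (Metric.ball (0 : Vel d) ρ)ᶜ, ρ ^ 2 * g y ≤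
        ∫ y in (Metric.ball (0 : Vel d) ρ)ᶜ, ‖y‖ ^ 2 * g y := by
      refine setIntegral_mono_on (hB.int.const_mul _).integrableOn hB.int2.integrableOn
        measurableSet_ball.compl fun y hy => mul_le_mul_of_nonneg_right ?_ (hg.nonneg y)
      exact pow_le_pow_left₀ hρ0.le (by simpa using hy) 2
    have h8 := setIntegral_le_integral (s := (Metric.ball (0 : Vel d) ρ)ᶜ) hB.int2
      (Eventually.of_forall fun y => mul_nonneg (sq_nonneg _) (hg.nonneg y))
    rw [integral_const_mul] at h7
    have h9 : ρ ^ 2 * ∫ y in (Metric.ball (0 : Vel d) ρ)ᶜ, g y ≤ ρ ^ 2 * (M₁ / 4) := by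
      have := hg.energy_le
      have := le_abs_self E₀
      linarith
    exact le_of_mul_le_mul_left h9 (by positivity)
  have h7 := hg.le_mass
  linarith

/-- **Ellipticity.** In directions orthogonal to `v` the diffusion is at least of size `⟨v⟩^(γ+2)`,
in the radial direction only of size `⟨v⟩^γ`. -/
theorem exists_le_quad_diffusion (d : ℕ) (M₀ E₀ H₀ : ℝ) (ha : 0 < a) (hM₁ : 0 < M₁) :
    ∃ l : ℝ, 0 < l ∧ ∀ γ : ℝ, Params d γ → ∀ g : Vel d → ℝ, Profile M₁ M₀ E₀ H₀ g →
      ∀ v ξ : Vel d, l * jap v ^ γ * (jap v ^ 2 * ‖ξ‖ ^ 2 - (inner ℝ v ξ) ^ 2) ≤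
        quad (diffusion a γ g v) ξ := by
  obtain ⟨ρ, δ, hρ, hδ, hmass⟩ := exists_mass_off_slab (M₁ := M₁) d M₀ E₀ H₀ hM₁
  set κ : ℝ := 2 + (1 + 2 * ρ ^ 2) / δ ^ 2 with hκ
  have hκ0 : 0 < κ := by positivity
  refine ⟨a * (M₁ / 4) * ((1 + ρ) ^ 2)⁻¹ * κ⁻¹, by positivity, fun γ hp g hg v ξ => ?_⟩
  obtain ⟨B, hB⟩ := hg.dens
  rw [quad_diffusion_eq hp hB]
  obtain ⟨e, he, heξ⟩ := exists_unit_orthogonal hp.dim ξ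
  set A := {y ∈ Metric.ball (0 : Vel d) ρ | δ ≤ |inner ℝ e y - inner ℝ e v|} with hA
  have hcont : Measurable fun y : Vel d => |inner ℝ e y - inner ℝ e v| :=
    ((continuous_const.inner continuous_id).sub continuous_const).abs.measurable
  have hAm : MeasurableSet A := measurableSet_ball.inter (measurableSet_le measurable_const hcont)
  set Q : ℝ := jap v ^ 2 * ‖ξ‖ ^ 2 - (inner ℝ v ξ) ^ 2 with hQ
  have hQ0 : 0 ≤ Q := by
    have h4 := (sq_le_sq₀ (abs_nonneg _) (by positivity)).2 (abs_real_inner_le_norm v ξ)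
    rw [sq_abs, mul_pow] at h4
    rw [hQ, jap_sq]
    nlinarith [sq_nonneg ‖ξ‖]
  set k : ℝ := ((1 + ρ) ^ 2)⁻¹ * κ⁻¹ * (jap v ^ γ * Q) with hk
  have hi := hg.integrable_quad_kernel hp v ξ
  have hnn : 0 ≤ᵐ[volume] fun y => quad (kernel γ (v - y)) ξ * g y := by
    filter_upwards [ae_sub_ne_zero hp.dim v] with y hy
    exact mul_nonneg (quad_kernel_nonneg hy ξ) (hg.nonneg y)
  have h1 : ∫ y in A, k * g y ≤ ∫ y in A, quad (kernel γ (v - y)) ξ * g y := by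
    refine setIntegral_mono_on (hB.int.const_mul k).integrableOn hi.integrableOn hAm fun y hy => ?_
    refine mul_le_mul_of_nonneg_right ?_ (hg.nonneg y)
    have hyρ : ‖y‖ < ρ := mem_ball_zero_iff.1 hy.1
    have hzδ : δ ≤ |inner ℝ e (v - y)| := by
      rw [inner_sub_right, abs_sub_comm]; exact hy.2
    have hz0 : v - y ≠ 0 := fun h => by
      rw [h, inner_zero_right, abs_zero] at hzδ; linarith
    have hzp : 0 < ‖v - y‖ := norm_pos_iff.2 hz0
    rw [quad_kernel hz0]
    set P : ℝ := ‖v - y‖ ^ 2 * ‖ξ‖ ^ 2 - (inner ℝ (v - y) ξ) ^ 2 with hP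
    have p1 : δ ^ 2 * ‖ξ‖ ^ 2 ≤ P := by
      refine le_trans ?_ (sq_inner_mul_le he heξ)
      rw [← sq_abs (inner ℝ e (v - y))]
      gcongr
    have p2 := wedge_add_le (v - y) y ξ
    rw [sub_add_cancel, ← hP] at p2
    have p3 : ‖y‖ ^ 2 * ‖ξ‖ ^ 2 ≤ ρ ^ 2 * ‖ξ‖ ^ 2 := by gcongr
    have p4 : Q ≤ κ * P := by
      have : (1 + 2 * ρ ^ 2) * ‖ξ‖ ^ 2 ≤ (1 + 2 * ρ ^ 2) / δ ^ 2 * P := by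
        rw [div_mul_eq_mul_div, le_div_iff₀ (by positivity)]
        nlinarith [mul_le_mul_of_nonneg_left p1 (by positivity : 0 ≤ 1 + 2 * ρ ^ 2)]
      rw [hQ, jap_sq, hκ]
      linarith
    have p5 : ((1 + ρ) ^ 2)⁻¹ * jap v ^ γ ≤ ‖v - y‖ ^ γ := by
      have q1 : ‖v - y‖ ≤ (1 + ρ) * jap v := by
        have := norm_sub_le v y
        have := norm_le_jap v
        nlinarith [one_le_jap v]
      have q2 : ((1 + ρ) * jap v) ^ γ ≤ ‖v - y‖ ^ γ :=
        Real.rpow_le_rpow_of_nonpos hzp q1 hp.mem.2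
      rw [Real.mul_rpow (by linarith) (jap_pos v).le] at q2
      have q3 : ((1 + ρ) ^ 2)⁻¹ ≤ (1 + ρ) ^ γ := by
        rw [← Real.rpow_natCast, ← Real.rpow_neg (by linarith)]
        exact Real.rpow_le_rpow_of_exponent_le (by linarith) (by exact_mod_cast hp.mem.1)
      exact (mul_le_mul_of_nonneg_right q3 (Real.rpow_nonneg (jap_pos v).le _)).trans q2
    have p6 : κ⁻¹ * Q ≤ P := by
      rw [inv_mul_le_iff₀ hκ0]; exact p4
    have p7 : 0 ≤ P := le_trans (by positivity) p1
    have hj := Real.rpow_nonneg (jap_pos v).le γ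
    calc k = (((1 + ρ) ^ 2)⁻¹ * jap v ^ γ) * (κ⁻¹ * Q) := by rw [hk]; ring
      _ ≤ ‖v - y‖ ^ γ * P := mul_le_mul p5 p6 (by positivity) (by positivity)
      _ = _ := mul_comm _ _
  have h2 := setIntegral_le_integral (s := A) hi hnn
  rw [integral_const_mul] at h1
  have h3 := hmass g hg e he (inner ℝ e v)
  have hk0 : 0 ≤ k := by have := Real.rpow_nonneg (jap_pos v).le γ; positivity
  calc _ = a * (k * (M₁ / 4)) := by rw [hk]; ring
    _ ≤ a * (k * ∫ y in A, g y) := by gcongr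
    _ ≤ _ := mul_le_mul_of_nonneg_left (h1.trans h2) ha.le

end

section

/-! ### Upper bounds on the diffusion -/

variable {d : ℕ} {a γ B : ℝ} {g : Vel d → ℝ} {M₁ M₀ E₀ H₀ : ℝ}

theorem Profile.quad_diffusion_le (hp : Params d γ) (ha : 0 ≤ a) (hg : Profile M₁ M₀ E₀ H₀ g)
    {v : Vel d} {ξ : Fin d → ℝ} {k : ℝ} (hk : 0 ≤ k)
    (h : ∀ y, v - y ≠ 0 → quad (kernel γ (v - y)) ξ ≤ k * (1 + ‖y‖ ^ 2)) :
    quad (diffusion a γ g v) ξ ≤ a * (k * (M₀ + E₀)) := by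
  obtain ⟨B, hB⟩ := hg.dens
  rw [quad_diffusion_eq hp hB]
  refine mul_le_mul_of_nonneg_left ?_ ha
  have hi := hg.integrable_quad_kernel hp v ξ
  have hm := integral_mono_ae hi ((hB.int.fun_add hB.int2).const_mul k) (by
    filter_upwards [ae_sub_ne_zero hp.dim v] with y hy
    have := mul_le_mul_of_nonneg_right (h y hy) (hg.nonneg y)
    calc _ ≤ _ := this
      _ = k * (g y + ‖y‖ ^ 2 * g y) := by ring)
  rw [integral_const_mul, integral_add hB.int hB.int2] at hm
  exact hm.trans (mul_le_mul_of_nonneg_left (add_le_add hg.mass_le hg.energy_le) hk)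

theorem norm_add_sub_le_jap {v₀ x : Vel d} (hx : ‖x‖ ≤ 1) (y : Vel d) :
    ‖v₀ + x - y‖ ≤ 3 * jap v₀ * jap y := by
  have h1 := norm_sub_le (v₀ + x) y
  have h2 := norm_add_le v₀ x
  have h3 := norm_le_jap v₀
  have h4 := norm_le_jap y
  have h5 := one_le_jap v₀
  have h6 := one_le_jap y
  nlinarith

theorem quad_kernel_single_le (hγ : γ ∈ Set.Icc (-2 : ℝ) 0) {v₀ x : Vel d} (hx : ‖x‖ ≤ 1)
    {y : Vel d} (hz : v₀ + x - y ≠ 0) {ξ : Vel d} (hξ : ‖ξ‖ = 1) :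
    quad (kernel γ (v₀ + x - y)) ξ ≤ 9 * jap v₀ ^ (γ + 2) * (1 + ‖y‖ ^ 2) := by
  have hzp : 0 < ‖v₀ + x - y‖ := norm_pos_iff.2 hz
  have hγ2 : 0 ≤ γ + 2 := by linarith [hγ.1]
  have hγ2' : γ + 2 ≤ 2 := by linarith [hγ.2]
  rw [quad_kernel hz, hξ, one_pow, mul_one]
  have h1 : (‖v₀ + x - y‖ ^ 2 - (inner ℝ (v₀ + x - y) ξ) ^ 2) * ‖v₀ + x - y‖ ^ γ ≤
      ‖v₀ + x - y‖ ^ (γ + 2) := by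
    rw [Real.rpow_add hzp, Real.rpow_two, mul_comm (‖v₀ + x - y‖ ^ γ)]
    exact mul_le_mul_of_nonneg_right (by linarith [sq_nonneg (inner ℝ (v₀ + x - y) ξ)])
      (Real.rpow_nonneg hzp.le _)
  have h2 : ‖v₀ + x - y‖ ^ (γ + 2) ≤ (3 * jap v₀ * jap y) ^ (γ + 2) :=
    Real.rpow_le_rpow hzp.le (norm_add_sub_le_jap hx y) hγ2
  have j0 := jap_pos v₀
  have j1 := jap_pos y
  rw [Real.mul_rpow (by positivity) j1.le, Real.mul_rpow (by norm_num) j0.le] at h2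
  have h3 : (3 : ℝ) ^ (γ + 2) ≤ 9 := by
    calc (3 : ℝ) ^ (γ + 2) ≤ 3 ^ (2 : ℝ) := Real.rpow_le_rpow_of_exponent_le (by norm_num) hγ2'
      _ = 9 := by norm_num
  have h4 : jap y ^ (γ + 2) ≤ 1 + ‖y‖ ^ 2 := by
    rw [← jap_sq, ← Real.rpow_two]
    exact Real.rpow_le_rpow_of_exponent_le (one_le_jap y) hγ2'
  have h5 := Real.rpow_nonneg j0.le (γ + 2)
  have h6 := Real.rpow_nonneg j1.le (γ + 2)
  calc _ ≤ _ := h1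
    _ ≤ _ := h2
    _ ≤ 9 * jap v₀ ^ (γ + 2) * (1 + ‖y‖ ^ 2) :=
      mul_le_mul (mul_le_mul_of_nonneg_right h3 h5) h4 h6 (by positivity)

/-- In the radial direction `v₀` the diffusion gains a factor `⟨v₀⟩^(-2)`: after cancellation of `v₀`
one has `|(v₀ + x - y) ∧ v₀| ≤ |x - y| |v₀|`, while a `y` close to `v₀` carries the weight `|y|²`. -/
theorem quad_kernel_self_le (hγ : γ ∈ Set.Icc (-2 : ℝ) 0) {v₀ x : Vel d} (hx : ‖x‖ ≤ 1)
    {y : Vel d} (hz : v₀ + x - y ≠ 0) :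
    quad (kernel γ (v₀ + x - y)) v₀ ≤ 32 * jap v₀ ^ (γ + 2) * (1 + ‖y‖ ^ 2) := by
  have hzp : 0 < ‖v₀ + x - y‖ := norm_pos_iff.2 hz
  have hγ2 : 0 ≤ γ + 2 := by linarith [hγ.1]
  rw [quad_kernel hz]
  set R := jap v₀ with hR
  have hR1 : 1 ≤ R := one_le_jap v₀
  have hvR : ‖v₀‖ ≤ R := norm_le_jap v₀
  have hy0 := norm_nonneg y
  have hRγ : R ^ (γ + 2) = R ^ γ * R ^ 2 := by
    rw [Real.rpow_add (by linarith), Real.rpow_two]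
  have hRγ0 := Real.rpow_nonneg (by linarith : 0 ≤ R) γ
  -- if `y` is close to `v₀`, then `|y|` is comparable to `R`
  by_cases hc : R / 4 ≤ ‖v₀ + x - y‖
  · have h1 : ‖v₀ + x - y‖ ^ γ ≤ 16 * R ^ γ := by
      have h2 : ‖v₀ + x - y‖ ^ γ ≤ (R / 4) ^ γ :=
        Real.rpow_le_rpow_of_nonpos (by positivity) hc hγ.2
      have h3 : (R / 4) ^ γ = (4 : ℝ) ^ (-γ) * R ^ γ := by
        rw [Real.div_rpow (by linarith) (by norm_num), Real.rpow_neg (by norm_num)]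
        field_simp
      have h4 : (4 : ℝ) ^ (-γ) ≤ 16 := by
        calc (4 : ℝ) ^ (-γ) ≤ 4 ^ (2 : ℝ) :=
              Real.rpow_le_rpow_of_exponent_le (by norm_num) (by linarith [hγ.1])
          _ = 16 := by norm_num
      rw [h3] at h2
      exact h2.trans (mul_le_mul_of_nonneg_right h4 hRγ0)
    have h2 : ‖v₀ + x - y‖ ^ 2 * ‖v₀‖ ^ 2 - (inner ℝ (v₀ + x - y) v₀) ^ 2 ≤
        2 * (1 + ‖y‖ ^ 2) * R ^ 2 := by
      have e : ‖v₀ + x - y‖ ^ 2 * ‖v₀‖ ^ 2 - (inner ℝ (v₀ + x - y) v₀) ^ 2 =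
          ‖x - y‖ ^ 2 * ‖v₀‖ ^ 2 - (inner ℝ (x - y) v₀) ^ 2 := by
        rw [add_sub_assoc, norm_add_sq_real, inner_add_left, real_inner_self_eq_norm_sq,
          real_inner_comm (x - y) v₀]
        ring
      rw [e]
      have h3 : ‖x - y‖ ≤ 1 + ‖y‖ := (norm_sub_le x y).trans (by linarith)
      have h4 : ‖x - y‖ ^ 2 ≤ 2 * (1 + ‖y‖ ^ 2) := by
        have := pow_le_pow_left₀ (norm_nonneg _) h3 2
        nlinarith [sq_nonneg (1 - ‖y‖)]
      have h5 : ‖v₀‖ ^ 2 ≤ R ^ 2 := pow_le_pow_left₀ (norm_nonneg _) hvR 2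
      have h6 := mul_le_mul h4 h5 (by positivity) (by positivity)
      linarith [sq_nonneg (inner ℝ (x - y) v₀)]
    have h0 : 0 ≤ ‖v₀ + x - y‖ ^ γ := Real.rpow_nonneg hzp.le _
    calc _ ≤ 2 * (1 + ‖y‖ ^ 2) * R ^ 2 * ‖v₀ + x - y‖ ^ γ := mul_le_mul_of_nonneg_right h2 h0
      _ ≤ 2 * (1 + ‖y‖ ^ 2) * R ^ 2 * (16 * R ^ γ) :=
          mul_le_mul_of_nonneg_left h1 (by positivity)
      _ = _ := by rw [hRγ]; ring
  · push Not at hc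
    have h1 : R ^ 2 ≤ 9 * (1 + ‖y‖ ^ 2) := by
      have h2 : ‖v₀‖ ≤ ‖v₀ + x - y‖ + ‖x‖ + ‖y‖ := by
        have e : v₀ = (v₀ + x - y) - x + y := by abel
        have h3 := norm_add_le ((v₀ + x - y) - x) y
        have h4 := norm_sub_le (v₀ + x - y) x
        rw [← e] at h3
        linarith
      have h3 := jap_le v₀
      have h4 : 3 / 4 * R ≤ 2 + ‖y‖ := by linarith
      have h5 : (3 / 4 * R) ^ 2 ≤ (2 + ‖y‖) ^ 2 := pow_le_pow_left₀ (by linarith) h4 2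
      nlinarith [sq_nonneg (2 * ‖y‖ - 1)]
    have h2 : ‖v₀ + x - y‖ ^ (γ + 2) ≤ R ^ (γ + 2) :=
      Real.rpow_le_rpow hzp.le (by linarith) hγ2
    have h3 : (‖v₀ + x - y‖ ^ 2 * ‖v₀‖ ^ 2 - (inner ℝ (v₀ + x - y) v₀) ^ 2) *
        ‖v₀ + x - y‖ ^ γ ≤ ‖v₀ + x - y‖ ^ (γ + 2) * R ^ 2 := by
      rw [Real.rpow_add hzp, Real.rpow_two]
      have h5 : ‖v₀‖ ^ 2 ≤ R ^ 2 := pow_le_pow_left₀ (norm_nonneg _) hvR 2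
      have h6 := mul_le_mul_of_nonneg_left h5 (sq_nonneg ‖v₀ + x - y‖)
      have h0 : 0 ≤ ‖v₀ + x - y‖ ^ γ := Real.rpow_nonneg hzp.le _
      calc _ ≤ (‖v₀ + x - y‖ ^ 2 * R ^ 2) * ‖v₀ + x - y‖ ^ γ :=
            mul_le_mul_of_nonneg_right
              (by linarith [sq_nonneg (inner ℝ (v₀ + x - y) v₀)]) h0
        _ = _ := by ring
    have h4 := Real.rpow_nonneg (by linarith : 0 ≤ R) (γ + 2)
    calc _ ≤ _ := h3
      _ ≤ R ^ (γ + 2) * (9 * (1 + ‖y‖ ^ 2)) := mul_le_mul h2 h1 (by positivity) h4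
      _ ≤ _ := by
          have : 0 ≤ R ^ (γ + 2) * (1 + ‖y‖ ^ 2) := by positivity
          nlinarith

theorem quad_single (A : Matrix (Fin d) (Fin d) ℝ) (i : Fin d) :
    quad A (EuclideanSpace.single i (1 : ℝ) : Vel d) = A i i := by
  unfold quad
  rw [Finset.sum_eq_single i, Finset.sum_eq_single i]
  · simp
  · intro j _ hj; simp [hj]
  · simp
  · intro j _ hj; simp [hj]
  · simp

/-- The diffusion seen by a quadratic form stretched in the radial direction. -/
theorem Profile.diffusion_le (hp : Params d γ) (ha : 0 ≤ a) (hg : Profile M₁ M₀ E₀ H₀ g)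
    {v₀ x : Vel d} (hx : ‖x‖ ≤ 1) :
    (∑ i, diffusion a γ g (v₀ + x) i i) + quad (diffusion a γ g (v₀ + x)) v₀ ≤
      a * (9 * d + 32) * (M₀ + E₀) * jap v₀ ^ (γ + 2) := by
  have hj := Real.rpow_nonneg (jap_pos v₀).le (γ + 2)
  have h1 : ∀ i, diffusion a γ g (v₀ + x) i i ≤ a * (9 * jap v₀ ^ (γ + 2) * (M₀ + E₀)) :=
    fun i => by
      refine (quad_single (diffusion a γ g (v₀ + x)) i).symm.le.trans ?_
      exact hg.quad_diffusion_le hp ha (by positivity) fun y hy =>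
        quad_kernel_single_le hp.mem hx hy (by simp)
  have h2 := hg.quad_diffusion_le hp ha (v := v₀ + x) (ξ := v₀) (k := 32 * jap v₀ ^ (γ + 2))
    (by positivity) fun y hy => quad_kernel_self_le hp.mem hx hy
  have h3 := Finset.sum_le_sum fun i (_ : i ∈ (Finset.univ : Finset (Fin d))) => h1 i
  simp only [Finset.sum_const, Finset.card_univ, Fintype.card_fin, nsmul_eq_mul] at h3
  calc _ ≤ _ := add_le_add h3 h2
    _ = _ := by ring

/-! ### The reaction coefficient -/

/-- The kernel `|w|^γ` near its singularity. -/
def nearSing (γ ρ : ℝ) (w : Vel d) : ℝ := (Metric.ball (0 : Vel d) ρ).indicator (fun w => ‖w‖ ^ γ) w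

/-- The volume of the unit ball. -/
def unitVol (d : ℕ) : ℝ := volume.real (Metric.ball (0 : Vel d) 1)

theorem unitVol_pos (d : ℕ) : 0 < unitVol d :=
  ENNReal.toReal_pos (Metric.measure_ball_pos volume _ one_pos).ne' measure_ball_lt_top.ne

theorem nearSing_nonneg (γ ρ : ℝ) (w : Vel d) : 0 ≤ nearSing γ ρ w :=
  Set.indicator_nonneg (fun _ _ => Real.rpow_nonneg (norm_nonneg _) _) w

theorem measurable_nearSing (γ ρ : ℝ) : Measurable (nearSing γ ρ : Vel d → ℝ) :=
  (measurable_norm.pow_const γ).indicator measurableSet_ball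

theorem nearSing_le_sing {ρ : ℝ} (hρ : ρ ≤ 1) (w : Vel d) : nearSing γ ρ w ≤ sing γ w := by
  refine Set.indicator_le_indicator_of_subset (Metric.ball_subset_ball hρ)
    (fun w => Real.rpow_nonneg (norm_nonneg _) _) w

theorem integrable_nearSing (hp : Params d γ) {ρ : ℝ} (hρ : ρ ≤ 1) :
    Integrable (nearSing γ ρ : Vel d → ℝ) :=
  (integrable_sing hp.dim hp.pos).mono' (measurable_nearSing γ ρ).aestronglyMeasurable
    (Eventually.of_forall fun w => by
      rw [Real.norm_of_nonneg (nearSing_nonneg γ ρ w)]; exact nearSing_le_sing hρ w)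

/-- The factor `d + γ` compensates the growth of this integral as `γ → -d`. -/
theorem integral_nearSing (hp : Params d γ) {ρ : ℝ} (hρ : 0 < ρ) :
    ((d : ℝ) + γ) * ∫ w : Vel d, nearSing γ ρ w = d * unitVol d * ρ ^ ((d : ℝ) + γ) := by
  have := nontrivial_vel hp.dim
  have e : (nearSing γ ρ : Vel d → ℝ) =
      fun w => (Set.Iio ρ).indicator (fun r : ℝ => r ^ γ) ‖w‖ := by
    funext w
    simp only [nearSing, Set.indicator, mem_ball_zero_iff, Set.mem_Iio]
  have hγ := hp.pos
  rw [e, integral_fun_norm_addHaar volume (fun r => (Set.Iio ρ).indicator (fun r : ℝ => r ^ γ) r),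
    finrank_euclideanSpace_fin]
  have h1 : ∫ y in Set.Ioi (0 : ℝ), y ^ (d - 1) • (Set.Iio ρ).indicator (fun r : ℝ => r ^ γ) y =
      ∫ y in (0 : ℝ)..ρ, y ^ ((d : ℝ) - 1 + γ) := by
    have h2 : ∀ y : ℝ, y ^ (d - 1) • (Set.Iio ρ).indicator (fun r : ℝ => r ^ γ) y =
        (Set.Iio ρ).indicator (fun r : ℝ => r ^ (d - 1) * r ^ γ) y := fun y => by
      by_cases hy : y ∈ Set.Iio ρ
      · simp [Set.indicator_of_mem hy]
      · simp [Set.indicator_of_notMem hy]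
    simp only [h2]
    rw [setIntegral_indicator measurableSet_Iio, Set.Ioi_inter_Iio,
      intervalIntegral.integral_of_le hρ.le, integral_Ioc_eq_integral_Ioo]
    refine setIntegral_congr_fun measurableSet_Ioo fun y hy => ?_
    have hd1 := hp.dim
    show y ^ (d - 1) * y ^ γ = y ^ ((d : ℝ) - 1 + γ)
    rw [Real.rpow_add hy.1, ← Real.rpow_natCast, Nat.cast_sub (by omega)]
    simp
  rw [h1, integral_rpow (Or.inl (by linarith)), Real.zero_rpow (by linarith : (d : ℝ) - 1 + γ + 1 ≠ 0)]
  have e2 : (d : ℝ) - 1 + γ + 1 = d + γ := by ring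
  rw [e2, sub_zero, nsmul_eq_mul, smul_eq_mul, unitVol]
  field_simp

/-- The part of the reaction coefficient generated by the large values of the density at a small
distance. -/
def nearReaction (a γ ρ m : ℝ) (g : Vel d → ℝ) (v : Vel d) : ℝ :=
  (((d : ℝ) - 1) * ((d : ℝ) + γ) * a) * ∫ w, nearSing γ ρ w * max (g (v - w) - m) 0

theorem reaction_const_nonneg (hp : Params d γ) (ha : 0 ≤ a) :
    0 ≤ ((d : ℝ) - 1) * ((d : ℝ) + γ) * a := by
  have hd : (2 : ℝ) ≤ d := by exact_mod_cast hp.dim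
  exact mul_nonneg (mul_nonneg (by linarith) hp.pos.le) ha

theorem nearReaction_nonneg (hp : Params d γ) (ha : 0 ≤ a) (ρ m : ℝ) (g : Vel d → ℝ) (v : Vel d) :
    0 ≤ nearReaction a γ ρ m g v :=
  mul_nonneg (reaction_const_nonneg hp ha) (integral_nonneg fun w =>
    mul_nonneg (nearSing_nonneg γ ρ w) (le_max_right _ _))

theorem Profile.integrable_nearSing_mul (hp : Params d γ) (hg : Profile M₁ M₀ E₀ H₀ g) {ρ m : ℝ}
    (hρ : ρ ≤ 1) (hm : 0 ≤ m) (v : Vel d) :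
    Integrable fun w => nearSing γ ρ w * max (g (v - w) - m) 0 := by
  obtain ⟨B, hB⟩ := hg.dens
  refine (integrable_nearSing hp hρ).mul_bdd (c := B) ?_ (Eventually.of_forall fun w => ?_)
  · exact (((hB.meas.comp (measurable_const.sub measurable_id)).sub_const m).max
      measurable_const).aestronglyMeasurable
  · rw [Real.norm_of_nonneg (le_max_right _ _)]
    exact max_le (by linarith [(le_abs_self _).trans (hB.bdd (v - w))]) hB.nonneg_const

/-- The reaction coefficient is bounded, apart from what the excess of the density over the level `m`
generates at distance less than `ρ`. -/
theorem Profile.reaction_le (hp : Params d γ) (ha : 0 ≤ a) (hg : Profile M₁ M₀ E₀ H₀ g) {ρ m : ℝ}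
    (hρ : 0 < ρ) (hρ1 : ρ ≤ 1) (hm : 0 ≤ m) (v : Vel d) :
    reaction a γ g v ≤ d * d * a * (unitVol d * m + M₀ + (∫ y, max (g y - m) 0) / ρ ^ 2) +
      nearReaction a γ ρ m g v := by
  obtain ⟨B, hB⟩ := hg.dens
  have hd : (2 : ℝ) ≤ d := by exact_mod_cast hp.dim
  have hω := unitVol_pos d
  have iE := hg.integrable_excess hm
  have i1 : Integrable fun w : Vel d => nearSing γ 1 w * m :=
    (integrable_nearSing hp le_rfl).mul_const m
  have i2 : Integrable fun w => g (v - w) := hB.int.comp_sub_left v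
  have i3 : Integrable fun w => 1 / ρ ^ 2 * max (g (v - w) - m) 0 :=
    (iE.comp_sub_left v).const_mul _
  have i4 := hg.integrable_nearSing_mul hp hρ1 hm v
  have hpt : ∀ w, ‖w‖ ^ γ * g (v - w) ≤ nearSing γ 1 w * m + g (v - w) +
      1 / ρ ^ 2 * max (g (v - w) - m) 0 + nearSing γ ρ w * max (g (v - w) - m) 0 := by
    intro w
    have hg0 := hg.nonneg (v - w)
    set F := max (g (v - w) - m) 0 with hF
    have hF0 : 0 ≤ F := le_max_right _ _
    have hgF : g (v - w) ≤ m + F := by linarith [le_max_left (g (v - w) - m) 0]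
    have n1 := mul_nonneg (nearSing_nonneg γ 1 w) hm
    have n2 := mul_nonneg (nearSing_nonneg γ ρ w) hF0
    have n3 : 0 ≤ 1 / ρ ^ 2 * F := by positivity
    by_cases h1 : ‖w‖ < 1
    · have e1 : nearSing γ 1 w = ‖w‖ ^ γ := Set.indicator_of_mem (by simpa using h1) _
      have hw0 := Real.rpow_nonneg (norm_nonneg w) γ
      have h2 : ‖w‖ ^ γ * g (v - w) ≤ ‖w‖ ^ γ * m + ‖w‖ ^ γ * F := by
        rw [← mul_add]; exact mul_le_mul_of_nonneg_left hgF hw0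
      rw [e1] at n1 ⊢
      by_cases h3 : ‖w‖ < ρ
      · have e2 : nearSing γ ρ w = ‖w‖ ^ γ := Set.indicator_of_mem (by simpa using h3) _
        rw [e2]; linarith
      · push Not at h3
        have h4 : ‖w‖ ^ γ ≤ 1 / ρ ^ 2 := by
          calc ‖w‖ ^ γ ≤ ρ ^ γ := Real.rpow_le_rpow_of_nonpos hρ h3 hp.mem.2
            _ ≤ ρ ^ (-2 : ℝ) := Real.rpow_le_rpow_of_exponent_ge hρ hρ1 hp.mem.1
            _ = 1 / ρ ^ 2 := by rw [Real.rpow_neg hρ.le, Real.rpow_two, one_div]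
        have := mul_le_mul_of_nonneg_right h4 hF0
        linarith
    · push Not at h1
      have h2 : ‖w‖ ^ γ ≤ 1 := Real.rpow_le_one_of_one_le_of_nonpos h1 hp.mem.2
      have := mul_le_of_le_one_left hg0 h2
      linarith
  have i0 : Integrable fun w => ‖w‖ ^ γ * g (v - w) := by
    have := (integrable_kernel_dens hp.dim hp.pos (by norm_num) (kernelBound_rpow hp.mem) hB
      v).comp_sub_left v
    simpa using this
  have hmono := integral_mono i0 (((i1.fun_add i2).fun_add i3).add i4) hpt
  have e : ∫ w, (nearSing γ 1 w * m + g (v - w) +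
      1 / ρ ^ 2 * max (g (v - w) - m) 0 + nearSing γ ρ w * max (g (v - w) - m) 0) =
      (∫ w : Vel d, nearSing γ 1 w) * m + (∫ y, g y) + 1 / ρ ^ 2 * (∫ y, max (g y - m) 0) +
        ∫ w, nearSing γ ρ w * max (g (v - w) - m) 0 := by
    rw [integral_add ((i1.fun_add i2).fun_add i3) i4, integral_add (i1.fun_add i2) i3,
      integral_add i1 i2, integral_mul_const, integral_const_mul, integral_sub_left_eq_self,
      integral_sub_left_eq_self (fun y => max (g y - m) 0)]
  have hc := reaction_const_nonneg hp ha (a := a)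
  have hIE : 0 ≤ ∫ y, max (g y - m) 0 := integral_nonneg fun y => le_max_right _ _
  have hI0 : 0 ≤ ∫ y, g y := integral_nonneg hg.nonneg
  have h1 := mul_le_mul_of_nonneg_left (hmono.trans e.le) hc
  have h2 := integral_nearSing hp one_pos
  rw [Real.one_rpow, mul_one] at h2
  have hcd : ((d : ℝ) - 1) * ((d : ℝ) + γ) * a ≤ d * d * a := by
    have := hp.mem.2
    have := hp.pos
    gcongr
    · linarith
    · linarith
  unfold reaction
  refine h1.trans ?_
  unfold nearReaction
  have k1 : ((d : ℝ) - 1) * ((d : ℝ) + γ) * a * ((∫ w : Vel d, nearSing γ 1 w) * m) ≤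
      d * d * a * (unitVol d * m) := by
    calc _ = ((d : ℝ) - 1) * a * m * (((d : ℝ) + γ) * ∫ w : Vel d, nearSing γ 1 w) := by ring
      _ = ((d : ℝ) - 1) * (d * a * (unitVol d * m)) := by rw [h2]; ring
      _ ≤ d * (d * a * (unitVol d * m)) := by gcongr; linarith
      _ = _ := by ring
  have k2 : ((d : ℝ) - 1) * ((d : ℝ) + γ) * a * (∫ y, g y) ≤ d * d * a * M₀ :=
    mul_le_mul hcd hg.mass_le hI0 (by positivity)
  have k3 : ((d : ℝ) - 1) * ((d : ℝ) + γ) * a * (1 / ρ ^ 2 * (∫ y, max (g y - m) 0)) ≤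
      d * d * a * ((∫ y, max (g y - m) 0) / ρ ^ 2) := by
    rw [one_div_mul_eq_div]
    exact mul_le_mul_of_nonneg_right hcd (by positivity)
  linarith

theorem Profile.nearReaction_le (hp : Params d γ) (ha : 0 ≤ a) (hg : Profile M₁ M₀ E₀ H₀ g)
    {ρ m L : ℝ} (hρ : 0 < ρ) (hρ1 : ρ ≤ 1) (hm : 0 ≤ m) (hL : ∀ v, g v ≤ L) (v : Vel d) :
    nearReaction a γ ρ m g v ≤ d * d * a * unitVol d * L * ρ ^ ((d : ℝ) + γ) := by
  have hd : (2 : ℝ) ≤ d := by exact_mod_cast hp.dim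
  have hL0 : 0 ≤ L := (hg.nonneg 0).trans (hL 0)
  have h1 : ∫ w, nearSing γ ρ w * max (g (v - w) - m) 0 ≤ ∫ w : Vel d, nearSing γ ρ w * L :=
    integral_mono (hg.integrable_nearSing_mul hp hρ1 hm v)
      ((integrable_nearSing hp hρ1).mul_const L) fun w =>
      mul_le_mul_of_nonneg_left (max_le (by linarith [hL (v - w)]) hL0) (nearSing_nonneg γ ρ w)
  rw [integral_mul_const] at h1
  have h2 := mul_le_mul_of_nonneg_left h1 (reaction_const_nonneg hp ha)
  refine h2.trans ?_
  have hρp := Real.rpow_nonneg hρ.le ((d : ℝ) + γ)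
  have hω := unitVol_pos d
  calc _ = ((d : ℝ) - 1) * a * L * (((d : ℝ) + γ) * ∫ w : Vel d, nearSing γ ρ w) := by ring
    _ = ((d : ℝ) - 1) * (d * a * unitVol d * L * ρ ^ ((d : ℝ) + γ)) := by
        rw [integral_nearSing hp hρ]; ring
    _ ≤ d * (d * a * unitVol d * L * ρ ^ ((d : ℝ) + γ)) := by gcongr; linarith
    _ = _ := by ring

theorem Profile.lintegral_nearReaction_le (hp : Params d γ) (ha : 0 ≤ a)
    (hg : Profile M₁ M₀ E₀ H₀ g) {ρ m : ℝ} (hρ : 0 < ρ) (hρ1 : ρ ≤ 1) (hm : 0 ≤ m) (v₀ : Vel d) :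
    ∫⁻ v in Metric.ball v₀ 1, ENNReal.ofReal (nearReaction a γ ρ m g v) ≤
      ENNReal.ofReal (d * d * a * unitVol d * ρ ^ ((d : ℝ) + γ)) *
        ∫⁻ v in Metric.ball v₀ 2, ENNReal.ofReal (max (g v - m) 0) := by
  obtain ⟨B, hB⟩ := hg.dens
  have hd : (2 : ℝ) ≤ d := by exact_mod_cast hp.dim
  set c := ((d : ℝ) - 1) * ((d : ℝ) + γ) * a with hc
  have hc0 : 0 ≤ c := reaction_const_nonneg hp ha
  set X : ENNReal := ∫⁻ v in Metric.ball v₀ 2, ENNReal.ofReal (max (g v - m) 0) with hX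
  have hFm : Measurable fun v => max (g v - m) 0 := (hB.meas.sub_const m).max measurable_const
  have e1 : ∀ v, ENNReal.ofReal (nearReaction a γ ρ m g v) = ENNReal.ofReal c *
      ∫⁻ w, ENNReal.ofReal (nearSing γ ρ w) * ENNReal.ofReal (max (g (v - w) - m) 0) := by
    intro v
    unfold nearReaction
    rw [ENNReal.ofReal_mul hc0, ofReal_integral_eq_lintegral_ofReal
      (hg.integrable_nearSing_mul hp hρ1 hm v) (Eventually.of_forall fun w =>
        mul_nonneg (nearSing_nonneg γ ρ w) (le_max_right _ _))]
    simp only [ENNReal.ofReal_mul (nearSing_nonneg γ ρ _)]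
  simp only [e1]
  rw [lintegral_const_mul' _ _ ENNReal.ofReal_ne_top, lintegral_lintegral_swap (by
    refine Measurable.aemeasurable ?_
    exact ((measurable_nearSing γ ρ).comp measurable_snd).ennreal_ofReal.mul
      (hFm.comp (measurable_fst.sub measurable_snd)).ennreal_ofReal)]
  have h1 : ∀ w : Vel d, ∫⁻ v in Metric.ball v₀ 1, ENNReal.ofReal (nearSing γ ρ w) *
      ENNReal.ofReal (max (g (v - w) - m) 0) ≤ ENNReal.ofReal (nearSing γ ρ w) * X := by
    intro w
    rw [lintegral_const_mul' _ _ ENNReal.ofReal_ne_top]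
    by_cases hw : w ∈ Metric.ball (0 : Vel d) ρ
    · gcongr
      rw [hX, ← lintegral_indicator measurableSet_ball, ← lintegral_indicator measurableSet_ball]
      rw [← lintegral_sub_right_eq_self ((Metric.ball v₀ 2).indicator
        fun v => ENNReal.ofReal (max (g v - m) 0)) w]
      refine lintegral_mono fun v => ?_
      by_cases hv : v ∈ Metric.ball v₀ 1
      · rw [Set.indicator_of_mem hv, Set.indicator_of_mem]
        rw [mem_ball_iff_norm] at hv ⊢
        have h2 := mem_ball_zero_iff.1 hw
        have h3 := norm_sub_le (v - v₀) w
        rw [show v - w - v₀ = v - v₀ - w by abel]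
        linarith
      · rw [Set.indicator_of_notMem hv]; exact zero_le
    · simp [nearSing, Set.indicator_of_notMem hw]
  have hXt : X ≠ ⊤ := by
    have h2 : X ≤ ∫⁻ v, ENNReal.ofReal (max (g v - m) 0) := setLIntegral_le_lintegral _ _
    refine (h2.trans_lt ?_).ne
    rw [← ofReal_integral_eq_lintegral_ofReal (hg.integrable_excess hm)
      (Eventually.of_forall fun v => le_max_right _ _)]
    exact ENNReal.ofReal_lt_top
  calc _ ≤ ENNReal.ofReal c * ∫⁻ w : Vel d, ENNReal.ofReal (nearSing γ ρ w) * X := by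
        gcongr with w; exact h1 w
    _ = ENNReal.ofReal (c * ∫ w : Vel d, nearSing γ ρ w) * X := by
        rw [lintegral_mul_const' _ _ hXt, ENNReal.ofReal_mul hc0,
          ofReal_integral_eq_lintegral_ofReal (integrable_nearSing hp hρ1)
          (Eventually.of_forall (nearSing_nonneg γ ρ)), mul_assoc]
    _ ≤ _ := by
        refine mul_le_mul_left (ENNReal.ofReal_le_ofReal ?_) X
        have hρp := Real.rpow_nonneg hρ.le ((d : ℝ) + γ)
        have hω := unitVol_pos d
        calc c * ∫ w : Vel d, nearSing γ ρ w
            = ((d : ℝ) - 1) * a * (((d : ℝ) + γ) * ∫ w : Vel d, nearSing γ ρ w) := by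
              rw [hc]; ring
          _ = ((d : ℝ) - 1) * (d * a * unitVol d * ρ ^ ((d : ℝ) + γ)) := by
              rw [integral_nearSing hp hρ]; ring
          _ ≤ d * (d * a * unitVol d * ρ ^ ((d : ℝ) + γ)) := by gcongr; linarith
          _ = _ := by ring

/-- The mass near a far away point is small. -/
theorem Profile.lintegral_ball_le (hg : Profile M₁ M₀ E₀ H₀ g) (v₀ : Vel d) :
    ∫⁻ v in Metric.ball v₀ 2, ENNReal.ofReal (g v) ≤
      ENNReal.ofReal (9 * (M₀ + E₀) / jap v₀ ^ 2) := by
  obtain ⟨B, hB⟩ := hg.dens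
  rw [← ofReal_integral_eq_lintegral_ofReal hB.int.integrableOn
    (Eventually.of_forall hg.nonneg)]
  refine ENNReal.ofReal_le_ofReal ?_
  have hj := jap_pos v₀
  have hi := (hB.int.fun_add hB.int2).const_mul (9 / jap v₀ ^ 2)
  have h1 : ∫ v in Metric.ball v₀ 2, g v ≤
      ∫ v in Metric.ball v₀ 2, 9 / jap v₀ ^ 2 * (g v + ‖v‖ ^ 2 * g v) := by
    refine setIntegral_mono_on hB.int.integrableOn hi.integrableOn measurableSet_ball
      fun v hv => ?_
    have h2 : ‖v₀‖ ≤ ‖v‖ + 2 := by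
      have := mem_ball_iff_norm.1 hv
      have h3 := norm_sub_norm_le v₀ v
      rw [norm_sub_rev] at h3
      linarith
    have h3 : jap v₀ ^ 2 ≤ 9 * (1 + ‖v‖ ^ 2) := by
      rw [jap_sq]
      have := pow_le_pow_left₀ (norm_nonneg _) h2 2
      nlinarith [sq_nonneg (‖v‖ - 2), sq_nonneg ‖v‖]
    have h4 := mul_le_mul_of_nonneg_right h3 (hg.nonneg v)
    rw [div_mul_eq_mul_div, le_div_iff₀ (by positivity)]
    linarith
  have h2 := setIntegral_le_integral (s := Metric.ball v₀ 2) hi (Eventually.of_forall fun v => by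
    have := hg.nonneg v
    show 0 ≤ 9 / jap v₀ ^ 2 * (g v + ‖v‖ ^ 2 * g v)
    positivity)
  refine (h1.trans h2).trans ?_
  rw [integral_const_mul, integral_add hB.int hB.int2]
  calc _ ≤ 9 / jap v₀ ^ 2 * (M₀ + E₀) := by
        gcongr
        · exact hg.mass_le
        · exact hg.energy_le
    _ = _ := by ring

/-- The large values of the density near a far away point. The integral is at most `η` and at most
`O(⟨v₀⟩^(-2))`; the geometric mean of the two bounds is small and gains one power of `⟨v₀⟩`. -/
theorem Profile.lintegral_ball_excess_le (hg : Profile M₁ M₀ E₀ H₀ g) {m η : ℝ} (hm : 0 ≤ m)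
    (hη : ∫ v, max (g v - m) 0 ≤ η) (v₀ : Vel d) :
    ∫⁻ v in Metric.ball v₀ 2, ENNReal.ofReal (max (g v - m) 0) ≤
      ENNReal.ofReal (Real.sqrt (9 * (M₀ + E₀) * η) / jap v₀) := by
  have hj := jap_pos v₀
  have hη0 : 0 ≤ η := (integral_nonneg fun v => le_max_right _ _).trans hη
  have hME : 0 ≤ M₀ + E₀ := add_nonneg ((integral_nonneg hg.nonneg).trans hg.mass_le)
    ((integral_nonneg fun v => mul_nonneg (sq_nonneg _) (hg.nonneg v)).trans hg.energy_le)
  have h1 : ∫⁻ v in Metric.ball v₀ 2, ENNReal.ofReal (max (g v - m) 0) ≤ ENNReal.ofReal η := by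
    refine (setLIntegral_le_lintegral _ _).trans ?_
    rw [← ofReal_integral_eq_lintegral_ofReal (hg.integrable_excess hm)
      (Eventually.of_forall fun v => le_max_right _ _)]
    exact ENNReal.ofReal_le_ofReal hη
  have h2 : ∫⁻ v in Metric.ball v₀ 2, ENNReal.ofReal (max (g v - m) 0) ≤
      ENNReal.ofReal (9 * (M₀ + E₀) / jap v₀ ^ 2) := by
    refine le_trans (lintegral_mono fun v => ENNReal.ofReal_le_ofReal ?_) (hg.lintegral_ball_le v₀)
    exact max_le (by linarith) (hg.nonneg v)
  have h3 : min η (9 * (M₀ + E₀) / jap v₀ ^ 2) ≤ Real.sqrt (9 * (M₀ + E₀) * η) / jap v₀ := by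
    rw [le_div_iff₀ hj]
    refine Real.le_sqrt_of_sq_le ?_
    have h4 : 0 ≤ min η (9 * (M₀ + E₀) / jap v₀ ^ 2) := le_min hη0 (by positivity)
    calc (min η (9 * (M₀ + E₀) / jap v₀ ^ 2) * jap v₀) ^ 2 =
        (min η (9 * (M₀ + E₀) / jap v₀ ^ 2) * min η (9 * (M₀ + E₀) / jap v₀ ^ 2)) *
          jap v₀ ^ 2 := by ring
      _ ≤ (η * (9 * (M₀ + E₀) / jap v₀ ^ 2)) * jap v₀ ^ 2 := by
          gcongr
          · exact min_le_left _ _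
          · exact min_le_right _ _
      _ = _ := by field_simp
  have h4 := ENNReal.ofReal_le_ofReal h3
  rw [ENNReal.ofReal_min] at h4
  exact (le_min h1 h2).trans h4

/-- Chebyshev's inequality near a far away point. -/
theorem Profile.volume_level_le (hg : Profile M₁ M₀ E₀ H₀ g) {N : ℝ} (hN : 0 < N) (v₀ : Vel d) :
    volume {v ∈ Metric.ball v₀ 1 | N ≤ g v} ≤
      ENNReal.ofReal (9 * (M₀ + E₀) / (N * jap v₀ ^ 2)) := by
  obtain ⟨B, hB⟩ := hg.dens
  have hj := jap_pos v₀
  have h1 := mul_meas_ge_le_lintegral₀ (μ := volume.restrict (Metric.ball v₀ 2))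
    (hB.meas.ennreal_ofReal.aemeasurable) (ENNReal.ofReal N)
  have h2 : volume {v ∈ Metric.ball v₀ 1 | N ≤ g v} ≤
      (volume.restrict (Metric.ball v₀ 2)) {v | ENNReal.ofReal N ≤ ENNReal.ofReal (g v)} := by
    rw [Measure.restrict_apply' measurableSet_ball]
    exact measure_mono fun v hv => ⟨ENNReal.ofReal_le_ofReal hv.2,
      Metric.ball_subset_ball (by norm_num) hv.1⟩
  have h3 := h1.trans (hg.lintegral_ball_le v₀)
  have h4 : ENNReal.ofReal N ≠ 0 := by simpa using hN
  refine h2.trans ?_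
  rw [mul_comm, ← ENNReal.le_div_iff_mul_le (Or.inl h4) (Or.inl ENNReal.ofReal_ne_top),
    ← ENNReal.ofReal_div_of_pos hN] at h3
  refine h3.trans (le_of_eq ?_)
  congr 1
  field_simp

end

section

variable {d : ℕ}

/-! ### Determinants and traces of nonnegative matrices -/

theorem posSemidef_of_quad {A : Matrix (Fin d) (Fin d) ℝ} (hA : ∀ i j, A i j = A j i)
    (h0 : ∀ ξ, 0 ≤ quad A ξ) : A.PosSemidef := by
  refine .of_dotProduct_mulVec_nonneg ?_ fun x => ?_
  · ext i j; simp [hA i j]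
  · refine (h0 x).trans (le_of_eq ?_)
    simp only [quad, dotProduct, Matrix.mulVec, Finset.mul_sum, star_trivial]
    exact Finset.sum_congr rfl fun i _ => Finset.sum_congr rfl fun j _ => by ring

theorem det_le_trace_pow {A : Matrix (Fin d) (Fin d) ℝ} (hA : A.PosSemidef) :
    A.det ≤ A.trace ^ d := by
  have h1 := hA.isHermitian.det_eq_prod_eigenvalues
  have h2 := hA.isHermitian.trace_eq_sum_eigenvalues
  simp only [RCLike.ofReal_real_eq_id, id] at h1 h2
  rw [h1, h2]
  have h3 := fun i => hA.eigenvalues_nonneg i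
  calc ∏ i, hA.isHermitian.eigenvalues i ≤ ∏ _i : Fin d, ∑ j, hA.isHermitian.eigenvalues j :=
        Finset.prod_le_prod (fun i _ => h3 i) fun i _ =>
          Finset.single_le_sum (fun j _ => h3 j) (Finset.mem_univ i)
    _ = _ := by simp

open scoped MatrixOrder in
theorem exists_eq_transpose_mul_self {A : Matrix (Fin d) (Fin d) ℝ} (hA : A.PosSemidef) :
    ∃ B : Matrix (Fin d) (Fin d) ℝ, A = B.transpose * B := by
  obtain ⟨B, hB⟩ := CStarAlgebra.nonneg_iff_eq_star_mul_self.mp hA.nonneg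
  exact ⟨B, hB⟩

/-- A product of two nonnegative matrices has the trace and the determinant of a nonnegative matrix,
the conjugate of one factor by a square root of the other. -/
theorem trace_mul_eq {A M : Matrix (Fin d) (Fin d) ℝ} (hA : A.PosSemidef) (hM : M.PosSemidef) :
    ∃ C : Matrix (Fin d) (Fin d) ℝ, C.PosSemidef ∧ C.trace = (A * M).trace ∧
      C.det = A.det * M.det := by
  obtain ⟨B, rfl⟩ := exists_eq_transpose_mul_self hA
  refine ⟨B * M * B.transpose, ?_, ?_, ?_⟩
  · simpa using hM.mul_mul_conjTranspose_same B
  · rw [Matrix.trace_mul_comm, ← Matrix.mul_assoc]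
  · simp only [Matrix.det_mul, Matrix.det_transpose]; ring

/-- The arithmetic-geometric inequality for a product of nonnegative matrices, in the form used
with the Krylov–Tso estimate. -/
theorem det_mul_det_le_trace_pow {A D M : Matrix (Fin d) (Fin d) ℝ} (hD : D.PosSemidef)
    (hAD : (A - D).PosSemidef) (hM : M.PosSemidef) :
    0 ≤ (A * M).trace ∧ D.det * M.det ≤ (A * M).trace ^ d := by
  obtain ⟨C, hC, hCt, hCd⟩ := trace_mul_eq hD hM
  obtain ⟨C', hC', hCt', -⟩ := trace_mul_eq hAD hM
  have h1 := hC'.trace_nonneg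
  have h2 := hC.trace_nonneg
  rw [hCt', Matrix.sub_mul, Matrix.trace_sub] at h1
  have h3 := det_le_trace_pow hC
  rw [hCd, hCt] at h3
  rw [hCt] at h2
  exact ⟨by linarith, h3.trans (pow_le_pow_left₀ h2 (by linarith) d)⟩

theorem det_one_add_smul_rank_one (c : ℝ) (v : Vel d) :
    (Matrix.of fun i j : Fin d => (if i = j then (1 : ℝ) else 0) + c * (v i * v j)).det =
      1 + c * ‖v‖ ^ 2 := by
  have e : (Matrix.of fun i j : Fin d => (if i = j then (1 : ℝ) else 0) + c * (v i * v j)) =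
      1 + Matrix.replicateCol Unit (fun i => c * v i) * Matrix.replicateRow Unit (fun i => v i) := by
    ext i j
    simp [Matrix.mul_apply, Matrix.one_apply]; ring
  rw [e, Matrix.det_one_add_replicateCol_mul_replicateRow, norm_sq_eq_sum, dotProduct,
    Finset.mul_sum]
  congr 1
  exact Finset.sum_congr rfl fun i _ => by ring

/-- The matrix `s ((1 + |v|²) I - v ⊗ v)`, which bounds the diffusion from below. -/
def lowerMat (s : ℝ) (v : Vel d) : Matrix (Fin d) (Fin d) ℝ :=
  Matrix.of fun i j => s * ((if i = j then jap v ^ 2 else 0) - v i * v j)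

theorem quad_lowerMat (s : ℝ) (v ξ : Vel d) :
    quad (lowerMat s v) ξ = s * (jap v ^ 2 * ‖ξ‖ ^ 2 - (inner ℝ v ξ) ^ 2) := by
  have e : inner ℝ v ξ = ∑ i, v i * ξ i := by
    rw [PiLp.inner_apply]; exact Finset.sum_congr rfl fun i _ => by simp [mul_comm]
  have e1 : ∀ i, ∑ j, lowerMat s v i j * (ξ i * ξ j) =
      s * (jap v ^ 2 * ξ i ^ 2 - v i * ξ i * inner ℝ v ξ) := by
    intro i
    rw [e, Finset.mul_sum]
    have : ∀ j, lowerMat s v i j * (ξ i * ξ j) =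
        (if i = j then s * jap v ^ 2 * (ξ i * ξ j) else 0) -
          s * (v i * ξ i * (v j * ξ j)) := by
      intro j; simp only [lowerMat, Matrix.of_apply]; split_ifs <;> ring
    rw [Finset.sum_congr rfl fun j _ => this j, Finset.sum_sub_distrib,
      Finset.sum_ite_eq, if_pos (Finset.mem_univ i), ← Finset.mul_sum]
    ring
  unfold quad
  rw [Finset.sum_congr rfl fun i _ => e1 i, ← Finset.mul_sum, Finset.sum_sub_distrib,
    ← Finset.mul_sum, ← Finset.sum_mul, ← e, ← norm_sq_eq_sum]
  ring

/-- The eigenvalues are `s (1 + |v|²)`, with multiplicity `d - 1`, and `s`. -/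
theorem det_lowerMat (s : ℝ) (v : Vel d) :
    (lowerMat s v).det * jap v ^ 2 = s ^ d * (jap v ^ 2) ^ d := by
  have hj := jap_pos v
  have e : lowerMat s v = (s * jap v ^ 2) • Matrix.of fun i j : Fin d =>
      (if i = j then (1 : ℝ) else 0) + (-1 / jap v ^ 2) * (v i * v j) := by
    ext i j
    simp only [lowerMat, Matrix.of_apply, Matrix.smul_apply, smul_eq_mul]
    split_ifs <;> field_simp <;> ring
  rw [e, Matrix.det_smul, det_one_add_smul_rank_one, Fintype.card_fin, mul_pow]
  have h : (1 + -1 / jap v ^ 2 * ‖v‖ ^ 2) * jap v ^ 2 = 1 := by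
    have := jap_sq v
    field_simp
    linarith
  rw [mul_assoc, h, mul_one]

/-! ### Gradient and Hessian in coordinates -/

/-- The gradient of `u`, assembled from its partial derivatives. -/
def grad (u : Vel d → ℝ) (v : Vel d) : Vel d := WithLp.toLp 2 fun i => pd i u v

theorem eq_sum_single (ξ : Vel d) :
    ξ = ∑ i, ξ i • (EuclideanSpace.single i (1 : ℝ) : Vel d) := by
  ext j
  simp [Finset.sum_apply, Pi.single_apply]

theorem hasGradientAt_grad {u : Vel d → ℝ} (hu : ContDiff ℝ 1 u) (v : Vel d) :
    HasGradientAt u (grad u v) v := by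
  rw [hasGradientAt_iff_hasFDerivAt]
  have h := (hu.differentiable one_ne_zero v).hasFDerivAt
  convert! h using 1
  ext ξ
  simp only [InnerProductSpace.toDual_apply_apply]
  conv_rhs => rw [eq_sum_single ξ, map_sum]
  rw [PiLp.inner_apply]
  refine Finset.sum_congr rfl fun i _ => ?_
  simp only [map_smul, smul_eq_mul, grad, pd]
  simp [mul_comm]

theorem contDiff_grad {u : Vel d → ℝ} (hu : ContDiff ℝ 2 u) : ContDiff ℝ 1 (grad u) :=
  contDiff_euclidean.2 fun i => contDiff_pd hu i

/-- The Hessian of `u`, as an endomorphism. -/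
def hess (u : Vel d → ℝ) (v : Vel d) : Vel d →L[ℝ] Vel d := fderiv ℝ (grad u) v

theorem hasFDerivAt_grad {u : Vel d → ℝ} (hu : ContDiff ℝ 2 u) (v : Vel d) :
    HasFDerivAt (grad u) (hess u v) v :=
  ((contDiff_grad hu).differentiable one_ne_zero v).hasFDerivAt

theorem continuous_hess {u : Vel d → ℝ} (hu : ContDiff ℝ 2 u) : Continuous (hess u) :=
  (contDiff_grad hu).continuous_fderiv one_ne_zero

theorem hess_single_apply {u : Vel d → ℝ} (hu : ContDiff ℝ 2 u) (v : Vel d) (i j : Fin d) :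
    hess u v (EuclideanSpace.single j 1) i = pd j (pd i u) v := by
  have h := (EuclideanSpace.proj i : Vel d →L[ℝ] ℝ).hasFDerivAt.comp v (hasFDerivAt_grad hu v)
  have e : (EuclideanSpace.proj i : Vel d →L[ℝ] ℝ) ∘ grad u = pd i u := rfl
  rw [e] at h
  unfold pd
  change _ = fderiv ℝ (pd i u) v _
  rw [h.fderiv]
  rfl

theorem pd_comm {u : Vel d → ℝ} (hu : ContDiff ℝ 2 u) (v : Vel d) (i j : Fin d) :
    pd i (pd j u) v = pd j (pd i u) v := by
  have hsym : IsSymmSndFDerivAt ℝ u v := hu.contDiffAt.isSymmSndFDerivAt (by simp)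
  have h : ∀ i j, pd i (pd j u) v =
      fderiv ℝ (fderiv ℝ u) v (EuclideanSpace.single i 1) (EuclideanSpace.single j 1) := by
    intro i j
    rw [← partial₂_eq hu, partial₂, iteratedFDeriv_two_apply]
    simp
  rw [h, h]
  exact hsym _ _

/-- The Hessian matrix of `u`. -/
def hessMat (u : Vel d → ℝ) (v : Vel d) : Matrix (Fin d) (Fin d) ℝ :=
  Matrix.of fun i j => pd i (pd j u) v

theorem det_hess {u : Vel d → ℝ} (hu : ContDiff ℝ 2 u) (v : Vel d) :
    (hess u v).det = (hessMat u v).det := by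
  have e : LinearMap.toMatrix (EuclideanSpace.basisFun (Fin d) ℝ).toBasis
      (EuclideanSpace.basisFun (Fin d) ℝ).toBasis (hess u v : Vel d →ₗ[ℝ] Vel d) =
      (hessMat u v).transpose := by
    ext i j
    rw [LinearMap.toMatrix_apply]
    simp only [OrthonormalBasis.coe_toBasis, EuclideanSpace.basisFun_apply,
      ContinuousLinearMap.coe_coe, OrthonormalBasis.coe_toBasis_repr_apply,
      EuclideanSpace.basisFun_repr, Matrix.transpose_apply, hessMat, Matrix.of_apply]
    exact hess_single_apply hu v i j
  rw [← Matrix.det_transpose, ← e, LinearMap.det_toMatrix]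

theorem quad_hessMat {u : Vel d → ℝ} (hu : ContDiff ℝ 2 u) (v ξ : Vel d) :
    quad (hessMat u v) ξ = inner ℝ ξ (hess u v ξ) := by
  have h : ∀ i, hess u v ξ i = ∑ j, ξ j * pd j (pd i u) v := fun i => by
    conv_lhs => rw [eq_sum_single ξ, map_sum]
    rw [WithLp.ofLp_sum, Finset.sum_apply]
    refine Finset.sum_congr rfl fun j _ => ?_
    rw [map_smul, PiLp.smul_apply, hess_single_apply hu, smul_eq_mul]
  rw [PiLp.inner_apply]
  unfold quad
  refine Finset.sum_congr rfl fun i _ => ?_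
  simp only [RCLike.inner_apply, conj_trivial, h, Finset.sum_mul]
  refine Finset.sum_congr rfl fun j _ => ?_
  rw [hessMat, Matrix.of_apply, pd_comm hu v i j]; ring

theorem det_neg_hessMat_abs {u : Vel d → ℝ} (hu : ContDiff ℝ 2 u) (v : Vel d)
    (h : (-hessMat u v).PosSemidef) : |(hess u v).det| = (-hessMat u v).det := by
  rw [det_hess hu, ← abs_of_nonneg h.det_nonneg, Matrix.det_neg, abs_mul, abs_pow]
  simp

theorem posSemidef_neg_hessMat {u : Vel d → ℝ} (hu : ContDiff ℝ 2 u) {v : Vel d}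
    (h : ∀ ξ, inner ℝ ξ (hess u v ξ) ≤ 0) : (-hessMat u v).PosSemidef := by
  refine posSemidef_of_quad (fun i j => ?_) fun ξ => ?_
  · simp only [Matrix.neg_apply, hessMat, Matrix.of_apply, pd_comm hu v i j]
  · have h1 := h (WithLp.toLp 2 ξ)
    rw [← quad_hessMat hu] at h1
    have e : quad (-hessMat u v) ξ = -quad (hessMat u v) ξ := by
      simp only [quad, Matrix.neg_apply, neg_mul, Finset.sum_neg_distrib]
    rw [e]
    exact neg_nonneg.2 h1

end

section

variable {d : ℕ}

/-! ### The contact set of an anisotropic paraboloid -/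

/-- The quadratic form `κ (|x|² + (v₀ · x)²)`, whose sublevel sets are ellipsoids adapted to the
anisotropy of the diffusion near `v₀`. -/
def stretch (κ : ℝ) (v₀ x : Vel d) : ℝ := κ * (‖x‖ ^ 2 + (inner ℝ v₀ x) ^ 2)

theorem stretch_nonneg {κ : ℝ} (hκ : 0 ≤ κ) (v₀ x : Vel d) : 0 ≤ stretch κ v₀ x := by
  unfold stretch; positivity

theorem contDiff_stretch (κ : ℝ) (v₀ : Vel d) {n : ℕ} :
    ContDiff ℝ n fun v => stretch κ v₀ (v - v₀) := by
  have h1 : ContDiff ℝ n fun v : Vel d => v - v₀ := contDiff_id.sub contDiff_const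
  exact contDiff_const.mul (((contDiff_norm_sq ℝ).comp h1).add
    ((contDiff_const.inner ℝ h1).pow 2))

theorem pd_eq_of_hasFDerivAt {u : Vel d → ℝ} {u' : Vel d →L[ℝ] ℝ} {v : Vel d}
    (h : HasFDerivAt u u' v) (i : Fin d) : pd i u v = u' (EuclideanSpace.single i 1) := by
  rw [pd, h.fderiv]

theorem hasFDerivAt_stretch (κ : ℝ) (v₀ v : Vel d) :
    HasFDerivAt (fun v => stretch κ v₀ (v - v₀))
      (κ • ((2 : ℝ) • innerSL ℝ (v - v₀) + (2 * inner ℝ v₀ (v - v₀)) • innerSL ℝ v₀)) v := by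
  have h0 : HasFDerivAt (fun v : Vel d => v - v₀) (ContinuousLinearMap.id ℝ (Vel d)) v :=
    (hasFDerivAt_id v).sub_const v₀
  have h1 := ((hasStrictFDerivAt_norm_sq (v - v₀)).hasFDerivAt).comp v h0
  have h2 := (((innerSL ℝ v₀).hasFDerivAt (x := v - v₀)).comp v h0).pow 2
  have h3 := (h1.add h2).const_mul κ
  refine h3.congr_fderiv ?_
  ext ξ
  simp only [smul_apply, add_apply,
    ContinuousLinearMap.comp_apply, innerSL_apply_apply, ContinuousLinearMap.id_apply, smul_eq_mul,
    Function.comp_apply, nsmul_eq_mul]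
  norm_num

theorem pd_sub_stretch {u : Vel d → ℝ} (hu : ContDiff ℝ 1 u) (κ c₀ c₁ : ℝ) (v₀ : Vel d)
    (j : Fin d) : pd j (fun v => u v - (c₀ + c₁ * stretch κ v₀ (v - v₀))) = fun v =>
      pd j u v - c₁ * (κ * (2 * (v j - v₀ j) + 2 * inner ℝ v₀ (v - v₀) * v₀ j)) := by
  funext v
  have h := (hu.differentiable one_ne_zero v).hasFDerivAt.sub
    (((hasFDerivAt_stretch κ v₀ v).const_mul c₁).const_add c₀)
  refine Eq.trans (pd_eq_of_hasFDerivAt h j) ?_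
  simp [pd, EuclideanSpace.inner_single_right]
  ring

theorem pd_pd_sub_stretch {u : Vel d → ℝ} (hu : ContDiff ℝ 2 u) (κ c₀ c₁ : ℝ) (v₀ v : Vel d)
    (i j : Fin d) : pd i (pd j (fun v => u v - (c₀ + c₁ * stretch κ v₀ (v - v₀)))) v =
      pd i (pd j u) v - c₁ * (κ * (2 * (if i = j then 1 else 0) + 2 * (v₀ i * v₀ j))) := by
  rw [pd_sub_stretch (hu.of_le (by norm_num))]
  have h0 : HasFDerivAt (fun v : Vel d => v - v₀) (ContinuousLinearMap.id ℝ (Vel d)) v :=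
    (hasFDerivAt_id v).sub_const v₀
  have h1 := (((hasFDerivAt_coord j v).sub_const (v₀ j)).const_mul 2)
  have h2 := (((((innerSL ℝ v₀).hasFDerivAt (x := v - v₀)).comp v h0).const_mul 2).mul_const (v₀ j))
  have h3 := ((contDiff_pd hu j).differentiable one_ne_zero v).hasFDerivAt.sub
    (((h1.add h2).const_mul κ).const_mul c₁)
  have e := pd_eq_of_hasFDerivAt h3 i
  refine Eq.trans e ?_
  simp [pd, EuclideanSpace.inner_single_right, eq_comm]
  split_ifs <;> ring

/-- The square root of the quadratic form `stretch κ v₀`: with `c = 1 / (1 + ⟨v₀⟩)` the square of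
`I + c v₀ ⊗ v₀` is `I + v₀ ⊗ v₀`. -/
def stretchMap (κ : ℝ) (v₀ : Vel d) : Vel d →ₗ[ℝ] Vel d :=
  Real.sqrt κ • LinearMap.transvection ((1 / (1 + jap v₀)) • (innerSL ℝ v₀ : Vel d →ₗ[ℝ] ℝ)) v₀

theorem stretchMap_apply (κ : ℝ) (v₀ x : Vel d) :
    stretchMap κ v₀ x = Real.sqrt κ • (x + (1 / (1 + jap v₀) * inner ℝ v₀ x) • v₀) := by
  simp [stretchMap, LinearMap.transvection.apply]

theorem norm_stretchMap_sq {κ : ℝ} (hκ : 0 ≤ κ) (v₀ x : Vel d) :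
    ‖stretchMap κ v₀ x‖ ^ 2 = stretch κ v₀ x := by
  have hj := jap_pos v₀
  rw [stretchMap_apply, norm_smul, mul_pow, Real.norm_eq_abs, sq_abs, Real.sq_sqrt hκ,
    norm_add_sq_real, inner_smul_right, norm_smul, mul_pow, Real.norm_eq_abs, sq_abs,
    real_inner_comm v₀ x]
  have h : ‖v₀‖ ^ 2 = jap v₀ ^ 2 - 1 := by rw [jap_sq]; ring
  have h1 : (1 + jap v₀) ≠ 0 := by positivity
  rw [h, stretch]
  field_simp
  ring

theorem inner_stretchMap (κ : ℝ) (v₀ z x : Vel d) :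
    inner ℝ (stretchMap κ v₀ z) x = inner ℝ z (stretchMap κ v₀ x) := by
  rw [stretchMap_apply, stretchMap_apply, inner_smul_left, inner_smul_right, inner_add_left,
    inner_add_right, inner_smul_left, inner_smul_right, real_inner_comm z v₀]
  simp only [conj_trivial]
  ring

theorem det_stretchMap (κ : ℝ) (v₀ : Vel d) :
    LinearMap.det (stretchMap κ v₀) = Real.sqrt κ ^ d * jap v₀ := by
  have hj := jap_pos v₀
  have h : ‖v₀‖ ^ 2 = jap v₀ ^ 2 - 1 := by rw [jap_sq]; ring
  have h1 : (1 + jap v₀) ≠ 0 := by positivity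
  rw [stretchMap, LinearMap.det_smul, LinearMap.transvection.det, finrank_euclideanSpace_fin]
  congr 1
  simp only [LinearMap.smul_apply, ContinuousLinearMap.coe_coe, innerSL_apply_apply,
    real_inner_self_eq_norm_sq, smul_eq_mul, h]
  field_simp
  ring

/-- The slopes of the affine functions which change little on the ellipsoid of `stretch κ v₀`. -/
def slopes (κ : ℝ) (v₀ : Vel d) (r : ℝ) : Set (Vel d) :=
  stretchMap κ v₀ '' Metric.closedBall 0 r

theorem measurableSet_slopes (κ : ℝ) (v₀ : Vel d) (r : ℝ) : MeasurableSet (slopes κ v₀ r) :=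
  ((isCompact_closedBall 0 r).image
    (LinearMap.continuous_of_finiteDimensional _)).measurableSet

theorem volume_slopes (κ : ℝ) (v₀ : Vel d) {r : ℝ} (hr : 0 ≤ r) :
    volume (slopes κ v₀ r) =
      ENNReal.ofReal (Real.sqrt κ ^ d * jap v₀ * r ^ d * unitVol d) := by
  have hj := jap_pos v₀
  rw [slopes, Measure.addHaar_image_linearMap, det_stretchMap,
    Measure.addHaar_closedBall _ _ hr, finrank_euclideanSpace_fin, abs_of_nonneg (by positivity)]
  rw [unitVol, ENNReal.ofReal_mul (by positivity), ENNReal.ofReal_mul (by positivity),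
    ENNReal.ofReal_mul (by positivity), ENNReal.ofReal_mul (by positivity), Measure.real,
    ENNReal.ofReal_toReal measure_ball_lt_top.ne]
  simp only [mul_assoc]

theorem abs_inner_slopes_le {κ : ℝ} (hκ : 0 ≤ κ) {v₀ p x : Vel d} {r : ℝ}
    (hp : p ∈ slopes κ v₀ r) (hx : stretch κ v₀ x ≤ 1) : |inner ℝ p x| ≤ r := by
  obtain ⟨z, hz, rfl⟩ := hp
  rw [inner_stretchMap]
  have h1 : ‖stretchMap κ v₀ x‖ ≤ 1 := by
    rw [← norm_stretchMap_sq hκ] at hx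
    exact (sq_le_one_iff₀ (norm_nonneg _)).1 hx
  have h2 : ‖z‖ ≤ r := by simpa using hz
  calc _ ≤ ‖z‖ * ‖stretchMap κ v₀ x‖ := abs_real_inner_le_norm _ _
    _ ≤ r * 1 := mul_le_mul h2 h1 (norm_nonneg _) ((norm_nonneg _).trans h2)
    _ = r := mul_one r

section
variable {a γ B : ℝ} {S : EReal} {f : ℝ → Vel d → ℝ}

theorem reaction_nonneg (hp : Params d γ) (ha : 0 ≤ a) {g : Vel d → ℝ} (h0 : ∀ v, 0 ≤ g v)
    (v : Vel d) : 0 ≤ reaction a γ g v :=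
  mul_nonneg (reaction_const_nonneg hp ha) (integral_nonneg fun w =>
    mul_nonneg (Real.rpow_nonneg (norm_nonneg _) _) (h0 _))

/-- At a point of contact from above, both `∂ₜu` and `det (-D²u)` are controlled by the equation:
`∂ₜu + tr (-A D²u)` is of size `N (c + s)`, and the inequality of arithmetic and geometric means
applies to the second term. -/
theorem mul_abs_det_hess_le {A : Matrix (Fin d) (Fin d) ℝ} (hA : ∀ i j, A i j = A j i)
    {g : Vel d → ℝ} (hg : ContDiff ℝ 2 g) {κ N c₀ l Λ s c ut : ℝ} {v₀ v : Vel d} (hl : 0 < l)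
    (hN : 0 ≤ N)
    (hlow : ∀ ξ : Vel d, l * (jap v ^ 2 * ‖ξ‖ ^ 2 - (inner ℝ v ξ) ^ 2) ≤ quad A ξ)
    (hup : κ * ((∑ i, A i i) + quad A v₀) ≤ Λ * s) (hs : 0 ≤ s) (hc : 0 ≤ c) (hΛ : 0 ≤ Λ)
    (hgN : g v ≤ 5 / 4 * N)
    (hut : ut = (∑ i, ∑ j, A i j * pd i (pd j g) v) + c * g v + 3 / 4 * N * s)
    (hneg : ∀ ξ, inner ℝ ξ (hess (fun v => g v - (c₀ + 3 / 4 * N * stretch κ v₀ (v - v₀))) v ξ) ≤ 0)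
    (hut0 : 0 < ut) :
    ut * |(hess (fun v => g v - (c₀ + 3 / 4 * N * stretch κ v₀ (v - v₀))) v).det| ≤
      ((5 / 4 + 3 / 2 * Λ) * N * (c + s)) ^ (d + 1) * (jap v ^ 2 / (l * jap v ^ 2) ^ d) := by
  set u : Vel d → ℝ := fun v => g v - (c₀ + 3 / 4 * N * stretch κ v₀ (v - v₀)) with hu
  have hu2 : ContDiff ℝ 2 u :=
    hg.sub (contDiff_const.add (contDiff_const.mul (contDiff_stretch κ v₀)))
  have hj := jap_pos v
  have hM := posSemidef_neg_hessMat hu2 hneg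
  have hD : (lowerMat l v).PosSemidef := by
    refine posSemidef_of_quad (fun i j => ?_) fun ξ => ?_
    · simp only [lowerMat, Matrix.of_apply]
      rw [mul_comm (v i)]
      by_cases h : i = j
      · simp [h]
      · simp [h, Ne.symm h]
    · have h1 := quad_lowerMat l v (WithLp.toLp 2 ξ)
      have h2 : quad (lowerMat l v) ξ = quad (lowerMat l v) (WithLp.toLp 2 ξ : Vel d) := rfl
      rw [h2, h1]
      have h4 := (sq_le_sq₀ (abs_nonneg _) (by positivity)).2
        (abs_real_inner_le_norm v (WithLp.toLp 2 ξ))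
      rw [sq_abs, mul_pow] at h4
      refine mul_nonneg hl.le ?_
      rw [jap_sq]
      nlinarith [sq_nonneg ‖(WithLp.toLp 2 ξ : Vel d)‖]
  have hAD : (A - lowerMat l v).PosSemidef := by
    refine posSemidef_of_quad (fun i j => ?_) fun ξ => ?_
    · rw [Matrix.sub_apply, Matrix.sub_apply, hA i j, ← hD.isHermitian.apply i j]
      simp
    · have h1 := hlow (WithLp.toLp 2 ξ)
      rw [← quad_lowerMat] at h1
      have e : quad (A - lowerMat l v) ξ = quad A ξ - quad (lowerMat l v) ξ := by
        simp only [quad, Matrix.sub_apply, sub_mul, Finset.sum_sub_distrib]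
      rw [e]
      exact sub_nonneg.2 h1
  obtain ⟨htr, hdet⟩ := det_mul_det_le_trace_pow hD hAD hM
  rw [det_neg_hessMat_abs hu2 v hM]
  set tr := (A * -hessMat u v).trace with htrd
  set W := (5 / 4 + 3 / 2 * Λ) * N * (c + s) with hW
  have hsum : ut + tr ≤ W := by
    have e1 : tr = -∑ i, ∑ j, A i j * pd i (pd j u) v := by
      rw [htrd, Matrix.trace]
      simp only [Matrix.diag_apply, Matrix.mul_apply, Matrix.neg_apply, mul_neg,
        Finset.sum_neg_distrib]
      congr 1
      refine Finset.sum_congr rfl fun i _ => Finset.sum_congr rfl fun j _ => ?_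
      rw [hessMat, Matrix.of_apply, pd_comm hu2 v j i]
    have e2 : ∑ i, ∑ j, A i j * pd i (pd j u) v = (∑ i, ∑ j, A i j * pd i (pd j g) v) -
        3 / 2 * N * (κ * ((∑ i, A i i) + quad A v₀)) := by
      have e3 : ∑ i, A i i = ∑ i, ∑ j, A i j * (if i = j then 1 else 0) := by
        simp
      rw [e3]
      unfold quad
      simp only [← Finset.sum_add_distrib, Finset.mul_sum, ← Finset.sum_sub_distrib]
      refine Finset.sum_congr rfl fun i _ => Finset.sum_congr rfl fun j _ => ?_
      rw [hu, pd_pd_sub_stretch hg]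
      ring
    have h1 : 3 / 2 * N * (κ * ((∑ i, A i i) + quad A v₀)) ≤ 3 / 2 * N * (Λ * s) :=
      mul_le_mul_of_nonneg_left hup (by positivity)
    have h2 : c * g v ≤ c * (5 / 4 * N) := mul_le_mul_of_nonneg_left hgN hc
    rw [e1, e2, hut, hW]
    have h3 : 0 ≤ N * s := by positivity
    have h4 : 0 ≤ Λ * N * c := by positivity
    nlinarith
  have hW0 : 0 ≤ W := by linarith
  have hdetM := hM.det_nonneg
  have hdetD := det_lowerMat l v
  have h1 : (lowerMat l v).det * (-hessMat u v).det ≤ W ^ d :=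
    hdet.trans (pow_le_pow_left₀ htr (by linarith) d)
  have hpos : 0 < (l * jap v ^ 2) ^ d := by positivity
  have h2 : (-hessMat u v).det ≤ W ^ d * (jap v ^ 2 / (l * jap v ^ 2) ^ d) := by
    rw [← mul_div_assoc, le_div_iff₀ hpos, mul_pow, ← hdetD]
    have := mul_le_mul_of_nonneg_right h1 (sq_nonneg (jap v))
    linarith
  calc ut * (-hessMat u v).det ≤ W * (W ^ d * (jap v ^ 2 / (l * jap v ^ 2) ^ d)) :=
        mul_le_mul (by linarith) h2 hdetM hW0
    _ = _ := by ring

/-- The Krylov–Tso estimate for the difference `u` of the solution and the paraboloid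
`3/4 N (1 + (t₀ - t) / (t₀ - t₁) + stretch κ v₀ (v - v₀))`. On the parabolic boundary of the ellipsoid
`stretch < 1` the paraboloid is at least `3/2 N`, hence exceeds the solution by `N / 4`, which leaves
room for the slopes in `slopes κ v₀ (N / 4)`; at `(t₀, v₀)` the solution exceeds the paraboloid by
`N / 4`; and at a point of contact the solution is at least `3/4 N - N/4`. -/
theorem IsClassicalSolution.contact_estimate (hp : Params d γ) (ha : 0 ≤ a)
    (hf : IsClassicalSolution a γ S f) {t₁ t₀ : ℝ} (ht₁ : 0 < t₁) (ht : t₁ < t₀)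
    (hS : (t₀ : EReal) < S) {v₀ : Vel d} {κ N l Λ : ℝ} (hκ : 1 ≤ κ) (hN : 0 < N) (hl : 0 < l)
    (hΛ : 0 ≤ Λ)
    (hlow : ∀ t ∈ Set.Ioo t₁ t₀, ∀ v ξ : Vel d,
      l * jap v ^ γ * (jap v ^ 2 * ‖ξ‖ ^ 2 - (inner ℝ v ξ) ^ 2) ≤
        quad (diffusion a γ (f t) v) ξ)
    (hup : ∀ t ∈ Set.Ioo t₁ t₀, ∀ x : Vel d, ‖x‖ ≤ 1 →
      κ * ((∑ i, diffusion a γ (f t) (v₀ + x) i i) + quad (diffusion a γ (f t) (v₀ + x)) v₀) ≤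
        Λ * (1 / (t₀ - t₁)))
    (hfN : ∀ t ∈ Set.Icc t₁ t₀, ∀ v, f t v ≤ 5 / 4 * N) (hNf : N ≤ f t₀ v₀) :
    ENNReal.ofReal (N / 4) *
        ENNReal.ofReal (Real.sqrt κ ^ d * jap v₀ * (N / 4) ^ d * unitVol d) ≤
      ∫⁻ t in Set.Ioo t₁ t₀, ∫⁻ v in {v ∈ Metric.ball v₀ 1 | N / 2 ≤ f t v},
        ENNReal.ofReal (((5 / 4 + 3 / 2 * Λ) * N *
          (reaction a γ (f t) v + 1 / (t₀ - t₁))) ^ (d + 1) *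
            (jap v ^ 2 / (l * jap v ^ γ * jap v ^ 2) ^ d)) := by
  have hκ0 : 0 < κ := by linarith
  set τ := t₀ - t₁ with hτ
  have hτ0 : 0 < τ := sub_pos.2 ht
  have hIcc : ∀ t ∈ Set.Icc t₁ t₀, 0 < t ∧ (t : EReal) < S := fun t h =>
    ⟨ht₁.trans_le h.1, coe_lt_of_le h.2 hS⟩
  have hIoo : ∀ t ∈ Set.Ioo t₁ t₀, t ∈ Set.Icc t₁ t₀ := fun t h => Set.Ioo_subset_Icc_self h
  set c₀ : ℝ → ℝ := fun t => N * (3 / 4 + 3 / 4 * ((t₀ - t) / τ)) with hc₀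
  set u : ℝ → Vel d → ℝ := fun t v => f t v - (c₀ t + 3 / 4 * N * stretch κ v₀ (v - v₀)) with hu
  set ut : ℝ → Vel d → ℝ := fun t v => deriv (fun s => f s v) t + 3 / 4 * N * (1 / τ) with hut
  have hf2 : ∀ t ∈ Set.Icc t₁ t₀, ContDiff ℝ 2 (f t) := fun t h =>
    hf.contDiff_velocity t (hIcc t h).1 (hIcc t h).2
  have hu2 : ∀ t ∈ Set.Icc t₁ t₀, ContDiff ℝ 2 (u t) := fun t h =>
    (hf2 t h).sub (contDiff_const.add (contDiff_const.mul (contDiff_stretch κ v₀)))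
  have hqc : Continuous fun v : Vel d => stretch κ v₀ (v - v₀) :=
    (contDiff_stretch κ v₀ (n := 0)).continuous
  set Ω : Set (Vel d) := {v | stretch κ v₀ (v - v₀) < 1} with hΩ
  set D : Set (Vel d) := {v | stretch κ v₀ (v - v₀) ≤ 1} with hD
  have hnorm : ∀ x : Vel d, ‖x‖ ^ 2 ≤ stretch κ v₀ x := fun x => by
    unfold stretch
    nlinarith [sq_nonneg ‖x‖, sq_nonneg (inner ℝ v₀ x : ℝ)]
  have hDb : D ⊆ Metric.closedBall v₀ 1 := fun v hv => by
    rw [mem_closedBall_iff_norm]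
    exact (sq_le_one_iff₀ (norm_nonneg _)).1 ((hnorm _).trans hv)
  have hΩb : Ω ⊆ Metric.ball v₀ 1 := fun v hv => by
    rw [mem_ball_iff_norm]
    exact (sq_lt_one_iff₀ (norm_nonneg _)).1 ((hnorm _).trans_lt hv)
  have hDc : IsCompact D := (isCompact_closedBall v₀ 1).of_isClosed_subset
    (isClosed_le hqc continuous_const) hDb
  have hv₀ : v₀ ∈ D := by simp [hD, stretch]
  have hslab := slab_subset_domain ht₁ hS (Set.univ : Set (Vel d))
  have hcu : ContinuousOn (fun p : ℝ × Vel d => u p.1 p.2) (Set.Icc t₁ t₀ ×ˢ Set.univ) := by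
    refine (hf.continuous_self.mono hslab).sub (Continuous.continuousOn ?_)
    have h1 : Continuous fun p : ℝ × Vel d => stretch κ v₀ (p.2 - v₀) := hqc.comp continuous_snd
    have h2 : Continuous fun p : ℝ × Vel d => c₀ p.1 := by
      simp only [hc₀]; fun_prop
    exact h2.add (continuous_const.mul h1)
  have hutd : ∀ t ∈ Set.Icc t₁ t₀, ∀ v, HasDerivAt (fun s => u s v) (ut t v) t := by
    intro t h v
    have h1 := (hf.differentiable_time t (hIcc t h).1 (hIcc t h).2 v).hasDerivAt
    have h2 : HasDerivAt c₀ (N * (3 / 4 * (-1 / τ))) t :=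
      (((((hasDerivAt_id t).const_sub t₀).div_const τ).const_mul (3 / 4)).const_add
        (3 / 4)).const_mul N
    have h3 := h1.sub (h2.add_const (3 / 4 * N * stretch κ v₀ (v - v₀)))
    refine h3.congr_deriv ?_
    simp only [hut]
    ring
  have hdcont : ContinuousOn (fun p : ℝ × Vel d => ut p.1 p.2) (Set.Icc t₁ t₀ ×ˢ Set.univ) :=
    (hf.continuous_time_deriv.mono hslab).add continuousOn_const
  obtain ⟨L, hL⟩ := (isCompact_slab (s := t₁) (s' := t₀) hDc).exists_bound_of_continuousOn
    (hdcont.mono (Set.prod_mono_right (Set.subset_univ D)))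
  have hutc : ∀ t ∈ Set.Icc t₁ t₀, Continuous (ut t) := fun t h => by
    rw [← continuousOn_univ]
    exact hdcont.comp (f := fun v => (t, v)) (by fun_prop) fun v _ => ⟨h, Set.mem_univ v⟩
  have hfc : ∀ t ∈ Set.Icc t₁ t₀, Continuous (f t) := fun t h => (hf2 t h).continuous
  set Γ : ℝ → Set (Vel d) := fun t =>
    {v | v ∈ Ω ∧ N / 2 ≤ f t v ∧ (∀ ξ, inner ℝ ξ (hess (u t) v ξ) ≤ 0) ∧ 0 < ut t v} with hΓ
  have hΓm : ∀ t ∈ Set.Ioo t₁ t₀, MeasurableSet (Γ t) := by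
    intro t h
    have h' := hIoo t h
    have m1 : MeasurableSet Ω := (isOpen_lt hqc continuous_const).measurableSet
    have m2 : MeasurableSet {v | N / 2 ≤ f t v} :=
      (isClosed_le continuous_const (hfc t h')).measurableSet
    have m3 : MeasurableSet {v | ∀ ξ, inner ℝ ξ (hess (u t) v ξ) ≤ 0} := by
      rw [Set.ofPred_forall]
      refine (isClosed_iInter fun ξ => isClosed_le ?_ continuous_const).measurableSet
      exact continuous_const.inner ((continuous_hess (hu2 t h')).clm_apply continuous_const)
    have m4 : MeasurableSet {v | 0 < ut t v} :=
      (isOpen_lt continuous_const (hutc t h')).measurableSet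
    exact m1.inter (m2.inter (m3.inter m4))
  have hlow2 : ∀ p ∈ slopes κ v₀ (N / 4), ∀ v ∈ D, |inner ℝ p (v - v₀)| ≤ N / 4 :=
    fun p hp v hv => abs_inner_slopes_le hκ0.le hp hv
  have key := krylov_tso (u := u) (ut := ut) (L := L) (b := N / 4) ht (Ω := Ω) (B := D)
    (P := slopes κ v₀ (N / 4)) (v₀ := v₀) (isOpen_lt hqc continuous_const) hDc hv₀
    (fun v hv => le_of_lt (show stretch κ v₀ (v - v₀) < 1 from hv)) hcu hutd
    (fun t h v hv => hL (t, v) ⟨h, hv⟩)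
    (grad := fun t => grad (u t)) (hess := fun t => hess (u t))
    (fun t h v _ => hasGradientAt_grad ((hu2 t (hIoo t h)).of_le (by norm_num)) v)
    (fun t h v _ => hasFDerivAt_grad (hu2 t (hIoo t h)) v)
    (measurableSet_slopes κ v₀ _)
    (fun p hp v hv => by
      have h1 := hlow2 p hp v hv
      have h2 := hfN t₁ ⟨le_rfl, ht.le⟩ v
      have h3 := mul_nonneg (by positivity : 0 ≤ 3 / 4 * N) (stretch_nonneg hκ0.le v₀ (v - v₀))
      have h4 : c₀ t₁ = N * (3 / 2) := by
        simp only [hc₀, ← hτ, div_self hτ0.ne']; ring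
      simp only [hu, h4]
      linarith [neg_abs_le (inner ℝ p (v - v₀))])
    (fun p hp t h v hv => by
      have h1 := hlow2 p hp v hv.1
      have h2 := hfN t h v
      have h3 : 1 ≤ stretch κ v₀ (v - v₀) := not_lt.1 hv.2
      have h3' := mul_le_mul_of_nonneg_left h3 (by positivity : 0 ≤ 3 / 4 * N)
      have h4 : N * (3 / 4) ≤ c₀ t := by
        simp only [hc₀]
        have : 0 ≤ (t₀ - t) / τ := div_nonneg (sub_nonneg.2 h.2) hτ0.le
        gcongr
        linarith
      simp only [hu]
      linarith [neg_abs_le (inner ℝ p (v - v₀))])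
    (by
      have h4 : c₀ t₀ = N * (3 / 4) := by simp [hc₀]
      simp only [hu, h4, sub_self, stretch, norm_zero, inner_zero_right]
      norm_num
      linarith)
    (Γ := Γ) hΓm (fun t _ v hv => hv.1)
    (fun t h v hv p hp hpos hneg hut0 => by
      refine ⟨hv, ?_, hneg, hut0⟩
      have h1 := hlow2 p hp v (le_of_lt (show stretch κ v₀ (v - v₀) < 1 from hv))
      have h3 := mul_nonneg (by positivity : 0 ≤ 3 / 4 * N) (stretch_nonneg hκ0.le v₀ (v - v₀))
      have h4 : N * (3 / 4) ≤ c₀ t := by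
        simp only [hc₀]
        have : 0 ≤ (t₀ - t) / τ := div_nonneg (sub_nonneg.2 (hIoo t h).2) hτ0.le
        gcongr
        linarith
      simp only [hu] at hpos
      linarith [neg_abs_le (inner ℝ p (v - v₀))])
    (fun t h => (hutc t (hIoo t h)).measurable)
    (fun t h => (ContinuousLinearMap.continuous_det.comp
      (continuous_hess (hu2 t (hIoo t h)))).measurable)
  rw [volume_slopes κ v₀ (by positivity)] at key
  refine key.trans (setLIntegral_mono' measurableSet_Ioo fun t h => ?_)
  have h' := hIoo t h
  refine le_trans ?_ (lintegral_mono_set (s := Γ t) fun v hv => ⟨hΩb hv.1, hv.2.1⟩)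
  refine setLIntegral_mono' (hΓm t h) fun v hv => ?_
  rw [← ENNReal.ofReal_mul hv.2.2.2.le]
  refine ENNReal.ofReal_le_ofReal ?_
  have hvx : ‖v - v₀‖ ≤ 1 := by
    have := mem_ball_iff_norm.1 (hΩb hv.1); exact this.le
  have hup' := hup t h (v - v₀) hvx
  rw [add_sub_cancel] at hup'
  have hjγ := Real.rpow_pos_of_pos (jap_pos v) γ
  refine mul_abs_det_hess_le (diffusion_symm a γ (f t) v) (hf2 t h') (by positivity) hN.le
    (hlow t h v) hup' (by positivity)
    (reaction_nonneg hp ha (hf.nonneg t (hIcc t h').1.le (hIcc t h').2) v) hΛ (hfN t h' v)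
    ?_ hv.2.2.1 hv.2.2.2
  simp only [hut, hf.equation t (hIcc t h').1 (hIcc t h').2 v, partial₂_eq (hf2 t h')]

end

end

section

variable {d : ℕ} {a γ : ℝ} {S : EReal} {f : ℝ → Vel d → ℝ}

/-! ### Continuity in time of the supremum -/

/-- At a maximum `tr (A D²u) ≤ 0`, for a nonnegative matrix `A`. -/
theorem sum_mul_pd_pd_nonpos {A : Matrix (Fin d) (Fin d) ℝ} (hA : A.PosSemidef) {u : Vel d → ℝ}
    (hu : ContDiff ℝ 2 u) {v : Vel d} (hmax : ∀ v', u v' ≤ u v) :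
    ∑ i, ∑ j, A i j * pd i (pd j u) v ≤ 0 := by
  have hlm : IsLocalMax (fun v' => u v' - inner ℝ (0 : Vel d) (v' - 0)) v :=
    Eventually.of_forall fun v' => by simpa using hmax v'
  have hneg := (grad_eq_and_hess_nonpos_of_isLocalMax (grad := grad u) (hess := hess u) isOpen_univ
    (Set.mem_univ v) (fun v _ => hasGradientAt_grad (hu.of_le (by norm_num)) v)
    (fun v _ => hasFDerivAt_grad hu v) hlm).2
  obtain ⟨C, hC, htr, -⟩ := trace_mul_eq hA (posSemidef_neg_hessMat hu hneg)
  have h : (A * -hessMat u v).trace = -∑ i, ∑ j, A i j * pd i (pd j u) v := by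
    rw [Matrix.trace]
    simp only [Matrix.diag_apply, Matrix.mul_apply, Matrix.neg_apply, mul_neg,
      Finset.sum_neg_distrib]
    congr 1
    refine Finset.sum_congr rfl fun i _ => Finset.sum_congr rfl fun j _ => ?_
    rw [hessMat, Matrix.of_apply, pd_comm hu v j i]
  have := hC.trace_nonneg
  linarith

theorem nonneg_of_hasDerivAt_of_max {φ : ℝ → ℝ} {φ' s t : ℝ} (hst : s < t)
    (h : HasDerivAt φ φ' t) (hmax : ∀ r ∈ Set.Icc s t, φ r ≤ φ t) : 0 ≤ φ' := by
  have h1 : Tendsto (slope φ t) (𝓝[<] t) (𝓝 φ') :=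
    (hasDerivAt_iff_tendsto_slope.1 h).mono_left (nhdsWithin_mono t fun r hr => ne_of_lt hr)
  refine ge_of_tendsto h1 ?_
  filter_upwards [Ioo_mem_nhdsLT hst] with r hr
  rw [slope_def_field]
  exact div_nonneg_of_nonpos (sub_nonpos.2 (hmax r ⟨hr.1.le, hr.2.le⟩)) (sub_nonpos.2 hr.2.le)

/-- The supremum does not jump upwards. This is the maximum principle on `ℝ^d`, with the barrier
`ε (1 + |v|²) e^{λ (t - t')}` for the behaviour at infinity; `λ` beats the at most quadratic growth of
the diffusion. -/
theorem IsClassicalSolution.exists_le_add_mul (hp : Params d γ) (ha : 0 ≤ a)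
    (hf : IsClassicalSolution a γ S f) {s s' : ℝ} (hs : 0 < s) (hS : (s' : EReal) < S) :
    ∃ A, 0 ≤ A ∧ ∀ t' ∈ Set.Icc s s', ∀ L, (∀ v, f t' v ≤ L) →
      ∀ t ∈ Set.Icc t' s', ∀ v, f t v ≤ L + A * (t - t') := by
  obtain ⟨B₀, hB₀⟩ := hf.dens hs hS
  set B := max B₀ 0 with hBd
  have hB0 : 0 ≤ B := le_max_right _ _
  set D := a * convConst d γ B₀ with hD
  set Cr := |d * d * D| with hCr
  set Λ := 2 * (d * |D|) with hΛd
  have hΛ : 0 ≤ Λ := by positivity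
  refine ⟨Cr * B, by positivity, fun t' ht' L hL t ht v => ?_⟩
  have hsub : Set.Icc t' s' ⊆ Set.Icc s s' := Set.Icc_subset_Icc_left ht'.1
  have hpos : ∀ r ∈ Set.Icc t' s', 0 < r ∧ (r : EReal) < S := fun r hr =>
    ⟨hs.trans_le (hsub hr).1, coe_lt_of_le hr.2 hS⟩
  have hfB : ∀ r ∈ Set.Icc t' s', ∀ v, f r v ≤ B := fun r hr v =>
    ((le_abs_self _).trans ((hB₀ r (hsub hr)).bdd v)).trans (le_max_left _ _)
  have hf0 : ∀ r ∈ Set.Icc t' s', ∀ v, 0 ≤ f r v := fun r hr v =>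
    hf.nonneg r (hpos r hr).1.le (hpos r hr).2 v
  set lam := 2 * Λ + 1 with hlam
  suffices H : ∀ ε > 0, ∀ t ∈ Set.Icc t' s', ∀ v, f t v ≤ L + Cr * B * (t - t') +
      ε * (Real.exp (lam * (t - t')) * (1 + ‖v‖ ^ 2)) by
    refine le_of_forall_pos_le_add fun δ hδ => ?_
    have hE : 0 < Real.exp (lam * (t - t')) * (1 + ‖v‖ ^ 2) := by positivity
    have := H (δ / (Real.exp (lam * (t - t')) * (1 + ‖v‖ ^ 2))) (by positivity) t ht v
    rwa [div_mul_cancel₀ _ hE.ne'] at this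
  intro ε hε t₁ ht₁ v₁
  by_contra! hcon
  set e : ℝ → ℝ := fun t => ε * Real.exp (lam * (t - t')) with he
  have hee : ∀ t ∈ Set.Icc t' s', ε ≤ e t := fun t ht => by
    have : 1 ≤ Real.exp (lam * (t - t')) :=
      Real.one_le_exp (mul_nonneg (by linarith) (sub_nonneg.2 ht.1))
    simp only [he]; nlinarith
  set c₀ : ℝ → ℝ := fun t => L + Cr * B * (t - t') + e t with hc₀
  set u : ℝ → Vel d → ℝ := fun t v => f t v - (c₀ t + e t * stretch 1 0 (v - 0)) with hu
  have hst : ∀ v : Vel d, stretch 1 0 (v - 0) = ‖v‖ ^ 2 := fun v => by simp [stretch]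
  have hu1 : 0 < u t₁ v₁ := by
    simp only [hu, hst, hc₀, he]; linarith
  set R := max (max 1 ‖v₁‖) ((B - L) / ε) with hR
  have hR1 : 1 ≤ R := (le_max_left _ _).trans (le_max_left _ _)
  have hRv : ‖v₁‖ ≤ R := (le_max_right _ _).trans (le_max_left _ _)
  have hRB : B - L ≤ ε * R := by
    have := le_max_right (max 1 ‖v₁‖) ((B - L) / ε)
    rw [← hR, div_le_iff₀ hε] at this; linarith
  have hout : ∀ r ∈ Set.Icc t' s', ∀ v, R ≤ ‖v‖ → u r v ≤ 0 := by
    intro r hr v hv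
    have h1 := hfB r hr v
    have h2 := hee r hr
    have h3 : 0 ≤ Cr * B * (r - t') := mul_nonneg (by positivity) (sub_nonneg.2 hr.1)
    have h4 : R ≤ ‖v‖ ^ 2 := by nlinarith
    have h5 : ε * R ≤ e r * ‖v‖ ^ 2 := mul_le_mul h2 h4 (by linarith) (by linarith)
    simp only [hu, hst, hc₀]
    linarith
  have hcu : ContinuousOn (fun p : ℝ × Vel d => u p.1 p.2)
      (Set.Icc t' s' ×ˢ Metric.closedBall 0 R) := by
    refine (hf.continuous_self.mono (slab_subset_domain (hs.trans_le ht'.1) hS _)).sub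
      (Continuous.continuousOn ?_)
    simp only [hst, hc₀, he]
    fun_prop
  obtain ⟨⟨t₂, v₂⟩, ⟨ht₂, -⟩, hmax⟩ :=
    (isCompact_slab (isCompact_closedBall (0 : Vel d) R)).exists_isMaxOn
      ⟨(t₁, v₁), ht₁, by simpa using hRv⟩ hcu
  have hmax' : ∀ r ∈ Set.Icc t' s', ∀ v, u r v ≤ u t₂ v₂ := by
    intro r hr v
    have h1 : u t₁ v₁ ≤ u t₂ v₂ := hmax (show (t₁, v₁) ∈ _ from ⟨ht₁, by simpa using hRv⟩)
    rcases le_total R ‖v‖ with h | h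
    · exact (hout r hr v h).trans (hu1.le.trans h1)
    · exact hmax (show (r, v) ∈ _ from ⟨hr, by simpa using h⟩)
  have hlt : t' < t₂ := by
    refine lt_of_le_of_ne ht₂.1 fun h => ?_
    have h1 := hmax' t₁ ht₁ v₁
    have h2 := hL v₂
    have h3 : 0 ≤ e t' * ‖v₂‖ ^ 2 := mul_nonneg (by simp only [he]; positivity) (sq_nonneg _)
    have h4 : 0 < e t' := by simp only [he]; positivity
    have h5 : u t' v₂ = f t' v₂ - (L + e t' + e t' * ‖v₂‖ ^ 2) := by
      simp only [hu, hst, hc₀, sub_self]; ring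
    rw [← h] at h1
    linarith
  obtain ⟨h20, h2S⟩ := hpos t₂ ht₂
  have hf2 := hf.contDiff_velocity t₂ h20 h2S
  have hdt : HasDerivAt (fun r => u r v₂) (deriv (fun r => f r v₂) t₂ -
      (Cr * B + lam * e t₂ + lam * e t₂ * ‖v₂‖ ^ 2)) t₂ := by
    have h1 := (hf.differentiable_time t₂ h20 h2S v₂).hasDerivAt
    have h0 : HasDerivAt (fun r => r - t') 1 t₂ := (hasDerivAt_id t₂).sub_const t'
    have h2 : HasDerivAt e (lam * e t₂) t₂ := by
      refine ((h0.const_mul lam).exp.const_mul ε).congr_deriv ?_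
      simp only [he]; ring
    have h3 := h1.sub ((((h0.const_mul (Cr * B)).const_add L).add h2).add
      (h2.mul_const (stretch 1 0 (v₂ - 0))))
    refine h3.congr_deriv ?_
    simp only [hst, mul_one]
  have hdt0 := nonneg_of_hasDerivAt_of_max hlt hdt fun r hr =>
    hmax' r ⟨hr.1, hr.2.trans ht₂.2⟩ v₂
  have hdens := hB₀ t₂ (hsub ht₂)
  have hA : (diffusion a γ (f t₂) v₂).PosSemidef := posSemidef_of_quad (diffusion_symm _ _ _ _)
    (quad_diffusion_nonneg hp ha hdens (hf0 t₂ ht₂) v₂)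
  have hu2 : ContDiff ℝ 2 (u t₂) :=
    hf2.sub (contDiff_const.add (contDiff_const.mul (contDiff_stretch 1 0)))
  have h1 := sum_mul_pd_pd_nonpos hA hu2 (hmax' t₂ ht₂)
  have h2 : ∑ i, ∑ j, diffusion a γ (f t₂) v₂ i j * pd i (pd j (u t₂)) v₂ =
      (∑ i, ∑ j, diffusion a γ (f t₂) v₂ i j * pd i (pd j (f t₂)) v₂) -
        2 * e t₂ * ∑ i, diffusion a γ (f t₂) v₂ i i := by
    have e3 : ∑ i, diffusion a γ (f t₂) v₂ i i =
        ∑ i, ∑ j, diffusion a γ (f t₂) v₂ i j * (if i = j then 1 else 0) := by simp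
    rw [e3]
    simp only [Finset.mul_sum, ← Finset.sum_sub_distrib]
    refine Finset.sum_congr rfl fun i _ => Finset.sum_congr rfl fun j _ => ?_
    rw [hu, pd_pd_sub_stretch hf2]
    split_ifs <;> simp <;> ring
  have h3 : ∑ i, diffusion a γ (f t₂) v₂ i i ≤ Λ * (1 + ‖v₂‖ ^ 2) := by
    calc _ ≤ ∑ _i : Fin d, |D| * (1 + ‖v₂‖) ^ 2 := Finset.sum_le_sum fun i _ =>
          (le_abs_self _).trans ((abs_diffusion_le hp ha hdens v₂ i i).trans
            (mul_le_mul_of_nonneg_right (le_abs_self _) (by positivity)))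
      _ = d * |D| * (1 + ‖v₂‖) ^ 2 := by simp; ring
      _ ≤ d * |D| * (2 * (1 + ‖v₂‖ ^ 2)) := by
          gcongr; nlinarith [sq_nonneg (1 - ‖v₂‖)]
      _ = _ := by rw [hΛd]; ring
  have h4 : reaction a γ (f t₂) v₂ * f t₂ v₂ ≤ Cr * B := by
    refine mul_le_mul ?_ (hfB t₂ ht₂ v₂) (hf0 t₂ ht₂ v₂) (abs_nonneg _)
    refine (le_abs_self _).trans ((abs_reaction_le hp ha hdens v₂).trans ?_)
    rw [hCr, hD, ← mul_assoc]; exact le_abs_self _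
  have heq := hf.equation t₂ h20 h2S v₂
  simp only [partial₂_eq hf2] at heq
  have he2 : 0 < e t₂ := by simp only [he]; positivity
  have h5 := mul_le_mul_of_nonneg_left h3 (by positivity : 0 ≤ 2 * e t₂)
  have h6 : 0 < e t₂ * (1 + ‖v₂‖ ^ 2) := by positivity
  rw [hlam] at hdt0
  nlinarith

end

section

variable {d : ℕ} {a γ : ℝ} {S : EReal} {f : ℝ → Vel d → ℝ}

/-! ### The contact estimate on a time slice -/

theorem jap_le_two_mul {v v₀ : Vel d} (h : v ∈ Metric.ball v₀ 1) : jap v ≤ 2 * jap v₀ := by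
  have h1 : ‖v‖ ≤ ‖v₀‖ + 1 := by
    have := mem_ball_iff_norm.1 h
    linarith [norm_le_insert' v v₀]
  have h2 : ‖v‖ ^ 2 ≤ (‖v₀‖ + 1) ^ 2 := pow_le_pow_left₀ (norm_nonneg _) h1 2
  have h3 : jap v ^ 2 ≤ (2 * jap v₀) ^ 2 := by
    rw [mul_pow, jap_sq, jap_sq]; nlinarith [sq_nonneg (‖v₀‖ - 1)]
  exact (sq_le_sq₀ (jap_pos v).le (by linarith [jap_pos v₀])).1 h3

/-- The weight `⟨v⟩² / (l ⟨v⟩^(γ+2))^d`, the inverse of the determinant of the lower bound for the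
diffusion, varies little on unit balls, uniformly in `γ`. -/
theorem jap_weight_le (hp : Params d γ) {l : ℝ} (hl : 0 < l) {v v₀ : Vel d}
    (h : v ∈ Metric.ball v₀ 1) : jap v ^ 2 / (l * jap v ^ γ * jap v ^ 2) ^ d ≤
      (4 / l) ^ d * (jap v₀ ^ 2 / (jap v₀ ^ (γ + 2)) ^ d) := by
  have hr := jap_pos v
  have hR := jap_pos v₀
  have h1 := jap_le_two_mul h
  have h2 : jap v₀ ≤ 2 * jap v := jap_le_two_mul (Metric.mem_ball_comm.1 h)
  have hg : 0 ≤ γ + 2 := by linarith [hp.mem.1]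
  have hX := Real.rpow_pos_of_pos hr (γ + 2)
  have hX₀ := Real.rpow_pos_of_pos hR (γ + 2)
  have e : l * jap v ^ γ * jap v ^ 2 = l * jap v ^ (γ + 2) := by
    rw [mul_assoc, Real.rpow_add hr, Real.rpow_two]
  have key : jap v ^ 2 * (jap v₀ ^ (γ + 2)) ^ d ≤
      4 ^ d * jap v₀ ^ 2 * (jap v ^ (γ + 2)) ^ d := by
    rcases le_total (jap v) (jap v₀) with h3 | h3
    · have h4 : jap v₀ ^ (γ + 2) ≤ 4 * jap v ^ (γ + 2) := by
        have h5 : (jap v₀ / jap v) ^ (γ + 2) ≤ 4 := by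
          calc (jap v₀ / jap v) ^ (γ + 2) ≤ (jap v₀ / jap v) ^ (2 : ℝ) :=
                Real.rpow_le_rpow_of_exponent_le ((one_le_div hr).2 h3) (by linarith [hp.mem.2])
            _ = (jap v₀ / jap v) ^ 2 := Real.rpow_two _
            _ ≤ 2 ^ 2 := pow_le_pow_left₀ (by positivity) ((div_le_iff₀ hr).2 h2) 2
            _ = 4 := by norm_num
        rw [Real.div_rpow hR.le hr.le, div_le_iff₀ hX] at h5
        exact h5
      calc _ ≤ jap v₀ ^ 2 * (4 * jap v ^ (γ + 2)) ^ d := by gcongr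
        _ = _ := by rw [mul_pow]; ring
    · have h4 : jap v ^ 2 ≤ 4 ^ d * jap v₀ ^ 2 := by
        calc _ ≤ (2 * jap v₀) ^ 2 := by gcongr
          _ = 4 ^ 1 * jap v₀ ^ 2 := by ring
          _ ≤ _ := by
            gcongr
            · norm_num
            · exact (by norm_num : 1 ≤ 2).trans hp.dim
      gcongr
  rw [e, mul_pow, div_pow, div_mul_div_comm, div_le_div_iff₀ (by positivity) (by positivity)]
  have := mul_le_mul_of_nonneg_left key (by positivity : 0 ≤ l ^ d)
  linarith

/-- The right hand side of the contact estimate at a fixed time, with `N = n ^ d` and `σ` the inverse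
length of the time interval. The reaction coefficient is at most `σ` plus a near part `q`; the terms
with `σ` are integrated over the small set where the density is large, and of the powers of `q` all
but one are bounded pointwise. -/
theorem Profile.lintegral_contact_le {M₁ M₀ E₀ H₀ : ℝ} {g : Vel d → ℝ} (hp : Params d γ)
    (ha : 0 ≤ a) (hg : Profile M₁ M₀ E₀ H₀ g) (hE : 0 ≤ M₀ + E₀) {C l σ m η n : ℝ} (hC : 0 ≤ C)
    (hl : 0 < l) (hσ : 0 < σ) (hm : 0 ≤ m) (hη : ∫ v, max (g v - m) 0 ≤ η) (hn : 1 ≤ n)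
    (hgn : ∀ v, g v ≤ 5 / 4 * n ^ d)
    (hc : d * d * a * (unitVol d * m + M₀ + η * n ^ 2) ≤ σ) (v₀ : Vel d) :
    ∫⁻ v in {v ∈ Metric.ball v₀ 1 | n ^ d / 2 ≤ g v},
        ENNReal.ofReal ((C * n ^ d * (reaction a γ g v + σ)) ^ (d + 1) *
          (jap v ^ 2 / (l * jap v ^ γ * jap v ^ 2) ^ d)) ≤
      ENNReal.ofReal ((C * n ^ d) ^ (d + 1) *
        ((4 / l) ^ d * (jap v₀ ^ 2 / (jap v₀ ^ (γ + 2)) ^ d)) *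
        (2 ^ d * ((2 * σ) ^ (d + 1) * (18 * (M₀ + E₀) / (n ^ d * jap v₀ ^ 2)) +
          (5 / 4 * (d * d * a * unitVol d) * n ^ 2) ^ d *
            (d * d * a * unitVol d * (n ^ 2 / n ^ d) *
              (Real.sqrt (9 * (M₀ + E₀) * η) / jap v₀))))) := by
  have hn0 : 0 < n := by linarith
  have hR := jap_pos v₀
  have hω := unitVol_pos d
  set D := (d : ℝ) * d * a * unitVol d with hD
  have hD0 : 0 ≤ D := by positivity
  -- the radius at which the mass of a ball filled up to the height `n ^ d` is of order one
  set ρ := n⁻¹ with hρd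
  have hρ : 0 < ρ := inv_pos.2 hn0
  have hρ1 : ρ ≤ 1 := inv_le_one_of_one_le₀ hn
  have hργ : ρ ^ ((d : ℝ) + γ) ≤ n ^ 2 / n ^ d := by
    rw [Real.rpow_add hρ, Real.rpow_natCast]
    have h1 : ρ ^ γ ≤ ρ ^ (-2 : ℝ) := Real.rpow_le_rpow_of_exponent_ge hρ hρ1 hp.mem.1
    have h2 : ρ ^ (-2 : ℝ) = n ^ 2 := by
      rw [Real.rpow_neg hρ.le, Real.rpow_two, hρd, inv_pow, inv_inv]
    rw [h2] at h1
    calc ρ ^ d * ρ ^ γ ≤ ρ ^ d * n ^ 2 := by gcongr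
      _ = _ := by rw [hρd, inv_pow]; field_simp
  set q : Vel d → ℝ := nearReaction a γ ρ m g with hq
  have hq0 : ∀ v, 0 ≤ q v := fun v => nearReaction_nonneg hp ha _ _ _ v
  have hqn : ∀ v, q v ≤ 5 / 4 * D * n ^ 2 := fun v => by
    refine (Profile.nearReaction_le hp ha hg hρ hρ1 hm hgn v).trans ?_
    calc _ ≤ d * d * a * unitVol d * (5 / 4 * n ^ d) * (n ^ 2 / n ^ d) := by gcongr
      _ = _ := by rw [hD]; field_simp
  have hcq : ∀ v, reaction a γ g v ≤ σ + q v := fun v => by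
    have h1 := Profile.reaction_le hp ha hg hρ hρ1 hm v
    refine h1.trans (add_le_add_left (le_trans ?_ hc) _)
    have h2 : (∫ y, max (g y - m) 0) / ρ ^ 2 ≤ η * n ^ 2 := by
      rw [hρd, inv_pow, div_inv_eq_mul]; gcongr
    gcongr
  set W := (C * n ^ d) ^ (d + 1) * ((4 / l) ^ d * (jap v₀ ^ 2 / (jap v₀ ^ (γ + 2)) ^ d)) with hW
  have hX₀ := Real.rpow_pos_of_pos hR (γ + 2)
  have hW0 : 0 ≤ W := by positivity
  have hpt : ∀ v ∈ Metric.ball v₀ 1, (C * n ^ d * (reaction a γ g v + σ)) ^ (d + 1) *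
      (jap v ^ 2 / (l * jap v ^ γ * jap v ^ 2) ^ d) ≤
      W * (2 ^ d * (2 * σ) ^ (d + 1)) + W * (2 ^ d * (5 / 4 * D * n ^ 2) ^ d) * q v := by
    intro v hv
    have h0 := reaction_nonneg hp ha hg.nonneg v
    have h1 : (reaction a γ g v + σ) ^ (d + 1) ≤
        2 ^ d * ((2 * σ) ^ (d + 1) + (5 / 4 * D * n ^ 2) ^ d * q v) := by
      calc (reaction a γ g v + σ) ^ (d + 1) ≤ (2 * σ + q v) ^ (d + 1) :=
            pow_le_pow_left₀ (by positivity) (by linarith [hcq v]) _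
        _ ≤ 2 ^ d * ((2 * σ) ^ (d + 1) + q v ^ (d + 1)) := by
            have := add_pow_le (by positivity : 0 ≤ 2 * σ) (hq0 v) (d + 1)
            simpa using this
        _ ≤ _ := by
            rw [pow_succ (q v)]
            have := pow_le_pow_left₀ (hq0 v) (hqn v) d
            have := hq0 v
            gcongr
    have h2 := jap_weight_le hp hl hv
    have hr := jap_pos v
    have hrγ := Real.rpow_pos_of_pos hr γ
    calc _ ≤ ((C * n ^ d) ^ (d + 1) *
          (2 ^ d * ((2 * σ) ^ (d + 1) + (5 / 4 * D * n ^ 2) ^ d * q v))) *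
          ((4 / l) ^ d * (jap v₀ ^ 2 / (jap v₀ ^ (γ + 2)) ^ d)) := by
          rw [mul_pow]
          have := hq0 v
          gcongr
      _ = _ := by rw [hW]; ring
  have hms : MeasurableSet {v ∈ Metric.ball v₀ 1 | n ^ d / 2 ≤ g v} := by
    obtain ⟨B, hB⟩ := hg.dens
    have hgm : Measurable g := hB.meas
    exact Metric.isOpen_ball.measurableSet.inter (measurableSet_le measurable_const hgm)
  have hk1 : 0 ≤ W * (2 ^ d * (2 * σ) ^ (d + 1)) := by positivity
  have hk2 : 0 ≤ W * (2 ^ d * (5 / 4 * D * n ^ 2) ^ d) := by positivity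
  have hvol := Profile.volume_level_le hg (N := n ^ d / 2) (by positivity) v₀
  have hnear : ∫⁻ v in Metric.ball v₀ 1, ENNReal.ofReal (q v) ≤
      ENNReal.ofReal (D * (n ^ 2 / n ^ d)) *
        ENNReal.ofReal (Real.sqrt (9 * (M₀ + E₀) * η) / jap v₀) := by
    refine (Profile.lintegral_nearReaction_le hp ha hg hρ hρ1 hm v₀).trans ?_
    gcongr
    · exact Profile.lintegral_ball_excess_le hg hm hη v₀
  calc _ ≤ ∫⁻ v in {v ∈ Metric.ball v₀ 1 | n ^ d / 2 ≤ g v},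
        (ENNReal.ofReal (W * (2 ^ d * (2 * σ) ^ (d + 1))) +
          ENNReal.ofReal (W * (2 ^ d * (5 / 4 * D * n ^ 2) ^ d)) * ENNReal.ofReal (q v)) := by
        refine setLIntegral_mono' hms fun v hv => ?_
        rw [← ENNReal.ofReal_mul hk2, ← ENNReal.ofReal_add hk1 (mul_nonneg hk2 (hq0 v))]
        exact ENNReal.ofReal_le_ofReal (hpt v hv.1)
    _ ≤ ENNReal.ofReal (W * (2 ^ d * (2 * σ) ^ (d + 1))) *
          ENNReal.ofReal (9 * (M₀ + E₀) / (n ^ d / 2 * jap v₀ ^ 2)) +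
        ENNReal.ofReal (W * (2 ^ d * (5 / 4 * D * n ^ 2) ^ d)) *
          (ENNReal.ofReal (D * (n ^ 2 / n ^ d)) *
            ENNReal.ofReal (Real.sqrt (9 * (M₀ + E₀) * η) / jap v₀)) := by
        rw [lintegral_add_left measurable_const, setLIntegral_const,
          lintegral_const_mul' _ _ ENNReal.ofReal_ne_top]
        refine add_le_add (mul_le_mul_right hvol _) (mul_le_mul_right ?_ _)
        exact (lintegral_mono_set fun v hv => hv.1).trans hnear
    _ = _ := by
        rw [← ENNReal.ofReal_mul (by positivity), ← ENNReal.ofReal_mul (by positivity),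
          ← ENNReal.ofReal_mul hk2, ← ENNReal.ofReal_add (by positivity) (by positivity)]
        congr 1
        field_simp
        ring

/-- The arithmetic behind the final contradiction: `n` is the `d`-th root of the height, `w ^ 2` the
length of the time interval, and `x ^ 2` the size `⟨v₀⟩^(γ+2)` of the diffusion. The first term on the
left is small because `k` is large, the second one because `η` is small. -/
theorem lt_of_scaling {A P E η D k n w x R : ℝ} {d : ℕ} (hA : 0 < A) (hP : 0 ≤ P) (hE : 0 ≤ E)
    (hD : 0 ≤ D) (hn : 0 < n) (hw : 0 < w) (hx : 1 ≤ x) (hR : 1 ≤ R)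
    (hk : 0 < k) {θ : ℝ} (hθ : 0 < θ) (hd : d ≠ 0) (h1 : k * θ ≤ w * x * n) (h2 : w * n ≤ k)
    (hkθ : 1 ≤ k * θ) (hk1 : 4 * (P * 2 ^ (d + 1) * (18 * E)) ≤ A * (k * θ))
    (hk2 : 4 * (P * (5 / 4 * D) ^ d * D * k ^ (d + 2) * Real.sqrt (9 * E * η)) ≤ A) :
    w ^ 2 * (P * (R ^ 2 / (x ^ 2) ^ d) *
      ((2 * (1 / w ^ 2)) ^ (d + 1) * (18 * E / (n ^ d * R ^ 2)) +
        (5 / 4 * D * n ^ 2) ^ d * (D * (n ^ 2 / n ^ d) * (Real.sqrt (9 * E * η) / R)))) <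
      A * ((1 / (w * x)) ^ d * R) := by
  have hx0 : 0 < x := by linarith
  have hR0 : 0 < R := by linarith
  set Q := (1 / (w * x)) ^ d * R with hQ
  have hQ0 : 0 < Q := by positivity
  have e1 : w ^ 2 * (P * (R ^ 2 / (x ^ 2) ^ d) *
      ((2 * (1 / w ^ 2)) ^ (d + 1) * (18 * E / (n ^ d * R ^ 2)))) =
      Q * (P * 2 ^ (d + 1) * (18 * E)) * (1 / (w * x * n) ^ d) / R := by
    rw [hQ]
    simp only [mul_pow, div_pow, ← pow_mul, one_pow, pow_succ]
    field_simp
    ring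
  have e2 : w ^ 2 * (P * (R ^ 2 / (x ^ 2) ^ d) *
      ((5 / 4 * D * n ^ 2) ^ d * (D * (n ^ 2 / n ^ d) * (Real.sqrt (9 * E * η) / R)))) =
      Q * (P * (5 / 4 * D) ^ d * D * (w * n) ^ (d + 2) * Real.sqrt (9 * E * η)) / x ^ d := by
    rw [hQ]
    simp only [mul_pow, div_pow, ← pow_mul, one_pow, pow_add]
    field_simp
    ring
  have b1 : Q * (P * 2 ^ (d + 1) * (18 * E)) * (1 / (w * x * n) ^ d) / R ≤ Q * (A / 4) := by
    have h3 : k * θ ≤ (w * x * n) ^ d :=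
      (le_self_pow₀ hkθ hd).trans (pow_le_pow_left₀ (by positivity) h1 d)
    have h4 : 1 / (w * x * n) ^ d ≤ 1 / (k * θ) := one_div_le_one_div_of_le (by positivity) h3
    refine (div_le_self (by positivity) hR).trans ?_
    rw [mul_assoc]
    refine mul_le_mul_of_nonneg_left ?_ hQ0.le
    calc _ ≤ P * 2 ^ (d + 1) * (18 * E) * (1 / (k * θ)) :=
          mul_le_mul_of_nonneg_left h4 (by positivity)
      _ ≤ _ := by rw [mul_one_div, div_le_iff₀ (by positivity)]; linarith
  have b2 : Q * (P * (5 / 4 * D) ^ d * D * (w * n) ^ (d + 2) * Real.sqrt (9 * E * η)) / x ^ d ≤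
      Q * (A / 4) := by
    refine (div_le_self (by positivity) (one_le_pow₀ hx)).trans ?_
    refine mul_le_mul_of_nonneg_left ?_ hQ0.le
    have h3 : (w * n) ^ (d + 2) ≤ k ^ (d + 2) := pow_le_pow_left₀ (by positivity) h2 _
    have h4 : P * (5 / 4 * D) ^ d * D * (w * n) ^ (d + 2) * Real.sqrt (9 * E * η) ≤
      P * (5 / 4 * D) ^ d * D * k ^ (d + 2) * Real.sqrt (9 * E * η) := by gcongr
    linarith
  have h5 : 0 < Q * A := by positivity
  rw [mul_add (P * _), mul_add, e1, e2]
  linarith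

end

section

variable {d : ℕ} {a γ : ℝ} {S : EReal} {f : ℝ → Vel d → ℝ}

/-! ### The pointwise bound -/

theorem contact_rescale (N Q ω : ℝ) (d : ℕ) :
    N ^ (d + 1) * (ω / 4 ^ (d + 1) * Q) = N / 4 * (Q * (N / 4) ^ d * ω) := by
  simp only [div_pow, pow_succ]
  field_simp

/-- A solution which on the last part of a time interval exceeds `k ^ d (t₀ - s) ^ (-d/2)` by at
most a quarter does not exceed this value at the end of the interval, if `k` is large, and if the
excess `η` over the level `m` and the length of the interval are small. -/
theorem IsClassicalSolution.le_of_contact (hp : Params d γ) (ha : 0 < a)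
    (hf : IsClassicalSolution a γ S f) {M₁ M₀ E₀ H₀ l Λ C D k η m θ : ℝ} (hE : 0 < M₀ + E₀)
    (hprof : ∀ t : ℝ, 0 < t → (t : EReal) < S → Profile M₁ M₀ E₀ H₀ (f t)) (hl : 0 < l)
    (hlow : ∀ g, Profile M₁ M₀ E₀ H₀ g → ∀ v ξ : Vel d,
      l * jap v ^ γ * (jap v ^ 2 * ‖ξ‖ ^ 2 - (inner ℝ v ξ) ^ 2) ≤ quad (diffusion a γ g v) ξ)
    (hΛ : Λ = a * (9 * d + 32) * (M₀ + E₀)) (hC : C = 5 / 4 + 3 / 2 * Λ)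
    (hD : D = d * d * a * unitVol d) (hk1 : 1 ≤ k) (hθ0 : 0 < θ) (hθ1 : θ ≤ 1 / 2)
    (hkθ : 1 ≤ k * θ)
    (hkA : 4 * (C ^ (d + 1) * (4 / l) ^ d * 2 ^ d * 2 ^ (d + 1) * (18 * (M₀ + E₀))) ≤
      unitVol d / 4 ^ (d + 1) * (k * θ))
    (hηA : 4 * (C ^ (d + 1) * (4 / l) ^ d * 2 ^ d * (5 / 4 * D) ^ d * D * k ^ (d + 2) *
      Real.sqrt (9 * (M₀ + E₀) * η)) ≤ unitVol d / 4 ^ (d + 1))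
    (hηk : d * d * a * (η * k ^ 2) ≤ 1 / 2) (hm0 : 0 ≤ m)
    (hm : ∀ g : Vel d → ℝ, Profile M₁ M₀ E₀ H₀ g → ∫ v, max (g v - m) 0 ≤ η) {s t₀ τ : ℝ}
    (hs : 0 < s) (hτ : t₀ - s = τ) (hτ0 : 0 < τ) (hτ1 : τ ≤ 1)
    (hτZ : d * d * a * (unitVol d * m + M₀) ≤ 1 / (2 * τ)) (hS : (t₀ : EReal) < S)
    (hfN : ∀ t ∈ Set.Icc (t₀ - θ * τ) t₀, ∀ v, f t v ≤ 5 / 4 * (k / Real.sqrt τ) ^ d) (v₀ : Vel d) :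
    f t₀ v₀ ≤ (k / Real.sqrt τ) ^ d := by
  by_contra! hcon
  have hd0 : d ≠ 0 := by have := hp.dim; omega
  have hω := unitVol_pos d
  have hΛ0 : 0 ≤ Λ := by rw [hΛ]; positivity
  have hC0 : 0 < C := by rw [hC]; positivity
  have hD0 : 0 ≤ D := by rw [hD]; positivity
  have hk0 : 0 < k := by linarith
  have hsτ : 0 < Real.sqrt τ := Real.sqrt_pos.2 hτ0
  obtain ⟨n, hn⟩ : ∃ n, n = k / Real.sqrt τ := ⟨_, rfl⟩
  rw [← hn] at hcon hfN
  have hn0 : 0 < n := by rw [hn]; positivity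
  have hn2 : n ^ 2 = k ^ 2 / τ := by rw [hn, div_pow, Real.sq_sqrt hτ0.le]
  have hn1 : 1 ≤ n := by
    rw [hn, one_le_div hsτ]
    exact (Real.sqrt_le_one.2 hτ1).trans hk1
  obtain ⟨R, hR⟩ : ∃ R, R = jap v₀ := ⟨_, rfl⟩
  have hR1 : 1 ≤ R := hR ▸ one_le_jap v₀
  have hR0 : 0 < R := by linarith
  obtain ⟨x, hx0, hx1, hx2⟩ : ∃ x, 0 < x ∧ 1 ≤ x ∧ x ^ 2 = R ^ (γ + 2) := by
    have hX1 : 1 ≤ R ^ (γ + 2) := Real.one_le_rpow hR1 (by linarith [hp.mem.1])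
    exact ⟨Real.sqrt (R ^ (γ + 2)), Real.sqrt_pos.2 (by linarith), Real.one_le_sqrt.2 hX1,
      Real.sq_sqrt (by linarith)⟩
  -- the length of the time interval is chosen so that the ellipsoid has size at most one
  obtain ⟨w, hw0, hw2⟩ : ∃ w, 0 < w ∧ w ^ 2 = θ * τ / (1 + τ * x ^ 2) :=
    ⟨Real.sqrt (θ * τ / (1 + τ * x ^ 2)), Real.sqrt_pos.2 (by positivity),
      Real.sq_sqrt (by positivity)⟩
  have hτX : 0 < τ * x ^ 2 := by positivity
  have hwθ : w ^ 2 ≤ θ * τ := by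
    rw [hw2]; exact div_le_self (by positivity) (by linarith only [hτX])
  have hwτ : w ^ 2 ≤ τ := hwθ.trans (mul_le_of_le_one_left hτ0.le (hθ1.trans (by norm_num)))
  have hσ : t₀ - (t₀ - w ^ 2) = w ^ 2 := sub_sub_cancel _ _
  have hwx : (w * x) ^ 2 ≤ 1 := by
    rw [mul_pow, hw2, div_mul_eq_mul_div, div_le_one (by positivity), mul_assoc]
    have := mul_le_of_le_one_left hτX.le (hθ1.trans (by norm_num))
    linarith only [this]
  have hκ : 1 ≤ (1 / (w * x)) ^ 2 := by
    rw [div_pow, one_pow]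
    exact (one_le_div (by positivity)).2 hwx
  have hsq : Real.sqrt ((1 / (w * x)) ^ 2) = 1 / (w * x) := Real.sqrt_sq (by positivity)
  have ht₁ : 0 < t₀ - w ^ 2 := by linarith only [hs, hτ, hwτ]
  have hpos : ∀ t ∈ Set.Ioo (t₀ - w ^ 2) t₀, Profile M₁ M₀ E₀ H₀ (f t) := fun t ht =>
    hprof t (ht₁.trans ht.1) (coe_lt_of_le ht.2.le hS)
  have hfN' : ∀ t ∈ Set.Icc (t₀ - w ^ 2) t₀, ∀ v, f t v ≤ 5 / 4 * n ^ d :=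
    fun t ht v => hfN t ⟨by linarith only [ht.1, hwθ], ht.2⟩ v
  have hup : ∀ t ∈ Set.Ioo (t₀ - w ^ 2) t₀, ∀ y : Vel d, ‖y‖ ≤ 1 → (1 / (w * x)) ^ 2 *
      ((∑ i, diffusion a γ (f t) (v₀ + y) i i) + quad (diffusion a γ (f t) (v₀ + y)) v₀) ≤
        Λ * (1 / (t₀ - (t₀ - w ^ 2))) := fun t ht y hy => by
    have h1 := Profile.diffusion_le hp ha.le (hpos t ht) (v₀ := v₀) hy
    have h2 := mul_le_mul_of_nonneg_left h1 (sq_nonneg (1 / (w * x)))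
    refine h2.trans (le_of_eq ?_)
    rw [hσ, ← hR, ← hx2, ← hΛ]
    field_simp
  have key := hf.contact_estimate hp ha.le ht₁ (sub_lt_self _ (by positivity)) hS (v₀ := v₀)
    (N := n ^ d) hκ (by positivity) hl hΛ0
    (fun t ht v ξ => hlow _ (hpos t ht) v ξ) hup hfN' hcon.le
  rw [hsq, hσ, ← hC] at key
  have hc : d * d * a * (unitVol d * m + M₀ + η * n ^ 2) ≤ 1 / w ^ 2 := by
    have h1 : d * d * a * (unitVol d * m + M₀ + η * n ^ 2) =
        d * d * a * (unitVol d * m + M₀) + d * d * a * (η * k ^ 2) / τ := by rw [hn2]; ring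
    have h2 : d * d * a * (η * k ^ 2) / τ ≤ 1 / 2 / τ := by gcongr
    have h3 : 1 / τ ≤ 1 / w ^ 2 := one_div_le_one_div_of_le (by positivity) hwτ
    have h4 : 1 / (2 * τ) + 1 / 2 / τ = 1 / τ := by field_simp; norm_num
    rw [h1]
    linarith only [h2, h3, h4, hτZ]
  have key2 := key.trans (setLIntegral_mono' measurableSet_Ioo fun t ht =>
    Profile.lintegral_contact_le hp ha.le (hpos t ht) hE.le hC0.le hl
      (by positivity : 0 < 1 / w ^ 2) hm0 (hm _ (hpos t ht)) hn1
      (hfN' t (Set.Ioo_subset_Icc_self ht)) hc v₀)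
  rw [← hR, ← hx2, ← hD] at key2
  rw [setLIntegral_const, Real.volume_Ioo, hσ, ← ENNReal.ofReal_mul (by positivity),
    ← ENNReal.ofReal_mul (by positivity), ENNReal.ofReal_le_ofReal_iff (by positivity),
    ← contact_rescale] at key2
  have hwxn : k * θ ≤ w * x * n := by
    refine (sq_le_sq₀ (by positivity) (by positivity)).1 ?_
    rw [mul_pow, mul_pow, mul_pow, hw2, hn2]
    have h1 : θ * τ / (1 + τ * x ^ 2) * x ^ 2 * (k ^ 2 / τ) =
        k ^ 2 * (θ * x ^ 2 / (1 + τ * x ^ 2)) := by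
      field_simp
    rw [h1]
    refine mul_le_mul_of_nonneg_left ?_ (sq_nonneg k)
    rw [le_div_iff₀ (by positivity)]
    have hx3 : 1 ≤ x ^ 2 := one_le_pow₀ hx1
    have h2 : 1 + τ * x ^ 2 ≤ 2 * x ^ 2 := by
      have := mul_le_of_le_one_left (sq_nonneg x) hτ1
      linarith only [this, hx3]
    calc θ ^ 2 * (1 + τ * x ^ 2) ≤ θ ^ 2 * (2 * x ^ 2) := by gcongr
      _ = θ * x ^ 2 * (2 * θ) := by ring
      _ ≤ θ * x ^ 2 * 1 := by gcongr; linarith only [hθ1]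
      _ = θ * x ^ 2 := mul_one _
  have hwn : w * n ≤ k := by
    rw [hn, mul_div_assoc', div_le_iff₀ hsτ, mul_comm]
    exact mul_le_mul_of_nonneg_left (Real.le_sqrt_of_sq_le hwτ) hk0.le
  have hlt := lt_of_scaling (by positivity) (by positivity) hE.le hD0 hn0 hw0 hx1 hR1 hk0 hθ0
    hd0 hwxn hwn hkθ hkA hηA
  have hN := mul_lt_mul_of_pos_left hlt (by positivity : 0 < (n ^ d) ^ (d + 1))
  refine absurd key2 (not_le.2 (lt_of_eq_of_lt ?_ hN))
  rw [mul_pow C]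
  ring

/-- The constants of `IsClassicalSolution.le_of_contact` can be chosen in the order `k`, `η`, `m`,
`T`, uniformly in the exponent of the kernel. -/
theorem exists_improved_bound (hd : 2 ≤ d) (ha : 0 < a) {M₁ M₀ E₀ : ℝ} (H₀ : ℝ) (hM₁ : 0 < M₁)
    (hM₀ : 0 < M₀) (hE₀ : 0 ≤ E₀) : ∃ k T : ℝ, 1 ≤ k ∧ 0 < T ∧ T ≤ 1 ∧
      ∀ γ, Params d γ → ∀ (S : EReal) (f : ℝ → Vel d → ℝ), IsClassicalSolution a γ S f →
      (∀ t : ℝ, 0 < t → (t : EReal) < S → Profile M₁ M₀ E₀ H₀ (f t)) →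
      ∀ s t₀ : ℝ, 0 < s → s < t₀ → t₀ ≤ s + T → (t₀ : EReal) < S →
      (∀ t ∈ Set.Icc (t₀ - 1 / (9 * d) * (t₀ - s)) t₀, ∀ v,
        f t v ≤ 5 / 4 * (k / Real.sqrt (t₀ - s)) ^ d) →
      ∀ v₀, f t₀ v₀ ≤ (k / Real.sqrt (t₀ - s)) ^ d := by
  have hdR : (2 : ℝ) ≤ d := by exact_mod_cast hd
  obtain ⟨l, hl, hlow⟩ := exists_le_quad_diffusion d M₀ E₀ H₀ ha hM₁
  have hE : 0 < M₀ + E₀ := by positivity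
  have hω := unitVol_pos d
  obtain ⟨Λ, hΛ⟩ : ∃ Λ, Λ = a * (9 * d + 32) * (M₀ + E₀) := ⟨_, rfl⟩
  have hΛ0 : 0 ≤ Λ := by rw [hΛ]; positivity
  obtain ⟨C, hC⟩ : ∃ C, C = 5 / 4 + 3 / 2 * Λ := ⟨_, rfl⟩
  have hC0 : 0 < C := by rw [hC]; positivity
  obtain ⟨D, hD⟩ : ∃ D, D = (d : ℝ) * d * a * unitVol d := ⟨_, rfl⟩
  have hA : 0 < unitVol d / 4 ^ (d + 1) := by positivity
  obtain ⟨θ, hθ⟩ : ∃ θ : ℝ, θ = 1 / (9 * d) := ⟨_, rfl⟩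
  have hθ0 : 0 < θ := by rw [hθ]; positivity
  have hθ1 : θ ≤ 1 / 2 := by
    rw [hθ, div_le_div_iff₀ (by positivity) (by norm_num)]; linarith
  obtain ⟨k, hkθ, hkA⟩ : ∃ k, 1 ≤ k * θ ∧
      4 * (C ^ (d + 1) * (4 / l) ^ d * 2 ^ d * 2 ^ (d + 1) * (18 * (M₀ + E₀))) ≤
        unitVol d / 4 ^ (d + 1) * (k * θ) := by
    obtain ⟨y, hy⟩ : ∃ y, y = max 1 (4 * (C ^ (d + 1) * (4 / l) ^ d * 2 ^ d * 2 ^ (d + 1) *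
      (18 * (M₀ + E₀))) / (unitVol d / 4 ^ (d + 1))) := ⟨_, rfl⟩
    refine ⟨y / θ, ?_, ?_⟩ <;> rw [div_mul_cancel₀ _ hθ0.ne']
    · exact hy ▸ le_max_left _ _
    · rw [← div_le_iff₀' hA]; exact hy ▸ le_max_right _ _
  have hk1 : 1 ≤ k := by nlinarith
  obtain ⟨η, hη0, hηA, hηk⟩ : ∃ η > 0,
      4 * (C ^ (d + 1) * (4 / l) ^ d * 2 ^ d * (5 / 4 * D) ^ d * D * k ^ (d + 2) *
        Real.sqrt (9 * (M₀ + E₀) * η)) ≤ unitVol d / 4 ^ (d + 1) ∧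
      d * d * a * (η * k ^ 2) ≤ 1 / 2 := by
    have hc : Continuous fun η : ℝ =>
        4 * (C ^ (d + 1) * (4 / l) ^ d * 2 ^ d * (5 / 4 * D) ^ d * D * k ^ (d + 2) *
          Real.sqrt (9 * (M₀ + E₀) * η)) := by fun_prop
    have hc' : Continuous fun η : ℝ => d * d * a * (η * k ^ 2) := by fun_prop
    have h1 := (hc.tendsto 0).eventually_le_const (u := unitVol d / 4 ^ (d + 1))
      (by simpa using hA)
    have h2 := (hc'.tendsto 0).eventually_le_const (u := 1 / 2) (by norm_num)
    obtain ⟨η, ⟨h3, h4⟩, h5⟩ := (((h1.and h2).filter_mono nhdsWithin_le_nhds).and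
      (self_mem_nhdsWithin (s := Set.Ioi (0 : ℝ)))).exists
    exact ⟨η, h5, h3, h4⟩
  obtain ⟨m, hm1, hm⟩ := exists_integral_excess_le d M₁ M₀ E₀ H₀ hη0
  obtain ⟨Z, hZ⟩ : ∃ Z, Z = (d : ℝ) * d * a * (unitVol d * m + M₀) := ⟨_, rfl⟩
  have hZ0 : 0 < Z := by rw [hZ]; positivity
  refine ⟨k, min 1 (1 / (2 * Z)), hk1, lt_min one_pos (by positivity), min_le_left _ _,
    fun γ hp S f hf hprof s t₀ hs hst htT hS hfN v₀ => ?_⟩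
  have hτ0 : 0 < t₀ - s := sub_pos.2 hst
  refine hf.le_of_contact hp ha hE hprof hl (hlow γ hp) hΛ hC hD hk1 hθ0 hθ1 hkθ hkA hηA hηk
    (by linarith) hm hs rfl hτ0 (by linarith [min_le_left 1 (1 / (2 * Z))]) ?_ hS
    (by rwa [hθ]) v₀
  have h1 : t₀ - s ≤ 1 / (2 * Z) := by linarith [min_le_right 1 (1 / (2 * Z))]
  rw [← hZ]
  rw [le_div_iff₀ (by positivity)] at h1 ⊢
  linarith

/-- Continuity in time of the supremum turns `exists_improved_bound` into an a priori bound: the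
first time at which the bound fails cannot exist. -/
theorem exists_bound_from (hd : 2 ≤ d) (ha : 0 < a) {M₁ M₀ E₀ : ℝ} (H₀ : ℝ) (hM₁ : 0 < M₁)
    (hM₀ : 0 < M₀) (hE₀ : 0 ≤ E₀) : ∃ k T : ℝ, 0 < k ∧ 0 < T ∧
      ∀ γ, Params d γ → ∀ (S : EReal) (f : ℝ → Vel d → ℝ), IsClassicalSolution a γ S f →
      (∀ t : ℝ, 0 < t → (t : EReal) < S → Profile M₁ M₀ E₀ H₀ (f t)) →
      ∀ s t : ℝ, 0 < s → s < t → t ≤ s + T → (t : EReal) < S →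
      ∀ v, f t v ≤ (k / Real.sqrt (t - s)) ^ d := by
  obtain ⟨k, T, hk, hT0, hT1, H⟩ := exists_improved_bound (a := a) hd ha H₀ hM₁ hM₀ hE₀
  refine ⟨k, T, by linarith, hT0, fun γ hp S f hf hprof s t₁ hs hst htT hS v₁ => ?_⟩
  by_contra! hcon
  have hk0 : 0 < k := by linarith
  have hdR : (2 : ℝ) ≤ d := by exact_mod_cast hd
  have hd0 : d ≠ 0 := by omega
  -- `Φ` is the bound to be proved, and `b` the first time at which it fails
  set Φ : ℝ → ℝ := fun t => (k / Real.sqrt (t - s)) ^ d with hΦ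
  have hΦm : ∀ {t t' : ℝ}, s < t → t ≤ t' → Φ t' ≤ Φ t := fun {t t'} h h' => by
    have h1 : 0 < Real.sqrt (t - s) := Real.sqrt_pos.2 (sub_pos.2 h)
    simp only [hΦ]
    gcongr
  set bad : Set ℝ := {t | t ∈ Set.Ioc s t₁ ∧ ∃ v, Φ t < f t v} with hbad
  have hne : bad.Nonempty := ⟨t₁, ⟨hst, le_rfl⟩, v₁, hcon⟩
  have hbdd : BddBelow bad := ⟨s, fun t ht => ht.1.1.le⟩
  set b := sInf bad with hb
  have hsb : s < b := by
    obtain ⟨B, hB⟩ := hf.locally_bounded s t₁ hs hS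
    have hB1 : 0 < max B 1 := lt_of_lt_of_le one_pos (le_max_right _ _)
    -- before this time, the bound is larger than the supremum `B` of the solution
    refine lt_of_lt_of_le (lt_add_of_pos_right s (by positivity : 0 < (k / max B 1) ^ 2))
      (le_csInf hne fun t ht => ?_)
    by_contra! hlt
    obtain ⟨⟨h1, h2⟩, v, hv⟩ := ht
    have h3 := (hB t ⟨h1.le, h2⟩).1 v
    have h4 : 0 < Real.sqrt (t - s) := Real.sqrt_pos.2 (sub_pos.2 h1)
    have h5 : Real.sqrt (t - s) < k / max B 1 := by
      rw [Real.sqrt_lt' (by positivity)]; linarith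
    have h6 : max B 1 ≤ k / Real.sqrt (t - s) := by
      rw [lt_div_iff₀ hB1] at h5
      rw [le_div_iff₀ h4]; linarith
    have h7 : max B 1 ≤ Φ t := h6.trans (le_self_pow₀ ((le_max_right _ _).trans h6) hd0)
    linarith [le_max_left B 1]
  have hbt : b ≤ t₁ := csInf_le hbdd ⟨⟨hst, le_rfl⟩, v₁, hcon⟩
  obtain ⟨A, hA0, hA⟩ := hf.exists_le_add_mul hp ha.le hs hS
  set θ : ℝ := 1 / (9 * d) with hθ
  have hθ0 : 0 < θ := by positivity
  have hθ1 : θ ≤ 1 / 2 := by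
    rw [hθ, div_le_div_iff₀ (by positivity) (by norm_num)]; linarith
  have hθd : (8 : ℝ) / 9 ≤ (1 - θ) ^ d := by
    have h1 := one_add_mul_le_pow (by linarith : (-2 : ℝ) ≤ -θ) d
    have h2 : (1 : ℝ) + d * -θ = 8 / 9 := by rw [hθ]; field_simp; norm_num
    rw [h2] at h1
    exact h1
  -- on a time `2 ζ` neither `Φ` nor the supremum of the solution changes by a large factor
  set ζ := min (θ * (b - s) / 2) (1 / (16 * (A + 1))) with hζ
  have hζ0 : 0 < ζ := lt_min (by have := sub_pos.2 hsb; positivity) (by positivity)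
  have hζ1 : 2 * ζ ≤ θ * (b - s) := by linarith [min_le_left (θ * (b - s) / 2) (1 / (16 * (A + 1)))]
  have hζ2 : A * (2 * ζ) ≤ 1 / 8 := by
    have h1 : ζ ≤ 1 / (16 * (A + 1)) := min_le_right _ _
    rw [le_div_iff₀ (by positivity)] at h1
    nlinarith
  obtain ⟨t₀, ⟨⟨hst₀, ht₀⟩, v₀, hv₀⟩, ht₀b⟩ := exists_lt_of_csInf_lt hne
    (lt_add_of_pos_right b hζ0)
  have hbt₀ : b ≤ t₀ := csInf_le hbdd ⟨⟨hst₀, ht₀⟩, v₀, hv₀⟩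
  have hS₀ : (t₀ : EReal) < S := coe_lt_of_le ht₀ hS
  set τ := t₀ - s with hτ
  have hτ0 : 0 < τ := sub_pos.2 hst₀
  have hgood : ∀ t ∈ Set.Ioo s b, ∀ v, f t v ≤ Φ t := fun t ht v => by
    by_contra! h
    exact not_le.2 ht.2 (csInf_le hbdd ⟨⟨ht.1, ht.2.le.trans hbt⟩, v, h⟩)
  have hθτ : 0 < (1 - θ) * τ := mul_pos (by linarith) hτ0
  have hΦ₀ : Φ (s + (1 - θ) * τ) ≤ 9 / 8 * Φ t₀ := by
    have h1 : (1 - θ) * Real.sqrt τ ≤ Real.sqrt ((1 - θ) * τ) := by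
      refine Real.le_sqrt_of_sq_le ?_
      rw [mul_pow, Real.sq_sqrt hτ0.le]
      nlinarith
    have h2 : 0 < (1 - θ) * Real.sqrt τ := mul_pos (by linarith) (Real.sqrt_pos.2 hτ0)
    have h3 : k / Real.sqrt ((1 - θ) * τ) ≤ k / ((1 - θ) * Real.sqrt τ) := by gcongr
    have h4 := pow_le_pow_left₀ (by positivity) h3 d
    have h5 : 0 < (1 - θ) ^ d := by linarith
    have h6 : 0 < Φ t₀ := by
      have := Real.sqrt_pos.2 hτ0
      simp only [hΦ]; positivity
    calc Φ (s + (1 - θ) * τ) = (k / Real.sqrt ((1 - θ) * τ)) ^ d := by simp [hΦ]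
      _ ≤ (k / ((1 - θ) * Real.sqrt τ)) ^ d := h4
      _ = Φ t₀ / (1 - θ) ^ d := by
        simp only [hΦ, ← hτ, div_pow, mul_pow]
        rw [mul_comm, div_div]
      _ ≤ _ := by
        rw [div_le_iff₀ h5]; nlinarith
  have hΦ1 : 1 ≤ Φ t₀ := by
    have h1 : 1 ≤ k / Real.sqrt τ := by
      rw [one_le_div (Real.sqrt_pos.2 hτ0)]
      exact (Real.sqrt_le_one.2 (by linarith)).trans hk
    exact one_le_pow₀ h1
  have hbsτ : b - s ≤ τ := by linarith
  have hpast : ∀ t ∈ Set.Ioo s b, t₀ - θ * τ ≤ t → ∀ v, f t v ≤ 9 / 8 * Φ t₀ := by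
    intro t ht h v
    refine (hgood t ht v).trans ((hΦm ?_ ?_).trans hΦ₀)
    · linarith
    · have : s + (1 - θ) * τ = t₀ - θ * τ := by rw [hτ]; ring
      linarith
  refine not_le.2 hv₀ (H γ hp S f hf hprof s t₀ hs hst₀ (by linarith) hS₀ (fun t ht v => ?_) v₀)
  change f t v ≤ 5 / 4 * Φ t₀
  rcases lt_or_ge t b with h | h
  · have h1 : s < t := by nlinarith [ht.1]
    linarith [hpast t ⟨h1, h⟩ ht.1 v]
  · have hmul : θ * (b - s) ≤ θ * τ := mul_le_mul_of_nonneg_left hbsτ hθ0.le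
    have h1 : s < b - ζ := by nlinarith
    have h2 := hA (b - ζ) ⟨h1.le, by linarith⟩ (9 / 8 * Φ t₀)
      (hpast (b - ζ) ⟨h1, by linarith⟩ (by linarith)) t ⟨by linarith, ht.2.trans ht₀⟩ v
    have h3 : A * (t - (b - ζ)) ≤ A * (2 * ζ) :=
      mul_le_mul_of_nonneg_left (by linarith [ht.2]) hA0
    linarith

end

end Landau

end

theorem theoremt (d : ℕ) (hd : 2 ≤ d) (a : ℝ) (ha : 0 < a)
    (M₁ M₀ E₀ H₀ : ℝ) (hM₁ : 0 < M₁) :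
    ∃ K T : ℝ, 0 < K ∧ 0 < T ∧
      ∀ γ : ℝ, γ ∈ Set.Icc (-2 : ℝ) 0 → (γ = -2 → 3 ≤ d) →
      ∀ (S : EReal) (f : ℝ → Landau.Vel d → ℝ), 0 < S →
        Landau.IsClassicalSolution a γ S f →
        M₁ ≤ Landau.mass (f 0) → Landau.mass (f 0) ≤ M₀ →
        Landau.energy (f 0) ≤ E₀ →
        Landau.entropy (f 0) ≤ H₀ →
        ∀ (t : ℝ) (v : Landau.Vel d), 0 < t → (t : EReal) < S →
          (t ≤ T → f t v ≤ K * t ^ (-((d : ℝ) / 2))) ∧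
          (T < t → f t v ≤ K * T ^ (-((d : ℝ) / 2))) := by
  obtain ⟨k, T, hk, hT, H⟩ := Landau.exists_bound_from (a := a) (M₁ := M₁) (M₀ := max M₀ 1)
    (E₀ := max E₀ 0) hd ha H₀ hM₁ (lt_max_of_lt_right one_pos) (le_max_right _ _)
  refine ⟨k ^ d, T, by positivity, hT, fun γ hγ hγd S f _ hf h1 h0 hE hH t v ht htS => ?_⟩
  have hp : Landau.Params d γ := by
    refine ⟨hd, hγ, ?_⟩
    have hdR : (2 : ℝ) ≤ d := by exact_mod_cast hd
    rcases eq_or_lt_of_le hγ.1 with h | h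
    · have : (3 : ℝ) ≤ d := by exact_mod_cast hγd h.symm
      linarith
    · linarith
  have hprof : ∀ t : ℝ, 0 < t → (t : EReal) < S →
      Landau.Profile M₁ (max M₀ 1) (max E₀ 0) H₀ (f t) := fun t ht htS =>
    hf.profile hp ha.le h1 (h0.trans (le_max_left _ _)) (hE.trans (le_max_left _ _)) hH ht htS
  have hpow : ∀ r : ℝ, 0 < r → (k / Real.sqrt r) ^ d = k ^ d * r ^ (-((d : ℝ) / 2)) := by
    intro r hr
    rw [div_pow, div_eq_mul_inv, Real.rpow_neg hr.le, Real.sqrt_eq_rpow, ← Real.rpow_natCast,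
      ← Real.rpow_natCast, ← Real.rpow_mul hr.le]
    congr 3
    ring
  constructor
  · intro htT
    rw [← hpow t ht]
    -- the bound started from a positive time `s`, in the limit `s → 0`
    have hc : ContinuousAt (fun s => (k / Real.sqrt (t - s)) ^ d) 0 := by
      refine ContinuousAt.pow (continuousAt_const.div ?_ ?_) d
      · fun_prop
      · simpa using (Real.sqrt_pos.2 ht).ne'
    have hlim : Tendsto (fun s => (k / Real.sqrt (t - s)) ^ d) (𝓝[>] 0)
        (𝓝 ((k / Real.sqrt t) ^ d)) := by
      simpa using hc.tendsto.mono_left nhdsWithin_le_nhds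
    refine ge_of_tendsto hlim ?_
    filter_upwards [Ioo_mem_nhdsGT ht] with s hs
    exact H γ hp S f hf hprof s t hs.1 hs.2 (by linarith [hs.1]) htS v
  · intro hTt
    have h := H γ hp S f hf hprof (t - T) t (by linarith) (by linarith) (by linarith) htS v
    rwa [sub_sub_cancel, hpow T hT] at h
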